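/- Let $X$ be a projective complex threefold (an integral closed subscheme of dimension $3$ of some $\mathbb P^n_{\mathbb C}$) all of whose singular points are ordinary double points; here $x\in X$ is an ordinary double point if $\widehat{\mathcal O}_{X,x}\cong \mathbb C[[x_0,x_1,x_2,x_3]]/(f)$ over $\mathbb C$, where $f$ and all its first partial derivatives vanish at the origin and the Hessian of $f$ at the origin is nonsingular. Let $S\subset X$ be a smooth Weil divisor, i.e. a closed subscheme which is smooth of pure dimension $2$ over $\mathbb C$, and suppose that $S$ contains all the ordinary double points of $X$. Then the blowup $\pi:\tilde X\to X$ of $X$ along $S$ exists and is a projective small crepant resolution of $X$. That is: 1. $\tilde X$ is a projective variety and $\pi$ is a projective morphism; 2. $\tilde X$ is smooth over $\mathbb C$, $\pi$ is proper and birational and is an isomorphism over the smooth locus of $X$, and the exceptional locus of $\pi$ (the set of points where $\pi$ is not a local isomorphism) has codimension at least $2$ in $\tilde X$; 3. $\omega_X$ is invertible and $\pi^*\omega_X=\omega_{\tilde X}$, where the canonical sheaf $\omega$ of a normal threefold is the sheaf of rational $3$-forms that are regular in codimension one, and both sides are regarded as sheaves of rational $3$-forms on $\tilde X$. Moreover,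 the restriction $\pi^{-1}(S)\to S$ of $\pi$ to the scheme-theoretic inverse image of $S$ is the blowup of $S$ along the (closed, reduced) set of points of $S$ that are ordinary double points of $X$. Finally, the natural map $\pi^*\Omega_X\to\Omega_{\tilde X}$ of sheaves of differentials over $\mathbb C$ is injective. -/

import Mathlib

open AlgebraicGeometry CategoryTheory CategoryTheory.Limits TopologicalSpace
open scoped TensorProduct

namespace SmallRes

noncomputable section

/-! ## Complex schemes and their local rings -/

/-- `Spec ℂ`. A complex scheme is a scheme `X` with a structure morphism `s : X ⟶ SpecC`. -/
abbrev SpecC : Scheme.{0} := Spec (CommRingCat.of ℂ)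

/-- The map `ℂ → 𝒪_{X,x}` induced by the structure morphism `s : X ⟶ Spec ℂ`. -/
def stalkStr {X : Scheme.{0}} (s : X ⟶ SpecC) (x : X) : ℂ →+* X.presheaf.stalk x :=
  ((Scheme.ΓSpecIso (CommRingCat.of ℂ)).inv ≫ s.appTop ≫
    X.presheaf.germ ⊤ x (Set.mem_univ x)).hom

/-- The `ℂ`-algebra structure of the local ring `𝒪_{X,x}` of a complex scheme. -/
abbrev stalkAlgebra {X : Scheme.{0}} (s : X ⟶ SpecC) (x : X) : Algebra ℂ (X.presheaf.stalk x) :=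
  (stalkStr s x).toAlgebra

/-- For `π : Y ⟶ X` over `ℂ` the map `𝒪_{X,π y} → 𝒪_{Y,y}` is `ℂ`-linear. -/
lemma stalkMap_comp_stalkStr {X Y : Scheme.{0}} (s : X ⟶ SpecC) (π : Y ⟶ X) (y : Y) :
    (π.stalkMap y).hom.comp (stalkStr s (π y)) = stalkStr (π ≫ s) y := by
  unfold stalkStr
  rw [← CommRingCat.hom_comp]
  congr 1
  simp only [Category.assoc]
  congr 1
  rw [Scheme.Hom.comp_appTop, Category.assoc]
  congr 1
  exact Scheme.Hom.germ_stalkMap π ⊤ y (Set.mem_univ _)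

/-- The complex scheme `X` is smooth at the point `x`. -/
def SmoothAt {X : Scheme.{0}} (s : X ⟶ SpecC) (x : X) : Prop :=
  ∃ U : X.Opens, x ∈ U ∧ Smooth (U.ι ≫ s)

/-! ## Ordinary double points -/

/-- The Hessian matrix `(∂ᵢ∂ⱼ f)(0)` of a power series in four variables. -/
def hessianAtZero (f : MvPowerSeries (Fin 4) ℂ) : Matrix (Fin 4) (Fin 4) ℂ :=
  Matrix.of fun j k =>
    (if j = k then 2 else 1) *
      MvPowerSeries.coeff (Finsupp.single j 1 + Finsupp.single k 1) f

/-- `x` is a (threefold) ordinary double point of the complex scheme `X`: the completed local ring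
of `X` at `x` is isomorphic over `ℂ` to `ℂ⟦x₀, x₁, x₂, x₃⟧ / (f)`, where `f` and all its first
partial derivatives vanish at the origin and the Hessian of `f` at the origin is nonsingular. -/
def IsODP {X : Scheme.{0}} (s : X ⟶ SpecC) (x : X) : Prop :=
  ∃ (f : MvPowerSeries (Fin 4) ℂ)
    (φ : MvPowerSeries (Fin 4) ℂ →+*
      AdicCompletion (IsLocalRing.maximalIdeal (X.presheaf.stalk x)) (X.presheaf.stalk x)),
    MvPowerSeries.constantCoeff f = 0 ∧
    (∀ j : Fin 4, MvPowerSeries.coeff (Finsupp.single j 1) f = 0) ∧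
    (hessianAtZero f).det ≠ 0 ∧
    Function.Surjective φ ∧
    RingHom.ker φ = Ideal.span {f} ∧
    φ.comp MvPowerSeries.C = (algebraMap (X.presheaf.stalk x) _).comp (stalkStr s x)

/-! ## Projective morphisms -/

attribute [local instance] MvPolynomial.gradedAlgebra

/-- Complex projective space `ℙⁿ = Proj ℂ[x₀, …, xₙ]`. -/
def ProjSpace (n : ℕ) : Scheme.{0} :=
  Proj (MvPolynomial.homogeneousSubmodule (Fin (n + 1)) ℂ)

/-- The structure morphism of `ℙⁿ`. -/
def ProjSpace.str (n : ℕ) : ProjSpace n ⟶ SpecC :=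
  Proj.toSpecZero (MvPolynomial.homogeneousSubmodule (Fin (n + 1)) ℂ) ≫
    Spec.map (CommRingCat.ofHom
      (algebraMap ℂ (MvPolynomial.homogeneousSubmodule (Fin (n + 1)) ℂ 0)))

/-- The complex scheme `X` is projective: it is a closed subscheme of some `ℙⁿ`. -/
def IsProjective {X : Scheme.{0}} (s : X ⟶ SpecC) : Prop :=
  ∃ (n : ℕ) (e : X ⟶ ProjSpace n), IsClosedImmersion e ∧ e ≫ ProjSpace.str n = s

/-- A morphism `π : Y ⟶ X` to a complex scheme `X` is projective: over `X`, it is a closed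
subscheme of some `X × ℙⁿ`. -/
def IsProjectiveMorphism {X Y : Scheme.{0}} (s : X ⟶ SpecC) (π : Y ⟶ X) : Prop :=
  ∃ (n : ℕ) (e : Y ⟶ pullback s (ProjSpace.str n)),
    IsClosedImmersion e ∧ e ≫ pullback.fst s (ProjSpace.str n) = π

/-! ## Blowing up -/

/-- The closed subscheme with ideal sheaf `J` is an effective Cartier divisor: locally `J` is
generated by one nonzerodivisor. -/
def IsEffectiveCartier {Y : Scheme.{0}} (J : Y.IdealSheafData) : Prop :=
  ∀ y : Y, ∃ U : Y.affineOpens, y ∈ U.1 ∧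
    ∃ a ∈ nonZeroDivisors Γ(Y, U.1), J.ideal U = Ideal.span {a}

/-- `π : X' ⟶ X` is the blowup of `X` along the closed subscheme with ideal sheaf `J`: the
scheme-theoretic inverse image of that subscheme is an effective Cartier divisor, and `π` is
universal with this property. -/
structure IsBlowup {X X' : Scheme.{0}} (J : X.IdealSheafData) (π : X' ⟶ X) : Prop where
  isEffectiveCartier : IsEffectiveCartier (J.comap π)
  existsUnique_lift : ∀ (T : Scheme.{0}) (g : T ⟶ X), IsEffectiveCartier (J.comap g) →
    ∃! h : T ⟶ X', h ≫ π = g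

/-! ## Small resolutions -/

/-- The exceptional locus of `π`: the points at which `π` is not a local isomorphism. -/
def exceptionalLocus {X X' : Scheme.{0}} (π : X' ⟶ X) : Set X' :=
  {y | ¬ ∃ V : X'.Opens, y ∈ V ∧ IsOpenImmersion (V.ι ≫ π)}

/-- `π : X' ⟶ X` is a small resolution of singularities of the complex variety `X`: `X'` is a
smooth variety, `π` is proper, birational, and an isomorphism over the smooth locus of `X`, and
the exceptional locus of `π` has codimension at least two in `X'`. -/
structure IsSmallResolution {X X' : Scheme.{0}} (s : X ⟶ SpecC) (π : X' ⟶ X) : Prop where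
  isIntegral : IsIntegral X'
  smooth : Smooth (π ≫ s)
  isProper : IsProper π
  birational : ∃ U : X.Opens, (U : Set X).Nonempty ∧ IsIso (π ∣_ U)
  isIso_over_smooth : ∀ U : X.Opens, (∀ x ∈ U, SmoothAt s x) → IsIso (π ∣_ U)
  small : ∀ y ∈ exceptionalLocus π, 2 ≤ ringKrullDim (X'.presheaf.stalk y)

/-! ## Canonical sheaves and crepant morphisms

For a normal variety `X` with function field `L`, the canonical sheaf `ω_X`, the push-forward of
the sheaf of `d`-forms from the smooth locus, is the subsheaf of the constant sheaf `⋀ᵈ Ω_{L/ℂ}`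
of the rational `d`-forms that are regular at all points of codimension one. -/

/-- For a subring `R` of `L` the `R`-submodule of `⋀ᵈ Ω_{L/ℂ}` generated by all
`da₁ ∧ ⋯ ∧ da_d` with `aⱼ ∈ R`, i.e. the image of `⋀ᵈ Ω_{R/ℂ}` if `R` contains `ℂ`. -/
def regularForms {L : Type} [Field L] [Algebra ℂ L] (R : Subring L) (d : ℕ) :
    AddSubgroup (⋀[L]^d (Ω[L⁄ℂ])) :=
  (Submodule.span R (Set.range fun a : Fin d → R =>
    exteriorPower.ιMulti L d fun j => KaehlerDifferential.D ℂ L (a j : L))).toAddSubgroup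

/-- The stalk at `x` of the canonical sheaf of a normal variety `X` of dimension `d` with function
field `L`, whose local rings are given as subrings `R z` of `L`: the rational `d`-forms that are
regular at all codimension one points `z` whose closure contains `x`. -/
def canonicalStalk {X : Scheme.{0}} {L : Type} [Field L] [Algebra ℂ L] (R : X → Subring L)
    (d : ℕ) (x : X) : AddSubgroup (⋀[L]^d (Ω[L⁄ℂ])) :=
  ⨅ z : X, ⨅ _ : z ⤳ x, ⨅ _ : ringKrullDim (X.presheaf.stalk z) = 1, regularForms (R z) d

/-- The birational morphism `π : X' ⟶ X` of normal varieties of dimension `d` is crepant: the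
canonical sheaf of `X` is invertible, and the natural map identifies `π^* ω_X` with `ω_{X'}`.
Both canonical sheaves are considered inside the rational `d`-forms of the common function field
`L` of `X'` and `X`; `π^* ω_X = ω_{X'}` says that at every point `y` of `X'` a generator of the
stalk of `ω_X` at `π y` also generates the stalk of `ω_{X'}` at `y`. -/
def IsCrepant {X X' : Scheme.{0}} [IsIntegral X'] (s : X ⟶ SpecC) (π : X' ⟶ X) (d : ℕ) : Prop :=
  letI : Algebra ℂ X'.functionField := stalkAlgebra (π ≫ s) (genericPoint X')
  ∃ hdom : ∀ x : X, π (genericPoint X') ⤳ x,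
    -- the local rings of `X` and of `X'` as subrings of the function field of `X'`
    let R : X → Subring X'.functionField := fun x =>
      (X.presheaf.stalkSpecializes (hdom x) ≫ π.stalkMap (genericPoint X')).hom.range
    let R' : X' → Subring X'.functionField := fun y =>
      (algebraMap (X'.presheaf.stalk y) X'.functionField).range
    ∀ y : X', ∃ η : ⋀[X'.functionField]^d (Ω[X'.functionField⁄ℂ]), η ≠ 0 ∧
      canonicalStalk R d (π y) = (Submodule.span (R (π y)) {η}).toAddSubgroup ∧
      canonicalStalk R' d y = (Submodule.span (R' y) {η}).toAddSubgroup

/-! ## The cotangent map -/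

/-- The natural map `π^* Ω_X → Ω_{X'}` of sheaves of differentials over `ℂ` is injective. The
stalk of this map at a point `y` of `X'` is
`𝒪_{X',y} ⊗ Ω_{𝒪_{X,π y}/ℂ} → Ω_{𝒪_{X',y}/ℂ}`, `b ⊗ da ↦ b • d(π^* a)`. -/
def CotangentMapInjective {X X' : Scheme.{0}} (s : X ⟶ SpecC) (π : X' ⟶ X) : Prop :=
  ∀ y : X',
    letI : Algebra ℂ (X.presheaf.stalk (π y)) := stalkAlgebra s (π y)
    letI : Algebra ℂ (X'.presheaf.stalk y) := stalkAlgebra (π ≫ s) y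
    letI : Algebra (X.presheaf.stalk (π y)) (X'.presheaf.stalk y) := (π.stalkMap y).hom.toAlgebra
    haveI : IsScalarTower ℂ (X.presheaf.stalk (π y)) (X'.presheaf.stalk y) :=
      IsScalarTower.of_algebraMap_eq' (stalkMap_comp_stalkStr s π y).symm
    Function.Injective
      (KaehlerDifferential.mapBaseChange ℂ (X.presheaf.stalk (π y)) (X'.presheaf.stalk y))

end

end SmallRes

namespace SmallRes

/-! ## Analytic independence in formally smooth local algebras -/

section AnalyticIndependence

open MvPolynomial IsLocalRing

variable {k O ι : Type*} [Field k] [CommRing O]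

/-! At a node `x` of `X` the surface `S` forces a normal form. The quadratic leading form of the
node is nondegenerate in four variables, and it vanishes on the tangent plane of `S`, because local
parameters of the smooth surface satisfy no quadratic relation. A nondegenerate form with an
isotropic plane splits as `y₀ γ₀ + y₁ γ₁`. Lifting this splitting to the local ring `A` gives `a g =
b h` with `(a, b)` the ideal of `S` and `(a, b, g, h)` the maximal ideal (`exists_quadric_relation`,
`exists_node_equation`).

Blow up `(a, b)`. In a local ring `O` of the blowup over the node one of `a`, `b` divides the other,
say `a = t b`, and then `h = t g`. At a closed point the maximal ideal of `O` is `(b, g, t - t₀)`.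
Three generators, where the function field has three independent differentials, make `O` smooth with
`db, dg, dt` generating its differentials (`formallySmooth_of_span_eq_maximalIdeal`,
`IsNode.isNodeChart`). Away from the nodes `S` is a Cartier divisor, so the blowup is an isomorphism
there. The exceptional locus lies in `b = g = 0`, and `b, g` is a regular sequence, so its
codimension is at least two.

The remaining claims are read off this chart. Crepancy: passing to the other chart changes `db ∧ dg
∧ dt` into `da ∧ dh ∧ d(1/t)`, which is its negative (`wedgeD_swap`). Hence one form generates the
regular forms at every codimension one point near the node. Functions regular in codimension one are
regular on both sides, because smooth local rings are normal and the node has depth two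
(`mem_range_of_forall_height_eq_one`, `exists_regular_pair`). Cotangent map: an element of the
kernel is a multiple of `g da + a dg - h db - b dh`, which is zero, since `b, g` is a regular
sequence (`mapBaseChange_injective_of_node`). Inverse image of `S`: since `g (a, b) = b (g, h)`, the
blowup is locally also the blowup of `(g, h)`, and this ideal restricts to the maximal ideal of the
node on `S`.

Existence and projectivity of the blowup of an ideal `J`: take the closure in `X × ℙⁿ` of the graph
of the rational map given by generators of a twist `J(d + 1)`. The universal property is checked in
the standard charts (`isBlowup_of_charts`). Choosing the generators as products of a linear
coordinate and a section of `J(d)` makes the projection to `ℙⁿ` a closed immersion, so the blowup is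
itself projective (`exists_blowup`).

The commutative algebra rests on analytic independence of generators of the maximal ideal: the
associated graded ring is then a polynomial ring, and being a domain, normality and primeness of
ideals generated by parameters follow by comparing leading forms. -/

lemma prod_pow_sub_prod_pow_mem {S : Type*} [CommRing S] (J : Ideal S) (u v : ι → S)
    (hv : ∀ i, v i ∈ J) (huv : ∀ i, u i - v i ∈ J ^ 2) (x : ι →₀ ℕ) :
    (x.prod fun i e => u i ^ e) ∈ J ^ x.degree ∧ (x.prod fun i e => v i ^ e) ∈ J ^ x.degree ∧
      (x.prod fun i e => u i ^ e) - (x.prod fun i e => v i ^ e) ∈ J ^ (x.degree + 1) := by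
  classical
  have hu : ∀ i, u i ∈ J := fun i => by
    have := J.add_mem (Ideal.pow_le_self two_ne_zero (huv i)) (hv i)
    simpa using this
  have key : ∀ (p q : ℕ) (a b a' b' : S), a ∈ J ^ p → b ∈ J ^ p → a - b ∈ J ^ (p + 1) →
      a' ∈ J ^ q → b' ∈ J ^ q → a' - b' ∈ J ^ (q + 1) →
      a * a' ∈ J ^ (p + q) ∧ b * b' ∈ J ^ (p + q) ∧ a * a' - b * b' ∈ J ^ (p + q + 1) := by
    intro p q a b a' b' ha hb hab ha' hb' hab'
    refine ⟨pow_add J p q ▸ Ideal.mul_mem_mul ha ha', pow_add J p q ▸ Ideal.mul_mem_mul hb hb', ?_⟩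
    have e : a * a' - b * b' = (a - b) * a' + b * (a' - b') := by ring
    rw [e]
    refine Ideal.add_mem _ ?_ ?_
    · have := Ideal.mul_mem_mul hab ha'
      rwa [← pow_add, show p + 1 + q = p + q + 1 by ring] at this
    · have := Ideal.mul_mem_mul hb hab'
      rwa [← pow_add, show p + (q + 1) = p + q + 1 by ring] at this
  induction x using Finsupp.induction_linear with
  | zero => simp
  | add x y hx hy =>
    have e : ∀ w : ι → S, ((x + y).prod fun i e => w i ^ e) =
        (x.prod fun i e => w i ^ e) * (y.prod fun i e => w i ^ e) := fun w =>
      Finsupp.prod_add_index' (by simp) (by simp [pow_add])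
    rw [e, e, map_add]
    exact key _ _ _ _ _ _ hx.1 hx.2.1 hx.2.2 hy.1 hy.2.1 hy.2.2
  | single i n =>
    have e : ∀ w : ι → S, ((Finsupp.single i n).prod fun i e => w i ^ e) = w i ^ n := fun w =>
      Finsupp.prod_single_index (by simp)
    rw [e, e]
    clear e
    simp only [Finsupp.degree_single]
    induction n with
    | zero => simp
    | succ n ih =>
      rw [pow_succ (u i), pow_succ (v i)]
      refine key _ _ _ _ _ _ ih.1 ih.2.1 ih.2.2 (by simpa using hu i) (by simpa using hv i)
        (by simpa using huv i)

lemma aeval_sub_aeval_mem {S : Type*} [CommRing S] [Algebra k S] (J : Ideal S) (u v : ι → S)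
    (hv : ∀ i, v i ∈ J) (huv : ∀ i, u i - v i ∈ J ^ 2) {n : ℕ} {F : MvPolynomial ι k}
    (hF : F.IsHomogeneous n) : aeval u F - aeval v F ∈ J ^ (n + 1) := by
  rw [aeval_def, aeval_def, eval₂_eq, eval₂_eq, ← Finset.sum_sub_distrib]
  refine Ideal.sum_mem _ fun x hx => ?_
  rw [← mul_sub]
  refine Ideal.mul_mem_left _ _ ?_
  have := (prod_pow_sub_prod_pow_mem J u v hv huv x).2.2
  have hd : x.degree = n := by
    have := hF (mem_support_iff.mp hx)
    rwa [Finsupp.degree_eq_weight_one]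
  rw [hd] at this
  exact this

lemma aeval_mem_pow {S : Type*} [CommRing S] [Algebra k S] (J : Ideal S) (v : ι → S)
    (hv : ∀ i, v i ∈ J) {n : ℕ} {F : MvPolynomial ι k}
    (hF : F.IsHomogeneous n) : aeval v F ∈ J ^ n := by
  rw [aeval_def, eval₂_eq]
  refine Ideal.sum_mem _ fun x hx => Ideal.mul_mem_left _ _ ?_
  have := (prod_pow_sub_prod_pow_mem J v v hv (by simp) x).1
  have hd : x.degree = n := by
    have := hF (mem_support_iff.mp hx)
    rwa [Finsupp.degree_eq_weight_one]
  rwa [hd] at this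

variable [IsLocalRing O] [Algebra k O]

/-- The residue field of the local `k`-algebra `O` is `k`. -/
def ResidueTrivial (k O : Type*) [Field k] [CommRing O] [IsLocalRing O] [Algebra k O] : Prop :=
  ∀ x : O, ∃ c : k, x - algebraMap k O c ∈ maximalIdeal O

/-- The monomials of degree `n` in the `c i` generate `I ^ n`, and each coefficient may be replaced
by its residue in `k` at the cost of an element of the maximal ideal. The ideal `I` need not be
maximal: it is also used for a part of a system of generators. -/
lemma exists_isHomogeneous_sub_mem (hres : ResidueTrivial k O) (c : ι → O) {I : Ideal O}
    (hc : I = Ideal.span (Set.range c)) (n : ℕ) {x : O}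
    (hx : x ∈ I ^ n) :
    ∃ F : MvPolynomial ι k, F.IsHomogeneous n ∧ x - aeval c F ∈ I ^ n * maximalIdeal O := by
  have hmem : ∀ i, c i ∈ I := fun i => hc ▸ Ideal.subset_span ⟨i, rfl⟩
  have h1 : I ^ n = Ideal.span
      ((fun x : ι →₀ ℕ => x.prod fun i e => c i ^ e) '' (Finsupp.degree ⁻¹' {n})) := by
    have : I = (MvPolynomial.idealOfVars ι k).map (aeval c : MvPolynomial ι k →ₐ[k] O) := by
      rw [Ideal.map_span, ← Set.range_comp, hc]
      congr 2; ext i; simp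
    rw [this, ← Ideal.map_pow, pow_idealOfVars_eq_span, Ideal.map_span, Set.image_image]
    congr 1
    refine Set.image_congr fun x _ => ?_
    simp [aeval_monomial]
  have hx' := hx
  rw [h1] at hx'
  refine Submodule.span_induction (p := fun x _ => ∃ F : MvPolynomial ι k, F.IsHomogeneous n ∧
    x - aeval c F ∈ I ^ n * maximalIdeal O) ?_ ?_ ?_ ?_ hx'
  · rintro _ ⟨x, hx, rfl⟩
    refine ⟨monomial x 1, isHomogeneous_monomial _ hx, ?_⟩
    simp [aeval_monomial]
  · exact ⟨0, isHomogeneous_zero _ _ _, by simp⟩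
  · rintro x y - - ⟨F, hF, hF'⟩ ⟨G, hG, hG'⟩
    refine ⟨F + G, hF.add hG, ?_⟩
    have := Ideal.add_mem _ hF' hG'
    rw [map_add]
    convert this using 1; ring
  · rintro r x - ⟨F, hF, hF'⟩
    obtain ⟨a, ha⟩ := hres r
    refine ⟨C a * F, by simpa using (isHomogeneous_C ι a).mul hF, ?_⟩
    have hx : x ∈ I ^ n := by
      have h1 : x - aeval c F ∈ I ^ n := (Ideal.mul_le_left : I ^ n * maximalIdeal O ≤ I ^ n) hF'
      have h2 := aeval_mem_pow I c hmem hF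
      simpa using (I ^ n).add_mem h1 h2
    have : r • x - aeval c (C a * F) = x * (r - algebraMap k O a) +
        algebraMap k O a * (x - aeval c F) := by
      simp [smul_eq_mul]; ring
    rw [this]
    exact Ideal.add_mem _ (Ideal.mul_mem_mul hx ha) (Ideal.mul_mem_left _ _ hF')

/-- The elements `c i` of the maximal ideal satisfy no nontrivial homogeneous relation modulo
higher order terms. -/
def AnalyticallyIndependent (k : Type*) {O ι : Type*} [Field k] [CommRing O] [IsLocalRing O]
    [Algebra k O] (c : ι → O) : Prop :=
  ∀ (n : ℕ) (F : MvPolynomial ι k), F.IsHomogeneous n → aeval c F ∈ maximalIdeal O ^ (n + 1) →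
    F = 0

/-- Independence in degree one identifies `O / m²` with the polynomial ring modulo squares. Formal
smoothness lifts the resulting map from `O` to a truncated polynomial ring of any length, with `c i`
going to `X i` plus terms of order two. A relation of degree `n` between the `c i` modulo `m ^ (n +
1)` is carried to the same relation between the variables, where it must be trivial. -/
theorem analyticallyIndependent_of_formallySmooth [Finite ι] [Algebra.FormallySmooth k O]
    (hres : ResidueTrivial k O) (c : ι → O)
    (hc : maximalIdeal O = Ideal.span (Set.range c))
    (hind : ∀ F : MvPolynomial ι k, F.IsHomogeneous 1 → aeval c F ∈ maximalIdeal O ^ 2 → F = 0) :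
    AnalyticallyIndependent k c := by
  intro n F hF hFm
  have hmem : ∀ i, c i ∈ maximalIdeal O := fun i => hc ▸ Ideal.subset_span ⟨i, rfl⟩
  let P := MvPolynomial ι k
  let T : Ideal P := idealOfVars ι k
  have hT : ∀ i, (X i : P) ∈ T := fun i => Ideal.subset_span ⟨i, rfl⟩
  -- the isomorphism modulo squares
  let α : (P ⧸ T ^ 2) →ₐ[k] (O ⧸ maximalIdeal O ^ 2) :=
    Ideal.quotientMapₐ _ (aeval c) (by
      rw [← Ideal.map_le_iff_le_comap, Ideal.map_pow]
      refine Ideal.pow_right_mono ?_ 2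
      rw [Ideal.map_span, Ideal.span_le]
      rintro _ ⟨_, ⟨i, rfl⟩, rfl⟩
      exact (aeval_X (R := k) c i).symm ▸ hmem i)
  have hα : ∀ p : P, α (Ideal.Quotient.mk _ p) = Ideal.Quotient.mk _ (aeval c p) := fun p => rfl
  have hαbij : Function.Bijective α := by
    constructor
    · rw [injective_iff_map_eq_zero]
      intro p hp
      obtain ⟨p, rfl⟩ := Ideal.Quotient.mk_surjective p
      rw [hα, Ideal.Quotient.eq_zero_iff_mem] at hp
      rw [Ideal.Quotient.eq_zero_iff_mem, mem_pow_idealOfVars_iff']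
      have hhigh : p - (homogeneousComponent 0 p + homogeneousComponent 1 p) ∈ T ^ 2 := by
        rw [mem_pow_idealOfVars_iff']
        intro x hx
        rw [coeff_sub, coeff_add, coeff_homogeneousComponent, coeff_homogeneousComponent]
        interval_cases hd : x.degree <;> simp
      have hmap : ∀ q ∈ T ^ 2, aeval c q ∈ maximalIdeal O ^ 2 := by
        intro q hq
        have := hα q
        rwa [Ideal.Quotient.eq_zero_iff_mem.mpr hq, map_zero, eq_comm,
          Ideal.Quotient.eq_zero_iff_mem] at this
      have h2 := Ideal.sub_mem _ hp (hmap _ hhigh)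
      rw [← map_sub, sub_sub_cancel, map_add] at h2
      have h1 : aeval c (homogeneousComponent 1 p) ∈ maximalIdeal O := by
        simpa using aeval_mem_pow (maximalIdeal O) c hmem (homogeneousComponent_isHomogeneous 1 p)
      have h0 : homogeneousComponent 0 p = 0 := by
        have h3 : aeval c (homogeneousComponent 0 p) ∈ maximalIdeal O := by
          have := Ideal.sub_mem _ (Ideal.pow_le_self two_ne_zero h2) h1
          simpa using this
        rw [homogeneousComponent_zero, aeval_C] at h3
        rw [homogeneousComponent_zero]
        by_contra hne
        have hne' : coeff 0 p ≠ 0 := fun h => hne (by rw [h, C_0])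
        exact (maximalIdeal.isMaximal O).ne_top (Ideal.eq_top_of_isUnit_mem _ h3
          ((isUnit_iff_ne_zero.mpr hne').map _))
      rw [h0, map_zero, zero_add] at h2
      have h1' := hind _ (homogeneousComponent_isHomogeneous 1 p) h2
      rw [h0, h1', add_zero, sub_zero, mem_pow_idealOfVars_iff'] at hhigh
      exact hhigh
    · intro y
      obtain ⟨y, rfl⟩ := Ideal.Quotient.mk_surjective y
      obtain ⟨a, ha⟩ := hres y
      obtain ⟨G, hG, hG'⟩ := exists_isHomogeneous_sub_mem hres c hc 1
        (by simpa using ha)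
      refine ⟨Ideal.Quotient.mk _ (C a + G), ?_⟩
      rw [hα, Ideal.Quotient.eq, ← neg_mem_iff]
      rw [pow_one, ← pow_two] at hG'
      convert hG' using 1
      simp; ring
  let β : O →ₐ[k] (P ⧸ T ^ 2) :=
    (AlgEquiv.ofBijective α hαbij).symm.toAlgHom.comp (Ideal.Quotient.mkₐ k _)
  have hβ : ∀ i, β (c i) = Ideal.Quotient.mk _ (X i) := by
    intro i
    change (AlgEquiv.ofBijective α hαbij).symm _ = _
    rw [AlgEquiv.symm_apply_eq, AlgEquiv.ofBijective_apply, hα]; simp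
  -- Truncating at `n + 1` would detect forms of degree `n`; the exponent `n + 2` also guarantees a
  -- map onto `P ⧸ T ^ 2` when `n = 0`.
  let S := P ⧸ T ^ (n + 2)
  have hle : T ^ (n + 2) ≤ T ^ 2 := Ideal.pow_le_pow_right (by omega)
  let γ : S →ₐ[k] (P ⧸ T ^ 2) := Ideal.Quotient.factorₐ k hle
  have hγ : Function.Surjective γ := Ideal.Quotient.factor_surjective hle
  let J : Ideal S := T.map (Ideal.Quotient.mk _)
  have hJ : ∀ m, J ^ m = (T ^ m).map (Ideal.Quotient.mk _) := fun m => (Ideal.map_pow _ _ _).symm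
  have hker : RingHom.ker γ = J ^ 2 := by
    rw [hJ]
    ext y
    obtain ⟨y, rfl⟩ := Ideal.Quotient.mk_surjective y
    rw [RingHom.mem_ker, Ideal.mem_quotient_iff_mem hle]
    change Ideal.Quotient.mk _ y = 0 ↔ _
    rw [Ideal.Quotient.eq_zero_iff_mem]
  have hnil : IsNilpotent (RingHom.ker γ) := by
    rw [hker]
    refine ⟨n + 2, ?_⟩
    rw [← pow_mul, hJ, Ideal.zero_eq_bot, Ideal.map_eq_bot_iff_le_ker, Ideal.mk_ker]
    exact Ideal.pow_le_pow_right (by omega)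
  let ψ : O →ₐ[k] S := Algebra.FormallySmooth.liftOfSurjective β γ hγ hnil
  have hψ : ∀ i, ψ (c i) - Ideal.Quotient.mk _ (X i) ∈ J ^ 2 := by
    intro i
    rw [← hker, RingHom.mem_ker, map_sub, sub_eq_zero]
    rw [Algebra.FormallySmooth.liftOfSurjective_apply, hβ]
    rfl
  have hXJ : ∀ i, (Ideal.Quotient.mk (T ^ (n + 2)) (X i)) ∈ J := fun i =>
    Ideal.mem_map_of_mem _ (hT i)
  have hψm : (maximalIdeal O).map ψ ≤ J := by
    rw [hc, Ideal.map_span, Ideal.span_le]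
    rintro _ ⟨_, ⟨i, rfl⟩, rfl⟩
    have := J.add_mem (Ideal.pow_le_self two_ne_zero (hψ i)) (hXJ i)
    simpa using this
  have h1 : ψ (aeval c F) ∈ J ^ (n + 1) := by
    refine Ideal.pow_right_mono hψm (n + 1) ?_
    rw [← Ideal.map_pow]
    exact Ideal.mem_map_of_mem _ hFm
  have h2 := aeval_sub_aeval_mem J (fun i => ψ (c i)) _ hXJ hψ hF
  have h3 : aeval (fun i => ψ (c i)) F = ψ (aeval c F) := by
    rw [← AlgHom.comp_apply]; congr 1; ext i; simp
  have h4 : aeval (fun i => Ideal.Quotient.mk (T ^ (n + 2)) (X i)) F =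
      Ideal.Quotient.mk (T ^ (n + 2)) F := by
    change _ = Ideal.Quotient.mkₐ k (T ^ (n + 2)) F
    congr 1; ext i; simp
  rw [h3, h4] at h2
  have h5 := Ideal.sub_mem _ h1 h2
  rw [sub_sub_cancel, hJ, Ideal.mem_quotient_iff_mem (Ideal.pow_le_pow_right (by omega)),
    mem_pow_idealOfVars_iff'] at h5
  ext x
  rw [coeff_zero]
  by_cases hx : x.degree = n
  · exact h5 x (by omega)
  · exact hF.coeff_eq_zero hx

lemma exists_mem_pow_notMem_pow [IsNoetherianRing O] {x : O} (hx : x ≠ 0) :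
    ∃ n, x ∈ maximalIdeal O ^ n ∧ x ∉ maximalIdeal O ^ (n + 1) := by
  classical
  have h : ∃ n, x ∉ maximalIdeal O ^ n := by
    by_contra h
    push Not at h
    refine hx ?_
    have : x ∈ (⨅ i, maximalIdeal O ^ i) := by simpa [Submodule.mem_iInf] using h
    rwa [Ideal.iInf_pow_eq_bot_of_isLocalRing _ (maximalIdeal.isMaximal O).ne_top] at this
  have h0 : Nat.find h ≠ 0 := by
    intro h0
    have := Nat.find_spec h
    rw [h0] at this; simp at this
  obtain ⟨n, hn⟩ := Nat.exists_eq_succ_of_ne_zero h0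
  refine ⟨n, by_contra fun h' => Nat.find_min h (m := n) (by omega) h', ?_⟩
  have := Nat.find_spec h
  rwa [hn] at this

/-- If `x` has order `p` and `y` has order `q`, then `x * y` has order `p + q`. -/
lemma mul_notMem_pow_of_analyticallyIndependent (hres : ResidueTrivial k O) {c : ι → O}
    (hc : maximalIdeal O = Ideal.span (Set.range c)) (hind : AnalyticallyIndependent k c)
    {x y : O} {p q : ℕ} (hx : x ∈ maximalIdeal O ^ p) (hx' : x ∉ maximalIdeal O ^ (p + 1))
    (hy : y ∈ maximalIdeal O ^ q) (hy' : y ∉ maximalIdeal O ^ (q + 1)) :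
    x * y ∉ maximalIdeal O ^ (p + q + 1) := by
  intro hxy
  obtain ⟨F, hF, hFx⟩ := exists_isHomogeneous_sub_mem hres c hc p hx
  obtain ⟨G, hG, hGy⟩ := exists_isHomogeneous_sub_mem hres c hc q hy
  rw [← pow_succ] at hFx hGy
  have hF0 : F ≠ 0 := by rintro rfl; exact hx' (by simpa using hFx)
  have hG0 : G ≠ 0 := by rintro rfl; exact hy' (by simpa using hGy)
  refine mul_ne_zero hF0 hG0 (hind (p + q) _ (hF.mul hG) ?_)
  have e : aeval c (F * G) = x * y - (x - aeval c F) * y - aeval c F * (y - aeval c G) := by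
    rw [map_mul]; ring
  have hmem : ∀ i, c i ∈ maximalIdeal O := fun i => hc ▸ Ideal.subset_span ⟨i, rfl⟩
  rw [e]
  refine Ideal.sub_mem _ (Ideal.sub_mem _ hxy ?_) ?_
  · have := Ideal.mul_mem_mul hFx hy
    rwa [← pow_add, show p + 1 + q = p + q + 1 by ring] at this
  · have := Ideal.mul_mem_mul (aeval_mem_pow _ c hmem hF) hGy
    rwa [← pow_add, show p + (q + 1) = p + q + 1 by ring] at this

/-- Krull's intersection theorem gives every nonzero element an order, and orders add because
leading forms multiply in a polynomial ring. -/
theorem isDomain_of_analyticallyIndependent [IsNoetherianRing O] (hres : ResidueTrivial k O)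
    {c : ι → O} (hc : maximalIdeal O = Ideal.span (Set.range c))
    (hind : AnalyticallyIndependent k c) : IsDomain O := by
  have : NoZeroDivisors O := ⟨fun {x y} hxy => by
    by_contra! h
    obtain ⟨p, hp, hp'⟩ := exists_mem_pow_notMem_pow h.1
    obtain ⟨q, hq, hq'⟩ := exists_mem_pow_notMem_pow h.2
    exact mul_notMem_pow_of_analyticallyIndependent hres hc hind hp hp' hq hq' (by simp [hxy])⟩
  exact NoZeroDivisors.to_isDomain O

end AnalyticIndependence


/-! ### The conormal module of a smooth quotient, and parameters of a smooth local ring. -/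

section Conormal

open IsLocalRing Algebra

variable {k A B : Type} [Field k] [CommRing A] [CommRing B] [Algebra k A] [Algebra k B]
  [Algebra A B] [IsScalarTower k A B]

/-- Minimal generators of the kernel of a surjection between formally smooth local algebras. -/
theorem exists_generators_ker_of_formallySmooth [IsLocalRing A] [IsNoetherianRing A]
    [IsLocalRing B] [FormallySmooth k A] [FormallySmooth k B] [Module.Finite A Ω[A⁄k]]
    [Module.Finite B Ω[B⁄k]] (hsurj : Function.Surjective (algebraMap A B)) {p q : ℕ}
    (hp : Module.finrank A Ω[A⁄k] = p) (hq : Module.finrank B Ω[B⁄k] = q) :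
    q ≤ p ∧ ∃ c : Fin (p - q) → A, RingHom.ker (algebraMap A B) = Ideal.span (Set.range c) ∧
      ∀ a : Fin (p - q) → A, ∑ i, a i * c i ∈ RingHom.ker (algebraMap A B) ^ 2 →
        ∀ i, a i ∈ RingHom.ker (algebraMap A B) := by
  let P : Algebra.Extension k B := ⟨A, _, Function.surjInv_eq hsurj⟩
  have hP : FormallySmooth k P.Ring := ‹FormallySmooth k A›
  -- Smoothness of `B` splits the conormal sequence `I/I² → B ⊗ Ω_A → Ω_B`, so `I/I²` is free of
  -- rank `p - q`.
  obtain ⟨l, hl⟩ := P.formallySmooth_iff_split_injection.mp ‹_›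
  have hpk : P.ker = RingHom.ker (algebraMap A B) := rfl
  have : Module.Free A Ω[A⁄k] := Module.free_of_flat_of_isLocalRing
  have : Module.Free B Ω[B⁄k] := Module.free_of_flat_of_isLocalRing
  have hfin : Module.Finite B P.CotangentSpace :=
    inferInstanceAs (Module.Finite B (B ⊗[A] Ω[A⁄k]))
  have hfree : Module.Free B P.CotangentSpace :=
    inferInstanceAs (Module.Free B (B ⊗[A] Ω[A⁄k]))
  have hrank : Module.finrank B P.CotangentSpace = p := by
    rw [← hp]; exact Module.finrank_baseChange
  have hlinj : Function.Injective P.cotangentComplex := by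
    intro x y hxy
    have := congrArg l hxy
    rwa [← LinearMap.comp_apply, ← LinearMap.comp_apply, hl] at this
  have hlsurj : Function.Surjective l := fun x => ⟨_, LinearMap.congr_fun hl x⟩
  have hcfin : Module.Finite B P.Cotangent := Module.Finite.of_surjective l hlsurj
  have hcproj : Module.Projective B P.Cotangent := Module.Projective.of_split _ _ hl
  have hcfree : Module.Free B P.Cotangent := Module.free_of_flat_of_isLocalRing
  let e : P.CotangentSpace ≃ₗ[B] P.Cotangent × Ω[B⁄k] :=
    (P.exact_cotangentComplex_toKaehler.splitInjectiveEquiv P.toKaehler_surjective ⟨l, hl⟩).1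
  have hsum : p = Module.finrank B P.Cotangent + q := by
    rw [← hrank, e.finrank_eq, Module.finrank_prod, hq]
  refine ⟨by omega, ?_⟩
  obtain ⟨b⟩ : Nonempty (Module.Basis (Fin (p - q)) B P.Cotangent) :=
    ⟨Module.finBasisOfFinrankEq B _ (by omega)⟩
  have hsmk : ∀ i, ∃ x : P.ker, Extension.Cotangent.mk x = b i := fun i =>
    Extension.Cotangent.mk_surjective _
  choose c hc using hsmk
  have hmk : ∀ (a : Fin (p - q) → A), Extension.Cotangent.mk (∑ i, (a i : P.Ring) • c i) =
      ∑ i, algebraMap A B (a i) • b i := by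
    intro a
    rw [map_sum]
    refine Finset.sum_congr rfl fun i _ => ?_
    rw [map_smul, hc]
    exact (algebraMap_smul B (a i) (b i)).symm
  have hcoe : ∀ (a : Fin (p - q) → A), ((∑ i, (a i : P.Ring) • c i : P.ker) : A) =
      ∑ i, a i * (c i : A) := by
    intro a
    change (P.ker.subtype _) = _
    rw [map_sum]; rfl
  refine ⟨fun i => (c i : A), ?_, ?_⟩
  -- Nakayama: lifts of a basis of `I/I²` generate `I`.
  · have hle : Ideal.span (Set.range fun i => (c i : A)) ≤ RingHom.ker (algebraMap A B) := by
      rw [Ideal.span_le]; rintro _ ⟨i, rfl⟩; exact (c i).2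
    refine le_antisymm ?_ hle
    have hfg : (RingHom.ker (algebraMap A B)).FG := IsNoetherian.noetherian _
    refine Submodule.le_of_le_smul_of_le_jacobson_bot (I := RingHom.ker (algebraMap A B)) hfg
      ?_ ?_
    · exact (le_maximalIdeal (RingHom.ker_ne_top _)).trans (maximalIdeal_le_jacobson _)
    · intro x hx
      let x' : P.ker := ⟨x, hx⟩
      have hsurj' : ∀ i, ∃ a : A, algebraMap A B a = b.repr (Extension.Cotangent.mk x') i :=
        fun i => hsurj _
      choose a ha using hsurj'
      have h0 : Extension.Cotangent.mk (x' - ∑ i, (a i : P.Ring) • c i) = 0 := by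
        rw [map_sub, hmk, sub_eq_zero]
        simp_rw [ha]
        exact (b.sum_repr _).symm
      rw [Extension.Cotangent.mk_eq_zero_iff] at h0
      have h1 : x - ∑ i, a i * (c i : A) ∈ RingHom.ker (algebraMap A B) ^ 2 := by
        rw [← hcoe a]; exact h0
      have h2 : x = (∑ i, a i * (c i : A)) + (x - ∑ i, a i * (c i : A)) := by ring
      rw [h2]
      refine Submodule.add_mem_sup ?_ (by simpa [pow_two] using h1)
      exact Ideal.sum_mem _ fun i _ => Ideal.mul_mem_left _ _ (Ideal.subset_span ⟨i, rfl⟩)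
  · intro a ha i
    have h0 : Extension.Cotangent.mk (∑ i, (a i : P.Ring) • c i) = 0 := by
      rw [Extension.Cotangent.mk_eq_zero_iff]
      rw [hcoe a]; exact ha
    rw [hmk] at h0
    exact Fintype.linearIndependent_iff.mp b.linearIndependent _ h0 i

open MvPolynomial in
lemma isHomogeneous_one_eq_sum {ι : Type*} [Fintype ι] {F : MvPolynomial ι k}
    (hF : F.IsHomogeneous 1) : F = ∑ i, C (coeff (Finsupp.single i 1) F) * X i := by
  classical
  ext x
  rw [coeff_sum]
  by_cases hx : ∃ j, x = Finsupp.single j 1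
  · obtain ⟨j, rfl⟩ := hx
    rw [Finset.sum_eq_single j]
    · simp [coeff_C_mul]
    · intro i _ hij
      rw [coeff_C_mul, coeff_X, if_neg, mul_zero]
      intro h
      exact hij (Finsupp.single_left_injective one_ne_zero h)
    · simp
  · rw [Finset.sum_eq_zero, hF.coeff_eq_zero]
    · intro h
      exact hx (by obtain ⟨j, hj⟩ := (Finsupp.sum_eq_one_iff x).mp h; exact ⟨j, hj⟩)
    · intro i _
      rw [coeff_C_mul, coeff_X, if_neg, mul_zero]
      intro h
      exact hx ⟨i, h.symm⟩

open MvPolynomial in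
-- Apply the conormal computation to the residue field, which is `k` and so is smooth without
-- differentials: `m/m²` is free of rank `r`. The lifted basis is independent in degree one, and
-- formal smoothness extends this to all degrees.
lemma exists_parameters_of_formallySmooth [IsLocalRing A] [IsNoetherianRing A]
    [FormallySmooth k A] [Module.Finite A Ω[A⁄k]] (hres : ResidueTrivial k A) {r : ℕ}
    (hr : Module.finrank A Ω[A⁄k] = r) :
    ∃ c : Fin r → A, maximalIdeal A = Ideal.span (Set.range c) ∧
      AnalyticallyIndependent k c := by
  let κ := ResidueField A
  have hbij : Function.Bijective (algebraMap k κ) := by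
    refine ⟨(algebraMap k κ).injective, fun x => ?_⟩
    obtain ⟨x, rfl⟩ := IsLocalRing.residue_surjective x
    obtain ⟨c, hc⟩ := hres x
    refine ⟨c, ?_⟩
    rw [IsScalarTower.algebraMap_apply k A κ]
    refine (sub_eq_zero.mp ?_).symm
    change residue A x - residue A _ = 0
    rw [← map_sub, residue_eq_zero_iff]
    exact hc
  have : FormallySmooth k κ := .of_equiv (AlgEquiv.ofBijective (Algebra.ofId k κ) hbij)
  have hsub : Subsingleton Ω[κ⁄k] := KaehlerDifferential.subsingleton_of_surjective k κ hbij.2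
  have hs : Function.Surjective (algebraMap A κ) := IsLocalRing.residue_surjective
  obtain ⟨-, c, hc, hind⟩ := exists_generators_ker_of_formallySmooth (k := k) hs hr
    (Module.finrank_zero_of_subsingleton (R := κ) (M := Ω[κ⁄k]))
  have hker : RingHom.ker (algebraMap A κ) = maximalIdeal A := IsLocalRing.ker_residue
  rw [hker] at hc hind
  refine ⟨c, hc, analyticallyIndependent_of_formallySmooth hres c hc ?_⟩
  intro F hF hFm
  have hsum : aeval c F = ∑ i, algebraMap k A (coeff (Finsupp.single i 1) F) * c i := by
    conv_lhs => rw [isHomogeneous_one_eq_sum hF]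
    simp
  have := hind (fun i => algebraMap k A (coeff (Finsupp.single i 1) F)) (hsum ▸ hFm)
  rw [isHomogeneous_one_eq_sum hF]
  refine Finset.sum_eq_zero fun i _ => ?_
  by_contra hne
  have hne' : coeff (Finsupp.single i 1) F ≠ 0 := fun h => hne (by rw [h, C_0, zero_mul])
  exact (maximalIdeal.isMaximal A).ne_top (Ideal.eq_top_of_isUnit_mem _ (this i)
    ((isUnit_iff_ne_zero.mpr hne').map _))

end Conormal


/-! ### The equation `a g = b h` of a node along a smooth surface. -/

section QuadricRelation

open IsLocalRing MvPolynomial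

variable {k A : Type*} [Field k] [CommRing A] [Algebra k A]

lemma sup_pow_succ_le (I J : Ideal A) (n : ℕ) :
    (I ⊔ J) ^ (n + 1) ≤ (I ⊔ J) ^ n * I ⊔ J ^ (n + 1) := by
  induction n with
  | zero => simp
  | succ n ih =>
    rw [pow_succ _ (n + 1)]
    refine (Ideal.mul_mono_left ih).trans ?_
    rw [Ideal.sup_mul, Ideal.mul_sup (J ^ (n + 1))]
    refine sup_le ?_ (sup_le ?_ ?_)
    · refine le_trans (le_of_eq ?_) le_sup_left
      rw [pow_succ]; ring
    · exact le_sup_of_le_left (Ideal.mul_mono_left (Ideal.pow_right_mono le_sup_right _))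
    · rw [← pow_succ]; exact le_sup_right

variable [IsLocalRing A]

/-- The elements `c i` form, modulo the ideal `I`, a system of analytically independent
generators of the maximal ideal. -/
structure IsParameterSystemMod (k : Type*) {A ι : Type*} [Field k] [CommRing A] [IsLocalRing A]
    [Algebra k A] (I : Ideal A) (c : ι → A) : Prop where
  sup_span : I ⊔ Ideal.span (Set.range c) = maximalIdeal A
  eq_zero : ∀ (n : ℕ) (F : MvPolynomial ι k), F.IsHomogeneous n →
    aeval c F ∈ I ⊔ maximalIdeal A ^ (n + 1) → F = 0

/-- Write an element of `m ^ (n + 1)` as an element of `m ^ n * I` plus a form of degree `n + 1` in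
the `c i` plus higher terms. If the element lies in `I`, the form is a relation modulo `I` and
vanishes. Iterating pushes the remainder into arbitrarily high powers of `m`, still inside `I`. -/
lemma IsParameterSystemMod.pow_inf_le {ι : Type*} [IsNoetherianRing A]
    (hres : ResidueTrivial k A) {I : Ideal A} {c : ι → A} (hc : IsParameterSystemMod k I c)
    (n : ℕ) : maximalIdeal A ^ (n + 1) ⊓ I ≤ maximalIdeal A ^ n * I := by
  set m := maximalIdeal A
  set J := Ideal.span (Set.range c)
  have hJm : J ≤ m := le_sup_right.trans hc.sup_span.le
  have step : ∀ p, n ≤ p → m ^ (p + 1) ⊓ I ≤ m ^ n * I ⊔ (m ^ (p + 2) ⊓ I) := by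
    rintro p hp y ⟨hy, hyI⟩
    have hy' : y ∈ m ^ p * I ⊔ J ^ (p + 1) := by
      have := sup_pow_succ_le I J p
      rw [hc.sup_span] at this
      exact this hy
    obtain ⟨i, hi, z, hz, rfl⟩ := Submodule.mem_sup.mp hy'
    have hiI : i ∈ I := Ideal.mul_le_right hi
    have hzI : z ∈ I := by simpa using I.sub_mem hyI hiI
    refine Submodule.add_mem_sup (Ideal.mul_mono_left (Ideal.pow_le_pow_right hp) hi) ⟨?_, hzI⟩
    obtain ⟨F, hF, hFz⟩ := exists_isHomogeneous_sub_mem hres c rfl (p + 1) hz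
    have h1 : z - aeval c F ∈ m ^ (p + 2) := by
      rw [pow_succ m (p + 1)]
      exact Ideal.mul_mono_left (Ideal.pow_right_mono hJm _) hFz
    have hF0 : F = 0 := by
      refine hc.eq_zero (p + 1) F hF ?_
      have : aeval c F = z - (z - aeval c F) := by ring
      rw [this]
      exact Ideal.sub_mem _ (Ideal.mem_sup_left hzI) (Ideal.mem_sup_right h1)
    rw [hF0, map_zero, sub_zero] at h1
    exact h1
  have steps : ∀ d, m ^ (n + 1) ⊓ I ≤ m ^ n * I ⊔ (m ^ (n + d + 1) ⊓ I) := by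
    intro d
    induction d with
    | zero => exact le_sup_right
    | succ d ih =>
      refine ih.trans (sup_le le_sup_left ?_)
      exact step (n + d) (by omega)
  -- Artin–Rees: far enough out, `m ^ N ⊓ I` is already contained in `m ^ n * I`.
  obtain ⟨e, he⟩ := Ideal.exists_pow_inf_eq_pow_smul m (I : Submodule A A)
  refine (steps e).trans (sup_le le_rfl ?_)
  have := he (n + e + 1) (by omega)
  simp only [smul_eq_mul, Ideal.mul_top] at this
  rw [this]
  refine (Ideal.mul_mono_right inf_le_right).trans (Ideal.mul_mono_left ?_)
  exact Ideal.pow_le_pow_right (by omega)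

lemma exists_linear_combination_sub_mem_sq {ι : Type*} [Fintype ι] (hres : ResidueTrivial k A)
    {x : ι → A} {m' : Ideal A} (hx : Ideal.span (Set.range x) ⊔ m' = maximalIdeal A)
    {y : A} (hy : y ∈ maximalIdeal A) :
    ∃ v : ι → k, y - ∑ j, v j • x j ∈ m' ⊔ maximalIdeal A ^ 2 := by
  rw [← hx] at hy
  obtain ⟨z, hz, w, hw, rfl⟩ := Submodule.mem_sup.mp hy
  obtain ⟨r, hr⟩ := (Submodule.mem_span_range_iff_exists_fun A).mp hz
  choose v hv using fun j => hres (r j)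
  refine ⟨v, ?_⟩
  have hxm : ∀ j, x j ∈ maximalIdeal A := fun j =>
    hx ▸ Ideal.mem_sup_left (Ideal.subset_span ⟨j, rfl⟩)
  have : z + w - ∑ j, v j • x j = w + ∑ j, (r j - algebraMap k A (v j)) * x j := by
    rw [← hr]
    simp only [smul_eq_mul, Algebra.smul_def, sub_mul, Finset.sum_sub_distrib]
    ring
  rw [this]
  refine Submodule.add_mem_sup hw (Ideal.sum_mem _ fun j _ => ?_)
  rw [pow_two]
  exact Ideal.mul_mem_mul (hv j) (hxm j)

/-- Split the cotangent space into the linear forms `y` vanishing on the surface and a complement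
`z` restricting to parameters of it. The quadratic form restricted to `y = 0` is a quadratic
relation between parameters, hence zero, so the form is `y ⬝ᵥ γ` with `γ` linear. Replacing `y` by
elements `a` of `I` leaves an error in `m ^ 3 ⊓ I`, which lies in `m ^ 2 * I` and can be absorbed
into `γ`. Nondegeneracy makes the mixed block invertible, so that `a` and the corrected `γ` generate
the maximal ideal. -/
theorem exists_quadric_relation [IsNoetherianRing A] (hk : (2 : k) ≠ 0)
    (hres : ResidueTrivial k A) {I : Ideal A} {c : Fin 2 → A} (hc : IsParameterSystemMod k I c)
    {x : Fin 4 → A} (hx : Ideal.span (Set.range x) ⊔ maximalIdeal A ^ 2 = maximalIdeal A)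
    {H : Matrix (Fin 4) (Fin 4) k} (hsymm : H.transpose = H) (hdet : H.det ≠ 0)
    (hq : x ⬝ᵥ (H.map (algebraMap k A)).mulVec x ∈ maximalIdeal A ^ 3) :
    ∃ a b g h : A, I = Ideal.span {a, b} ∧ a * g = b * h ∧
      maximalIdeal A = Ideal.span {a, b, g, h} := by
  classical
  set m := maximalIdeal A with hm
  have hxm : ∀ j, x j ∈ m := fun j => hx ▸ Ideal.mem_sup_left (Ideal.subset_span ⟨j, rfl⟩)
  have hIm : I ≤ m := le_sup_left.trans hc.sup_span.le
  have hcm : ∀ i, c i ∈ m := fun i =>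
    hc.sup_span.le (Ideal.mem_sup_right (Ideal.subset_span ⟨i, rfl⟩))
  have hsmul : ∀ (J : Ideal A) (v : k) {y : A}, y ∈ J → v • y ∈ J := fun J v y hy => by
    rw [Algebra.smul_def]; exact J.mul_mem_left _ hy
  -- linear relations among the parameters
  have hlin : ∀ v : Fin 2 → k, ∑ i, v i • c i ∈ I ⊔ m ^ 2 → v = 0 := by
    intro v hv
    have h0 := hc.eq_zero 1 (∑ i, C (v i) * X i)
      (IsHomogeneous.sum _ _ _ fun i _ => isHomogeneous_C_mul_X _ _) (by
        simpa [Algebra.smul_def] using hv)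
    ext i
    have := congrArg (coeff (Finsupp.single i 1)) h0
    rw [coeff_sum, coeff_zero, Finset.sum_eq_single i] at this
    · simpa [coeff_C_mul] using this
    · intro j _ hji
      rw [coeff_C_mul, coeff_X, if_neg, mul_zero]
      exact fun h => hji (Finsupp.single_left_injective one_ne_zero h)
    · simp
  -- the linear map to the cotangent space of the quotient
  have hsup : Ideal.span (Set.range c) ⊔ I = m := by rw [sup_comm]; exact hc.sup_span
  choose r hr using fun j => exists_linear_combination_sub_mem_sq (k := k) hres hsup (hxm j)
  let xl : (Fin 4 → k) →ₗ[k] A := Fintype.linearCombination k x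
  have hxl : ∀ v, xl v = ∑ j, v j • x j := fun v => Fintype.linearCombination_apply k x v
  have hxlm : ∀ v, xl v ∈ m := fun v => by
    rw [hxl]; exact Ideal.sum_mem _ fun j _ => hsmul _ _ (hxm j)
  let ρ : (Fin 4 → k) →ₗ[k] (Fin 2 → k) := Fintype.linearCombination k r
  have hρ : ∀ v, xl v - ∑ i, (ρ v) i • c i ∈ I ⊔ m ^ 2 := by
    intro v
    have : xl v - ∑ i, (ρ v) i • c i = ∑ j, v j • (x j - ∑ i, r j i • c i) := by
      rw [hxl]
      simp only [ρ, Fintype.linearCombination_apply, Finset.sum_apply, Pi.smul_apply, smul_sub,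
        Finset.sum_sub_distrib, Finset.sum_smul, Finset.smul_sum]
      rw [Finset.sum_comm (s := (Finset.univ : Finset (Fin 2)))]
      simp [mul_smul]
    rw [this]
    exact Ideal.sum_mem _ fun j _ => hsmul _ _ (hr j)
  have hρsurj : Function.Surjective ρ := by
    have hs : ∀ i, ∃ s : Fin 4 → k, ρ s = Pi.single i 1 := by
      intro i
      obtain ⟨s, hs⟩ := exists_linear_combination_sub_mem_sq (k := k) hres hx (hcm i)
      rw [sup_idem] at hs
      refine ⟨s, ?_⟩
      rw [← sub_eq_zero]
      apply hlin
      have h1 : ∑ l, (ρ s - (Pi.single i (1 : k) : Fin 2 → k)) l • c l =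
          -(c i - xl s) - (xl s - ∑ l, (ρ s) l • c l) := by
        simp [sub_smul, Finset.sum_sub_distrib, Pi.single_apply]
      rw [h1, hxl]
      refine Ideal.sub_mem _ (neg_mem (Ideal.mem_sup_right hs)) ?_
      rw [← hxl]; exact hρ s
    choose s hs using hs
    intro w
    refine ⟨∑ i, w i • s i, ?_⟩
    rw [map_sum]
    simp_rw [map_smul, hs]
    ext i; simp [Pi.single_apply]
  obtain ⟨σ, hσ⟩ := ρ.exists_rightInverse_of_surjective (LinearMap.range_eq_top.mpr hρsurj)
  have hkerrank : Module.finrank k (LinearMap.ker ρ) = 2 := by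
    have := LinearMap.finrank_range_add_finrank_ker ρ
    rw [LinearMap.range_eq_top.mpr hρsurj] at this
    simp at this; omega
  let bk : Module.Basis (Fin 2) k (LinearMap.ker ρ) := Module.finBasisOfFinrankEq k _ hkerrank
  -- new generators of the maximal ideal modulo its square
  let u : Fin 2 → (Fin 4 → k) := fun i => bk i
  let w : Fin 2 → (Fin 4 → k) := fun i => σ (Pi.single i 1)
  have hmemk : ∀ v, v - σ (ρ v) ∈ LinearMap.ker ρ := fun v => by
    rw [LinearMap.mem_ker, map_sub, ← LinearMap.comp_apply ρ σ, hσ]; simp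
  have hsingle : ∀ t : Fin 2 → k, t = ∑ i, t i • Pi.single i (1 : k) := fun t => by
    ext i; simp [Pi.single_apply]
  -- `p` holds the coordinates of the standard basis along the kernel of `ρ`, and `q` those along
  -- the section `σ`, so that `x = p y + q z`.
  let p : Matrix (Fin 4) (Fin 2) k := fun j => bk.repr ⟨_, hmemk (Pi.single j 1)⟩
  let q : Matrix (Fin 4) (Fin 2) k := fun j => ρ (Pi.single j 1)
  let Um : Matrix (Fin 2) (Fin 4) k := u
  let Wm : Matrix (Fin 2) (Fin 4) k := w
  have hdec : ∀ j : Fin 4, Pi.single j 1 = ∑ i, p j i • u i + ∑ i, q j i • w i := by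
    intro j
    have h1 : ∑ i, p j i • u i = Pi.single j 1 - σ (ρ (Pi.single j 1)) := by
      have := congrArg (Submodule.subtype _) (bk.sum_repr ⟨_, hmemk (Pi.single j 1)⟩)
      rw [map_sum] at this
      simpa only [map_smul, Submodule.subtype_apply] using this
    have h2 : ∑ i, q j i • w i = σ (ρ (Pi.single j 1)) := by
      conv_rhs => rw [hsingle (ρ (Pi.single j 1)), map_sum]
      simp [w, q]
    rw [h1, h2]; simp
  have hpq : p * Um + q * Wm = 1 := by
    ext j l
    have := congrFun (hdec j) l
    rw [Matrix.add_apply, Matrix.mul_apply, Matrix.mul_apply, Matrix.one_apply]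
    simp only [Pi.add_apply, Finset.sum_apply, Pi.smul_apply, smul_eq_mul] at this
    rw [← this, Pi.single_apply]
    simp [eq_comm]
  have hρw : ∀ i, ρ (w i) = Pi.single i 1 := fun i => LinearMap.congr_fun hσ _
  have hWq : Wm * q = 1 := by
    ext i l
    rw [Matrix.mul_apply, Matrix.one_apply]
    have h1 : w i = ∑ j, w i j • Pi.single j (1 : k) := by ext l; simp [Pi.single_apply]
    have h2 := congrFun (hρw i) l
    rw [h1, map_sum] at h2
    simp only [map_smul, Finset.sum_apply, Pi.smul_apply, smul_eq_mul] at h2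
    change ∑ j, w i j * ρ (Pi.single j 1) l = _
    rw [h2, Pi.single_apply]; simp [eq_comm]
  let φ := algebraMap k A
  let y : Fin 2 → A := fun i => xl (u i)
  let z : Fin 2 → A := fun i => xl (w i)
  have hxyz : x = (p.map φ).mulVec y + (q.map φ).mulVec z := by
    ext j
    have h1 : x j = xl (Pi.single j 1) := by rw [hxl]; simp [Pi.single_apply]
    rw [h1, hdec j, map_add, map_sum, map_sum]
    simp only [map_smul]
    simp [Matrix.mulVec, dotProduct, y, z, ← Algebra.smul_def, φ]
  have hyI : ∀ i, y i ∈ I ⊔ m ^ 2 := fun i => by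
    have := hρ (u i)
    have h0 : ρ (u i) = 0 := (bk i).2
    rw [h0] at this; simpa using this
  have hzc : ∀ i, z i - c i ∈ I ⊔ m ^ 2 := fun i => by
    have := hρ (w i)
    rw [hρw] at this
    simpa [Pi.single_apply] using this
  have hym : ∀ i, y i ∈ m := fun i => hxlm _
  have hzm : ∀ i, z i ∈ m := fun i => hxlm _
  let U : Matrix (Fin 2) (Fin 2) k := p.transpose * H * p
  let W : Matrix (Fin 2) (Fin 2) k := p.transpose * H * q
  let T : Matrix (Fin 2) (Fin 2) k := q.transpose * H * q
  have hbil : ∀ (P Q : Matrix (Fin 4) (Fin 2) k) (s t : Fin 2 → A),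
      (P.map φ).mulVec s ⬝ᵥ (H.map φ).mulVec ((Q.map φ).mulVec t) =
        s ⬝ᵥ ((P.transpose * H * Q).map φ).mulVec t := by
    intro P Q s t
    rw [Matrix.map_mul, Matrix.map_mul, Matrix.mulVec_mulVec, Matrix.dotProduct_mulVec,
      Matrix.dotProduct_mulVec, ← Matrix.vecMul_transpose, Matrix.vecMul_vecMul,
      Matrix.transpose_map, Matrix.mul_assoc]
  have hsw : ∀ (M : Matrix (Fin 2) (Fin 2) A) (s t : Fin 2 → A),
      s ⬝ᵥ M.mulVec t = t ⬝ᵥ M.transpose.mulVec s := by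
    intro M s t
    rw [Matrix.dotProduct_mulVec, dotProduct_comm, Matrix.mulVec_transpose]
  -- The cofactor of `y` in `yᵀUy + 2 yᵀWz + zᵀTz`.
  let γ : Fin 2 → A := (U.map φ).mulVec y + (2 : A) • (W.map φ).mulVec z
  have hform : x ⬝ᵥ (H.map φ).mulVec x = y ⬝ᵥ γ + z ⬝ᵥ (T.map φ).mulVec z := by
    have h1 : z ⬝ᵥ ((q.transpose * H * p).map φ).mulVec y = y ⬝ᵥ (W.map φ).mulVec z := by
      rw [hsw, ← Matrix.transpose_map]
      congr 3
      rw [Matrix.transpose_mul, Matrix.transpose_mul, hsymm, Matrix.transpose_transpose,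
        ← Matrix.mul_assoc]
    conv_lhs => rw [hxyz]
    rw [Matrix.mulVec_add, add_dotProduct, dotProduct_add, dotProduct_add, hbil, hbil, hbil, hbil,
      h1, dotProduct_add, dotProduct_smul, smul_eq_mul]
    ring
  have hmv : ∀ (M : Matrix (Fin 2) (Fin 2) k) (t : Fin 2 → A) (J : Ideal A), (∀ i, t i ∈ J) →
      ∀ i, (M.map φ).mulVec t i ∈ J := fun M t J ht i =>
    show ∑ j, (M.map φ) i j * t j ∈ J from Ideal.sum_mem _ fun j _ => J.mul_mem_left _ (ht j)
  have hdot : ∀ (s t : Fin 2 → A) (J K : Ideal A), (∀ i, s i ∈ J) → (∀ i, t i ∈ K) →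
      s ⬝ᵥ t ∈ J * K := fun s t J K hs ht =>
    Ideal.sum_mem _ fun j _ => Ideal.mul_mem_mul (hs j) (ht j)
  have hγm : ∀ i, γ i ∈ m := fun i => m.add_mem (hmv _ _ _ hym i)
    (m.mul_mem_left _ (hmv _ _ _ hzm i))
  have hle3 : (I ⊔ m ^ 2) * m ≤ I ⊔ m ^ 3 := by
    rw [Ideal.sup_mul, ← pow_succ]
    exact sup_le_sup_right Ideal.mul_le_left _
  have hTz : z ⬝ᵥ (T.map φ).mulVec z ∈ I ⊔ m ^ 3 := by
    have h1 : z ⬝ᵥ (T.map φ).mulVec z = x ⬝ᵥ (H.map φ).mulVec x - y ⬝ᵥ γ := by rw [hform]; ring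
    rw [h1]
    exact Ideal.sub_mem _ (Ideal.mem_sup_right hq) (hle3 (hdot _ _ _ _ hyI hγm))
  have hTc : c ⬝ᵥ (T.map φ).mulVec c ∈ I ⊔ m ^ 3 := by
    have h1 : c ⬝ᵥ (T.map φ).mulVec c = z ⬝ᵥ (T.map φ).mulVec z -
        (z - c) ⬝ᵥ (T.map φ).mulVec z - (z - c) ⬝ᵥ (T.map φ).transpose.mulVec c := by
      rw [← hsw, sub_dotProduct, Matrix.mulVec_sub, dotProduct_sub]
      ring
    rw [h1, ← Matrix.transpose_map]
    exact Ideal.sub_mem _ (Ideal.sub_mem _ hTz (hle3 (hdot _ _ _ _ hzc (hmv _ _ _ hzm))))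
      (hle3 (hdot _ _ _ _ hzc (hmv _ _ _ hcm)))
  have hTsymm : T.transpose = T := by
    simp only [T, Matrix.transpose_mul, hsymm, Matrix.transpose_transpose, Matrix.mul_assoc]
  -- The plane is isotropic: `T` is a quadratic form in the parameters that vanishes modulo `I ⊔ m ^
  -- 3`. Its mixed coefficient appears doubled, so `2 ≠ 0` is needed.
  have hT0 : T = 0 := by
    have h0 := hc.eq_zero 2 (∑ i, ∑ j, C (T i j) * (X i * X j))
      (IsHomogeneous.sum _ _ _ fun i _ => IsHomogeneous.sum _ _ _ fun j _ => by
        simpa using (isHomogeneous_C _ (T i j)).mul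
          ((isHomogeneous_X k i).mul (isHomogeneous_X k j))) (by
        convert hTc using 1
        simp only [map_sum, map_mul, aeval_C, aeval_X, dotProduct, Matrix.mulVec, Matrix.map_apply,
          Finset.mul_sum, φ]
        refine Finset.sum_congr rfl fun i _ => Finset.sum_congr rfl fun j _ => ?_
        ring)
    have hev : ∀ a b : k, T 0 0 * a * a + 2 * T 0 1 * a * b + T 1 1 * b * b = 0 := by
      intro a b
      have := congrArg (eval ![a, b]) h0
      have h10 : T 1 0 = T 0 1 := congrFun (congrFun hTsymm 0) 1
      simp [Fin.sum_univ_two, h10] at this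
      linear_combination this
    have h00 : T 0 0 = 0 := by simpa using hev 1 0
    have h11 : T 1 1 = 0 := by simpa using hev 0 1
    have h01 : T 0 1 = 0 := by
      have := hev 1 1
      simp [h00, h11, hk] at this
      exact this
    have h10 : T 1 0 = 0 := by rw [← h01]; exact congrFun (congrFun hTsymm 0) 1
    ext i j
    fin_cases i <;> fin_cases j <;> simp [h00, h11, h01, h10]
  -- inverting the off-diagonal block
  let Lft : Matrix (Fin 2) (Fin 2) k := Wm * H⁻¹ * Um.transpose
  -- With `T = 0` the product `Um.transpose * W` collapses to `H * q`, and `H` is invertible.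
  have hLft : Lft * W = 1 := by
    have h1 : Um.transpose * W = H * q := by
      have h2 : Um.transpose * p.transpose = 1 - Wm.transpose * q.transpose := by
        rw [← Matrix.transpose_mul, ← Matrix.transpose_mul, ← Matrix.transpose_one,
          ← Matrix.transpose_sub, ← hpq, add_sub_cancel_right]
      calc Um.transpose * W = (Um.transpose * p.transpose) * (H * q) := by
            simp only [W, Matrix.mul_assoc]
        _ = H * q - Wm.transpose * T := by
            rw [h2, Matrix.sub_mul, Matrix.one_mul]; simp only [T, Matrix.mul_assoc]
        _ = H * q := by rw [hT0]; simp
    calc Lft * W = Wm * H⁻¹ * (Um.transpose * W) := by simp only [Lft, Matrix.mul_assoc]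
      _ = Wm * (H⁻¹ * H) * q := by rw [h1]; simp only [Matrix.mul_assoc]
      _ = 1 := by
        rw [Matrix.nonsing_inv_mul _ (isUnit_iff_ne_zero.mpr hdet), Matrix.mul_one, hWq]
  -- lifting to `I`
  have hlift : ∀ i, ∃ a ∈ I, y i - a ∈ m ^ 2 := fun i => by
    obtain ⟨a, ha, b, hb, hab⟩ := Submodule.mem_sup.mp (hyI i)
    exact ⟨a, ha, by rw [← hab]; simpa using hb⟩
  choose a haI hay using hlift
  -- Nakayama: an element of `I` agrees with a combination of the `a i` up to `m ^ 2 ⊓ I`, which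
  -- lies in `m * I`.
  have hIa : I = Ideal.span (Set.range a) := by
    have hle : Ideal.span (Set.range a) ≤ I := by
      rw [Ideal.span_le]; rintro _ ⟨i, rfl⟩; exact haI i
    refine le_antisymm ?_ hle
    refine Submodule.le_of_le_smul_of_le_jacobson_bot (I := m) (IsNoetherian.noetherian _)
      (maximalIdeal_le_jacobson _) ?_
    intro t ht
    obtain ⟨v, hv⟩ := exists_linear_combination_sub_mem_sq (k := k) hres hx (hIm ht)
    rw [sup_idem, ← hxl] at hv
    have hρv : ρ v = 0 := by
      apply hlin
      have h1 : ∑ i, (ρ v) i • c i = t - (t - xl v) - (xl v - ∑ i, (ρ v) i • c i) := by ring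
      rw [h1]
      exact Ideal.sub_mem _ (Ideal.sub_mem _ (Ideal.mem_sup_left ht) (Ideal.mem_sup_right hv))
        (hρ v)
    have hvu : v = ∑ i, bk.repr ⟨v, hρv⟩ i • u i := by
      have := congrArg (Submodule.subtype _) (bk.sum_repr ⟨v, hρv⟩)
      rw [map_sum] at this
      simpa only [map_smul, Submodule.subtype_apply] using this.symm
    set s := bk.repr ⟨v, hρv⟩
    have hxv : xl v = ∑ i, s i • y i := by rw [hvu, map_sum]; simp [y]
    have hmem : t - ∑ i, s i • a i ∈ m ^ 2 := by
      have h1 : t - ∑ i, s i • a i = (t - xl v) + ∑ i, s i • (y i - a i) := by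
        rw [hxv]; simp only [smul_sub, Finset.sum_sub_distrib]; ring
      rw [h1]
      exact Ideal.add_mem _ hv (Ideal.sum_mem _ fun i _ => hsmul _ _ (hay i))
    have hmem' : ∑ i, s i • a i ∈ Ideal.span (Set.range a) :=
      Ideal.sum_mem _ fun i _ => hsmul _ _ (Ideal.subset_span ⟨i, rfl⟩)
    have h2 : t = ∑ i, s i • a i + (t - ∑ i, s i • a i) := by ring
    rw [h2]
    refine Submodule.add_mem_sup hmem' ?_
    have := hc.pow_inf_le hres 1 ⟨hmem, I.sub_mem ht (hle hmem')⟩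
    simpa using this
  -- This puts the error in the form `∑ δ i * a i` with `δ i ∈ m ^ 2`, so that subtracting `δ` from
  -- `γ` gives an exact relation without changing `γ` modulo `m ^ 2`.
  have hdotI : a ⬝ᵥ γ ∈ m ^ 2 * I := by
    refine hc.pow_inf_le hres 2 ⟨?_, ?_⟩
    · have h1 : a ⬝ᵥ γ = x ⬝ᵥ (H.map φ).mulVec x - (y - a) ⬝ᵥ γ := by
        rw [hform, hT0, sub_dotProduct]; simp
      rw [h1]
      refine Ideal.sub_mem _ hq ?_
      have := hdot (y - a) γ (m ^ 2) m hay hγm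
      rwa [← pow_succ] at this
    · exact Ideal.sum_mem _ fun i _ => I.mul_mem_right _ (haI i)
  rw [hIa] at hdotI
  obtain ⟨δ, hδ, hδs⟩ := (Submodule.mem_ideal_smul_span_iff_exists_sum _ _ _).mp
    (by rwa [← smul_eq_mul] at hdotI : a ⬝ᵥ γ ∈ m ^ 2 • Submodule.span A (Set.range a))
  rw [Finsupp.sum_fintype _ _ (by simp)] at hδs
  have hrel : a 0 * (γ 0 - δ 0) = a 1 * (δ 1 - γ 1) := by
    simp only [dotProduct, Fin.sum_univ_two, smul_eq_mul] at hδs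
    linear_combination -hδs
  refine ⟨a 0, a 1, γ 0 - δ 0, δ 1 - γ 1, ?_, hrel, ?_⟩
  · rw [hIa]; congr 1; ext t; simp [Fin.exists_fin_two, eq_comm]
  · set S := Ideal.span {a 0, a 1, γ 0 - δ 0, δ 1 - γ 1}
    have hm2 : ∀ i, δ i ∈ m := fun i => Ideal.pow_le_self two_ne_zero (hδ i)
    have hSm : S ≤ m := by
      rw [Ideal.span_le]
      rintro t (rfl | rfl | rfl | rfl)
      exacts [hIm (haI 0), hIm (haI 1), m.sub_mem (hγm 0) (hm2 0), m.sub_mem (hm2 1) (hγm 1)]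
    refine le_antisymm ?_ hSm
    refine Submodule.le_of_le_smul_of_le_jacobson_bot (I := m) (IsNoetherian.noetherian _)
      (maximalIdeal_le_jacobson _) ?_
    change m ≤ S ⊔ m * m
    rw [← pow_two]
    have haS : ∀ i, a i ∈ S ⊔ m ^ 2 := by
      intro i; apply Ideal.mem_sup_left; fin_cases i <;> exact Ideal.subset_span (by simp)
    have hyS : ∀ i, y i ∈ S ⊔ m ^ 2 := fun i => by
      have := Ideal.add_mem _ (Ideal.mem_sup_right (hay i)) (haS i)
      simpa using this
    have hγS : ∀ i, γ i ∈ S ⊔ m ^ 2 := by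
      have h1 : γ 0 - δ 0 ∈ S := Ideal.subset_span (by simp)
      have h2 : δ 1 - γ 1 ∈ S := Ideal.subset_span (by simp)
      intro i; fin_cases i
      · simpa using Ideal.add_mem _ (Ideal.mem_sup_left h1) (Ideal.mem_sup_right (S := S) (hδ 0))
      · simpa using Ideal.sub_mem _ (Ideal.mem_sup_right (S := S) (hδ 1)) (Ideal.mem_sup_left h2)
    -- Solve `2 W z = γ - U y` for `z`: both `2` and `W` are invertible, and the right side already
    -- lies in `S ⊔ m ^ 2`.
    have hzS : ∀ i, z i ∈ S ⊔ m ^ 2 := by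
      intro i
      have h1 : (2 : A) • (Lft.map φ).mulVec ((W.map φ).mulVec z) =
          (Lft.map φ).mulVec (γ - (U.map φ).mulVec y) := by
        rw [← Matrix.mulVec_smul]; congr 1; simp [γ]
      rw [Matrix.mulVec_mulVec, ← Matrix.map_mul, hLft, Matrix.map_one _ (map_zero φ) (map_one φ),
        Matrix.one_mulVec] at h1
      have h2 : z i = φ 2⁻¹ * ((2 : A) • z) i := by
        have : φ 2⁻¹ * 2 = 1 := by
          rw [← map_ofNat φ 2, ← map_mul, inv_mul_cancel₀ hk, map_one]
        rw [Pi.smul_apply, smul_eq_mul, ← mul_assoc, this, one_mul]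
      rw [h2, h1]
      exact Ideal.mul_mem_left _ _ (hmv _ _ _ (fun i => Ideal.sub_mem _ (hγS i)
        (hmv _ _ _ hyS i)) i)
    have hxS : ∀ j, x j ∈ S ⊔ m ^ 2 := by
      intro j
      rw [hxyz]
      have hP : ∀ (P : Matrix (Fin 4) (Fin 2) k) (t : Fin 2 → A), (∀ i, t i ∈ S ⊔ m ^ 2) →
          ∑ i, (P.map φ) j i * t i ∈ S ⊔ m ^ 2 := fun P t ht =>
        Ideal.sum_mem _ fun i _ => Ideal.mul_mem_left _ _ (ht i)
      exact Ideal.add_mem _ (hP p y hyS) (hP q z hzS)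
    conv_lhs => rw [← hx]
    refine sup_le ?_ le_sup_right
    rw [Ideal.span_le]; rintro _ ⟨j, rfl⟩; exact hxS j

end QuadricRelation


/-! ### Analytically independent parameters: differentials, quotients, prime ideals. -/

section Parameters

open IsLocalRing MvPolynomial

/-- Nakayama: every `y` is a constant plus an element of `m`, and by the Leibniz rule the
differentials of `m` lie in the span of the `dx_i` plus `m Ω`. The base `P` is arbitrary, because
the statement is also used over a polynomial ring to prove that an algebra is unramified. -/
lemma span_range_D_eq_top {P O ι : Type*} [CommRing P] [CommRing O] [IsLocalRing O] [Algebra P O]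
    [Module.Finite O Ω[O⁄P]] (hres : ∀ y : O, ∃ c : P, y - algebraMap P O c ∈ maximalIdeal O)
    {x : ι → O} (hx : maximalIdeal O = Ideal.span (Set.range x)) :
    Submodule.span O (Set.range fun i => KaehlerDifferential.D P O (x i)) = ⊤ := by
  set N := Submodule.span O (Set.range fun i => KaehlerDifferential.D P O (x i))
  rw [eq_top_iff]
  refine Submodule.le_of_le_smul_of_le_jacobson_bot (I := maximalIdeal O) Module.Finite.fg_top
    (maximalIdeal_le_jacobson _) ?_
  rw [← KaehlerDifferential.span_range_derivation P O, Submodule.span_le]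
  rintro _ ⟨y, rfl⟩
  obtain ⟨c, hc⟩ := hres y
  have key : ∀ z ∈ Ideal.span (Set.range x), KaehlerDifferential.D P O z ∈
      N ⊔ maximalIdeal O • (⊤ : Submodule O Ω[O⁄P]) := by
    intro z hz
    induction hz using Submodule.span_induction with
    | mem z hz =>
      obtain ⟨i, rfl⟩ := hz
      exact Submodule.mem_sup_left (Submodule.subset_span ⟨i, rfl⟩)
    | zero => simp
    | add u v _ _ hu hv => rw [map_add]; exact Submodule.add_mem _ hu hv
    | smul a z hz ih =>
      rw [smul_eq_mul, Derivation.leibniz]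
      refine Submodule.add_mem _ (Submodule.smul_mem _ _ ih) (Submodule.mem_sup_right ?_)
      exact Submodule.smul_mem_smul (hx ▸ hz) trivial
  have h := key _ (hx ▸ hc)
  rw [map_sub, Derivation.map_algebraMap, sub_zero] at h
  rw [KaehlerDifferential.span_range_derivation]
  exact h

variable {k A : Type*} [Field k] [CommRing A] [Algebra k A] [IsLocalRing A]

lemma AnalyticallyIndependent.notMem_sq {ι : Type*} {c : ι → A}
    (h : AnalyticallyIndependent k c) (i : ι) : c i ∉ maximalIdeal A ^ 2 := by
  intro hi
  have := h 1 (X i) (isHomogeneous_X k i) (by simpa using hi)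
  exact X_ne_zero i this

lemma AnalyticallyIndependent.comp_equiv {ι κ : Type*} {c : ι → A}
    (h : AnalyticallyIndependent k c) (e : κ ≃ ι) : AnalyticallyIndependent k (c ∘ e) := by
  intro n F hF hFm
  have := h n (rename e F) hF.rename_isHomogeneous (by rwa [aeval_rename])
  exact rename_injective e e.injective (by rw [this, map_zero])

/-- A parameter may be divided out: if a form `F` in the other parameters equals `ω * c none` to
leading order, then `F = G * X none` with `G` the leading form of `ω`. Since `F` does not involve `X
none`, both sides vanish. -/
theorem IsParameterSystemMod.of_analyticallyIndependent [IsNoetherianRing A] {ι : Type*}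
    (hres : ResidueTrivial k A) {c : Option ι → A}
    (hc : maximalIdeal A = Ideal.span (Set.range c)) (hind : AnalyticallyIndependent k c) :
    IsParameterSystemMod k (Ideal.span {c none}) (fun i => c (some i)) where
  sup_span := by
    rw [hc, ← Ideal.span_union]
    congr 1
    ext y
    simp only [Set.mem_union, Set.mem_singleton_iff, Set.mem_range, Option.exists, eq_comm]
  eq_zero := by
    intro n F hF hFm
    have hcm : ∀ o, c o ∈ maximalIdeal A := fun o => hc ▸ Ideal.subset_span ⟨o, rfl⟩
    obtain ⟨y, hy, μ, hμ, hyμ⟩ := Submodule.mem_sup.mp hFm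
    obtain ⟨ω, rfl⟩ := Ideal.mem_span_singleton'.mp hy
    have hF' : aeval c (rename some F) = aeval (fun i => c (some i)) F := by
      rw [aeval_rename]; rfl
    by_cases hn : n = 0
    · refine rename_injective (R := k) some (Option.some_injective ι) ?_
      rw [map_zero]
      refine hind n _ hF.rename_isHomogeneous ?_
      rw [hF', ← hyμ, hn]
      rw [hn] at hμ
      refine Ideal.add_mem _ ?_ hμ
      simpa using Ideal.mul_mem_left _ ω (hcm none)
    obtain ⟨n, rfl⟩ := Nat.exists_eq_succ_of_ne_zero hn
    -- Orders add and `c none` has order exactly one, so a product of order at least `n + 1` forces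
    -- `ω` to have order at least `n`.
    have hω : ω ∈ maximalIdeal A ^ n := by
      by_contra hω
      have hω0 : ω ≠ 0 := by rintro rfl; exact hω (zero_mem _)
      obtain ⟨q, hq, hq'⟩ := exists_mem_pow_notMem_pow hω0
      have hqn : q < n := by
        by_contra h; exact hω (Ideal.pow_le_pow_right (not_lt.mp h) hq)
      refine mul_notMem_pow_of_analyticallyIndependent hres hc hind hq hq'
        (p := q) (q := 1) (y := c none) (by simpa using hcm none) (hind.notMem_sq none) ?_
      refine Ideal.pow_le_pow_right (show q + 1 + 1 ≤ n + 1 by omega) ?_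
      have : ω * c none = aeval (fun i => c (some i)) F - μ := by rw [← hyμ]; ring
      rw [this]
      exact Ideal.sub_mem _ (aeval_mem_pow _ _ (fun i => hcm _) hF)
        (Ideal.pow_le_pow_right (by omega) hμ)
    obtain ⟨G, hG, hGω⟩ := exists_isHomogeneous_sub_mem hres c hc n hω
    have h0 : rename some F - G * X none = 0 := by
      refine hind (n + 1) _ (hF.rename_isHomogeneous.sub (hG.mul (isHomogeneous_X k none))) ?_
      rw [map_sub, map_mul, aeval_X, hF', ← hyμ]
      have : ω * c none + μ - aeval c G * c none = (ω - aeval c G) * c none + μ := by ring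
      rw [this]
      refine Ideal.add_mem _ ?_ hμ
      rw [← pow_succ] at hGω
      rw [pow_succ _ (n + 1)]
      exact Ideal.mul_mem_mul hGω (hcm none)
    -- Setting the variable `X none` to zero kills `G * X none` and leaves `F`.
    have := congrArg (aeval (fun o : Option ι => o.elim (0 : MvPolynomial ι k) X)) h0
    rw [map_sub, map_mul, aeval_X, aeval_rename, map_zero] at this
    simpa [Function.comp_def] using this

section Quotient

variable {B : Type*} [CommRing B] [IsLocalRing B] [Algebra A B] [Algebra k B] [IsScalarTower k A B]

lemma comap_maximalIdeal_pow (hsurj : Function.Surjective (algebraMap A B)) (n : ℕ) :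
    (maximalIdeal B ^ n).comap (algebraMap A B) =
      RingHom.ker (algebraMap A B) ⊔ maximalIdeal A ^ n := by
  have h1 : maximalIdeal B = (maximalIdeal A).map (algebraMap A B) := by
    have : IsLocalHom (algebraMap A B) := IsLocalHom.of_surjective _ hsurj
    have hcomap : (maximalIdeal B).comap (algebraMap A B) = maximalIdeal A :=
      ((local_hom_TFAE (algebraMap A B)).out 0 4).mp this
    rw [← hcomap, Ideal.map_comap_of_surjective _ hsurj]
  rw [h1, ← Ideal.map_pow, Ideal.comap_map_of_surjective' _ hsurj, sup_comm]

lemma isParameterSystemMod_ker_iff (hsurj : Function.Surjective (algebraMap A B)) {ι : Type*}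
    {c : ι → A} : IsParameterSystemMod k (RingHom.ker (algebraMap A B)) c ↔
      maximalIdeal B = Ideal.span (Set.range fun i => algebraMap A B (c i)) ∧
        AnalyticallyIndependent k (fun i => algebraMap A B (c i)) := by
  have hloc : IsLocalHom (algebraMap A B) := IsLocalHom.of_surjective _ hsurj
  have hcomap : (maximalIdeal B).comap (algebraMap A B) = maximalIdeal A :=
    ((local_hom_TFAE (algebraMap A B)).out 0 4).mp hloc
  have hspan : Ideal.span (Set.range fun i => algebraMap A B (c i)) =
      (Ideal.span (Set.range c)).map (algebraMap A B) := by
    rw [Ideal.map_span, ← Set.range_comp]; rfl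
  have haeval : ∀ F : MvPolynomial ι k, aeval (fun i => algebraMap A B (c i)) F =
      algebraMap A B (aeval c F) := fun F => (aeval_algebraMap_apply B c F)
  constructor
  · rintro ⟨h1, h2⟩
    refine ⟨?_, fun n F hF hFm => h2 n F hF ?_⟩
    · rw [hspan]
      apply Ideal.comap_injective_of_surjective _ hsurj
      rw [hcomap, Ideal.comap_map_of_surjective' _ hsurj, sup_comm, h1]
    · rw [← comap_maximalIdeal_pow (B := B) hsurj, Ideal.mem_comap, ← haeval]; exact hFm
  · rintro ⟨h1, h2⟩
    refine ⟨?_, fun n F hF hFm => h2 n F hF ?_⟩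
    · rw [← hcomap, h1, hspan, Ideal.comap_map_of_surjective' _ hsurj, sup_comm]
    · rw [← comap_maximalIdeal_pow (B := B) hsurj, Ideal.mem_comap, ← haeval] at hFm; exact hFm

end Quotient

lemma ResidueTrivial.of_surjective {B : Type*} [CommRing B] [IsLocalRing B] [Algebra A B]
    [Algebra k B] [IsScalarTower k A B] (hres : ResidueTrivial k A)
    (hsurj : Function.Surjective (algebraMap A B)) : ResidueTrivial k B := by
  intro y
  obtain ⟨x, rfl⟩ := hsurj y
  obtain ⟨c, hc⟩ := hres x
  have hloc : IsLocalHom (algebraMap A B) := IsLocalHom.of_surjective _ hsurj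
  have hcomap : (maximalIdeal B).comap (algebraMap A B) = maximalIdeal A :=
    ((local_hom_TFAE (algebraMap A B)).out 0 4).mp hloc
  refine ⟨c, ?_⟩
  rw [IsScalarTower.algebraMap_apply k A B, ← map_sub, ← Ideal.mem_comap, hcomap]
  exact hc

/-- The images of the `c i` are analytically independent generators of the maximal ideal of the
quotient, which is therefore a domain. -/
theorem IsParameterSystemMod.isPrime [IsNoetherianRing A] (hres : ResidueTrivial k A)
    {I : Ideal A} (hI : I ≠ ⊤) {ι : Type*} {c : ι → A} (hc : IsParameterSystemMod k I c) :
    I.IsPrime := by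
  have : Nontrivial (A ⧸ I) := Ideal.Quotient.nontrivial_iff.mpr hI
  have hsurj : Function.Surjective (algebraMap A (A ⧸ I)) := Ideal.Quotient.mk_surjective
  have : IsLocalRing (A ⧸ I) := .of_surjective' _ hsurj
  have hker : RingHom.ker (algebraMap A (A ⧸ I)) = I := Ideal.mk_ker
  rw [← hker] at hc
  obtain ⟨h1, h2⟩ := (isParameterSystemMod_ker_iff (B := A ⧸ I) hsurj).mp hc
  have := isDomain_of_analyticallyIndependent (hres.of_surjective (B := A ⧸ I) hsurj) h1 h2
  exact (Ideal.Quotient.isDomain_iff_prime I).mp this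

lemma IsParameterSystemMod.notMem {I : Ideal A} {ι : Type*} {c : ι → A}
    (hc : IsParameterSystemMod k I c) (i : ι) : c i ∉ I := fun hi =>
  X_ne_zero (R := k) i (hc.eq_zero 1 (X i) (isHomogeneous_X k i)
    (by rw [aeval_X]; exact Ideal.mem_sup_left hi))

/-- Any generating family of the right size is independent. Expressing the independent parameters
`c` through `x` and back gives square matrices with product one modulo `m ^ 2`, hence mutually
inverse, so a linear relation between the `x i` would be one between the `c i`. -/
theorem analyticallyIndependent_of_finrank {k A : Type} [Field k] [CommRing A] [Algebra k A]
    [IsLocalRing A] [IsNoetherianRing A] [Algebra.FormallySmooth k A]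
    [Module.Finite A Ω[A⁄k]] (hres : ResidueTrivial k A) {r : ℕ}
    (hr : Module.finrank A Ω[A⁄k] = r) {x : Fin r → A}
    (hx : maximalIdeal A = Ideal.span (Set.range x)) : AnalyticallyIndependent k x := by
  classical
  obtain ⟨c, hc, hind⟩ := exists_parameters_of_formallySmooth hres hr
  refine analyticallyIndependent_of_formallySmooth hres x hx ?_
  have hcm : ∀ i, c i ∈ maximalIdeal A := fun i => hc ▸ Ideal.subset_span ⟨i, rfl⟩
  have hxm : ∀ i, x i ∈ maximalIdeal A := fun i => hx ▸ Ideal.subset_span ⟨i, rfl⟩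
  have hlin : ∀ v : Fin r → k, ∑ i, v i • c i ∈ maximalIdeal A ^ 2 → v = 0 := by
    intro v hv
    have h0 := hind 1 (∑ i, C (v i) * X i)
      (IsHomogeneous.sum _ _ _ fun i _ => isHomogeneous_C_mul_X _ _) (by
        simpa [Algebra.smul_def] using hv)
    ext i
    have := congrArg (coeff (Finsupp.single i 1)) h0
    rw [coeff_sum, coeff_zero, Finset.sum_eq_single i] at this
    · simpa [coeff_C_mul] using this
    · intro j _ hji
      rw [coeff_C_mul, coeff_X, if_neg, mul_zero]
      exact fun h => hji (Finsupp.single_left_injective one_ne_zero h)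
    · simp
  choose M hM using fun i => exists_linear_combination_sub_mem_sq (k := k) hres (x := x) (m' := ⊥)
    (by rw [sup_bot_eq, hx]) (hcm i)
  choose N hN using fun i => exists_linear_combination_sub_mem_sq (k := k) hres (x := c) (m' := ⊥)
    (by rw [sup_bot_eq, hc]) (hxm i)
  simp only [bot_sup_eq] at hM hN
  have hsm : ∀ (v : k) {y : A}, y ∈ maximalIdeal A ^ 2 → v • y ∈ maximalIdeal A ^ 2 :=
    fun v y hy => by rw [Algebra.smul_def]; exact Ideal.mul_mem_left _ _ hy
  have hcomp : ∀ (v : Fin r → k), ∑ i, v i • x i - ∑ j, (∑ i, v i * N i j) • c j ∈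
      maximalIdeal A ^ 2 := by
    intro v
    have : ∑ i, v i • x i - ∑ j, (∑ i, v i * N i j) • c j =
        ∑ i, v i • (x i - ∑ j, N i j • c j) := by
      simp only [Finset.sum_smul, smul_sub, Finset.sum_sub_distrib, Finset.smul_sum, mul_smul]
      rw [Finset.sum_comm]
    rw [this]
    exact Ideal.sum_mem _ fun i _ => hsm _ (hN i)
  have hMN : Matrix.of M * Matrix.of N = 1 := by
    ext i j
    have h1 := hlin (fun j => (∑ l, M i l * N l j) - if i = j then 1 else 0) (by
      have : ∑ j, ((∑ l, M i l * N l j) - if i = j then 1 else 0) • c j =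
        -(∑ l, M i l • x l - ∑ j, (∑ l, M i l * N l j) • c j) - (c i - ∑ l, M i l • x l) := by
        simp [sub_smul, Finset.sum_sub_distrib]
      rw [this]
      exact Ideal.sub_mem _ (neg_mem (hcomp _)) (hM i))
    have := congrFun h1 j
    rw [Matrix.mul_apply, Matrix.one_apply]
    exact sub_eq_zero.mp this
  have hNM := mul_eq_one_comm.mp hMN
  intro F hF hFm
  rw [isHomogeneous_one_eq_sum hF] at hFm ⊢
  set a : Fin r → k := fun i => coeff (Finsupp.single i 1) F
  have h1 : ∑ i, a i • x i ∈ maximalIdeal A ^ 2 := by simpa [Algebra.smul_def] using hFm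
  have h2 : (fun j => ∑ i, a i * N i j) = 0 := by
    apply hlin
    have := Ideal.sub_mem _ h1 (hcomp a)
    simpa using this
  have h3 : a = 0 := by
    have h4 : Matrix.vecMul a (Matrix.of N) = 0 := h2
    have := congrArg (fun v => Matrix.vecMul v (Matrix.of M)) h4
    simpa [Matrix.vecMul_vecMul, hNM] using this
  refine Finset.sum_eq_zero fun i _ => ?_
  rw [show coeff (Finsupp.single i 1) F = 0 from congrFun h3 i]; simp

end Parameters


/-! ### Smoothness from algebraically independent generators of the maximal ideal. -/

section EtaleCoordinates

open IsLocalRing MvPolynomial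

lemma mvPolynomial_D_aeval {k L ι : Type*} [Field k] [CommRing L] [Algebra k L]
    [Fintype ι] (x : ι → L) (F : MvPolynomial ι k) :
    KaehlerDifferential.D k L (aeval x F) =
      ∑ i, aeval x (pderiv i F) • KaehlerDifferential.D k L (x i) := by
  classical
  induction F using MvPolynomial.induction_on with
  | C a => simp
  | add p q hp hq => simp [hp, hq, add_smul, Finset.sum_add_distrib]
  | mul_X p j hp =>
    rw [map_mul, aeval_X, Derivation.leibniz, hp]
    simp only [Derivation.leibniz, pderiv_X, smul_eq_mul, map_add, map_mul, aeval_X, add_smul,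
      Finset.sum_add_distrib, Finset.smul_sum, mul_smul]
    congr 1
    rw [Finset.sum_eq_single j]
    · simp
    · intro i _ hij; simp [hij.symm]
    · simp

lemma eq_C_of_pderiv_eq_zero {k ι : Type*} [Field k] [CharZero k] {F : MvPolynomial ι k}
    (h : ∀ i, pderiv i F = 0) : F = C (coeff 0 F) := by
  classical
  ext m
  rw [coeff_C]
  split_ifs with hm
  · rw [← hm]
  · obtain ⟨i, hi⟩ : ∃ i, m i ≠ 0 := by
      by_contra! hc; exact hm (Finsupp.ext hc).symm
    have := congrArg (coeff (m - Finsupp.single i 1)) (h i)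
    rw [coeff_pderiv, coeff_zero] at this
    have hadd : m - Finsupp.single i 1 + Finsupp.single i 1 = m :=
      tsub_add_cancel_of_le (Finsupp.single_le_iff.mpr (Nat.one_le_iff_ne_zero.mpr hi))
    rw [hadd] at this
    exact (mul_eq_zero.mp this).resolve_right (Nat.cast_add_one_ne_zero _)

/-- Differentiating a relation `F(x) = 0` shows that all partial derivatives of `F` are relations
too. By induction on the degree they vanish identically, and in characteristic zero `F` is then a
constant. -/
theorem algebraicIndependent_of_linearIndependent_D {k L ι : Type*} [Field k] [CharZero k] [Field L]
    [Algebra k L] [Finite ι] {x : ι → L}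
    (hx : LinearIndependent L fun i => KaehlerDifferential.D k L (x i)) :
    AlgebraicIndependent k x := by
  classical
  have := Fintype.ofFinite ι
  rw [algebraicIndependent_iff]
  suffices ∀ (n : ℕ) (F : MvPolynomial ι k), F.totalDegree ≤ n → aeval x F = 0 → F = 0 from
    fun F hF => this _ F le_rfl hF
  intro n
  induction n with
  | zero =>
    intro F hn hF
    rw [totalDegree_eq_zero_iff_eq_C.mp (Nat.le_zero.mp hn)] at hF ⊢
    rw [aeval_C, map_eq_zero] at hF
    rw [hF, map_zero]
  | succ n ih =>
    intro F hn hF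
    have h0 : ∀ i, pderiv i F = 0 := by
      intro i
      apply ih
      · refine Finset.sup_le fun m hm => ?_
        have hm' : m + Finsupp.single i 1 ∈ F.support := by
          rw [mem_support_iff] at hm ⊢
          rw [coeff_pderiv] at hm
          exact left_ne_zero_of_mul hm
        have h1 := (le_totalDegree hm').trans hn
        rw [Finsupp.sum_add_index' (fun _ => rfl) (fun _ _ _ => rfl),
          Finsupp.sum_single_index rfl] at h1
        omega
      · have h1 := mvPolynomial_D_aeval x F
        rw [hF, map_zero] at h1
        exact Fintype.linearIndependent_iff.mp hx _ h1.symm i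
    rw [eq_C_of_pderiv_eq_zero h0] at hF ⊢
    rw [aeval_C, map_eq_zero] at hF
    rw [hF, map_zero]

/-- The parameters map a polynomial ring `P` to `O`, and this map is unramified because the `dx_i`
generate the differentials. Hence `O` is a quotient of a local ring `Eq` of a standard étale
`P`-algebra. As `Eq` is a domain and both rings contain `P`, the quotient map loses nothing: `O` is
étale over `P`. -/
theorem formallySmooth_of_algebraicIndependent {k R O : Type} [Field k] [CommRing R] [Algebra k R]
    [Algebra.FiniteType k R] [CommRing O] [IsDomain O] [IsLocalRing O] [Algebra R O] [Algebra k O]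
    [IsScalarTower k R O] (n : Ideal R) [n.IsPrime] [IsLocalization.AtPrime O n]
    (hres : ResidueTrivial k O) {r : ℕ} {x : Fin r → R}
    (hx : maximalIdeal O = Ideal.span (Set.range fun i => algebraMap R O (x i)))
    (hind : AlgebraicIndependent k fun i => algebraMap R O (x i)) :
    Algebra.FormallySmooth k O ∧ Module.finrank O Ω[O⁄k] = r := by
  let P := MvPolynomial (Fin r) k
  let _ : Algebra P R := (aeval x).toAlgebra
  have hkPR : IsScalarTower k P R := IsScalarTower.of_algebraMap_eq fun c => by
    rw [RingHom.algebraMap_toAlgebra, MvPolynomial.algebraMap_eq]; exact (aeval_C x c).symm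
  let _ : Algebra P O := ((algebraMap R O).comp (algebraMap P R)).toAlgebra
  have hPRO : IsScalarTower P R O := IsScalarTower.of_algebraMap_eq fun _ => rfl
  have hkPO : IsScalarTower k P O := IsScalarTower.of_algebraMap_eq fun c => by
    rw [IsScalarTower.algebraMap_apply k R O, IsScalarTower.algebraMap_apply k P R,
      ← IsScalarTower.algebraMap_apply P R O]
  have hPX : ∀ i, algebraMap P O (X i) = algebraMap R O (x i) := fun i => by
    rw [IsScalarTower.algebraMap_apply P R O]; congr 1; exact aeval_X x i
  have hPinj : Function.Injective (algebraMap P O) := by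
    have : (algebraMap P O) = (aeval (R := k) fun i => algebraMap R O (x i)).toRingHom := by
      refine MvPolynomial.ringHom_ext (fun c => ?_) fun i => ?_
      · change algebraMap P O (algebraMap k P c) = _
        rw [← IsScalarTower.algebraMap_apply]; simp
      · rw [hPX]; simp
    rw [this]; exact hind
  have hft : Algebra.FiniteType P R := .of_restrictScalars_finiteType k P R
  have hessP : Algebra.EssFiniteType P O := by
    have := Algebra.EssFiniteType.of_isLocalization O n.primeCompl
    exact Algebra.EssFiniteType.comp P R O
  -- unramified at the point
  have hunrO : Algebra.FormallyUnramified P O := by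
    have hspan := span_range_D_eq_top (P := P) (O := O) (x := fun i => algebraMap R O (x i))
      (fun y => by
        obtain ⟨c, hc⟩ := hres y
        exact ⟨C c, by
          rwa [← MvPolynomial.algebraMap_eq, ← IsScalarTower.algebraMap_apply k P O]⟩) hx
    have h0 : ∀ i, KaehlerDifferential.D P O (algebraMap R O (x i)) = 0 := fun i => by
      rw [← hPX, Derivation.map_algebraMap]
    refine ⟨(Submodule.subsingleton_iff O).mp ((subsingleton_iff_bot_eq_top).mp ?_)⟩
    rw [← hspan, eq_comm, Submodule.span_eq_bot]
    rintro _ ⟨i, rfl⟩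
    exact h0 i
  let e : O ≃ₐ[R] Localization.AtPrime n := IsLocalization.algEquiv n.primeCompl _ _
  have hunr : Algebra.IsUnramifiedAt P n := .of_equiv (e.restrictScalars P)
  -- Near an unramified point the algebra is a quotient of a standard étale one.
  obtain ⟨f, hf, SP, φ, hφ⟩ :=
    Algebra.IsUnramifiedAt.exists_hasStandardEtaleSurjectionOn (R := P) n
  let E := SP.Ring
  have hfu : IsUnit (algebraMap R O f) := IsLocalization.map_units O (⟨f, hf⟩ : n.primeCompl)
  let θ : Localization.Away f →+* O := IsLocalization.Away.lift f hfu
  have hθ : ∀ y : R, θ (algebraMap R _ y) = algebraMap R O y := IsLocalization.Away.lift_eq f hfu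
  let ψ : E →+* O := θ.comp φ.toRingHom
  have hψP : ∀ p : P, ψ (algebraMap P E p) = algebraMap P O p := fun p => by
    change θ (φ (algebraMap P E p)) = _
    rw [φ.commutes, IsScalarTower.algebraMap_apply P R (Localization.Away f), hθ,
      ← IsScalarTower.algebraMap_apply]
  have hψR : ∀ y : R, ∃ z : E, ψ z = algebraMap R O y := fun y => by
    obtain ⟨z, hz⟩ := hφ (algebraMap R _ y)
    exact ⟨z, by rw [← hθ, ← hz]; rfl⟩
  let q : Ideal E := (maximalIdeal O).comap ψ
  have hq : q.IsPrime := Ideal.comap_isPrime ψ _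
  obtain ⟨Eq, _, _, _⟩ : ∃ (Eq : Type) (_ : CommRing Eq) (_ : Algebra E Eq),
      IsLocalization.AtPrime Eq q := ⟨Localization.AtPrime q, inferInstance, inferInstance,
        inferInstance⟩
  have hlocE : IsLocalRing Eq := IsLocalization.AtPrime.isLocalRing Eq q
  have hu : ∀ y : q.primeCompl, IsUnit (ψ y) := fun y => by
    have h := y.2
    by_contra hy
    exact h ((mem_maximalIdeal _).mpr hy)
  let Ψ : Eq →+* O := IsLocalization.lift hu
  have hΨ : ∀ z : E, Ψ (algebraMap E Eq z) = ψ z := IsLocalization.lift_eq hu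
  have hΨsurj : Function.Surjective Ψ := by
    intro o
    obtain ⟨y, s, rfl⟩ := IsLocalization.exists_mk'_eq n.primeCompl o
    obtain ⟨z, hz⟩ := hψR y
    obtain ⟨w, hw⟩ := hψR s
    have hwq : w ∈ q.primeCompl := fun h => by
      have h : ψ w ∈ maximalIdeal O := h
      rw [hw] at h
      exact h (IsLocalization.map_units O s)
    refine ⟨IsLocalization.mk' Eq z (⟨w, hwq⟩ : q.primeCompl), ?_⟩
    rw [eq_comm, IsLocalization.mk'_eq_iff_eq_mul, ← hw, ← hz, ← hΨ, ← hΨ, ← map_mul]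
    exact congrArg Ψ (IsLocalization.mk'_spec Eq z (⟨w, hwq⟩ : q.primeCompl)).symm
  -- structures over the polynomial ring and the field
  let _ : Algebra P Eq := ((algebraMap E Eq).comp (algebraMap P E)).toAlgebra
  have hPE : IsScalarTower P E Eq := IsScalarTower.of_algebraMap_eq fun _ => rfl
  let _ : Algebra k Eq := ((algebraMap P Eq).comp (algebraMap k P)).toAlgebra
  have hkP : IsScalarTower k P Eq := IsScalarTower.of_algebraMap_eq fun _ => rfl
  have hetE : Algebra.FormallyEtale E Eq := .of_isLocalization q.primeCompl
  have hetP : Algebra.FormallyEtale P Eq := .comp P E Eq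
  have hfs : Algebra.FormallySmooth k Eq := .comp k P Eq
  have hess : Algebra.EssFiniteType k Eq := by
    have h1 := Algebra.EssFiniteType.of_isLocalization Eq q.primeCompl
    have h2 : Algebra.EssFiniteType P Eq := .comp P E Eq
    exact .comp k P Eq
  have hnoeth : IsNoetherianRing Eq := Algebra.EssFiniteType.isNoetherianRing k Eq
  let bE : Module.Basis (Fin r) Eq Ω[Eq⁄k] :=
    ((KaehlerDifferential.mvPolynomialBasis k (Fin r)).baseChange Eq).map
      (KaehlerDifferential.tensorKaehlerEquivOfFormallyEtale k P Eq)
  have hrank : Module.finrank Eq Ω[Eq⁄k] = r := by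
    rw [Module.finrank_eq_card_basis bE, Fintype.card_fin]
  let _ : Algebra Eq O := Ψ.toAlgebra
  have hkEO : IsScalarTower k Eq O := IsScalarTower.of_algebraMap_eq fun c => by
    change _ = Ψ (algebraMap E Eq (algebraMap P E (algebraMap k P c)))
    rw [hΨ, hψP, ← IsScalarTower.algebraMap_apply]
  have hloc : IsLocalHom Ψ := IsLocalHom.of_surjective _ hΨsurj
  have hresE : ResidueTrivial k Eq := fun y => by
    obtain ⟨c, hc⟩ := hres (Ψ y)
    refine ⟨c, (mem_maximalIdeal _).mpr fun h => ?_⟩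
    refine hc ?_
    have := h.map Ψ
    rw [map_sub] at this
    rwa [IsScalarTower.algebraMap_apply k Eq O]
  -- `Eq` is smooth with residue field `k`, hence a domain; this makes the kernel of `E → Eq` a
  -- prime ideal.
  have hdom : IsDomain Eq := by
    obtain ⟨c, hc, hcind⟩ := exists_parameters_of_formallySmooth hresE hrank
    exact isDomain_of_analyticallyIndependent hresE hc hcind
  have hPEq : ∀ p : P, Ψ (algebraMap P Eq p) = algebraMap P O p := fun p => by
    rw [← hψP, ← hΨ]; rfl
  have hΨinj : Function.Injective Ψ := by
    have h1 : RingHom.ker (algebraMap E Eq) = RingHom.ker ψ := by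
      have := RingHom.ker_isPrime ψ
      have := RingHom.ker_isPrime (algebraMap E Eq)
      -- In a quasi-finite algebra nested primes with the same contraction coincide; here both
      -- contract to zero, because `P` embeds in `O`.
      refine Algebra.QuasiFinite.eq_of_le_of_under_eq (R := P) _ _ (fun z hz => ?_) ?_
      · rw [RingHom.mem_ker] at hz ⊢
        rw [← hΨ, hz, map_zero]
      · trans (⊥ : Ideal P)
        · rw [eq_bot_iff]
          intro p hp
          have hp : algebraMap E Eq (algebraMap P E p) = 0 := hp
          refine hPinj ?_
          rw [map_zero, ← hψP, ← hΨ, hp, map_zero]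
        · rw [eq_comm, eq_bot_iff]
          intro p hp
          have hp : ψ (algebraMap P E p) = 0 := hp
          refine hPinj ?_
          rw [map_zero, ← hψP, hp]
    rw [injective_iff_map_eq_zero]
    intro y hy
    obtain ⟨z, s, rfl⟩ := IsLocalization.exists_mk'_eq q.primeCompl y
    have h2 : Ψ (algebraMap E Eq z) = 0 := by
      rw [← IsLocalization.mk'_spec Eq z s, map_mul, hy, zero_mul]
    rw [hΨ, ← RingHom.mem_ker, ← h1, RingHom.mem_ker] at h2
    rw [IsLocalization.mk'_eq_iff_eq_mul, h2, zero_mul]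
  let eΨ : Eq ≃ₐ[k] O := AlgEquiv.ofBijective (IsScalarTower.toAlgHom k Eq O) ⟨hΨinj, hΨsurj⟩
  refine ⟨.of_equiv eΨ, ?_⟩
  have hetO : Algebra.FormallyEtale Eq O :=
    .of_equiv (AlgEquiv.ofBijective (Algebra.ofId Eq O) ⟨hΨinj, hΨsurj⟩)
  rw [Module.finrank_eq_card_basis ((bE.baseChange O).map
    (KaehlerDifferential.tensorKaehlerEquivOfFormallyEtale k Eq O)), Fintype.card_fin]

end EtaleCoordinates


/-! ### Normality by comparison of leading forms. -/

section Normality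

open IsLocalRing MvPolynomial

lemma sub_mul_mem_pow {A : Type*} [CommRing A] {I : Ideal A} {x y x' y' : A} {p q : ℕ}
    (hx : x - x' ∈ I ^ (p + 1)) (hx' : x' ∈ I ^ p) (hy : y - y' ∈ I ^ (q + 1)) (hy' : y' ∈ I ^ q) :
    x * y - x' * y' ∈ I ^ (p + q + 1) := by
  have hxp : x ∈ I ^ p := by
    have := Ideal.add_mem _ (Ideal.pow_le_pow_right (Nat.le_succ p) hx) hx'
    simpa using this
  have : x * y - x' * y' = x * (y - y') + (x - x') * y' := by ring
  rw [this]
  refine Ideal.add_mem _ ?_ ?_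
  · rw [add_assoc, pow_add]; exact Ideal.mul_mem_mul hxp hy
  · rw [show p + q + 1 = (p + 1) + q by ring, pow_add]; exact Ideal.mul_mem_mul hx hy'

lemma pow_sub_pow_mem_pow {A : Type*} [CommRing A] {I : Ideal A} {x x' : A} {p : ℕ}
    (hx : x - x' ∈ I ^ (p + 1)) (hx' : x' ∈ I ^ p) (n : ℕ) :
    x ^ n - x' ^ n ∈ I ^ (n * p + 1) := by
  induction n with
  | zero => simp
  | succ n ih =>
    have h : x' ^ n ∈ I ^ (n * p) := by rw [mul_comm, pow_mul]; exact Ideal.pow_mem_pow hx' n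
    have := sub_mul_mem_pow ih h hx hx'
    rwa [← Nat.succ_mul, ← pow_succ, ← pow_succ] at this

variable {k A ι : Type*} [Field k] [CommRing A] [Algebra k A] [IsLocalRing A]

/-- An element of `m ^ n` outside `m ^ (n + 1)` has a leading form of degree `n`. -/
lemma exists_leadingForm (hres : ResidueTrivial k A) {c : ι → A}
    (hc : maximalIdeal A = Ideal.span (Set.range c)) {n : ℕ} {x : A} (hx : x ∈ maximalIdeal A ^ n) :
    ∃ F : MvPolynomial ι k, F.IsHomogeneous n ∧ x - aeval c F ∈ maximalIdeal A ^ (n + 1) := by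
  obtain ⟨F, hF, h⟩ := exists_isHomogeneous_sub_mem hres c hc n hx
  exact ⟨F, hF, by rwa [pow_succ]⟩

variable [IsNoetherianRing A]

lemma mem_of_forall_mem_sup_pow {I : Ideal A} {x : A} (h : ∀ n, x ∈ I ⊔ maximalIdeal A ^ n) :
    x ∈ I := by
  rw [← Ideal.Quotient.eq_zero_iff_mem, ← Submodule.mem_bot (R := A),
    ← Ideal.iInf_pow_smul_eq_bot_of_isLocalRing (maximalIdeal A) (Ideal.IsPrime.ne_top'),
    Submodule.mem_iInf]
  intro n
  obtain ⟨y, hy, z, hz, rfl⟩ := Submodule.mem_sup.mp (h n)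
  rw [map_add, Ideal.Quotient.eq_zero_iff_mem.mpr hy, zero_add]
  have : (Ideal.Quotient.mk I z : A ⧸ I) = z • (1 : A ⧸ I) := by
    rw [Algebra.smul_def, mul_one]; rfl
  rw [this]
  exact Submodule.smul_mem_smul hz trivial

lemma exists_eq_mul_isHomogeneous {p q : ℕ} {F G H : MvPolynomial ι k} (hF : F.IsHomogeneous p)
    (hF0 : F ≠ 0) (hG : G.IsHomogeneous q) (h : F = G * H) :
    q ≤ p ∧ ∃ H' : MvPolynomial ι k, H'.IsHomogeneous (p - q) ∧ F = G * H' := by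
  classical
  have hcomp : ∀ i, homogeneousComponent p (G * homogeneousComponent i H) =
      if p = q + i then G * homogeneousComponent i H else 0 := fun i =>
    homogeneousComponent_of_mem (hG.mul (homogeneousComponent_isHomogeneous i H))
  have hF' : F = ∑ i ∈ Finset.range (H.totalDegree + 1),
      if p = q + i then G * homogeneousComponent i H else 0 := by
    have h1 : homogeneousComponent p F = F := by
      rw [homogeneousComponent_of_mem hF, if_pos rfl]
    rw [← h1, h]
    conv_lhs => rw [← sum_homogeneousComponent H, Finset.mul_sum, map_sum]
    exact Finset.sum_congr rfl fun i _ => hcomp i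
  have hqp : q ≤ p := by
    by_contra hlt
    refine hF0 (hF'.trans (Finset.sum_eq_zero fun i _ => if_neg (by omega)))
  refine ⟨hqp, homogeneousComponent (p - q) H, homogeneousComponent_isHomogeneous _ _, ?_⟩
  by_cases hmem : p - q ∈ Finset.range (H.totalDegree + 1)
  · rw [Finset.sum_eq_single_of_mem _ hmem, if_pos (by omega)] at hF'
    · exact hF'
    · intro i _ hi; exact if_neg (by omega)
  · exfalso
    refine hF0 (hF'.trans (Finset.sum_eq_zero fun i hi => if_neg ?_))
    intro hpi
    exact hmem (by rwa [show p - q = i by omega])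

/-- Divisibility of leading forms for almost integral fractions. -/
lemma leadingForm_dvd [Finite ι] (hres : ResidueTrivial k A) {c : ι → A}
    (hc : maximalIdeal A = Ideal.span (Set.range c)) (hind : AnalyticallyIndependent k c)
    {d u v : A} {r p q : ℕ} {Fd Fu Fv : MvPolynomial ι k}
    (hFd : Fd.IsHomogeneous r) (hd : d - aeval c Fd ∈ maximalIdeal A ^ (r + 1)) (hd0 : Fd ≠ 0)
    (hFu : Fu.IsHomogeneous p) (hu : u - aeval c Fu ∈ maximalIdeal A ^ (p + 1))
    (hFv : Fv.IsHomogeneous q) (hv : v - aeval c Fv ∈ maximalIdeal A ^ (q + 1)) (hv0 : Fv ≠ 0)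
    (hdiv : ∀ n, v ^ n ∣ d * u ^ n) : Fv ∣ Fu := by
  have hcm : ∀ i, c i ∈ maximalIdeal A := fun i => hc ▸ Ideal.subset_span ⟨i, rfl⟩
  have hev : ∀ {n : ℕ} {F : MvPolynomial ι k}, F.IsHomogeneous n →
      aeval c F ∈ maximalIdeal A ^ n := fun hF => aeval_mem_pow _ _ hcm hF
  have hdom := isDomain_of_analyticallyIndependent hres hc hind
  by_cases hFu0 : Fu = 0
  · rw [hFu0]; exact dvd_zero _
  -- Leading forms multiply, so the divisibilities in `A` pass to leading forms. They say that `Fu /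
  -- Fv` is almost integral over the polynomial ring, which is noetherian and normal, so this
  -- fraction is a polynomial.
  have hdvd : ∀ n, Fv ^ n ∣ Fd * Fu ^ n := by
    intro n
    obtain ⟨e, he⟩ := hdiv n
    have hun : u ^ n - aeval c (Fu ^ n) ∈ maximalIdeal A ^ (n * p + 1) := by
      rw [map_pow]; exact pow_sub_pow_mem_pow hu (hev hFu) n
    have hvn : v ^ n - aeval c (Fv ^ n) ∈ maximalIdeal A ^ (n * q + 1) := by
      rw [map_pow]; exact pow_sub_pow_mem_pow hv (hev hFv) n
    have hFun : (Fu ^ n).IsHomogeneous (n * p) := by rw [mul_comm]; exact hFu.pow n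
    have hFvn : (Fv ^ n).IsHomogeneous (n * q) := by rw [mul_comm]; exact hFv.pow n
    have hdun : d * u ^ n - aeval c (Fd * Fu ^ n) ∈ maximalIdeal A ^ (r + n * p + 1) := by
      rw [map_mul]; exact sub_mul_mem_pow hd (hev hFd) hun (hev hFun)
    have hne : Fd * Fu ^ n ≠ 0 := mul_ne_zero hd0 (pow_ne_zero _ hFu0)
    have hnot : d * u ^ n ∉ maximalIdeal A ^ (r + n * p + 1) := fun h => by
      refine hne (hind _ _ (hFd.mul hFun) ?_)
      have := Ideal.sub_mem _ h hdun
      simpa using this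
    have he0 : e ≠ 0 := by
      rintro rfl; rw [mul_zero] at he; rw [he] at hnot; exact hnot (zero_mem _)
    obtain ⟨s, hs, hs'⟩ := exists_mem_pow_notMem_pow he0
    obtain ⟨Fe, hFe, hes⟩ := exists_leadingForm hres hc hs
    have hve : v ^ n * e - aeval c (Fv ^ n * Fe) ∈ maximalIdeal A ^ (n * q + s + 1) := by
      rw [map_mul]; exact sub_mul_mem_pow hvn (hev hFvn) hes (hev hFe)
    have hFe0 : Fe ≠ 0 := by
      rintro rfl; rw [map_zero, sub_zero] at hes; exact hs' hes
    have hne' : Fv ^ n * Fe ≠ 0 := mul_ne_zero (pow_ne_zero _ hv0) hFe0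
    have hnot' : v ^ n * e ∉ maximalIdeal A ^ (n * q + s + 1) := fun h => by
      refine hne' (hind _ _ (hFvn.mul hFe) ?_)
      have := Ideal.sub_mem _ h hve
      simpa using this
    have hdeg : r + n * p = n * q + s := by
      have h1 : d * u ^ n ∈ maximalIdeal A ^ (r + n * p) := by
        have := Ideal.add_mem _ (Ideal.pow_le_pow_right (Nat.le_succ _) hdun)
          (hev (hFd.mul hFun))
        simpa using this
      have h2 : v ^ n * e ∈ maximalIdeal A ^ (n * q + s) := by
        have := Ideal.add_mem _ (Ideal.pow_le_pow_right (Nat.le_succ _) hve)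
          (hev (hFvn.mul hFe))
        simpa using this
      rw [← he] at hnot' h2
      by_contra hne
      rcases lt_or_gt_of_ne hne with h | h
      · exact hnot (Ideal.pow_le_pow_right h h2)
      · exact hnot' (Ideal.pow_le_pow_right h h1)
    have heq : Fd * Fu ^ n - Fv ^ n * Fe = 0 := by
      refine hind _ _ ((hFd.mul hFun).sub (hdeg ▸ hFvn.mul hFe)) ?_
      have := Ideal.sub_mem _ (hdeg ▸ hve) hdun
      rw [he] at this
      simpa using this
    exact ⟨Fe, sub_eq_zero.mp heq⟩
  -- pass to the fraction field of the polynomial ring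
  let K := FractionRing (MvPolynomial ι k)
  let β : K := algebraMap _ K Fu / algebraMap _ K Fv
  have hinj := IsFractionRing.injective (MvPolynomial ι k) K
  have hv0' : algebraMap (MvPolynomial ι k) K Fv ≠ 0 := fun h =>
    hv0 (hinj (by rw [h, map_zero]))
  have hβ : IsAlmostIntegral (MvPolynomial ι k) β := by
    refine ⟨Fd, mem_nonZeroDivisors_of_ne_zero hd0, fun n => ?_⟩
    obtain ⟨e, he⟩ := hdvd n
    refine ⟨e, ?_⟩
    have := congrArg (algebraMap (MvPolynomial ι k) K) he
    rw [map_mul, map_mul, map_pow, map_pow] at this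
    rw [Algebra.smul_def, div_pow, ← mul_div_assoc, this, mul_div_cancel_left₀]
    exact pow_ne_zero _ hv0'
  obtain ⟨G, hG⟩ := (isIntegrallyClosed_iff K).mp inferInstance hβ.isIntegral
  refine ⟨G, hinj ?_⟩
  rw [map_mul, hG, mul_div_cancel₀]
  exact hv0'

/-- An integral fraction `u / v` is almost integral, so the leading form of `v` divides that of `u`.
Subtracting a multiple of `v` raises the order of `u`, and repetition gives `u ∈ (v) + m ^ N` for
every `N`. Krull's intersection theorem concludes that `v` divides `u`. -/
theorem isIntegrallyClosed_of_analyticallyIndependent [Finite ι] (hres : ResidueTrivial k A) {c : ι → A}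
    (hc : maximalIdeal A = Ideal.span (Set.range c)) (hind : AnalyticallyIndependent k c) :
    IsIntegrallyClosed A := by
  have hcm : ∀ i, c i ∈ maximalIdeal A := fun i => hc ▸ Ideal.subset_span ⟨i, rfl⟩
  have hdom := isDomain_of_analyticallyIndependent hres hc hind
  let K := FractionRing A
  rw [isIntegrallyClosed_iff K]
  intro β hβ
  obtain ⟨d, hd, hdβ⟩ := hβ.isAlmostIntegral
  have hd0 : d ≠ 0 := nonZeroDivisors.ne_zero hd
  obtain ⟨u, v, hv, rfl⟩ := IsFractionRing.div_surjective (A := A) β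
  have hv0 : v ≠ 0 := nonZeroDivisors.ne_zero hv
  have hinj := IsFractionRing.injective A K
  have hvK : algebraMap A K v ≠ 0 := fun h => hv0 (hinj (by rw [h, map_zero]))
  obtain ⟨r, hr, hr'⟩ := exists_mem_pow_notMem_pow hd0
  obtain ⟨q, hq, hq'⟩ := exists_mem_pow_notMem_pow hv0
  obtain ⟨Fd, hFd, hFd'⟩ := exists_leadingForm hres hc hr
  obtain ⟨Fv, hFv, hFv'⟩ := exists_leadingForm hres hc hq
  have hFd0 : Fd ≠ 0 := by rintro rfl; rw [map_zero, sub_zero] at hFd'; exact hr' hFd'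
  have hFv0 : Fv ≠ 0 := by rintro rfl; rw [map_zero, sub_zero] at hFv'; exact hq' hFv'
  have hdiv : ∀ n, v ^ n ∣ d * u ^ n := fun n => by
    obtain ⟨e, he⟩ := hdβ n
    refine ⟨e, hinj ?_⟩
    rw [map_mul, map_mul, map_pow, map_pow, he, Algebra.smul_def, div_pow]
    rw [mul_div_assoc', mul_div_cancel₀]
    exact pow_ne_zero _ hvK
  -- successive approximation of the quotient
  have key : ∀ N, ∃ w, u - v * w ∈ maximalIdeal A ^ N := by
    intro N
    induction N with
    | zero => exact ⟨0, by simp⟩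
    | succ N ih =>
      obtain ⟨w, hw⟩ := ih
      -- Subtracting `w` from `u / v` keeps it almost integral with the same denominator `d`, so the
      -- approximation can continue.
      have hdiv' : ∀ n, v ^ n ∣ d * (u - v * w) ^ n := by
        intro n
        rw [sub_pow, Finset.mul_sum]
        refine Finset.dvd_sum fun m hm => ?_
        have hm : m ≤ n := Nat.lt_succ_iff.mp (Finset.mem_range.mp hm)
        obtain ⟨e, he⟩ := hdiv m
        have hvn : v ^ n = v ^ m * v ^ (n - m) := by rw [← pow_add]; congr 1; omega
        rw [hvn, mul_pow]
        refine ⟨(-1) ^ (m + n) * e * w ^ (n - m) * (n.choose m), ?_⟩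
        linear_combination (-1) ^ (m + n) * v ^ (n - m) * w ^ (n - m) * (n.choose m) * he
      obtain ⟨Fu, hFu, hFu'⟩ := exists_leadingForm hres hc hw
      obtain ⟨G, hG⟩ := leadingForm_dvd hres hc hind hFd hFd' hFd0 hFu hFu' hFv hFv' hFv0 hdiv'
      by_cases hFu0 : Fu = 0
      · rw [hFu0, map_zero, sub_zero] at hFu'; exact ⟨w, hFu'⟩
      obtain ⟨hqN, G, hGhom, hG⟩ := exists_eq_mul_isHomogeneous hFu hFu0 hFv hG
      refine ⟨w + aeval c G, ?_⟩
      have h1 : aeval c G ∈ maximalIdeal A ^ (N - q) := aeval_mem_pow _ _ hcm hGhom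
      have h2 : u - v * (w + aeval c G) = (u - v * w - aeval c Fu) - (v - aeval c Fv) * aeval c G := by
        rw [hG, map_mul]; ring
      rw [h2]
      refine Ideal.sub_mem _ hFu' ?_
      have h3 := Ideal.mul_mem_mul hFv' h1
      rw [← pow_add, show q + 1 + (N - q) = N + 1 by omega] at h3
      exact h3
  have hmem : u ∈ Ideal.span {v} := by
    refine mem_of_forall_mem_sup_pow fun N => ?_
    obtain ⟨w, hw⟩ := key N
    have : u = v * w + (u - v * w) := by ring
    rw [this]
    exact Submodule.add_mem_sup (Ideal.mul_mem_right _ _ (Ideal.mem_span_singleton_self v)) hw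
  obtain ⟨w, hw⟩ := Ideal.mem_span_singleton'.mp hmem
  refine ⟨w, ?_⟩
  rw [← hw, map_mul, mul_div_assoc, div_self hvK, mul_one]

end Normality


/-! ### Smooth algebras are normal; extension over codimension two; depth of a node. -/

section Normality

open IsLocalRing MvPolynomial

lemma residueTrivial_of_isMaximal {k R : Type*} [Field k] [IsAlgClosed k] [CommRing R] [Algebra k R]
    [Algebra.FiniteType k R] (n : Ideal R) [n.IsMaximal] (y : R) :
    ∃ c : k, y - algebraMap k R c ∈ n := by
  let _ := Ideal.Quotient.field n
  have : Algebra.FiniteType k (R ⧸ n) := inferInstance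
  have : Module.Finite k (R ⧸ n) := finite_of_finite_type_of_isJacobsonRing k (R ⧸ n)
  have hb := IsAlgClosed.algebraMap_bijective_of_isIntegral (k := k) (K := R ⧸ n)
  obtain ⟨c, hc⟩ := hb.2 (Ideal.Quotient.mk n y)
  refine ⟨c, Ideal.Quotient.eq.mp ?_⟩
  rw [← hc]; rfl

lemma residueTrivial_localization {k R O : Type*} [Field k] [CommRing R] [Algebra k R]
    [CommRing O] [IsLocalRing O] [Algebra R O] [Algebra k O] [IsScalarTower k R O] (n : Ideal R)
    [n.IsPrime] [IsLocalization.AtPrime O n] (h : ∀ y : R, ∃ c : k, y - algebraMap k R c ∈ n) :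
    ResidueTrivial k O := by
  have hmem : ∀ y : R, algebraMap R O y ∈ maximalIdeal O ↔ y ∈ n := fun y =>
    IsLocalization.AtPrime.to_map_mem_maximal_iff O n y
  intro o
  obtain ⟨y, s, rfl⟩ := IsLocalization.exists_mk'_eq n.primeCompl o
  obtain ⟨c, hc⟩ := h y
  obtain ⟨d, hd⟩ := h s
  have hd0 : d ≠ 0 := by
    rintro rfl
    rw [map_zero, sub_zero] at hd
    exact s.2 hd
  refine ⟨c / d, ?_⟩
  have hs : IsUnit (algebraMap R O s) := IsLocalization.map_units O s
  rw [← Ideal.unit_mul_mem_iff_mem _ hs]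
  have h1 : algebraMap R O s * (IsLocalization.mk' O y s - algebraMap k O (c / d)) =
      algebraMap R O (y - algebraMap k R c) -
        algebraMap R O (s - algebraMap k R d) * algebraMap k O (c / d) := by
    have h2 : algebraMap R O s * IsLocalization.mk' O y s = algebraMap R O y := by
      rw [mul_comm, IsLocalization.mk'_spec]
    have h3 : algebraMap k O d * algebraMap k O (c / d) = algebraMap k O c := by
      rw [← map_mul, mul_div_cancel₀ _ hd0]
    rw [mul_sub, h2, map_sub, map_sub, sub_mul, ← IsScalarTower.algebraMap_apply,
      ← IsScalarTower.algebraMap_apply, h3]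
    ring
  rw [h1]
  exact Ideal.sub_mem _ ((hmem _).mpr hc) (Ideal.mul_mem_right _ _ ((hmem _).mpr hd))

/-- Normality may be tested at maximal ideals. There the residue field is `k` by the
Nullstellensatz, and smoothness supplies analytically independent parameters. -/
theorem isIntegrallyClosed_of_formallySmooth {k R : Type} [Field k] [IsAlgClosed k] [CommRing R]
    [IsDomain R] [Algebra k R] [Algebra.FiniteType k R] [Algebra.FormallySmooth k R] :
    IsIntegrallyClosed R := by
  have : IsNoetherianRing R := Algebra.FiniteType.isNoetherianRing k R
  refine IsIntegrallyClosed.of_localization_maximal fun n _ hn => ?_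
  let O := Localization.AtPrime n
  have hfs : Algebra.FormallySmooth k O := by
    have : Algebra.FormallySmooth R O := .of_isLocalization n.primeCompl
    exact .comp k R O
  have hess : Algebra.EssFiniteType k O := by
    have := Algebra.EssFiniteType.of_isLocalization O n.primeCompl
    exact .comp k R O
  have hres : ResidueTrivial k O := residueTrivial_localization n (residueTrivial_of_isMaximal n)
  obtain ⟨c, hc, hind⟩ := exists_parameters_of_formallySmooth hres rfl
  exact isIntegrallyClosed_of_analyticallyIndependent hres hc hind

/-- Elements of the fraction field that are regular in codimension one are regular, for a domain
all of whose localizations are normal or of depth at least two. -/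
theorem mem_range_of_forall_height_eq_one {A K : Type*} [CommRing A] [IsDomain A]
    [IsNoetherianRing A] [Field K] [Algebra A K] [IsFractionRing A K]
    (hP : ∀ P : Ideal A, P.IsPrime → P ≠ ⊥ →
      (∀ γ : K, IsIntegral A γ → ∃ s, s ∉ P ∧ s • γ ∈ (algebraMap A K).range) ∨
      (∃ a ∈ P, ∃ s ∈ P, a ≠ 0 ∧ ∀ u v, s * u = a * v → a ∣ u))
    {β : K} (h : ∀ P : Ideal A, P.IsPrime → P.height = 1 →
      ∃ s, s ∉ P ∧ s • β ∈ (algebraMap A K).range) : β ∈ (algebraMap A K).range := by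
  by_contra hβ
  have hinj := IsFractionRing.injective A K
  let N : Submodule A K := LinearMap.range (Algebra.linearMap A K)
  have hN : ∀ y : K, y ∈ N ↔ y ∈ (algebraMap A K).range := fun y => Iff.rfl
  have hβ0 : N.mkQ β ≠ 0 := by
    rw [Submodule.mkQ_apply, ne_eq, Submodule.Quotient.mk_eq_zero]; exact hβ
  -- If `β` is not in `A`, its class in `K / A` is nonzero and its annihilator lies in an associated
  -- prime `P`, the annihilator of some `γ`. It is enough to show that `P` has height one, because
  -- then the hypothesis on `β` contradicts this inclusion.
  obtain ⟨P, hPass, hle⟩ := exists_le_isAssociatedPrime_of_isNoetherianRing A (N.mkQ β) hβ0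
  obtain ⟨hprime, γ', hγ'⟩ := isAssociatedPrime_iff.mp hPass
  obtain ⟨γ, rfl⟩ := N.mkQ_surjective γ'
  have hmem : ∀ (r : A) (y : K), r • N.mkQ y = 0 ↔ r • y ∈ (algebraMap A K).range := fun r y => by
    rw [← map_smul, Submodule.mkQ_apply, Submodule.Quotient.mk_eq_zero]; rfl
  have hPγ : ∀ r : A, r ∈ P ↔ r • γ ∈ (algebraMap A K).range := fun r => by
    rw [hγ', ← hmem]
    simp
  have hPβ : ∀ r : A, r • β ∈ (algebraMap A K).range → r ∈ P := fun r hr => hle (by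
    have := (hmem r β).mpr hr
    simpa using this)
  have hγ : γ ∉ (algebraMap A K).range := fun hγ =>
    hprime.ne_top ((Ideal.eq_top_iff_one _).mpr ((hPγ 1).mpr (by rwa [one_smul])))
  have hPbot : P ≠ ⊥ := by
    obtain ⟨u, v, hv, rfl⟩ := IsFractionRing.div_surjective (A := A) β
    have hv0 : v ≠ 0 := nonZeroDivisors.ne_zero hv
    have hvP : v ∈ P := hPβ v ⟨u, by
      rw [Algebra.smul_def, mul_div_cancel₀]
      exact fun h => hv0 (hinj (by rw [h, map_zero]))⟩
    rintro rfl
    exact hv0 hvP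
  have hht : P.height = 1 := by
    -- Either `P • γ ⊆ P`, and then `γ` is integral, against normality at `P`, while a regular pair
    -- in `P` also forces `γ ∈ A`. Or some `u ∈ P` has `u • γ` outside `P`, and then `P` is minimal
    -- over `u`, so Krull's principal ideal theorem applies.
    by_cases hstab : ∀ r ∈ P, ∀ w : A, algebraMap A K w = r • γ → w ∈ P
    · exfalso
      rcases hP P hprime hPbot with hn | ⟨a, ha, s, hs, ha0, hreg⟩
      · have hint : IsIntegral A γ := by
          refine isIntegral_of_smul_mem_submodule (R := A) (A := K)
            (M := K) (Submodule.map (Algebra.linearMap A K) P) ?_ ?_ γ ?_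
          · intro hbot
            apply hPbot
            rw [eq_bot_iff]
            intro r hr
            have : algebraMap A K r ∈ Submodule.map (Algebra.linearMap A K) P := ⟨r, hr, rfl⟩
            rw [hbot, Submodule.mem_bot] at this
            exact hinj (by rw [map_zero]; exact this)
          · exact (IsNoetherian.noetherian P).map _
          · rintro _ ⟨r, hr, rfl⟩
            obtain ⟨w, hw⟩ := (hPγ r).mp hr
            refine ⟨w, hstab r hr w hw, ?_⟩
            rw [Algebra.linearMap_apply, hw, Algebra.smul_def, smul_eq_mul, mul_comm]; rfl
        obtain ⟨s, hs, hsγ⟩ := hn γ hint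
        exact hs ((hPγ s).mpr hsγ)
      · obtain ⟨u, hu⟩ := (hPγ a).mp ha
        obtain ⟨v, hv⟩ := (hPγ s).mp hs
        obtain ⟨w, hw⟩ := hreg u v (hinj (by
          rw [map_mul, map_mul, hu, hv, Algebra.smul_def, Algebra.smul_def]; ring))
        apply hγ
        refine ⟨w, ?_⟩
        have ha0' : algebraMap A K a ≠ 0 := fun h => ha0 (hinj (by rw [h, map_zero]))
        apply mul_left_cancel₀ ha0'
        rw [← map_mul, ← hw, hu, Algebra.smul_def]
    · push Not at hstab
      obtain ⟨u, huP, w, hw, hwP⟩ := hstab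
      have hdvd : ∀ r ∈ P, r * w ∈ Ideal.span {u} := by
        intro r hr
        obtain ⟨z, hz⟩ := (hPγ r).mp hr
        refine Ideal.mem_span_singleton'.mpr ⟨z, hinj ?_⟩
        rw [map_mul, map_mul, hz, hw, Algebra.smul_def, Algebra.smul_def]; ring
      have hu0 : u ≠ 0 := by
        rintro rfl
        rw [zero_smul, ← map_zero (algebraMap A K)] at hw
        exact hwP (hinj hw ▸ zero_mem P)
      have hmin : P ∈ (Ideal.span {u}).minimalPrimes := by
        refine ⟨⟨hprime, (Ideal.span_singleton_le_iff_mem _).mpr huP⟩, ?_⟩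
        rintro Q ⟨hQ, huQ⟩ hQP r hr
        exact (hQ.mem_or_mem (huQ (hdvd r hr))).resolve_right fun h => hwP (hQP h)
      have hunit : ¬ IsUnit u := fun h => hprime.ne_top (Ideal.eq_top_of_isUnit_mem _ huP h)
      refine le_antisymm (Ideal.height_le_one_of_isPrincipal_of_mem_minimalPrimes _ _ hmin) ?_
      rw [← Ideal.height_span_singleton_eq_one_of_mem_nonZeroDivisors (mem_nonZeroDivisors_of_ne_zero hu0) hunit]
      exact Ideal.height_mono hmin.1.2
  obtain ⟨s, hs, hsβ⟩ := h P hprime hht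
  exact hs (hPβ s hsβ)

variable {k A O : Type*} [Field k] [CommRing A] [Algebra k A] [IsLocalRing A] [IsNoetherianRing A]
  [CommRing O] [IsLocalRing O] [IsNoetherianRing O] [Algebra k O] [Algebra A O] [IsScalarTower k A O]

omit [IsNoetherianRing O] in
-- Modulo `Q` an element of `A` is to leading order a form in the `c i`. If its image lies in `J`,
-- that form is a relation between parameters modulo `J` and vanishes, so the element lies in `Q + m
-- ^ n` for all `n`. In this way the ideal `Q` is recognised as the preimage of an ideal of a smooth
-- local ring `O` above `A`.
theorem mem_span_of_algebraMap_mem_span (hresA : ResidueTrivial k A)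
    [IsLocalHom (algebraMap A O)] {Q : Ideal A} {ι : Type*} {c : ι → A}
    (hQ : Q ⊔ Ideal.span (Set.range c) = maximalIdeal A) {J : Ideal O}
    (hQJ : Q.map (algebraMap A O) ≤ J)
    (hc : IsParameterSystemMod k J fun i => algebraMap A O (c i)) {x : A}
    (hx : algebraMap A O x ∈ J) : x ∈ Q := by
  refine mem_of_forall_mem_sup_pow fun n => ?_
  induction n with
  | zero => simp
  | succ n ih =>
    set L := Ideal.span (Set.range c)
    have hLm : L ≤ maximalIdeal A := le_sup_right.trans hQ.le
    have hmn : ∀ n, maximalIdeal A ^ n ≤ Q ⊔ L ^ n := by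
      intro n
      cases n with
      | zero => simp
      | succ n =>
        rw [← hQ]
        exact (sup_pow_succ_le Q L n).trans (sup_le_sup_right Ideal.mul_le_right _)
    have hmap : ∀ n {y : A}, y ∈ maximalIdeal A ^ n →
        algebraMap A O y ∈ maximalIdeal O ^ n := fun n y hy => by
      have h1 : (maximalIdeal A).map (algebraMap A O) ≤ maximalIdeal O :=
        ((local_hom_TFAE (algebraMap A O)).out 0 2).mp ‹IsLocalHom (algebraMap A O)›
      have := Ideal.pow_right_mono h1 n
      rw [← Ideal.map_pow] at this
      exact this (Ideal.mem_map_of_mem _ hy)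
    obtain ⟨y, hy, z, hz, rfl⟩ := Submodule.mem_sup.mp (sup_le le_sup_left (hmn n) ih)
    obtain ⟨F, hF, hFz⟩ := exists_isHomogeneous_sub_mem hresA c rfl n hz
    have h1 : z - aeval c F ∈ maximalIdeal A ^ (n + 1) := by
      rw [pow_succ]; exact Ideal.mul_mono_left (Ideal.pow_right_mono hLm _) hFz
    have h0 : F = 0 := by
      refine hc.eq_zero n F hF ?_
      have h2 : aeval (fun i => algebraMap A O (c i)) F =
          (algebraMap A O (y + z) - algebraMap A O y) - algebraMap A O (z - aeval c F) := by
        rw [← map_sub, ← map_sub]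
        refine (aeval_algebraMap_apply O c F).trans (congrArg _ ?_)
        ring
      rw [h2]
      refine Ideal.sub_mem _ (Ideal.mem_sup_left (J.sub_mem hx ?_)) (Ideal.mem_sup_right (hmap _ h1))
      exact hQJ (Ideal.mem_map_of_mem _ hy)
    rw [h0, map_zero, sub_zero] at h1
    exact Submodule.add_mem_sup hy h1

/-- A node has depth two. With `a' = a - t₀ b` and `h' = h - t₀ g` one has `a' g = b h'`, so `a' =
0` is the union of the surfaces `(a', b)` and `(a', h')`. The first ideal is `(a, b)`, which is
prime, and the second contains the preimage of the prime `(t - t₀)` of `O`. An element in both is a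
combination of `a'` and `b h'`, hence a multiple of `a'`. The shift by `t₀` makes `a'` and `h'` map
into `(t - t₀)`. -/
theorem exists_regular_pair [IsDomain A] (hresA : ResidueTrivial k A) (hresO : ResidueTrivial k O)
    [IsLocalHom (algebraMap A O)] {a b g h : A}
    (hrel : a * g = b * h) (hm : maximalIdeal A = Ideal.span {a, b, g, h})
    (hI : IsParameterSystemMod k (Ideal.span {a, b}) ![g, h]) {t : O} {t₀ : k}
    (hta : algebraMap A O a = t * algebraMap A O b) (hth : algebraMap A O h = t * algebraMap A O g)
    (hO : maximalIdeal O =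
      Ideal.span (Set.range ![algebraMap A O b, algebraMap A O g, t - algebraMap k O t₀]))
    (hind : AnalyticallyIndependent k ![algebraMap A O b, algebraMap A O g, t - algebraMap k O t₀]) :
    ∃ a' ∈ maximalIdeal A, ∃ s ∈ maximalIdeal A, a' ≠ 0 ∧ ∀ u v, s * u = a' * v → a' ∣ u := by
  set φ := algebraMap A O
  set τ := t - algebraMap k O t₀ with hτ
  set a' := a - algebraMap k A t₀ * b with ha'
  set h' := h - algebraMap k A t₀ * g with hh'
  have hk : φ (algebraMap k A t₀) = algebraMap k O t₀ := (IsScalarTower.algebraMap_apply k A O _).symm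
  have hrel' : a' * g = b * h' := by rw [ha', hh']; linear_combination hrel
  have hφa : φ a' = τ * φ b := by rw [ha', map_sub, map_mul, hk, hta, hτ]; ring
  have hφh : φ h' = τ * φ g := by rw [hh', map_sub, map_mul, hk, hth, hτ]; ring
  have hspanI : Ideal.span {a, b} = Ideal.span {a', b} := by
    apply le_antisymm <;> rw [Ideal.span_le] <;> rintro y (rfl | rfl)
    · have : y = a' + algebraMap k A t₀ * b := by rw [ha']; ring
      rw [this]
      exact Ideal.add_mem _ (Ideal.subset_span (by simp))
        (Ideal.mul_mem_left _ _ (Ideal.subset_span (by simp)))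
    · exact Ideal.subset_span (by simp)
    · exact Ideal.sub_mem _ (Ideal.subset_span (by simp))
        (Ideal.mul_mem_left _ _ (Ideal.subset_span (by simp)))
    · exact Ideal.subset_span (by simp)
  have hmem : ∀ y ∈ ({a, b, g, h} : Set A), y ∈ maximalIdeal A := fun y hy =>
    hm ▸ Ideal.subset_span hy
  have ham : a ∈ maximalIdeal A := hmem a (by simp)
  have hbm : b ∈ maximalIdeal A := hmem b (by simp)
  have hgm : g ∈ maximalIdeal A := hmem g (by simp)
  have hhm : h ∈ maximalIdeal A := hmem h (by simp)
  have ha'm : a' ∈ maximalIdeal A := Ideal.sub_mem _ ham (Ideal.mul_mem_left _ _ hbm)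
  have hh'm : h' ∈ maximalIdeal A := Ideal.sub_mem _ hhm (Ideal.mul_mem_left _ _ hgm)
  -- the two primes containing `a'`
  have hIprime : (Ideal.span {a, b}).IsPrime := by
    refine hI.isPrime hresA ?_
    intro htop
    have : Ideal.span {a, b} ≤ maximalIdeal A := by
      rw [Ideal.span_le]; rintro y (rfl | rfl) <;> assumption
    exact IsLocalRing.maximalIdeal.isMaximal A |>.ne_top (top_le_iff.mp (htop ▸ this))
  have hh'I : h' ∉ Ideal.span {a, b} := by
    intro hmemI
    have h0 := hI.eq_zero 1 (X 1 - C t₀ * X 0)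
      ((isHomogeneous_X k 1).sub (isHomogeneous_C_mul_X _ _)) (by
        simpa using Ideal.mem_sup_left hmemI)
    have := congrArg (eval ![0, 1]) h0
    simp at this
  let c : Option (Fin 2) → O := fun o => o.elim τ ![φ b, φ g]
  have hc : c = ![φ b, φ g, τ] ∘ (finSuccEquivLast (n := 2)).symm := by
    funext o
    cases o with
    | none => rfl
    | some i => fin_cases i <;> rfl
  have hcind : AnalyticallyIndependent k c := hc ▸ hind.comp_equiv _
  have hcO : maximalIdeal O = Ideal.span (Set.range c) := by
    rw [hO, hc, Set.range_comp, Equiv.range_eq_univ, Set.image_univ]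
  have hpar := IsParameterSystemMod.of_analyticallyIndependent hresO hcO hcind
  have hτprime : (Ideal.span {τ}).IsPrime := by
    refine hpar.isPrime hresO fun htop => ?_
    have hτm : τ ∈ maximalIdeal O := hcO ▸ Ideal.subset_span ⟨none, rfl⟩
    exact (IsLocalRing.maximalIdeal.isMaximal O).ne_top
      (top_le_iff.mp (htop ▸ (Ideal.span_singleton_le_iff_mem _).mpr hτm))
  have hbτ : φ b ∉ Ideal.span {τ} := hpar.notMem 0
  have hQmem : ∀ x : A, φ x ∈ Ideal.span {τ} → x ∈ Ideal.span {a', h'} := by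
    intro x hx
    refine mem_span_of_algebraMap_mem_span (O := O) (c := ![b, g]) hresA ?_ ?_ ?_ hx
    · apply le_antisymm
      · refine sup_le ?_ ?_ <;> rw [Ideal.span_le]
        · rintro y (rfl | rfl) <;> assumption
        · rintro _ ⟨i, rfl⟩; fin_cases i <;> assumption
      · rw [hm, Ideal.span_le]
        have h1 : a' ∈ Ideal.span {a', h'} := Ideal.subset_span (by simp)
        have h2 : h' ∈ Ideal.span {a', h'} := Ideal.subset_span (by simp)
        have h3 : b ∈ Ideal.span (Set.range ![b, g]) := Ideal.subset_span ⟨0, rfl⟩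
        have h4 : g ∈ Ideal.span (Set.range ![b, g]) := Ideal.subset_span ⟨1, rfl⟩
        rintro y (rfl | rfl | rfl | rfl)
        · have : y = a' + algebraMap k A t₀ * b := by rw [ha']; ring
          rw [this]
          exact Submodule.add_mem_sup h1 (Ideal.mul_mem_left _ _ h3)
        · exact Ideal.mem_sup_right h3
        · exact Ideal.mem_sup_right h4
        · have : y = h' + algebraMap k A t₀ * g := by rw [hh']; ring
          rw [this]
          exact Submodule.add_mem_sup h2 (Ideal.mul_mem_left _ _ h4)
    · rw [Ideal.map_span, Ideal.span_le]
      rintro _ ⟨y, (rfl | rfl), rfl⟩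
      · exact Ideal.mem_span_singleton'.mpr ⟨φ b, by rw [mul_comm, ← hφa]⟩
      · exact Ideal.mem_span_singleton'.mpr ⟨φ g, by rw [mul_comm, ← hφh]⟩
    · have h1 : (fun i => algebraMap A O (![b, g] i)) = fun i => c (some i) := by
        funext i; fin_cases i <;> rfl
      rw [h1]; exact hpar
  -- `b` vanishes on the first component and `h'` on the second, but neither on the other one, so `b
  -- - h'` is a nonzerodivisor on each of them.
  refine ⟨a', ha'm, b - h', Ideal.sub_mem _ hbm hh'm, ?_, ?_⟩
  · intro h0
    have h1 : τ * φ b = 0 := by rw [← hφa, h0, map_zero]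
    have hdom := isDomain_of_analyticallyIndependent hresO hcO hcind
    rcases mul_eq_zero.mp h1 with h2 | h2
    · exact hcind.notMem_sq none (by change τ ∈ _; rw [h2]; exact zero_mem _)
    · exact hbτ (h2 ▸ zero_mem _)
  · intro u v huv
    have hbI : b ∈ Ideal.span {a, b} := Ideal.subset_span (by simp)
    have ha'I : a' ∈ Ideal.span {a, b} := hspanI ▸ Ideal.subset_span (by simp)
    have huI : u ∈ Ideal.span {a, b} := by
      refine (hIprime.mem_or_mem (?_ : h' * u ∈ _)).resolve_left hh'I
      have : h' * u = b * u - a' * v := by rw [← huv]; ring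
      rw [this]
      exact Ideal.sub_mem _ (Ideal.mul_mem_right _ _ hbI) (Ideal.mul_mem_right _ _ ha'I)
    have huQ : u ∈ Ideal.span {a', h'} := by
      refine hQmem u ((hτprime.mem_or_mem (?_ : φ b * φ u ∈ _)).resolve_left hbτ)
      refine Ideal.mem_span_singleton'.mpr ⟨φ b * φ v + φ g * φ u, ?_⟩
      have : b * u = a' * v + h' * u := by rw [← huv]; ring
      rw [← map_mul φ b u, this, map_add, map_mul, map_mul, hφa, hφh]; ring
    obtain ⟨α, β, hαβ⟩ := Ideal.mem_span_pair.mp huQ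
    have hβI : β ∈ Ideal.span {a, b} := by
      refine (hIprime.mem_or_mem (?_ : h' * β ∈ _)).resolve_left hh'I
      have : h' * β = u - α * a' := by rw [← hαβ]; ring
      rw [this]
      exact Ideal.sub_mem _ huI (Ideal.mul_mem_left _ _ ha'I)
    rw [hspanI] at hβI
    obtain ⟨γ, δ, hγδ⟩ := Ideal.mem_span_pair.mp hβI
    refine ⟨α + h' * γ + g * δ, ?_⟩
    rw [← hαβ, ← hγδ]
    linear_combination -δ * hrel'

end Normality


/-! ### Power series: powers of the maximal ideal and the quadratic part. -/

section PowerSeries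

open IsLocalRing

lemma mvPowerSeries_eq_sum_X_mul {k : Type*} [Field k] {N : ℕ} (p : MvPowerSeries (Fin N) k)
    (hp : MvPowerSeries.constantCoeff p = 0) :
    ∃ q : Fin N → MvPowerSeries (Fin N) k, p = ∑ i, MvPowerSeries.X i * q i ∧
      ∀ n, (∀ d, d.degree < n + 1 → MvPowerSeries.coeff d p = 0) →
        ∀ i d, d.degree < n → MvPowerSeries.coeff d (q i) = 0 := by
  classical
  -- Each monomial is assigned to the variable of least index occurring in it, so that it is divided
  -- exactly once.
  let q : Fin N → MvPowerSeries (Fin N) k := fun i m =>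
    if ∀ j < i, m j = 0 then MvPowerSeries.coeff (m + Finsupp.single i 1) p else 0
  have hq : ∀ i m, MvPowerSeries.coeff m (q i) =
    if ∀ j < i, m j = 0 then MvPowerSeries.coeff (m + Finsupp.single i 1) p else 0 :=
    fun i m => rfl
  refine ⟨q, ?_, ?_⟩
  · ext d
    rw [map_sum]
    have hX : ∀ i, MvPowerSeries.coeff d (MvPowerSeries.X i * q i) =
        if d i ≠ 0 ∧ ∀ j < i, d j = 0 then MvPowerSeries.coeff d p else 0 := by
      intro i
      by_cases hd : d i = 0
      · rw [if_neg (by simp [hd])]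
        exact (MvPowerSeries.X_dvd_iff.mp (dvd_mul_right _ _)) d hd
      · have hle : Finsupp.single i 1 ≤ d :=
          Finsupp.single_le_iff.mpr (Nat.one_le_iff_ne_zero.mpr hd)
        have hdd : Finsupp.single i 1 + (d - Finsupp.single i 1) = d := add_tsub_cancel_of_le hle
        conv_lhs => rw [← hdd]
        rw [MvPowerSeries.X, MvPowerSeries.coeff_add_monomial_mul, one_mul, hq]
        rw [add_comm, hdd]
        congr 1
        simp only [ne_eq, hd, not_false_eq_true, true_and, eq_iff_iff]
        refine forall₂_congr fun j hj => ?_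
        simp [hj.ne']
    simp_rw [hX]
    by_cases hd0 : d = 0
    · subst hd0
      rw [MvPowerSeries.coeff_zero_eq_constantCoeff_apply, hp]
      simp
    · have hne : (d.support).Nonempty := Finsupp.support_nonempty_iff.mpr hd0
      rw [Finset.sum_eq_single (d.support.min' hne)]
      · rw [if_pos]
        refine ⟨Finsupp.mem_support_iff.mp (d.support.min'_mem hne), fun j hj => ?_⟩
        by_contra h
        exact absurd (d.support.min'_le j (Finsupp.mem_support_iff.mpr h)) (not_le.mpr hj)
      · intro i _ hi
        rw [if_neg]
        rintro ⟨h1, h2⟩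
        refine hi (le_antisymm ?_ (d.support.min'_le i (Finsupp.mem_support_iff.mpr h1)))
        by_contra hlt
        exact Finsupp.mem_support_iff.mp (d.support.min'_mem hne) (h2 _ (not_le.mp hlt))
      · simp
  · intro n hn i d hd
    rw [hq]
    split_ifs
    · refine hn _ ?_
      rw [map_add, Finsupp.degree_single]; omega
    · rfl

lemma mvPowerSeries_mem_span_X_pow {k : Type*} [Field k] {N : ℕ} (n : ℕ)
    (p : MvPowerSeries (Fin N) k) (hp : ∀ d, d.degree < n → MvPowerSeries.coeff d p = 0) :
    p ∈ Ideal.span (Set.range (MvPowerSeries.X : Fin N → MvPowerSeries (Fin N) k)) ^ n := by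
  induction n generalizing p with
  | zero => simp
  | succ n ih =>
    obtain ⟨q, hq, hqn⟩ := mvPowerSeries_eq_sum_X_mul p (by
      rw [← MvPowerSeries.coeff_zero_eq_constantCoeff_apply]; exact hp 0 (by simp))
    rw [hq, pow_succ']
    exact Ideal.sum_mem _ fun i _ => Ideal.mul_mem_mul (Ideal.subset_span ⟨i, rfl⟩)
      (ih _ (hqn n hp i))

lemma exists_eq_single_of_degree_eq_one {σ : Type*} {d : σ →₀ ℕ} (hd : d.degree = 1) :
    ∃ b, d = Finsupp.single b 1 := by
  classical
  have hne : d ≠ 0 := by rintro rfl; simp at hd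
  obtain ⟨b, hb⟩ := Finsupp.support_nonempty_iff.mpr hne
  have hb' : Finsupp.single b 1 ≤ d := Finsupp.single_le_iff.mpr
    (Nat.one_le_iff_ne_zero.mpr (Finsupp.mem_support_iff.mp hb))
  have hd' := add_tsub_cancel_of_le hb'
  have h := congrArg Finsupp.degree hd'
  rw [map_add, Finsupp.degree_single, hd] at h
  refine ⟨b, ?_⟩
  have h0 := (Finsupp.degree_eq_zero_iff (d - Finsupp.single b 1)).mp (by omega)
  rw [← hd', h0, add_zero]

lemma coeff_single_eq_zero_of_mem_sq {k : Type*} [Field k] {N : ℕ} {p : MvPowerSeries (Fin N) k}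
    (hp : p ∈ Ideal.span (Set.range (MvPowerSeries.X : Fin N → MvPowerSeries (Fin N) k)) ^ 2)
    (j : Fin N) : MvPowerSeries.coeff (Finsupp.single j 1) p = 0 := by
  have h0 : ∀ a ∈ Ideal.span (Set.range (MvPowerSeries.X : Fin N → MvPowerSeries (Fin N) k)),
      (1 : ℕ) ≤ a.order := by
    intro a ha
    refine MvPowerSeries.nat_le_order fun d hd => ?_
    rw [(Finsupp.degree_eq_zero_iff d).mp (by omega : d.degree = 0),
      MvPowerSeries.coeff_zero_eq_constantCoeff_apply, ← RingHom.mem_ker]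
    refine (Ideal.span_le.mpr ?_ : _ ≤ RingHom.ker _) ha
    rintro _ ⟨i, rfl⟩
    simp
  rw [pow_two] at hp
  refine Submodule.mul_induction_on hp (fun a ha b hb => ?_) fun a b ha hb => by
    rw [map_add, ha, hb, add_zero]
  refine MvPowerSeries.coeff_of_lt_order (lt_of_lt_of_le ?_ MvPowerSeries.le_order_mul)
  rw [Finsupp.degree_single]
  exact lt_of_lt_of_le (by norm_num) (add_le_add (h0 a ha) (h0 b hb))

/-- The sum runs over ordered pairs, so a mixed monomial appears twice, and a diagonal entry of the
Hessian is twice the coefficient: the quadratic part of `2 f` is the Hessian form. -/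
lemma two_mul_sub_hessian_mem (f : MvPowerSeries (Fin 4) ℂ)
    (h0 : MvPowerSeries.constantCoeff f = 0)
    (h1 : ∀ j : Fin 4, MvPowerSeries.coeff (Finsupp.single j 1) f = 0) :
    2 * f - ∑ i, ∑ j, MvPowerSeries.C (hessianAtZero f i j) *
      (MvPowerSeries.X i * MvPowerSeries.X j) ∈
      Ideal.span (Set.range (MvPowerSeries.X : Fin 4 → MvPowerSeries (Fin 4) ℂ)) ^ 3 := by
  classical
  refine mvPowerSeries_mem_span_X_pow 3 _ fun d hd => ?_
  have h2 : MvPowerSeries.coeff d (2 * f) = 2 * MvPowerSeries.coeff d f := by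
    rw [show (2 : MvPowerSeries (Fin 4) ℂ) = MvPowerSeries.C 2 from (map_ofNat MvPowerSeries.C 2).symm, MvPowerSeries.coeff_C_mul]
  have hXX : ∀ i j : Fin 4, MvPowerSeries.coeff d (MvPowerSeries.X i * MvPowerSeries.X j :
      MvPowerSeries (Fin 4) ℂ) = if Finsupp.single i 1 + Finsupp.single j 1 = d then 1 else 0 := by
    intro i j
    rw [MvPowerSeries.X, MvPowerSeries.X, MvPowerSeries.monomial_mul_monomial,
      MvPowerSeries.coeff_monomial, one_mul]
    simp [eq_comm]
  rw [map_sub, h2, map_sum, sub_eq_zero]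
  simp_rw [map_sum, MvPowerSeries.coeff_C_mul, hXX]
  have hdeg : ∀ i j : Fin 4, (Finsupp.single i 1 + Finsupp.single j 1 : Fin 4 →₀ ℕ).degree = 2 :=
    fun i j => by rw [map_add, Finsupp.degree_single, Finsupp.degree_single]
  by_cases hd2 : d.degree = 2
  · obtain ⟨a, b, rfl⟩ : ∃ a b : Fin 4, d = Finsupp.single a 1 + Finsupp.single b 1 := by
      have hne : d ≠ 0 := by rintro rfl; simp at hd2
      obtain ⟨a, ha⟩ := Finsupp.support_nonempty_iff.mpr hne
      have ha' : Finsupp.single a 1 ≤ d := Finsupp.single_le_iff.mpr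
        (Nat.one_le_iff_ne_zero.mpr (Finsupp.mem_support_iff.mp ha))
      have hd' := add_tsub_cancel_of_le ha'
      have hdeg1 : (d - Finsupp.single a 1).degree = 1 := by
        have := congrArg Finsupp.degree hd'
        rw [map_add, Finsupp.degree_single, hd2] at this
        omega
      obtain ⟨b, hb⟩ := exists_eq_single_of_degree_eq_one hdeg1
      exact ⟨a, b, by rw [← hd', hb]⟩
    have hiff : ∀ i j : Fin 4, (Finsupp.single i 1 + Finsupp.single j 1 : Fin 4 →₀ ℕ) =
        Finsupp.single a 1 + Finsupp.single b 1 ↔ (i = a ∧ j = b) ∨ (i = b ∧ j = a) := by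
      intro i j
      rw [Finsupp.single_add_single_eq_single_add_single one_ne_zero one_ne_zero]
      simp
    simp_rw [hiff]
    by_cases hab : a = b
    · subst hab
      simp only [or_self, mul_ite, mul_one, mul_zero]
      rw [Finset.sum_eq_single a, Finset.sum_eq_single a]
      · simp [hessianAtZero]
      · intro j _ hj; simp [hj]
      · simp
      · intro i _ hi; simp [hi]
      · simp
    · have : ∀ i j : Fin 4, hessianAtZero f i j * (if (i = a ∧ j = b) ∨ (i = b ∧ j = a) then 1 else 0)
          = (if i = a then if j = b then hessianAtZero f i j else 0 else 0) +
            (if i = b then if j = a then hessianAtZero f i j else 0 else 0) := by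
        intro i j
        by_cases h1 : i = a <;> by_cases h2 : j = b <;> by_cases h3 : i = b <;> by_cases h4 : j = a <;>
          simp_all
      simp_rw [this, Finset.sum_add_distrib]
      simp [hessianAtZero, hab, Ne.symm hab, add_comm (Finsupp.single b 1)]
      ring
  · have hz : MvPowerSeries.coeff d f = 0 := by
      have hlt : d.degree = 0 ∨ d.degree = 1 := by omega
      rcases hlt with h | h
      · rw [(Finsupp.degree_eq_zero_iff d).mp h,
          MvPowerSeries.coeff_zero_eq_constantCoeff_apply, h0]
      · obtain ⟨b, hb⟩ := exists_eq_single_of_degree_eq_one h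
        rw [hb]; exact h1 b
    rw [hz, mul_zero, eq_comm]
    refine Finset.sum_eq_zero fun i _ => Finset.sum_eq_zero fun j _ => ?_
    rw [if_neg, mul_zero]
    intro h; exact hd2 (h ▸ hdeg i j)

lemma hessianAtZero_transpose (f : MvPowerSeries (Fin 4) ℂ) :
    (hessianAtZero f).transpose = hessianAtZero f := by
  ext i j
  simp only [hessianAtZero, Matrix.transpose_apply, Matrix.of_apply,
    add_comm (Finsupp.single j 1) (Finsupp.single i 1), eq_comm (a := j)]

end PowerSeries

/-! ### From the completed local ring of a double point to the local ring itself. -/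

section CompletedLocalRing

open IsLocalRing

variable {A : Type} [CommRing A] [IsLocalRing A] [IsNoetherianRing A] [Algebra ℂ A]
  {f : MvPowerSeries (Fin 4) ℂ}
  {m : Ideal A} {φ : MvPowerSeries (Fin 4) ℂ →+* AdicCompletion m A}

/-- Everything needed is visible in `A / m³`, a quotient of the power series ring. Lifting the
images of the variables gives four elements that generate `m` modulo `m²` and on which the Hessian
form takes a value in `m³`. They stay independent modulo `m²` because `f` has no linear term. -/
lemma exists_of_completion (hm : m = maximalIdeal A) (h0 : MvPowerSeries.constantCoeff f = 0)
    (h1 : ∀ j : Fin 4, MvPowerSeries.coeff (Finsupp.single j 1) f = 0)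
    (hφ : Function.Surjective φ) (hker : RingHom.ker φ = Ideal.span {f})
    (hC : φ.comp MvPowerSeries.C = (algebraMap A _).comp (algebraMap ℂ A)) :
    ResidueTrivial ℂ A ∧ ∃ x : Fin 4 → A,
      Ideal.span (Set.range x) ⊔ m ^ 2 = m ∧
      x ⬝ᵥ ((hessianAtZero f).map (algebraMap ℂ A)).mulVec x ∈ m ^ 3 ∧
      ∀ v : Fin 4 → ℂ, ∑ i, v i • x i ∈ m ^ 2 → v = 0 := by
  have hmmax : m.IsMaximal := hm ▸ maximalIdeal.isMaximal A
  let ev : AdicCompletion m A →+* A ⧸ m ^ 3 := (AdicCompletion.evalₐ m 3 : _ →+* _)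
  let ε : MvPowerSeries (Fin 4) ℂ →+* A ⧸ m ^ 3 := ev.comp φ
  have hεsurj : Function.Surjective ε := (AdicCompletion.surjective_evalₐ m 3).comp hφ
  have hm3 : m ^ 3 ≠ ⊤ := fun h => hmmax.ne_top
    (top_le_iff.mp (h ▸ Ideal.pow_le_self three_ne_zero))
  have : Nontrivial (A ⧸ m ^ 3) := Ideal.Quotient.nontrivial_iff.mpr hm3
  have hεC : ∀ z, ε (MvPowerSeries.C z) = Ideal.Quotient.mk (m ^ 3) (algebraMap ℂ A z) := by
    intro z
    change ev (φ (MvPowerSeries.C z)) = _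
    rw [← RingHom.comp_apply φ, hC]
    exact (AdicCompletion.evalₐ m 3).commutes _
  have hmk : ∀ y : A, Ideal.Quotient.mk (m ^ 3) y ∈ m.map (Ideal.Quotient.mk (m ^ 3)) ↔ y ∈ m := by
    intro y
    rw [← Ideal.mem_comap, Ideal.comap_map_of_surjective' _ Ideal.Quotient.mk_surjective,
      Ideal.mk_ker, sup_eq_left.mpr (Ideal.pow_le_self three_ne_zero)]
  set MP := Ideal.span (Set.range (MvPowerSeries.X : Fin 4 → MvPowerSeries (Fin 4) ℂ))
  have hMP : ∀ p, MvPowerSeries.constantCoeff p = 0 → p ∈ MP := fun p hp => by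
    have := mvPowerSeries_mem_span_X_pow 1 p (fun d hd => by
      rw [(Finsupp.degree_eq_zero_iff d).mp (by omega),
        MvPowerSeries.coeff_zero_eq_constantCoeff_apply, hp])
    rwa [pow_one] at this
  have hloc : IsLocalHom ε := IsLocalHom.of_surjective _ hεsurj
  have hεm : ∀ p, MvPowerSeries.constantCoeff p = 0 → ∃ y ∈ m, ε p = Ideal.Quotient.mk (m ^ 3) y := by
    intro p hp
    obtain ⟨y, hy⟩ := Ideal.Quotient.mk_surjective (ε p)
    refine ⟨y, hm ▸ (mem_maximalIdeal _).mpr fun hyu => ?_, hy.symm⟩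
    have hu : IsUnit (ε p) := hy ▸ hyu.map _
    have := (MvPowerSeries.isUnit_iff_constantCoeff.mp (isUnit_of_map_unit ε p hu))
    rw [hp] at this
    exact not_isUnit_zero this
  have hres : ResidueTrivial ℂ A := by
    intro y
    obtain ⟨p, hp⟩ := hεsurj (Ideal.Quotient.mk (m ^ 3) y)
    refine ⟨MvPowerSeries.constantCoeff p, ?_⟩
    obtain ⟨z, hz, hpz⟩ := hεm (p - MvPowerSeries.C (MvPowerSeries.constantCoeff p)) (by simp)
    rw [map_sub, hp, hεC, ← map_sub] at hpz
    have := (hmk (y - algebraMap ℂ A (MvPowerSeries.constantCoeff p))).mp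
      (by rw [hpz]; exact Ideal.mem_map_of_mem _ hz)
    exact hm ▸ this
  choose x hxm hx using fun i : Fin 4 => hεm (MvPowerSeries.X i) (by simp)
  have hεMP : MP.map ε ≤ m.map (Ideal.Quotient.mk (m ^ 3)) := by
    rw [Ideal.map_span, Ideal.span_le]
    rintro _ ⟨_, ⟨i, rfl⟩, rfl⟩
    rw [hx i]; exact Ideal.mem_map_of_mem _ (hxm i)
  have hlift : ∀ y ∈ m, ∃ p ∈ MP, ε p = Ideal.Quotient.mk (m ^ 3) y := by
    intro y hy
    obtain ⟨p, hp⟩ := hεsurj (Ideal.Quotient.mk (m ^ 3) y)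
    refine ⟨p, hMP p ?_, hp⟩
    by_contra hne
    have hu := (MvPowerSeries.isUnit_iff_constantCoeff.mpr (isUnit_iff_ne_zero.mpr hne)).map ε
    rw [hp] at hu
    have h1 : Ideal.Quotient.mk (m ^ 3) y ∈ m.map (Ideal.Quotient.mk (m ^ 3)) := (hmk y).mpr hy
    have h2 := Ideal.eq_top_of_isUnit_mem _ h1 hu
    have h3 := (hmk 1).mp (h2 ▸ Submodule.mem_top)
    exact hmmax.ne_top ((Ideal.eq_top_iff_one _).mpr h3)
  refine ⟨hres, x, ?_, ?_, ?_⟩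
  · apply le_antisymm
    · refine sup_le ?_ (Ideal.pow_le_self two_ne_zero)
      rw [Ideal.span_le]; rintro _ ⟨i, rfl⟩; exact hxm i
    · intro y hy
      obtain ⟨p, hpM, hp⟩ := hlift y hy
      have hmem : Ideal.Quotient.mk (m ^ 3) y ∈ (Ideal.span (Set.range x)).map
          (Ideal.Quotient.mk (m ^ 3)) := by
        have h1 : ε p ∈ MP.map ε := Ideal.mem_map_of_mem _ hpM
        rw [hp, Ideal.map_span, ← Set.range_comp] at h1
        rw [Ideal.map_span, ← Set.range_comp]
        convert h1 using 3
        funext i; exact (hx i).symm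
      rw [← Ideal.mem_comap, Ideal.comap_map_of_surjective' _ Ideal.Quotient.mk_surjective,
        Ideal.mk_ker] at hmem
      exact (sup_le_sup_left (Ideal.pow_le_pow_right (by norm_num)) _ :
        Ideal.span (Set.range x) ⊔ m ^ 3 ≤ Ideal.span (Set.range x) ⊔ m ^ 2) hmem
  · rw [← Ideal.Quotient.eq_zero_iff_mem]
    have h2f : ε (2 * f) = 0 := by
      have : φ f = 0 := by rw [← RingHom.mem_ker, hker]; exact Ideal.mem_span_singleton_self f
      change ev (φ (2 * f)) = 0
      rw [map_mul, this, mul_zero, map_zero]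
    have h3 : ε (2 * f - ∑ i, ∑ j, MvPowerSeries.C (hessianAtZero f i j) *
      (MvPowerSeries.X i * MvPowerSeries.X j)) = 0 := by
      have h4 := Ideal.mem_map_of_mem ε (two_mul_sub_hessian_mem f h0 h1)
      rw [Ideal.map_pow] at h4
      have h5 := Ideal.pow_right_mono hεMP 3 h4
      rw [← Ideal.map_pow, Ideal.map_quotient_self, Ideal.mem_bot] at h5
      exact h5
    rw [map_sub, h2f, zero_sub, neg_eq_zero] at h3
    rw [← h3]
    simp only [dotProduct, Matrix.mulVec, Matrix.map_apply, map_sum, map_mul, hεC, hx,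
      Finset.mul_sum]
    refine Finset.sum_congr rfl fun i _ => Finset.sum_congr rfl fun j _ => ?_
    ring
  · intro v hv
    have hMPeq : MP.map ε = m.map (Ideal.Quotient.mk (m ^ 3)) := by
      refine le_antisymm hεMP (Ideal.map_le_iff_le_comap.mpr fun y hy => ?_)
      obtain ⟨p, hpM, hp⟩ := hlift y hy
      rw [Ideal.mem_comap, ← hp]
      exact Ideal.mem_map_of_mem _ hpM
    have hMPφ : m.map (algebraMap A (AdicCompletion m A)) ≤ MP.map φ := by
      refine Ideal.map_le_iff_le_comap.mpr fun y hy => ?_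
      obtain ⟨p, hp⟩ := hφ (algebraMap A _ y)
      rw [Ideal.mem_comap, ← hp]
      refine Ideal.mem_map_of_mem _ (hMP p ?_)
      by_contra hne
      have hu := (MvPowerSeries.isUnit_iff_constantCoeff.mpr (isUnit_iff_ne_zero.mpr hne)).map ε
      have hεp : ε p = Ideal.Quotient.mk (m ^ 3) y := by
        change ev (φ p) = _
        rw [hp]
        exact (AdicCompletion.evalₐ m 3).commutes _
      rw [hεp] at hu
      have h1 : Ideal.Quotient.mk (m ^ 3) y ∈ m.map (Ideal.Quotient.mk (m ^ 3)) := (hmk y).mpr hy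
      have h3 := (hmk 1).mp ((Ideal.eq_top_of_isUnit_mem _ h1 hu) ▸ Submodule.mem_top)
      exact hmmax.ne_top ((Ideal.eq_top_iff_one _).mpr h3)
    have hfM : f ∈ MP ^ 2 := mvPowerSeries_mem_span_X_pow 2 f fun d hd => by
      rcases (by omega : d.degree = 0 ∨ d.degree = 1) with h | h
      · rw [(Finsupp.degree_eq_zero_iff d).mp h, MvPowerSeries.coeff_zero_eq_constantCoeff_apply, h0]
      · obtain ⟨b, rfl⟩ := exists_eq_single_of_degree_eq_one h
        exact h1 b
    -- The kernel of the completion onto `A / m³` is generated by `m ^ 3`, so this kernel is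
    -- contained in `(f) + MP ^ 3`, and `f ∈ MP ^ 2`.
    have hkerε : ∀ p, ε p = 0 → p ∈ MP ^ 2 := by
      intro p hp
      have hp1 : φ p ∈ (m ^ 3 • ⊤ : Submodule A (AdicCompletion m A)) := by
        rw [AdicCompletion.pow_smul_top_eq_ker_eval m.fg_of_isNoetherianRing, LinearMap.mem_ker,
          ← AdicCompletion.factor_evalₐ_eq_eval m _ (by simp)]
        change Ideal.Quotient.factor _ (ε p) = 0
        rw [hp, map_zero]
      have hp2 : φ p ∈ (MP ^ 3).map φ := by
        rw [Ideal.smul_top_eq_map, Submodule.restrictScalars_mem, Ideal.map_pow] at hp1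
        rw [Ideal.map_pow]
        exact Ideal.pow_right_mono hMPφ 3 hp1
      obtain ⟨q, hq, hqp⟩ := (Ideal.mem_map_iff_of_surjective φ hφ).mp hp2
      have hpq : p - q ∈ Ideal.span {f} := by
        rw [← hker, RingHom.mem_ker, map_sub, hqp, sub_self]
      have h3 : p - q ∈ MP ^ 2 := (Ideal.span_le.mpr (Set.singleton_subset_iff.mpr hfM)) hpq
      have h4 := (MP ^ 2).add_mem h3 (Ideal.pow_le_pow_right (by norm_num : 2 ≤ 3) hq)
      rwa [sub_add_cancel] at h4
    have hy : ε (∑ i, MvPowerSeries.C (v i) * MvPowerSeries.X i) ∈ (MP ^ 2).map ε := by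
      rw [Ideal.map_pow, hMPeq, ← Ideal.map_pow]
      convert Ideal.mem_map_of_mem (Ideal.Quotient.mk (m ^ 3)) hv using 1
      simp only [map_sum, map_mul, hεC, hx, Algebra.smul_def]
    obtain ⟨q, hq, hqy⟩ := (Ideal.mem_map_iff_of_surjective ε hεsurj).mp hy
    have h5 := (MP ^ 2).add_mem (hkerε (∑ i, MvPowerSeries.C (v i) * MvPowerSeries.X i - q)
      (by rw [map_sub, hqy, sub_self])) hq
    rw [sub_add_cancel] at h5
    funext j
    have h6 := coeff_single_eq_zero_of_mem_sq h5 j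
    rw [map_sum] at h6
    simp only [MvPowerSeries.coeff_C_mul, MvPowerSeries.coeff_X,
      Finsupp.single_left_inj one_ne_zero] at h6
    simpa using h6

omit [IsNoetherianRing A] in
-- The four-by-three matrix expressing the `x i` through three generators has a kernel vector, which
-- would be a linear relation modulo `m ^ 2`. This separates double points from smooth points of a
-- threefold.
lemma not_exists_three_generators (hres : ResidueTrivial ℂ A) {x : Fin 4 → A}
    (hxm : ∀ i, x i ∈ maximalIdeal A)
    (hx : ∀ v : Fin 4 → ℂ, ∑ i, v i • x i ∈ maximalIdeal A ^ 2 → v = 0) (c : Fin 3 → A) :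
    maximalIdeal A ≠ Ideal.span (Set.range c) := by
  intro hc
  choose r hr using fun j => exists_linear_combination_sub_mem_sq (k := ℂ) (m' := ⊥) hres
    (by rw [sup_bot_eq, hc]) (hxm j)
  simp only [bot_sup_eq] at hr
  have hlt : Module.finrank ℂ (Fin 3 → ℂ) < Module.finrank ℂ (Fin 4 → ℂ) := by simp
  obtain ⟨v, hv, hv0⟩ := (Submodule.ne_bot_iff _).mp
    (LinearMap.ker_ne_bot_of_finrank_lt (f := Fintype.linearCombination ℂ r) hlt)
  refine hv0 (hx v ?_)
  rw [LinearMap.mem_ker, Fintype.linearCombination_apply] at hv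
  have h1 : ∑ i, v i • x i = ∑ i, v i • (x i - ∑ j, r i j • c j) := by
    simp only [smul_sub, Finset.sum_sub_distrib, Finset.smul_sum, smul_smul]
    rw [Finset.sum_comm, eq_comm, sub_eq_self]
    refine Finset.sum_eq_zero fun j _ => ?_
    rw [← Finset.sum_smul]
    have := congrFun hv j
    simp only [Finset.sum_apply, Pi.smul_apply, smul_eq_mul, Pi.zero_apply] at this
    rw [this, zero_smul]
  rw [h1]
  refine Ideal.sum_mem _ fun i _ => ?_
  rw [Algebra.smul_def]
  exact Ideal.mul_mem_left _ _ (hr i)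

/-- The structure of the local ring at an ordinary double point along a smooth Weil divisor. -/
theorem exists_node_equation (hm : m = maximalIdeal A)
    (h0 : MvPowerSeries.constantCoeff f = 0)
    (h1 : ∀ j : Fin 4, MvPowerSeries.coeff (Finsupp.single j 1) f = 0)
    (hdet : (hessianAtZero f).det ≠ 0)
    (hφ : Function.Surjective φ) (hker : RingHom.ker φ = Ideal.span {f})
    (hC : φ.comp MvPowerSeries.C = (algebraMap A _).comp (algebraMap ℂ A))
    {B : Type} [CommRing B] [IsLocalRing B] [Algebra A B] [Algebra ℂ B] [IsScalarTower ℂ A B]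
    [Algebra.FormallySmooth ℂ B] [Module.Finite B Ω[B⁄ℂ]] (hB : Module.finrank B Ω[B⁄ℂ] = 2)
    (hsurj : Function.Surjective (algebraMap A B)) :
    ∃ a b g h : A, RingHom.ker (algebraMap A B) = Ideal.span {a, b} ∧ a * g = b * h ∧
      maximalIdeal A = Ideal.span {a, b, g, h} ∧
      IsParameterSystemMod ℂ (Ideal.span {a, b}) ![g, h] := by
  obtain ⟨hres, x, hx, hq, -⟩ := exists_of_completion hm h0 h1 hφ hker hC
  subst hm
  have hresB : ResidueTrivial ℂ B := hres.of_surjective hsurj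
  have : IsNoetherianRing B := isNoetherianRing_of_surjective A B _ hsurj
  obtain ⟨c', hc', hind⟩ := exists_parameters_of_formallySmooth hresB hB
  choose c hc using fun i => hsurj (c' i)
  have hps : IsParameterSystemMod ℂ (RingHom.ker (algebraMap A B)) c := by
    rw [isParameterSystemMod_ker_iff hsurj]
    simp_rw [hc]
    exact ⟨hc', hind⟩
  obtain ⟨a, b, g, h, hab, hrel, hmax⟩ := exists_quadric_relation two_ne_zero hres hps hx
    (hessianAtZero_transpose f) hdet hq
  refine ⟨a, b, g, h, hab, hrel, hmax, ?_⟩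
  rw [← hab, isParameterSystemMod_ker_iff hsurj]
  have hspan : maximalIdeal B = Ideal.span (Set.range fun i => algebraMap A B (![g, h] i)) := by
    have hloc : IsLocalHom (algebraMap A B) := IsLocalHom.of_surjective _ hsurj
    have hcomap : (maximalIdeal B).comap (algebraMap A B) = maximalIdeal A :=
      ((local_hom_TFAE (algebraMap A B)).out 0 4).mp hloc
    rw [← Ideal.map_comap_of_surjective _ hsurj (maximalIdeal B), hcomap, hmax, Ideal.map_span]
    have ha : algebraMap A B a = 0 := by
      rw [← RingHom.mem_ker, hab]; exact Ideal.subset_span (by simp)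
    have hb : algebraMap A B b = 0 := by
      rw [← RingHom.mem_ker, hab]; exact Ideal.subset_span (by simp)
    have : (fun i => algebraMap A B (![g, h] i)) = ![algebraMap A B g, algebraMap A B h] := by
      funext i; fin_cases i <;> rfl
    rw [this]
    simp only [Set.image_insert_eq, Set.image_singleton, ha, hb, Set.insert_eq_of_mem,
      Set.mem_insert_iff, true_or, Ideal.span_insert_zero]
    simp [Matrix.range_cons, Matrix.range_empty, Set.pair_comm]
  exact ⟨hspan, analyticallyIndependent_of_finrank hresB hB hspan⟩

end CompletedLocalRing


/-! ### Generators of differentials under localization. -/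

section SpanD

variable {k A B ι : Type*} [CommRing k] [CommRing A] [CommRing B] [Algebra k A] [Algebra k B]
  [Algebra A B] [IsScalarTower k A B]

lemma span_D_eq_top_of_fraction (T : Set B)
    (hT : ∀ z : B, ∃ u ∈ T, ∃ v ∈ T, IsUnit v ∧ z * v = u) :
    Submodule.span B (KaehlerDifferential.D k B '' T) = ⊤ := by
  rw [eq_top_iff, ← KaehlerDifferential.span_range_derivation k B, Submodule.span_le]
  rintro _ ⟨z, rfl⟩
  obtain ⟨u, hu, v, hv, ⟨w, rfl⟩, hz⟩ := hT z
  have h := congrArg (KaehlerDifferential.D k B) hz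
  rw [Derivation.leibniz] at h
  have h2 : KaehlerDifferential.D k B z = (↑w⁻¹ : B) • (KaehlerDifferential.D k B u -
      z • KaehlerDifferential.D k B (w : B)) := by
    rw [← h, add_sub_cancel_left, smul_smul, Units.inv_mul, one_smul]
  rw [h2]
  exact Submodule.smul_mem _ _ (Submodule.sub_mem _ (Submodule.subset_span ⟨u, hu, rfl⟩)
    (Submodule.smul_mem _ _ (Submodule.subset_span ⟨_, hv, rfl⟩)))

variable (k B) in
lemma D_algebraMap_mem_span {x : ι → A}
    (hx : Submodule.span A (Set.range fun i => KaehlerDifferential.D k A (x i)) = ⊤) (z : A) :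
    KaehlerDifferential.D k B (algebraMap A B z) ∈
      Submodule.span A (Set.range fun i => KaehlerDifferential.D k B (algebraMap A B (x i))) := by
  have h : KaehlerDifferential.D k A z ∈
    Submodule.span A (Set.range fun i => KaehlerDifferential.D k A (x i)) := hx ▸ Submodule.mem_top
  have h2 := Submodule.mem_map_of_mem (f := KaehlerDifferential.map k k A B) h
  rw [Submodule.map_span, ← Set.range_comp, KaehlerDifferential.map_D] at h2
  convert h2 using 3
  funext i
  simp

lemma span_range_D_algebraMap_eq_top {x : ι → A}
    (hx : Submodule.span A (Set.range fun i => KaehlerDifferential.D k A (x i)) = ⊤)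
    (hB : Submodule.span B (KaehlerDifferential.D k B '' Set.range (algebraMap A B)) = ⊤) :
    Submodule.span B (Set.range fun i => KaehlerDifferential.D k B (algebraMap A B (x i))) = ⊤ := by
  rw [eq_top_iff, ← hB, Submodule.span_le]
  rintro _ ⟨_, ⟨z, rfl⟩, rfl⟩
  exact Submodule.span_le_restrictScalars A B _ (D_algebraMap_mem_span k B hx z)

lemma span_range_D_of_isLocalization (M : Submonoid A) [IsLocalization M B] {x : ι → A}
    (hx : Submodule.span A (Set.range fun i => KaehlerDifferential.D k A (x i)) = ⊤) :
    Submodule.span B (Set.range fun i => KaehlerDifferential.D k B (algebraMap A B (x i))) = ⊤ := by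
  refine span_range_D_algebraMap_eq_top hx (span_D_eq_top_of_fraction _ fun z => ?_)
  obtain ⟨u, s, rfl⟩ := IsLocalization.exists_mk'_eq M z
  exact ⟨_, ⟨u, rfl⟩, _, ⟨s, rfl⟩, IsLocalization.map_units B s, IsLocalization.mk'_spec B u s⟩

end SpanD

/-! ### Alternating maps on spans. -/

section Multilinear

lemma multilinearMap_mem_span {R ι M N : Type*} [CommRing R] [AddCommGroup M] [Module R M]
    [AddCommGroup N] [Module R N] [Fintype ι] [DecidableEq ι] (f : MultilinearMap R (fun _ : ι => M) N)
    (s : Set M) {v : ι → M} (hv : ∀ i, v i ∈ Submodule.span R s) :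
    f v ∈ Submodule.span R (f '' {w | ∀ i, w i ∈ s}) := by
  choose n c w hw using fun i => (Submodule.mem_span_set'.mp (hv i))
  have hv' : v = fun i => ∑ j, c i j • (w i j : M) := funext fun i => (hw i).symm
  rw [hv', MultilinearMap.map_sum]
  refine Submodule.sum_mem _ fun r _ => ?_
  rw [MultilinearMap.map_smul_univ]
  exact Submodule.smul_mem _ _ (Submodule.subset_span ⟨_, fun i => (w i (r i)).2, rfl⟩)

lemma alternatingMap_mem_span_singleton {R ι M N : Type*} [CommRing R] [AddCommGroup M]
    [Module R M] [AddCommGroup N] [Module R N] [Fintype ι] [DecidableEq ι] (f : M [⋀^ι]→ₗ[R] N)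
    (e : ι → M) {v : ι → M} (hv : ∀ i, v i ∈ Submodule.span R (Set.range e)) :
    f v ∈ Submodule.span R {f e} := by
  refine (Submodule.span_le.mpr ?_) (multilinearMap_mem_span f.toMultilinearMap _ hv)
  rintro _ ⟨w, hw, rfl⟩
  choose σ hσ using hw
  obtain rfl : (fun i => e (σ i)) = w := funext hσ
  by_cases hinj : Function.Injective σ
  · let σ' : Equiv.Perm ι := Equiv.ofBijective σ (Finite.injective_iff_bijective.mp hinj)
    have : f (fun i => e (σ i)) = Equiv.Perm.sign σ' • f e := f.map_perm e σ'
    change f (fun i => e (σ i)) ∈ _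
    rw [this, Units.smul_def, ← Int.cast_smul_eq_zsmul R]
    exact Submodule.smul_mem _ _ (Submodule.mem_span_singleton_self _)
  · obtain ⟨i, j, hij, hne⟩ := Function.not_injective_iff.mp hinj
    have : f (fun i => e (σ i)) = 0 :=
      f.map_eq_zero_of_eq (fun i => e (σ i)) (congrArg e hij) hne
    change f (fun i => e (σ i)) ∈ _
    rw [this]
    exact Submodule.zero_mem _

end Multilinear

/-! ### Generators of the module of regular forms. -/

section RegularForms

variable {O L : Type} [CommRing O] [Field L] [Algebra ℂ L] [Algebra ℂ O] [Algebra O L]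
  [IsScalarTower ℂ O L]

/-- If `d` differentials generate `Ω_O`, every wedge of `d` exact differentials is, by
multilinearity and alternation, an `O`-multiple of the wedge of these generators. -/
theorem regularForms_range_eq {d : ℕ} {x : Fin d → O}
    (hx : Submodule.span O (Set.range fun i => KaehlerDifferential.D ℂ O (x i)) = ⊤) :
    regularForms (algebraMap O L).range d = (Submodule.span (algebraMap O L).range
      {exteriorPower.ιMulti L d fun i => KaehlerDifferential.D ℂ L (algebraMap O L (x i))}).toAddSubgroup := by
  set R := (algebraMap O L).range
  let f : Ω[L⁄ℂ] [⋀^Fin d]→ₗ[R] ⋀[L]^d (Ω[L⁄ℂ]) :=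
    { (exteriorPower.ιMulti L d (M := Ω[L⁄ℂ])).toMultilinearMap.restrictScalars R with
      map_eq_zero_of_eq' := (exteriorPower.ιMulti L d (M := Ω[L⁄ℂ])).map_eq_zero_of_eq' }
  have hspan : ∀ z : R, KaehlerDifferential.D ℂ L (z : L) ∈
      Submodule.span R (Set.range fun i => KaehlerDifferential.D ℂ L (algebraMap O L (x i))) := by
    rintro ⟨_, z, rfl⟩
    refine Submodule.span_induction (p := fun y _ => y ∈ Submodule.span R (Set.range fun i =>
      KaehlerDifferential.D ℂ L (algebraMap O L (x i)))) (fun y hy => Submodule.subset_span hy)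
      (Submodule.zero_mem _) (fun _ _ _ _ => Submodule.add_mem _) (fun c y _ hy => ?_)
      (D_algebraMap_mem_span ℂ L hx z)
    have : c • y = (⟨algebraMap O L c, c, rfl⟩ : R) • y := by
      rw [← algebraMap_smul L c y]; rfl
    rw [this]
    exact Submodule.smul_mem _ _ hy
  unfold regularForms
  congr 1
  apply le_antisymm
  · rw [Submodule.span_le]
    rintro _ ⟨a, rfl⟩
    exact alternatingMap_mem_span_singleton f
      (fun i => KaehlerDifferential.D ℂ L (algebraMap O L (x i))) fun j => hspan (a j)
  · rw [Submodule.span_le, Set.singleton_subset_iff]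
    exact Submodule.subset_span (Set.mem_range_self
      (f := fun a : Fin d → R => exteriorPower.ιMulti L d fun j => KaehlerDifferential.D ℂ L (a j : L))
      fun i => ⟨algebraMap O L (x i), x i, rfl⟩)

end RegularForms

/-! ### Injectivity of the cotangent map at a node. -/

section Cotangent

variable {k A O : Type*} [CommRing k] [CommRing A] [CommRing O] [Algebra k A] [Algebra k O]
  [Algebra A O] [IsScalarTower k A O]

/-- The pullback of `Ω_A` is generated by `da, db, dg, dh`, and substituting `a = t b`, `h = t g`
expresses their images through the independent `db, dg, dt`. The kernel equations leave only
multiples of the differential of `b h - a g`, which vanishes in `Ω_A`. No presentation of `Ω_A` by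
relations is needed. -/
theorem mapBaseChange_injective_of_node {a b g h : A} (hrel : a * g = b * h) {t : O}
    (hta : algebraMap A O a = t * algebraMap A O b) (hth : algebraMap A O h = t * algebraMap A O g)
    (hspan : Submodule.span A (Set.range fun i => KaehlerDifferential.D k A (![a, b, g, h] i)) = ⊤)
    (hind : LinearIndependent O ![KaehlerDifferential.D k O (algebraMap A O b),
      KaehlerDifferential.D k O (algebraMap A O g), KaehlerDifferential.D k O t])
    (hb : ∀ z, algebraMap A O b * z = 0 → z = 0)
    (hg : ∀ z, algebraMap A O b ∣ algebraMap A O g * z → algebraMap A O b ∣ z) :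
    Function.Injective (KaehlerDifferential.mapBaseChange k A O) := by
  set D := KaehlerDifferential.D k A
  rw [injective_iff_map_eq_zero]
  intro w hw
  have hform : ∀ w : O ⊗[A] Ω[A⁄k], ∃ c : Fin 4 → O, w = ∑ i, c i ⊗ₜ D (![a, b, g, h] i) := by
    intro w
    induction w using TensorProduct.induction_on with
    | zero => exact ⟨0, by simp⟩
    | add w₁ w₂ h₁ h₂ =>
      obtain ⟨c₁, rfl⟩ := h₁
      obtain ⟨c₂, rfl⟩ := h₂
      exact ⟨c₁ + c₂, by simp [TensorProduct.add_tmul, Finset.sum_add_distrib]⟩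
    | tmul z ω =>
      obtain ⟨r, hr⟩ := (Submodule.mem_span_range_iff_exists_fun A).mp
        (show ω ∈ _ from hspan ▸ Submodule.mem_top)
      refine ⟨fun i => r i • z, ?_⟩
      rw [← hr, TensorProduct.tmul_sum]
      refine Finset.sum_congr rfl fun i _ => ?_
      rw [TensorProduct.tmul_smul, TensorProduct.smul_tmul']
  obtain ⟨c, rfl⟩ := hform w
  simp only [Fin.sum_univ_four, map_add, KaehlerDifferential.mapBaseChange_tmul,
    KaehlerDifferential.map_D, Matrix.cons_val, D] at hw
  rw [hta, hth, Derivation.leibniz, Derivation.leibniz] at hw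
  -- The coefficients of `db`, `dg` and `dt`.
  obtain ⟨h0, h1, h2⟩ : c 0 * t + c 1 = 0 ∧ c 2 + c 3 * t = 0 ∧
      c 0 * algebraMap A O b + c 3 * algebraMap A O g = 0 := by
    have := Fintype.linearIndependent_iff.mp hind ![c 0 * t + c 1, c 2 + c 3 * t,
      c 0 * algebraMap A O b + c 3 * algebraMap A O g] (by
        rw [Fin.sum_univ_three, ← hw]
        simp only [Matrix.cons_val]
        module)
    exact ⟨this 0, this 1, this 2⟩
  -- From `c 0 * b + c 3 * g = 0` and the regular sequence `b, g` one gets `c 3 = b e` and `c 0 = -g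
  -- e`; the other two coefficients follow.
  obtain ⟨e, he⟩ := hg (c 3) ⟨-c 0, by linear_combination h2⟩
  have hc0 : c 0 = -(e * algebraMap A O g) := by
    have := hb (c 0 + e * algebraMap A O g) (by rw [he] at h2; linear_combination h2)
    linear_combination this
  have hc1 : c 1 = e * algebraMap A O h := by rw [hth]; linear_combination h0 - t * hc0
  have hc2 : c 2 = -(e * algebraMap A O a) := by rw [hta]; linear_combination h1 - t * he
  have hD : g • D a + a • D g = h • D b + b • D h := by
    rw [← add_comm (a • D g), ← Derivation.leibniz, hrel, Derivation.leibniz, add_comm]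
  have hsm : ∀ (y : A) (ω : Ω[A⁄k]), (e * algebraMap A O y) ⊗ₜ[A] ω = e ⊗ₜ (y • ω) := by
    intro y ω
    rw [TensorProduct.tmul_smul, TensorProduct.smul_tmul', Algebra.smul_def, mul_comm]
  simp only [Fin.sum_univ_four, Matrix.cons_val]
  rw [hc0, hc1, hc2, he, mul_comm (algebraMap A O b), TensorProduct.neg_tmul, TensorProduct.neg_tmul,
    hsm, hsm, hsm, hsm, ← TensorProduct.tmul_neg, ← TensorProduct.tmul_neg, ← TensorProduct.tmul_add,
    ← TensorProduct.tmul_add, ← TensorProduct.tmul_add]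
  have : -(g • D a) + h • D b + -(a • D g) + b • D h = 0 := by
    rw [show -(g • D a) + h • D b + -(a • D g) + b • D h =
      (h • D b + b • D h) - (g • D a + a • D g) by abel, hD, sub_self]
  rw [this, TensorProduct.tmul_zero]

end Cotangent


/-! ### Recognising smooth local rings by the number of generators of the maximal ideal. -/

section EssFinite

open IsLocalRing

variable {O L : Type} [CommRing O] [Algebra ℂ O] [Field L] [Algebra ℂ L] [Algebra O L] [IsScalarTower ℂ O L]

lemma exists_finiteType_isLocalization_atPrime (k O : Type*) [Field k] [CommRing O] [IsLocalRing O]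
    [Algebra k O] [Algebra.EssFiniteType k O] :
    ∃ (R : Subalgebra k O) (n : Ideal R) (_ : n.IsPrime), Algebra.FiniteType k R ∧
      IsLocalization.AtPrime O n ∧ ∀ y, y ∈ n ↔ (y : O) ∈ maximalIdeal O := by
  let R := Algebra.EssFiniteType.subalgebra k O
  let n : Ideal R := (maximalIdeal O).comap (algebraMap R O)
  refine ⟨R, n, inferInstance, inferInstance, ?_, fun y => Iff.rfl⟩
  refine IsLocalization.of_le (Algebra.EssFiniteType.submonoid k O) n.primeCompl ?_ ?_
  · intro r hr hrn
    exact (mem_maximalIdeal _).mp (Ideal.mem_comap.mp hrn) (IsLocalization.map_units O (⟨r, hr⟩ :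
      Algebra.EssFiniteType.submonoid k O))
  · intro r hr
    by_contra h
    exact hr (Ideal.mem_comap.mpr ((mem_maximalIdeal _).mpr h))

lemma linearIndependent_D_of_span [IsDomain O] [IsFractionRing O L] {r : ℕ} {x : Fin r → O}
    (hL : Module.finrank L Ω[L⁄ℂ] = r)
    (hx : Submodule.span O (Set.range fun i => KaehlerDifferential.D ℂ O (x i)) = ⊤) :
    LinearIndependent L fun i => KaehlerDifferential.D ℂ L (algebraMap O L (x i)) := by
  refine linearIndependent_of_top_le_span_of_card_eq_finrank ?_ (by rw [hL, Fintype.card_fin])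
  exact (span_range_D_of_isLocalization (nonZeroDivisors O) hx).ge

lemma linearIndependent_D_of_linearIndependent_map [FaithfulSMul O L] {ι : Type*} {x : ι → O}
    (hx : LinearIndependent L fun i => KaehlerDifferential.D ℂ L (algebraMap O L (x i))) :
    LinearIndependent O fun i => KaehlerDifferential.D ℂ O (x i) := by
  have h1 : LinearIndependent O fun i => KaehlerDifferential.D ℂ L (algebraMap O L (x i)) :=
    hx.restrict_scalars (fun a b hab => FaithfulSMul.algebraMap_injective O L (by
      simpa [Algebra.smul_def] using hab))
  refine LinearIndependent.of_comp (KaehlerDifferential.map ℂ ℂ O L) ?_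
  convert h1 using 2 with i
  simp

variable [IsLocalRing O] [Algebra.EssFiniteType ℂ O]

/-- Differentials of generators of `m` generate `Ω_O`, hence `Ω_L`. When their number is the
dimension of `Ω_L` they form a basis, so the generators are algebraically independent and `O` is
étale over a polynomial ring. -/
theorem formallySmooth_of_span_eq_maximalIdeal [IsDomain O] [IsFractionRing O L]
    (hres : ResidueTrivial ℂ O) {r : ℕ} (hL : Module.finrank L Ω[L⁄ℂ] = r) {x : Fin r → O}
    (hx : maximalIdeal O = Ideal.span (Set.range x)) :
    Algebra.FormallySmooth ℂ O ∧ Module.finrank O Ω[O⁄ℂ] = r ∧ AnalyticallyIndependent ℂ x := by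
  obtain ⟨R, n, hn, hR, hO, hmem⟩ := exists_finiteType_isLocalization_atPrime ℂ O
  have : IsNoetherianRing O := Algebra.EssFiniteType.isNoetherianRing ℂ O
  -- Denominators are units of `O`, so the generators may be taken from the finitely generated
  -- subalgebra.
  choose y s hys using fun i => IsLocalization.exists_mk'_eq n.primeCompl (x i)
  have hspan : maximalIdeal O = Ideal.span (Set.range fun i => algebraMap R O (y i)) := by
    rw [hx]
    apply le_antisymm <;> rw [Ideal.span_le] <;> rintro _ ⟨i, rfl⟩
    · obtain ⟨u, hu⟩ := IsLocalization.map_units O (s i)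
      have : x i = (↑u⁻¹ : O) * algebraMap R O (y i) := by
        rw [← IsLocalization.mk'_spec O (y i) (s i), hys, ← hu, mul_comm, Units.mul_inv_cancel_right]
      rw [this]
      exact Ideal.mul_mem_left _ _ (Ideal.subset_span ⟨i, rfl⟩)
    · change algebraMap R O (y i) ∈ _
      rw [← IsLocalization.mk'_spec O (y i) (s i), hys]
      exact Ideal.mul_mem_right _ _ (Ideal.subset_span ⟨i, rfl⟩)
  have hind := algebraicIndependent_of_linearIndependent_D
    (linearIndependent_D_of_span hL (span_range_D_eq_top hres hspan))
  have hind' : AlgebraicIndependent ℂ fun i => algebraMap R O (y i) :=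
    AlgebraicIndependent.of_comp (IsScalarTower.toAlgHom ℂ O L) hind
  obtain ⟨hfs, hfr⟩ := formallySmooth_of_algebraicIndependent n hres hspan hind'
  exact ⟨hfs, hfr, analyticallyIndependent_of_finrank hres hfr hx⟩

lemma exists_span_D_eq_top [Algebra.FormallySmooth ℂ O] {r : ℕ}
    (hr : Module.finrank O Ω[O⁄ℂ] = r) :
    ∃ x : Fin r → O, Submodule.span O (Set.range fun i => KaehlerDifferential.D ℂ O (x i)) = ⊤ := by
  have : IsNoetherianRing O := Algebra.EssFiniteType.isNoetherianRing ℂ O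
  have : Module.FinitePresentation O Ω[O⁄ℂ] := Module.finitePresentation_of_finite O _
  obtain ⟨κ, a, b, hb⟩ := Module.exists_basis_of_span_of_flat (KaehlerDifferential.D ℂ O)
    (KaehlerDifferential.span_range_derivation ℂ O)
  have : Finite κ := Module.Finite.finite_basis b
  have := Fintype.ofFinite κ
  have hc : Fintype.card κ = r := by rw [← hr, Module.finrank_eq_card_basis b]
  let e : κ ≃ Fin r := Fintype.equivFinOfCardEq hc
  refine ⟨a ∘ e.symm, ?_⟩
  rw [← b.span_eq]
  congr 1
  ext ω
  constructor
  · rintro ⟨i, rfl⟩; exact ⟨e.symm i, hb _⟩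
  · rintro ⟨i, rfl⟩; exact ⟨e i, by simp [hb]⟩

end EssFinite

/-! ### Local rings over a node. -/

section Node

open IsLocalRing

variable {A O : Type} [CommRing A] [CommRing O] [Algebra A O] {a b g h : A} {t : O}

lemma node_ratio [IsDomain O] (hrel : a * g = b * h) (hta : algebraMap A O a = t * algebraMap A O b)
    (hb : algebraMap A O b ≠ 0) : algebraMap A O h = t * algebraMap A O g := by
  have := congrArg (algebraMap A O) hrel
  rw [map_mul, map_mul, hta] at this
  refine mul_left_cancel₀ hb ?_
  linear_combination -this

variable [IsLocalRing A] [Algebra ℂ A] [IsLocalRing O] [Algebra ℂ O] [IsScalarTower ℂ A O]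
  [IsLocalHom (algebraMap A O)]

/-- Modulo `J = (b, g, t - t₀)` all four generators of the maximal ideal of `A` vanish, so each
polynomial in `t` over `A` is congruent to a complex number. For a numerator lying in the maximal
ideal this number is zero. -/
theorem maximalIdeal_eq_of_node (hresA : ResidueTrivial ℂ A)
    (hm : maximalIdeal A = Ideal.span {a, b, g, h})
    (hta : algebraMap A O a = t * algebraMap A O b) (hth : algebraMap A O h = t * algebraMap A O g)
    (hO : ∀ z : O, ∃ u v : Polynomial A, IsUnit (Polynomial.aeval t v) ∧
      z * Polynomial.aeval t v = Polynomial.aeval t u) {t₀ : ℂ}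
    (ht₀ : t - algebraMap ℂ O t₀ ∈ maximalIdeal O) :
    maximalIdeal O =
      Ideal.span (Set.range ![algebraMap A O b, algebraMap A O g, t - algebraMap ℂ O t₀]) := by
  set J := Ideal.span (Set.range ![algebraMap A O b, algebraMap A O g, t - algebraMap ℂ O t₀])
  have hAO : ∀ z ∈ maximalIdeal A, algebraMap A O z ∈ maximalIdeal O := fun z hz =>
    (mem_maximalIdeal _).mpr fun hu => (mem_maximalIdeal _).mp hz (isUnit_of_map_unit _ z hu)
  have hJm : J ≤ maximalIdeal O := by
    rw [Ideal.span_le]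
    rintro _ ⟨i, rfl⟩
    fin_cases i
    · exact hAO b (hm ▸ Ideal.subset_span (by simp))
    · exact hAO g (hm ▸ Ideal.subset_span (by simp))
    · exact ht₀
  have hbJ : algebraMap A O b ∈ J := Ideal.subset_span ⟨0, rfl⟩
  have hgJ : algebraMap A O g ∈ J := Ideal.subset_span ⟨1, rfl⟩
  have htJ : t - algebraMap ℂ O t₀ ∈ J := Ideal.subset_span ⟨2, rfl⟩
  have hmJ : maximalIdeal A ≤ J.comap (algebraMap A O) := by
    rw [hm, Ideal.span_le]
    rintro z (rfl | rfl | rfl | rfl)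
    · exact Ideal.mem_comap.mpr (hta ▸ J.mul_mem_left _ hbJ)
    · exact hbJ
    · exact hgJ
    · exact Ideal.mem_comap.mpr (hth ▸ J.mul_mem_left _ hgJ)
  have key : ∀ p : Polynomial A, ∃ c : ℂ, Polynomial.aeval t p - algebraMap ℂ O c ∈ J := by
    intro p
    induction p using Polynomial.induction_on' with
    | add p q hp hq =>
      obtain ⟨c, hc⟩ := hp
      obtain ⟨d, hd⟩ := hq
      refine ⟨c + d, ?_⟩
      rw [map_add, map_add, add_sub_add_comm]
      exact J.add_mem hc hd
    | monomial n z =>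
      obtain ⟨c, hc⟩ := hresA z
      refine ⟨c * t₀ ^ n, ?_⟩
      have h1 : algebraMap A O z - algebraMap ℂ O c ∈ J := by
        have := hmJ hc
        rwa [Ideal.mem_comap, map_sub, ← IsScalarTower.algebraMap_apply] at this
      have h2 : t ^ n - (algebraMap ℂ O t₀) ^ n ∈ J :=
        Ideal.mem_of_dvd J (sub_dvd_pow_sub_pow _ _ n) htJ
      rw [Polynomial.aeval_monomial, map_mul, map_pow]
      have : algebraMap A O z * t ^ n - algebraMap ℂ O c * algebraMap ℂ O t₀ ^ n =
        (algebraMap A O z - algebraMap ℂ O c) * t ^ n +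
          algebraMap ℂ O c * (t ^ n - (algebraMap ℂ O t₀) ^ n) := by ring
      rw [this]
      exact J.add_mem (J.mul_mem_right _ h1) (J.mul_mem_left _ h2)
  refine le_antisymm (fun z hz => ?_) hJm
  obtain ⟨u, v, ⟨w, hw⟩, hz'⟩ := hO z
  obtain ⟨c, hc⟩ := key u
  have huJ : Polynomial.aeval t u ∈ J := by
    have hum : Polynomial.aeval t u ∈ maximalIdeal O := hz' ▸ Ideal.mul_mem_right _ _ hz
    have hcm : algebraMap ℂ O c ∈ maximalIdeal O := by
      have := (maximalIdeal O).sub_mem hum (hJm hc)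
      rwa [sub_sub_cancel] at this
    have hc0 : c = 0 := by
      by_contra hne
      exact (mem_maximalIdeal _).mp hcm ((isUnit_iff_ne_zero.mpr hne).map _)
    rwa [hc0, map_zero, sub_zero] at hc
  have : z = Polynomial.aeval t u * ↑w⁻¹ := by rw [← hz', ← hw, Units.mul_inv_cancel_right]
  rw [this]
  exact J.mul_mem_right _ huJ

end Node

/-! ### The standard chart of the small resolution. -/

section Regular

open IsLocalRing

/-- The properties, near a point over a node `A` with equation `a * g = b * h`, of the local ring
`O` of the small resolution on which `b` generates the ideal `(a, b)`. -/
structure IsNodeChart (A : Type) {O : Type} [CommRing A] [CommRing O] [Algebra ℂ O]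
    [Algebra A O] [IsLocalRing O] (b g : A) (t : O) : Prop where
  formallySmooth : Algebra.FormallySmooth ℂ O
  span_D : Submodule.span O (Set.range fun i =>
    KaehlerDifferential.D ℂ O (![algebraMap A O b, algebraMap A O g, t] i)) = ⊤
  ne_zero : algebraMap A O b ≠ 0
  dvd_of_dvd_mul : ∀ z, algebraMap A O b ∣ algebraMap A O g * z → algebraMap A O b ∣ z

variable {A O : Type} [CommRing A] [CommRing O] [IsLocalRing O] [Algebra ℂ O]
  [Algebra A O] {b g : A} {t : O}

/-- Dividing out the parameter `b` leaves a domain in which `g` is still a parameter. Hence `b` is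
prime and does not divide `g`, which makes `b, g` a regular sequence. -/
theorem IsNodeChart.of_analyticallyIndependent [Algebra.EssFiniteType ℂ O]
    (hfs : Algebra.FormallySmooth ℂ O) (hresO : ResidueTrivial ℂ O) {t₀ : ℂ}
    (hm : maximalIdeal O =
      Ideal.span (Set.range ![algebraMap A O b, algebraMap A O g, t - algebraMap ℂ O t₀]))
    (hind : AnalyticallyIndependent ℂ ![algebraMap A O b, algebraMap A O g, t - algebraMap ℂ O t₀]) :
    IsNodeChart A b g t := by
  have : IsNoetherianRing O := Algebra.EssFiniteType.isNoetherianRing ℂ O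
  let x := ![algebraMap A O b, algebraMap A O g, t - algebraMap ℂ O t₀]
  let e : Option (Fin 2) ≃ Fin 3 := (finSuccEquiv 2).symm
  have hps : IsParameterSystemMod ℂ (Ideal.span {(x ∘ e) none}) fun i => (x ∘ e) (some i) :=
    .of_analyticallyIndependent hresO (by rw [hm, e.surjective.range_comp]) (hind.comp_equiv e)
  have hbx : (x ∘ e) none = algebraMap A O b := rfl
  have hgx : (x ∘ e) (some 0) = algebraMap A O g := rfl
  rw [hbx] at hps
  have hbm : algebraMap A O b ∈ maximalIdeal O := hm ▸ Ideal.subset_span ⟨0, rfl⟩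
  have htop : Ideal.span {algebraMap A O b} ≠ ⊤ := fun h => (maximalIdeal.isMaximal O).ne_top
    (top_le_iff.mp (h ▸ (Ideal.span_singleton_le_iff_mem _).mpr hbm))
  have hprime := hps.isPrime hresO htop
  have hg := hps.notMem 0
  rw [hgx] at hg
  refine ⟨hfs, ?_, fun hb0 => hind.notMem_sq 0 ?_, fun z hz => ?_⟩
  · rw [← span_range_D_eq_top hresO hm]
    congr 2
    funext i
    fin_cases i <;> simp
  · change algebraMap A O b ∈ _
    rw [hb0]; exact Ideal.zero_mem _
  · rw [← Ideal.mem_span_singleton] at hz ⊢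
    exact (hprime.mem_or_mem hz).resolve_left hg

/-- The chart property is stable under generization. It is established at closed points, where the
residue field is `ℂ`, and transported from there to all other points; `b` and `g` may become units
on the way. -/
theorem IsNodeChart.localization [IsDomain O] (H : IsNodeChart A b g t)
    {O' : Type} [CommRing O'] [IsLocalRing O'] [Algebra ℂ O'] [Algebra A O']
    [Algebra O O'] [IsScalarTower A O O'] [IsScalarTower ℂ O O'] (M : Submonoid O)
    (hM : M ≤ nonZeroDivisors O) [IsLocalization M O'] : IsNodeChart A b g (algebraMap O O' t) := by
  have hA : ∀ z, algebraMap A O' z = algebraMap O O' (algebraMap A O z) :=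
    IsScalarTower.algebraMap_apply A O O'
  have hinj : Function.Injective (algebraMap O O') := IsLocalization.injective O' hM
  refine ⟨?_, ?_, ?_, ?_⟩
  · have := H.formallySmooth
    have : Algebra.FormallySmooth O O' := .of_isLocalization M
    exact .comp ℂ O O'
  · rw [← span_range_D_of_isLocalization (B := O') M H.span_D]
    congr 2
    funext i
    fin_cases i <;> simp [hA]
  · rw [hA]
    exact (map_ne_zero_iff _ hinj).mpr H.ne_zero
  · rintro z ⟨w, hw⟩
    obtain ⟨⟨z0, s⟩, hz0⟩ := IsLocalization.surj M z
    obtain ⟨⟨w0, r⟩, hw0⟩ := IsLocalization.surj M w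
    dsimp only at hz0 hw0
    have h1 : algebraMap A O g * (r * z0) = algebraMap A O b * (s * w0) := by
      apply hinj
      simp only [map_mul, ← hz0, ← hw0, ← hA]
      linear_combination (algebraMap O O' r * algebraMap O O' s) * hw
    obtain ⟨v, hv⟩ := H.dvd_of_dvd_mul _ ⟨_, h1⟩
    have hz : IsUnit (algebraMap O O' (s * r : M)) := IsLocalization.map_units O' (s * r)
    rw [← hz.dvd_mul_right (a := algebraMap A O' b)]
    refine ⟨algebraMap O O' v, ?_⟩
    rw [hA, ← map_mul, ← hv, Submonoid.coe_mul, map_mul, map_mul, ← mul_assoc, hz0, mul_comm]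

/-- Dividing successively by the regular sequence `b, g` lowers the dimension by at least one each
time and leaves a nonzero ring. -/
theorem IsNodeChart.two_le_ringKrullDim (H : IsNodeChart A b g t) [IsDomain O]
    (hb : algebraMap A O b ∈ maximalIdeal O) (hg : algebraMap A O g ∈ maximalIdeal O) :
    2 ≤ ringKrullDim O := by
  set β := algebraMap A O b
  set γ := algebraMap A O g
  have h1 := ringKrullDim_quotient_succ_le_of_nonZeroDivisor (r := β)
    (mem_nonZeroDivisors_of_ne_zero H.ne_zero)
  have h2 := ringKrullDim_quotient_succ_le_of_nonZeroDivisor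
    (r := Ideal.Quotient.mk (Ideal.span {β}) γ) (by
      rw [mem_nonZeroDivisors_iff_right]
      intro z hz
      obtain ⟨z, rfl⟩ := Ideal.Quotient.mk_surjective z
      rw [← map_mul, Ideal.Quotient.eq_zero_iff_mem, Ideal.mem_span_singleton] at hz
      rw [Ideal.Quotient.eq_zero_iff_mem, Ideal.mem_span_singleton]
      exact H.dvd_of_dvd_mul z (by rwa [mul_comm]))
  have hβ : Ideal.span {β} ≠ ⊤ := fun h => (maximalIdeal.isMaximal O).ne_top
    (top_le_iff.mp (h ▸ (Ideal.span_singleton_le_iff_mem _).mpr hb))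
  have : Nontrivial (O ⧸ Ideal.span {β}) := Ideal.Quotient.nontrivial_iff.mpr hβ
  have hloc : IsLocalHom (Ideal.Quotient.mk (Ideal.span {β})) :=
    IsLocalHom.of_surjective _ Ideal.Quotient.mk_surjective
  have hγ : Ideal.span {Ideal.Quotient.mk (Ideal.span {β}) γ} ≠ ⊤ := by
    rw [Ne, Ideal.span_singleton_eq_top]
    intro hu
    exact (mem_maximalIdeal _).mp hg (isUnit_of_map_unit _ γ hu)
  have : Nontrivial ((O ⧸ Ideal.span {β}) ⧸ Ideal.span {Ideal.Quotient.mk (Ideal.span {β}) γ}) :=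
    Ideal.Quotient.nontrivial_iff.mpr hγ
  have h3 := ringKrullDim_nonneg_of_nontrivial
    (R := (O ⧸ Ideal.span {β}) ⧸ Ideal.span {Ideal.Quotient.mk (Ideal.span {β}) γ})
  calc (2 : WithBot ℕ∞) = 0 + 1 + 1 := by norm_num
    _ ≤ _ := add_le_add_left ((add_le_add_left h3 1).trans h2) 1
    _ ≤ _ := h1

end Regular


/-! ### Krull dimension and the rank of the differentials of the function field. -/

section Dimension

/-- Incomparability gives one inequality; for the other, chains of primes are lifted step by step by
going up. -/
lemma ringKrullDim_eq_of_isIntegral (P R : Type*) [CommRing P] [CommRing R] [Algebra P R]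
    [Algebra.IsIntegral P R] [FaithfulSMul P R] : ringKrullDim R = ringKrullDim P := by
  apply le_antisymm
  · refine Order.krullDim_le_of_strictMono (PrimeSpectrum.comap (algebraMap P R)) fun I J hIJ => ?_
    exact Ideal.IsIntegral.comap_lt_comap (R := P) (I := I.asIdeal) (J := J.asIdeal) hIJ
  · have key : ∀ p : LTSeries (PrimeSpectrum P), ∃ q : LTSeries (PrimeSpectrum R),
        q.length = p.length ∧ PrimeSpectrum.comap (algebraMap P R) q.last = p.last := by
      intro p
      induction p using RelSeries.inductionOn' with
      | singleton x =>
        obtain ⟨Q, -, hQ, hQx⟩ := Ideal.exists_ideal_over_prime_of_isIntegral (S := R) x.asIdeal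
          (⊥ : Ideal R) (by
            rw [← RingHom.ker_eq_comap_bot,
              (RingHom.injective_iff_ker_eq_bot _).mp (FaithfulSMul.algebraMap_injective P R)]
            exact bot_le)
        exact ⟨RelSeries.singleton _ ⟨Q, hQ⟩, rfl, PrimeSpectrum.ext hQx⟩
      | snoc p x hx ih =>
        obtain ⟨q, hq, hlast⟩ := ih
        have hle : q.last.asIdeal.comap (algebraMap P R) ≤ x.asIdeal := by
          have := congrArg PrimeSpectrum.asIdeal hlast
          rw [PrimeSpectrum.comap_asIdeal] at this
          rw [this]; exact le_of_lt hx
        obtain ⟨Q, hle', hQ, hQx⟩ := Ideal.exists_ideal_over_prime_of_isIntegral x.asIdeal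
          q.last.asIdeal hle
        have hlt : q.last < ⟨Q, hQ⟩ := by
          refine lt_of_le_of_ne hle' fun heq => ?_
          have h1 : p.last = x := by
            rw [← hlast, heq]; exact PrimeSpectrum.ext hQx
          exact (ne_of_lt hx) h1
        refine ⟨q.snoc ⟨Q, hQ⟩ hlt, ?_, ?_⟩
        · simp [hq]
        · rw [RelSeries.last_snoc, RelSeries.last_snoc]; exact PrimeSpectrum.ext hQx
    refine iSup_le fun p => ?_
    obtain ⟨q, hq, -⟩ := key p
    rw [← hq]
    exact Order.LTSeries.length_le_krullDim q

/-- Noether normalization: `R` is finite over a polynomial ring in `s` variables, which has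
dimension `s`. In characteristic zero `L` is separable algebraic over its fraction field, so `Ω_L`
is the base change of the free module of rank `s`. -/
theorem finrank_kaehlerDifferential_eq_ringKrullDim (k R L : Type) [Field k] [CharZero k]
    [CommRing R] [IsDomain R] [Algebra k R] [Algebra.FiniteType k R] [Field L] [Algebra R L]
    [IsFractionRing R L] [Algebra k L] [IsScalarTower k R L] :
    (Module.finrank L Ω[L⁄k] : WithBot ℕ∞) = ringKrullDim R := by
  obtain ⟨s, f, hf, hfin⟩ := exists_finite_inj_algHom_of_fg k R
  let P := MvPolynomial (Fin s) k
  let _ : Algebra P R := f.toAlgebra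
  have hkPR : IsScalarTower k P R := IsScalarTower.of_algebraMap_eq fun c => (f.commutes c).symm
  have : Module.Finite P R := hfin
  have : FaithfulSMul P R := (faithfulSMul_iff_algebraMap_injective P R).mpr hf
  let _ : Algebra P L := ((algebraMap R L).comp (algebraMap P R)).toAlgebra
  have : IsScalarTower P R L := IsScalarTower.of_algebraMap_eq fun _ => rfl
  have : IsScalarTower k P L := IsScalarTower.of_algebraMap_eq fun c => by
    rw [IsScalarTower.algebraMap_apply k R L, IsScalarTower.algebraMap_apply k P R,
      IsScalarTower.algebraMap_apply P R L]
  have hPL : FaithfulSMul P L := (faithfulSMul_iff_algebraMap_injective P L).mpr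
    ((IsFractionRing.injective R L).comp hf)
  let K := FractionRing P
  let _ : Algebra K L := FractionRing.liftAlgebra P L
  have : IsScalarTower P K L := FractionRing.isScalarTower_liftAlgebra P L
  have : IsScalarTower k K L := IsScalarTower.of_algebraMap_eq fun c => by
    rw [IsScalarTower.algebraMap_apply k P L, IsScalarTower.algebraMap_apply k P K,
      IsScalarTower.algebraMap_apply P K L]
  have hPLalg : Algebra.IsAlgebraic P L := by
    have : Algebra.IsAlgebraic R L := IsLocalization.isAlgebraic L (nonZeroDivisors R)
    exact Algebra.IsAlgebraic.trans P R L
  have : Algebra.IsAlgebraic K L := (IsFractionRing.comap_isAlgebraic_iff (A := P)).mp hPLalg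
  have : CharZero K := charZero_of_injective_algebraMap (algebraMap k K).injective
  have : Algebra.FormallyEtale K L := .of_isSeparable K L
  have : Algebra.FormallyEtale P K := .of_isLocalization (nonZeroDivisors P)
  have e1 := KaehlerDifferential.tensorKaehlerEquivOfFormallyEtale k K L
  have e2 := KaehlerDifferential.tensorKaehlerEquivOfFormallyEtale k P K
  have : Module.Free P Ω[P⁄k] := .of_basis (KaehlerDifferential.mvPolynomialBasis k (Fin s))
  have h1 : Module.finrank L Ω[L⁄k] = s := by
    rw [← e1.finrank_eq, Module.finrank_baseChange, ← e2.finrank_eq, Module.finrank_baseChange,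
      Module.finrank_eq_card_basis (KaehlerDifferential.mvPolynomialBasis k (Fin s)), Fintype.card_fin]
  rw [h1, ringKrullDim_eq_of_isIntegral P R, MvPolynomial.ringKrullDim_of_isNoetherianRing]
  simp

end Dimension


/-! ### Inverse images and stalks of ideal sheaves. -/

section IdealSheaf

variable {X Y : Scheme.{0}}

lemma fromSpec_appLE_top {U : X.Opens} (hU : IsAffineOpen U) :
    hU.fromSpec.appLE U ⊤ (by rw [hU.fromSpec_preimage_self]) =
      (Scheme.ΓSpecIso Γ(X, U)).inv := by
  rw [Scheme.Hom.appLE, hU.fromSpec_app_self, Category.assoc, ← Functor.map_comp]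
  convert! Category.comp_id _

lemma ideal_comap_fromSpec_le {U : X.affineOpens} (hU : IsAffineOpen U.1)
    (J : X.IdealSheafData) {Q : CommRingCat.{0}}
    (d : Γ(X, U.1) ⟶ Q) (hd : J.ideal U ≤ RingHom.ker d.hom) :
    J.comap hU.fromSpec ≤ (Spec.map d).ker := by
  refine Scheme.IdealSheafData.le_of_isAffine fun x hx => ?_
  rw [Scheme.IdealSheafData.ideal_comap_of_isOpenImmersion] at hx
  have hle : U.1 ≤ hU.fromSpec ''ᵁ ⊤ := by
    rw [Scheme.Hom.image_top_eq_opensRange, IsAffineOpen.opensRange_fromSpec]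
  let U' : X.affineOpens := ⟨hU.fromSpec ''ᵁ ⊤, (isAffineOpen_top _).image_of_isOpenImmersion _⟩
  have hUU' : U ≤ U' := hle
  have hy := J.ideal_le_comap_ideal hUU' (Ideal.mem_comap.mp hx)
  rw [Ideal.mem_comap] at hy
  set y := (X.presheaf.map (homOfLE hle).op).hom ((hU.fromSpec.appIso ⊤).inv x)
  have hxy : x = (Scheme.ΓSpecIso Γ(X, U)).inv y := by
    rw [← fromSpec_appLE_top hU]
    change x = (X.presheaf.map (homOfLE hle).op ≫ hU.fromSpec.appLE U ⊤ _).hom _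
    rw [Scheme.Hom.map_appLE, ← Scheme.Hom.appIso_hom', ← CommRingCat.comp_apply,
      Iso.inv_hom_id]
    rfl
  rw [Scheme.Hom.ker_apply, RingHom.mem_ker]
  have h1 : (Spec.map d).app ⊤ ((Scheme.ΓSpecIso Γ(X, U)).inv y) =
      (Scheme.ΓSpecIso Q).inv (d y) :=
    (ConcreteCategory.congr_hom (Scheme.ΓSpecIso_inv_naturality d) y).symm
  rw [hxy]
  refine h1.trans ?_
  rw [show d y = 0 from hd hy, map_zero]
  rfl

/-- For `≤`, the closed subscheme of `V` cut out by the extended ideal maps into the subscheme of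
`J`, and the adjunction between `comap` and `map` applies to its kernel. For `≥`, sections of `J`
pull back to functions vanishing on the inverse image subscheme. -/
theorem ideal_comap_eq_map (J : Y.IdealSheafData) (f : X ⟶ Y) {U : Y.affineOpens}
    {V : X.affineOpens} (h : V.1 ≤ f ⁻¹ᵁ U.1) :
    (J.comap f).ideal V = (J.ideal U).map (f.appLE U V h).hom := by
  have hU : IsAffineOpen U.1 := U.2
  have hV : IsAffineOpen V.1 := V.2
  apply le_antisymm
  · set K := (J.ideal U).map (f.appLE U V h).hom
    let q : Γ(X, V.1) ⟶ CommRingCat.of (Γ(X, V.1) ⧸ K) := CommRingCat.ofHom (Ideal.Quotient.mk K)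
    have hJ : J.comap f ≤ (Spec.map q ≫ hV.fromSpec).ker := by
      rw [← Scheme.IdealSheafData.le_map_iff_comap_le, Scheme.IdealSheafData.map_ker,
        Category.assoc, ← IsAffineOpen.SpecMap_appLE_fromSpec f hU hV h, ← Category.assoc,
        ← Spec.map_comp, ← Scheme.IdealSheafData.map_ker, Scheme.IdealSheafData.le_map_iff_comap_le]
      refine ideal_comap_fromSpec_le hU J _ fun x hx => ?_
      rw [RingHom.mem_ker]
      exact Ideal.Quotient.eq_zero_iff_mem.mpr (Ideal.mem_map_of_mem _ hx)
    intro x hx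
    have hx1 := Scheme.Hom.ideal_ker_le _ V (hJ V hx)
    rw [RingHom.mem_ker] at hx1
    have hx2 := congrArg ((Spec _).presheaf.map (homOfLE (show ⊤ ≤ (Spec.map q ≫ hV.fromSpec) ⁻¹ᵁ V.1
      from by rw [Scheme.Hom.comp_preimage, hV.fromSpec_preimage_self]; rfl)).op).hom hx1
    rw [map_zero] at hx2
    have hx3 : (Scheme.ΓSpecIso _).inv (q x) = 0 := by
      rw [← hx2]
      change _ = ((Spec.map q ≫ hV.fromSpec).appLE V.1 ⊤ _) x
      rw [← Scheme.Hom.appLE_comp_appLE _ _ V.1 ⊤ ⊤ (by rw [hV.fromSpec_preimage_self]) le_top,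
        fromSpec_appLE_top, CommRingCat.comp_apply, ← CommRingCat.comp_apply q,
        Scheme.ΓSpecIso_inv_naturality]
      simp [Scheme.Hom.appLE]
      rfl
    have hx4 : q x = 0 := by
      have := congrArg (Scheme.ΓSpecIso _).hom hx3
      rwa [map_zero, ← CommRingCat.comp_apply, Iso.inv_hom_id] at this
    exact Ideal.Quotient.eq_zero_iff_mem.mp hx4
  · rw [Ideal.map_le_iff_le_comap]
    intro x hx
    have hx1 := Scheme.IdealSheafData.le_map_comap J f U hx
    have hx2 := Scheme.Hom.ideal_ker_le _ U hx1
    rw [Ideal.mem_comap, ← Scheme.IdealSheafData.ker_subschemeι_app, RingHom.mem_ker]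
    rw [RingHom.mem_ker] at hx2
    change (f.appLE U V h ≫ (J.comap f).subschemeι.app V) x = 0
    have : f.appLE U V h ≫ (J.comap f).subschemeι.app V =
        ((J.comap f).subschemeι ≫ f).app U ≫ (J.comap f).subscheme.presheaf.map
          (homOfLE (show (J.comap f).subschemeι ⁻¹ᵁ V.1 ≤ _ from
            (Opens.map (J.comap f).subschemeι.base).monotone h)).op := by
      simp only [Scheme.Hom.appLE, Scheme.Hom.comp_app, Category.assoc, Scheme.Hom.naturality]
      rfl
    rw [this, CommRingCat.comp_apply]
    refine (congrArg _ hx2).trans (map_zero _)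

/-- The stalk of an ideal sheaf. -/
noncomputable def stalkIdeal (J : X.IdealSheafData) (x : X) : Ideal (X.presheaf.stalk x) :=
  ⨆ U : X.affineOpens, ⨆ h : x ∈ U.1, (J.ideal U).map (X.presheaf.germ U.1 x h).hom

lemma map_germ_ideal_eq (J : X.IdealSheafData) {U V : X.affineOpens} (hUV : U ≤ V) {x : X}
    (hxU : x ∈ U.1) (hxV : x ∈ V.1) :
    (J.ideal V).map (X.presheaf.germ V.1 x hxV).hom =
      (J.ideal U).map (X.presheaf.germ U.1 x hxU).hom := by
  rw [← J.map_ideal hUV, Ideal.map_map, ← CommRingCat.hom_comp]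
  congr 2
  exact (X.presheaf.germ_res (homOfLE hUV) x hxU).symm

lemma stalkIdeal_eq_map (J : X.IdealSheafData) {x : X} {U : X.affineOpens} (h : x ∈ U.1) :
    stalkIdeal J x = (J.ideal U).map (X.presheaf.germ U.1 x h).hom := by
  refine le_antisymm (iSup₂_le fun V hV => ?_) (le_iSup₂_of_le U h le_rfl)
  obtain ⟨W, hW, hxW, hWUV⟩ := exists_isAffineOpen_mem_and_subset
    (show x ∈ (U.1 ⊓ V.1 : X.Opens) from ⟨h, hV⟩)
  let W' : X.affineOpens := ⟨W, hW⟩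
  rw [map_germ_ideal_eq J (U := W') (fun y hy => (hWUV hy).2) hxW hV,
    map_germ_ideal_eq J (U := W') (fun y hy => (hWUV hy).1) hxW h]

lemma stalkIdeal_comap (J : Y.IdealSheafData) (f : X ⟶ Y) (x : X) :
    stalkIdeal (J.comap f) x = (stalkIdeal J (f x)).map (f.stalkMap x).hom := by
  obtain ⟨U, hU, hxU, -⟩ := exists_isAffineOpen_mem_and_subset (show f x ∈ (⊤ : Y.Opens) from trivial)
  obtain ⟨V, hV, hxV, hVU⟩ := exists_isAffineOpen_mem_and_subset (show x ∈ f ⁻¹ᵁ U from hxU)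
  let U' : Y.affineOpens := ⟨U, hU⟩
  let V' : X.affineOpens := ⟨V, hV⟩
  rw [stalkIdeal_eq_map (U := V') _ hxV, stalkIdeal_eq_map (U := U') _ hxU,
    ideal_comap_eq_map J f (U := U') (V := V') hVU, Ideal.map_map, Ideal.map_map,
    ← CommRingCat.hom_comp, ← CommRingCat.hom_comp]
  congr 2
  refine Eq.trans ?_ (Scheme.Hom.germ_stalkMap f U x hxU).symm
  change (f.app U ≫ X.presheaf.map _) ≫ _ = _
  rw [Category.assoc]
  congr 1
  exact X.presheaf.germ_res (homOfLE hVU) x hxV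

end IdealSheaf


/-! ### The affine blowup algebra. -/

section ChartRing

variable {A R T ι : Type*} [CommRing A] [CommRing R] [CommRing T]

/-- The subring generated by these pairs is to be the graph of the sought homomorphism `R → T`. A
power of `f l` clears the denominators of an element in both coordinates at once, with the same `a :
A`. -/
lemma exists_pow_mul_eq_of_mem_closure {φ : A →+* R} {ψ : A →+* T} {f : ι → A} {l : ι}
    {t : ι → R} {τ : ι → T} (ht : ∀ m, φ (f m) = t m * φ (f l))
    (hτ : ∀ m, ψ (f m) = τ m * ψ (f l)) {z : R × T}
    (hz : z ∈ Subring.closure (Set.range (fun a => (φ a, ψ a)) ∪ Set.range fun m => (t m, τ m))) :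
    ∃ (N : ℕ) (a : A), φ (f l) ^ N * z.1 = φ a ∧ ψ (f l) ^ N * z.2 = ψ a := by
  induction hz using Subring.closure_induction with
  | mem x hx =>
    rcases hx with ⟨a, rfl⟩ | ⟨m, rfl⟩
    · exact ⟨0, a, by simp, by simp⟩
    · exact ⟨1, f m, by simp [ht m, mul_comm], by simp [hτ m, mul_comm]⟩
  | zero => exact ⟨0, 0, by simp, by simp⟩
  | one => exact ⟨0, 1, by simp, by simp⟩
  | add x y _ _ hx hy =>
    obtain ⟨N, a, h1, h2⟩ := hx
    obtain ⟨M, b, h3, h4⟩ := hy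
    refine ⟨N + M, f l ^ M * a + f l ^ N * b, ?_, ?_⟩
    · simp only [map_add, map_mul, map_pow, ← h1, ← h3, Prod.fst_add]; ring
    · simp only [map_add, map_mul, map_pow, ← h2, ← h4, Prod.snd_add]; ring
  | neg x _ hx =>
    obtain ⟨N, a, h1, h2⟩ := hx
    exact ⟨N, -a, by simp [← h1], by simp [← h2]⟩
  | mul x y _ _ hx hy =>
    obtain ⟨N, a, h1, h2⟩ := hx
    obtain ⟨M, b, h3, h4⟩ := hy
    refine ⟨N + M, a * b, ?_, ?_⟩
    · simp only [map_mul, ← h1, ← h3, Prod.fst_mul]; ring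
    · simp only [map_mul, ← h2, ← h4, Prod.snd_mul]; ring

/-- The universal property of the affine blowup algebra. -/
theorem exists_ringHom_of_blowup_chart {φ : A →+* R} (hφ : Function.Injective φ) (ψ : A →+* T)
    {f : ι → A} {l : ι} {t : ι → R} {τ : ι → T} (ht : ∀ m, φ (f m) = t m * φ (f l))
    (hgen : Subring.closure (Set.range φ ∪ Set.range t) = ⊤)
    (hl : ψ (f l) ∈ nonZeroDivisors T) (hτ : ∀ m, ψ (f m) = τ m * ψ (f l)) :
    ∃ χ : R →+* T, χ.comp φ = ψ := by
  let G : Subring (R × T) :=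
    Subring.closure (Set.range (fun a => (φ a, ψ a)) ∪ Set.range fun m => (t m, τ m))
  let p : G →+* R := (RingHom.fst R T).comp G.subtype
  -- Injectivity says that the subring is a graph: if the first coordinate vanishes, the common
  -- numerator is zero because `φ` is injective, and then so is the second coordinate, because `ψ (f
  -- l)` is a nonzerodivisor.
  have hp : Function.Bijective p := by
    constructor
    · rw [injective_iff_map_eq_zero]
      intro z hz
      obtain ⟨N, a, h1, h2⟩ := exists_pow_mul_eq_of_mem_closure ht hτ z.2
      have hz1 : z.1.1 = 0 := hz
      rw [hz1, mul_zero, ← map_zero φ] at h1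
      rw [← hφ h1, map_zero] at h2
      have : z.1.2 = 0 := (mul_left_mem_nonZeroDivisors_eq_zero_iff (pow_mem hl N)).mp h2
      exact Subtype.ext (Prod.ext hz1 this)
    · rw [← RingHom.range_eq_top, eq_top_iff, ← hgen, Subring.closure_le]
      rintro _ (⟨a, rfl⟩ | ⟨m, rfl⟩)
      · exact ⟨⟨(φ a, ψ a), Subring.subset_closure (Or.inl ⟨a, rfl⟩)⟩, rfl⟩
      · exact ⟨⟨(t m, τ m), Subring.subset_closure (Or.inr ⟨m, rfl⟩)⟩, rfl⟩
  let e : G ≃+* R := RingEquiv.ofBijective p hp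
  refine ⟨((RingHom.snd R T).comp G.subtype).comp e.symm.toRingHom, RingHom.ext fun a => ?_⟩
  have : e.symm (φ a) = ⟨(φ a, ψ a), Subring.subset_closure (Or.inl ⟨a, rfl⟩)⟩ := by
    rw [RingEquiv.symm_apply_eq]; rfl
  simp [this]

theorem ringHom_ext_of_blowup_chart {φ : A →+* R} {f : ι → A} {l : ι} {t : ι → R}
    (ht : ∀ m, φ (f m) = t m * φ (f l))
    (hgen : Subring.closure (Set.range φ ∪ Set.range t) = ⊤) {χ χ' : R →+* T}
    (h : χ.comp φ = χ'.comp φ) (hl : χ (φ (f l)) ∈ nonZeroDivisors T) : χ = χ' := by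
  refine RingHom.eq_of_eqOn_set_top fun x _ => ?_
  have hφ (a : A) : χ (φ a) = χ' (φ a) := congr($h a)
  refine (show Subring.closure (Set.range φ ∪ Set.range t) ≤ χ.eqLocus χ' from ?_)
    (hgen ▸ Subring.mem_top x)
  rw [Subring.closure_le]
  rintro _ (⟨a, rfl⟩ | ⟨m, rfl⟩)
  · exact hφ a
  · change χ (t m) = χ' (t m)
    have h1 := hφ (f m)
    rw [ht, map_mul, map_mul, ← hφ (f l)] at h1
    exact (mul_cancel_right_mem_nonZeroDivisors hl).mp h1

end ChartRing

/-! ### Effective Cartier divisors under flat pullback and shrinking. -/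

section Cartier

variable {X Y : Scheme.{0}}

lemma map_mem_nonZeroDivisors_of_flat {A B : Type*} [CommRing A] [CommRing B] {φ : A →+* B}
    (hφ : φ.Flat) {a : A} (ha : a ∈ nonZeroDivisors A) : φ a ∈ nonZeroDivisors B := by
  let _ : Algebra A B := φ.toAlgebra
  have : Module.Flat A B := hφ
  have h := Module.Flat.isSMulRegular_of_nonZeroDivisors (M := B) ha
  refine mem_nonZeroDivisors_iff_right.mpr fun z hz => h ?_
  change a • z = a • (0 : B)
  rw [smul_zero, Algebra.smul_def, mul_comm]
  exact hz

lemma restrict_mem_nonZeroDivisors {U V : X.Opens} (hU : IsAffineOpen U) (hV : IsAffineOpen V)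
    (h : V ≤ U) {a : Γ(X, U)} (ha : a ∈ nonZeroDivisors Γ(X, U)) :
    (X.presheaf.map (homOfLE h).op).hom a ∈ nonZeroDivisors Γ(X, V) := by
  have := HasRingHomProperty.appLE @Flat (𝟙 X) inferInstance ⟨U, hU⟩ ⟨V, hV⟩ (by simpa using h)
  have e : (𝟙 X : X ⟶ X).appLE U V (by simpa using h) = X.presheaf.map (homOfLE h).op := by
    simp only [Scheme.Hom.appLE, Scheme.Hom.id_app]
    exact Category.id_comp _
  exact e ▸ map_mem_nonZeroDivisors_of_flat this ha

lemma IsEffectiveCartier.comap_of_flat {J : Y.IdealSheafData} (hJ : IsEffectiveCartier J)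
    (f : X ⟶ Y) [Flat f] : IsEffectiveCartier (J.comap f) := by
  intro x
  obtain ⟨U, hxU, a, ha, hU⟩ := hJ (f x)
  obtain ⟨V, hV, hxV, hVU⟩ := exists_isAffineOpen_mem_and_subset (show x ∈ f ⁻¹ᵁ U.1 from hxU)
  let V' : X.affineOpens := ⟨V, hV⟩
  refine ⟨V', hxV, f.appLE U.1 V hVU a,
    map_mem_nonZeroDivisors_of_flat (HasRingHomProperty.appLE @Flat f inferInstance U V' hVU) ha, ?_⟩
  rw [ideal_comap_eq_map J f (U := U) (V := V') hVU, hU, Ideal.map_span, Set.image_singleton]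

/-- Around each point an effective Cartier divisor has an equation on an arbitrarily small
affine neighbourhood. -/
lemma IsEffectiveCartier.exists_le {J : Y.IdealSheafData} (hJ : IsEffectiveCartier J)
    {O : Y.Opens} {y : Y} (hy : y ∈ O) : ∃ U : Y.affineOpens, y ∈ U.1 ∧ U.1 ≤ O ∧
      ∃ a ∈ nonZeroDivisors Γ(Y, U.1), J.ideal U = Ideal.span {a} := by
  obtain ⟨U, hyU, a, ha, hU⟩ := hJ y
  obtain ⟨V, hV, hyV, hVU⟩ := exists_isAffineOpen_mem_and_subset
    (show y ∈ U.1 ⊓ O from ⟨hyU, hy⟩)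
  let V' : Y.affineOpens := ⟨V, hV⟩
  have hVU' : V' ≤ U := fun z hz => (hVU hz).1
  refine ⟨V', hyV, fun z hz => (hVU hz).2, _, restrict_mem_nonZeroDivisors U.2 hV hVU' ha, ?_⟩
  rw [← J.map_ideal hVU', hU, Ideal.map_span, Set.image_singleton]
  rfl

end Cartier

/-! ### The universal property of the blowup from local charts. -/

section Glue

variable {X X' : Scheme.{0}}

lemma existsUnique_lift_of_cover (π : X' ⟶ X) {T : Scheme.{0}} (g : T ⟶ X) (𝒰 : T.OpenCover)
    (h : ∀ i, 𝒰.X i ⟶ X') (hh : ∀ i, h i ≫ π = 𝒰.f i ≫ g)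
    (huniq : ∀ (T' : Scheme) (j : T' ⟶ T) [IsOpenImmersion j] (h h' : T' ⟶ X'),
      h ≫ π = j ≫ g → h' ≫ π = j ≫ g → h = h') :
    ∃! h : T ⟶ X', h ≫ π = g := by
  have hglue : ∀ p q : 𝒰.I₀, pullback.fst (𝒰.f p) (𝒰.f q) ≫ h p =
      pullback.snd (𝒰.f p) (𝒰.f q) ≫ h q := fun p q => by
    refine huniq _ (pullback.fst (𝒰.f p) (𝒰.f q) ≫ 𝒰.f p) _ _ ?_ ?_
    · rw [Category.assoc, hh p, Category.assoc]
    · rw [pullback.condition, Category.assoc, hh q, Category.assoc]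
  have hg : 𝒰.glueMorphisms h hglue ≫ π = g := by
    refine 𝒰.hom_ext _ _ fun p => ?_
    rw [Scheme.Cover.ι_glueMorphisms_assoc]
    exact hh p
  refine ⟨𝒰.glueMorphisms h hglue, hg, fun h' hh' => ?_⟩
  refine huniq T (𝟙 T) _ _ (by simpa using hh') ?_
  rw [Category.id_comp, hg]

/-- Existence and uniqueness of lifts along `π` can be checked locally on the source. -/
theorem existsUnique_lift_of_local (π : X' ⟶ X) {T : Scheme.{0}} (g : T ⟶ X)
    (hex : ∀ p : T, ∃ V : T.Opens, p ∈ V ∧ ∃ h : V.toScheme ⟶ X', h ≫ π = V.ι ≫ g)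
    (huniq : ∀ (T' : Scheme.{0}) (j : T' ⟶ T) [IsOpenImmersion j] (h h' : T' ⟶ X'),
      h ≫ π = j ≫ g → h' ≫ π = j ≫ g → h = h') :
    ∃! h : T ⟶ X', h ≫ π = g := by
  choose V hpV h hh using hex
  have hV : IsOpenCover V := .mk (by
    rw [eq_top_iff]; intro p _; exact Opens.mem_iSup.mpr ⟨p, hpV p⟩)
  exact existsUnique_lift_of_cover π g (T.openCoverOfIsOpenCover V hV) h hh huniq

/-- Charts showing that `π` is, over the affine open `U`, the blowup of the ideal sheaf `J`. -/
structure BlowupCharts (J : X.IdealSheafData) (π : X' ⟶ X) (U : X.affineOpens) where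
  ι : Type
  f : ι → Γ(X, U.1)
  W : ι → X'.Opens
  isAffineOpen_W : ∀ l, IsAffineOpen (W l)
  W_le : ∀ l, W l ≤ π ⁻¹ᵁ U.1
  t : ∀ l, ι → Γ(X', W l)
  ideal_eq : J.ideal U = Ideal.span (Set.range f)
  le_iSup : π ⁻¹ᵁ U.1 ≤ ⨆ l, W l
  injective : ∀ l, Function.Injective (π.appLE U.1 (W l) (W_le l)).hom
  mem_nonZeroDivisors : ∀ l, (π.appLE U.1 (W l) (W_le l)).hom (f l) ∈ nonZeroDivisors _
  map_f : ∀ l m, (π.appLE U.1 (W l) (W_le l)).hom (f m) =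
    t l m * (π.appLE U.1 (W l) (W_le l)).hom (f l)
  closure_eq : ∀ l, Subring.closure (Set.range (π.appLE U.1 (W l) (W_le l)).hom ∪
    Set.range (t l)) = ⊤
  basicOpen_le : ∀ l m, X'.basicOpen (t l m) ≤ W m

namespace BlowupCharts

variable {J : X.IdealSheafData} {π : X' ⟶ X} {U : X.affineOpens} (C : BlowupCharts J π U)
include C

lemma exists_equation {y : X'} (hy : π y ∈ U.1) : ∃ V : X'.affineOpens, y ∈ V.1 ∧
    ∃ a ∈ nonZeroDivisors Γ(X', V.1), (J.comap π).ideal V = Ideal.span {a} := by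
  obtain ⟨l, hl⟩ := Opens.mem_iSup.mp (C.le_iSup hy)
  let V' : X'.affineOpens := ⟨C.W l, C.isAffineOpen_W l⟩
  refine ⟨V', hl, _, C.mem_nonZeroDivisors l, ?_⟩
  rw [ideal_comap_eq_map J π (U := U) (V := V') (C.W_le l), C.ideal_eq, Ideal.map_span,
    ← Set.range_comp]
  refine le_antisymm (Ideal.span_le.mpr ?_) (Ideal.span_mono (by
    rw [Set.singleton_subset_iff]; exact ⟨l, rfl⟩))
  rintro _ ⟨m, rfl⟩
  exact Ideal.mem_span_singleton'.mpr ⟨_, (C.map_f l m).symm⟩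

/-- If the pulled back ideal is generated by a nonzerodivisor `a` and the generators become `c m *
a`, cancelling `a` shows that the `c m` generate the unit ideal. Some `c l` is then invertible near
the given point, so there the generator with index `l` alone generates the ideal. -/
lemma exists_generator {T : Scheme.{0}} {g : T ⟶ X} (hg : IsEffectiveCartier (J.comap g)) {p : T}
    (hp : g p ∈ U.1) : ∃ (l : C.ι) (V : T.Opens) (_ : IsAffineOpen V) (hVU : V ≤ g ⁻¹ᵁ U.1)
      (τ : C.ι → Γ(T, V)), p ∈ V ∧ (g.appLE U.1 V hVU).hom (C.f l) ∈ nonZeroDivisors _ ∧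
        ∀ m, (g.appLE U.1 V hVU).hom (C.f m) = τ m * (g.appLE U.1 V hVU).hom (C.f l) := by
  obtain ⟨V, hpV, hVU, a, ha, haV⟩ := hg.exists_le (show p ∈ g ⁻¹ᵁ U.1 from hp)
  rw [ideal_comap_eq_map J g hVU, C.ideal_eq, Ideal.map_span, ← Set.range_comp] at haV
  have hV : IsAffineOpen V.1 := V.2
  have h1 (m) : ∃ c, c * a = (g.appLE U.1 V.1 hVU).hom (C.f m) :=
    Ideal.mem_span_singleton'.mp (haV ▸ Ideal.subset_span ⟨m, rfl⟩)
  choose c hc using h1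
  have h2 : (1 : Γ(T, V.1)) ∈ Ideal.span (Set.range c) := by
    have h3 : a ∈ Ideal.span (Set.range (⇑(g.appLE U.1 V.1 hVU).hom ∘ C.f)) :=
      haV ▸ Ideal.mem_span_singleton_self a
    obtain ⟨w, hw⟩ := (Finsupp.mem_ideal_span_range_iff_exists_finsupp).mp h3
    have : (w.sum fun m x => x * c m) * a = 1 * a := by
      rw [one_mul, Finsupp.sum_mul]
      conv_rhs => rw [← hw]
      refine Finsupp.sum_congr fun m _ => ?_
      rw [mul_assoc, hc]; rfl
    rw [← (mul_cancel_right_mem_nonZeroDivisors ha).mp this]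
    exact Ideal.sum_mem _ fun m _ => Ideal.mul_mem_left _ _ (Ideal.subset_span ⟨m, rfl⟩)
  obtain ⟨l, hl⟩ : ∃ l, p ∈ T.basicOpen (c l) := by
    by_contra! hcon
    have h4 : Ideal.span (Set.range c) ≤ Ideal.comap (T.presheaf.germ V.1 p hpV).hom
        (IsLocalRing.maximalIdeal _) := by
      rw [Ideal.span_le]
      rintro _ ⟨m, rfl⟩
      have := hcon m
      rw [Scheme.mem_basicOpen _ _ _ hpV] at this
      exact this
    have h5 := h4 h2
    rw [Ideal.mem_comap, map_one] at h5
    exact (Ideal.ne_top_iff_one _).mp (IsLocalRing.maximalIdeal.isMaximal _).ne_top h5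
  have hle : T.basicOpen (c l) ≤ V.1 := T.basicOpen_le _
  let r := (T.presheaf.map (homOfLE hle).op).hom
  have hr (m) : (g.appLE U.1 (T.basicOpen (c l)) (hle.trans hVU)).hom (C.f m) = r (c m) * r a := by
    rw [← map_mul, hc, ← Scheme.Hom.appLE_map g hVU (homOfLE hle).op]
    rfl
  have hu : IsUnit (r (c l)) := RingedSpace.isUnit_res_basicOpen _ _
  have hra : r a ∈ nonZeroDivisors _ := restrict_mem_nonZeroDivisors hV (hV.basicOpen _) hle ha
  obtain ⟨v, hv⟩ := hu.exists_left_inv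
  refine ⟨l, T.basicOpen (c l), hV.basicOpen _, hle.trans hVU, fun m => r (c m) * v, hl, ?_,
    fun m => ?_⟩
  · rw [hr]
    exact mul_mem hu.mem_nonZeroDivisors hra
  · rw [hr, hr]
    linear_combination (-(r (c m)) * r a) * hv

lemma exists_lift {T : Scheme.{0}} {g : T ⟶ X} (hg : IsEffectiveCartier (J.comap g)) {p : T}
    (hp : g p ∈ U.1) : ∃ V : T.Opens, p ∈ V ∧ ∃ h : V.toScheme ⟶ X', h ≫ π = V.ι ≫ g := by
  obtain ⟨l, V, hV, hVU, τ, hpV, h1, h2⟩ := C.exists_generator hg hp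
  obtain ⟨χ, hχ⟩ := exists_ringHom_of_blowup_chart (C.injective l) (g.appLE U.1 V hVU).hom
    (C.map_f l) (C.closure_eq l) h1 h2
  have hU : IsAffineOpen U.1 := U.2
  refine ⟨V, hpV, hV.isoSpec.hom ≫ Spec.map (CommRingCat.ofHom χ) ≫
    (C.isAffineOpen_W l).fromSpec, ?_⟩
  have hχ' : π.appLE U.1 (C.W l) (C.W_le l) ≫ CommRingCat.ofHom χ = g.appLE U.1 V hVU :=
    CommRingCat.hom_ext hχ
  rw [Category.assoc, Category.assoc,
    ← IsAffineOpen.SpecMap_appLE_fromSpec π hU (C.isAffineOpen_W l) (C.W_le l),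
    ← Spec.map_comp_assoc, hχ', IsAffineOpen.SpecMap_appLE_fromSpec g hU hV hVU,
    IsAffineOpen.isoSpec_hom_fromSpec_assoc]

/-- Where the generator with index `l` generates, every lift lands in the chart `W l`: in another
chart `W m` the coordinate `t m l` becomes invertible, and `basicOpen_le` puts that locus inside `W
l`. Within one affine chart two lifts agree by cancelling nonzerodivisors. -/
lemma lift_eq {T : Scheme.{0}} {g : T ⟶ X} (hg : IsEffectiveCartier (J.comap g)) {p : T}
    (hp : g p ∈ U.1) {h h' : T ⟶ X'} (hh : h ≫ π = g) (hh' : h' ≫ π = g) :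
    ∃ V : T.Opens, p ∈ V ∧ V.ι ≫ h = V.ι ≫ h' := by
  obtain ⟨l, V, hV, hVU, τ, hpV, h1, h2⟩ := C.exists_generator hg hp
  have key : ∀ k : T ⟶ X', k ≫ π = g → V ≤ k ⁻¹ᵁ C.W l := by
    intro k hk q hq
    have hkq : π (k q) ∈ U.1 := by
      rw [← Scheme.Hom.comp_apply, hk]; exact hVU hq
    obtain ⟨m, hm⟩ := Opens.mem_iSup.mp (C.le_iSup hkq)
    obtain ⟨V', hV', hqV', hle⟩ := exists_isAffineOpen_mem_and_subset
      (show q ∈ V ⊓ k ⁻¹ᵁ C.W m from ⟨hq, hm⟩)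
    have hle1 : V' ≤ V := fun z hz => (hle hz).1
    have hle2 : V' ≤ k ⁻¹ᵁ C.W m := fun z hz => (hle hz).2
    let r := (T.presheaf.map (homOfLE hle1).op).hom
    let χ := (k.appLE (C.W m) V' hle2).hom
    have hχ (a) : χ ((π.appLE U.1 (C.W m) (C.W_le m)).hom a) = r ((g.appLE U.1 V hVU).hom a) := by
      change (π.appLE U.1 (C.W m) (C.W_le m) ≫ k.appLE (C.W m) V' hle2).hom a =
        (g.appLE U.1 V hVU ≫ T.presheaf.map (homOfLE hle1).op).hom a
      subst hk
      rw [Scheme.Hom.appLE_comp_appLE, Scheme.Hom.appLE_map]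
    have hnzd : r ((g.appLE U.1 V hVU).hom (C.f l)) ∈ nonZeroDivisors _ :=
      restrict_mem_nonZeroDivisors hV hV' hle1 h1
    have h3 := hχ (C.f l)
    rw [C.map_f, map_mul, hχ, h2 m, map_mul, ← mul_assoc] at h3
    have h4 : χ (C.t m l) * r (τ m) = 1 :=
      (mul_cancel_right_mem_nonZeroDivisors hnzd).mp (h3.trans (one_mul _).symm)
    apply C.basicOpen_le m l
    have h5 : T.basicOpen (χ (C.t m l)) = V' :=
      Scheme.basicOpen_of_isUnit _ (IsUnit.of_mul_eq_one _ h4)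
    rw [Scheme.basicOpen_appLE] at h5
    exact (h5.ge hqV').2
  have hW := C.isAffineOpen_W l
  refine ⟨V, hpV, ?_⟩
  have e : h.appLE _ _ (key h hh) = h'.appLE _ _ (key h' hh') := by
    have hc (k : T ⟶ X') (hk : k ≫ π = g) :
        π.appLE U.1 (C.W l) (C.W_le l) ≫ k.appLE _ V (key k hk) = g.appLE U.1 V hVU := by
      subst hk; rw [Scheme.Hom.appLE_comp_appLE]
    refine CommRingCat.hom_ext (ringHom_ext_of_blowup_chart (C.map_f l) (C.closure_eq l) ?_ ?_)
    · rw [← CommRingCat.hom_comp, ← CommRingCat.hom_comp, hc h hh, hc h' hh']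
    · have := congr($(hc h hh).hom (C.f l))
      exact this ▸ h1
  have h6 := IsAffineOpen.SpecMap_appLE_fromSpec h hW hV (key h hh)
  rw [e, IsAffineOpen.SpecMap_appLE_fromSpec h' hW hV (key h' hh')] at h6
  rw [← hV.isoSpec_hom_fromSpec, Category.assoc, Category.assoc, h6]

end BlowupCharts

theorem isBlowup_of_charts {J : X.IdealSheafData} {π : X' ⟶ X}
    (H : ∀ x : X, ∃ U : X.affineOpens, x ∈ U.1 ∧ Nonempty (BlowupCharts J π U)) :
    IsBlowup J π where
  isEffectiveCartier y := by
    obtain ⟨U, hU, ⟨C⟩⟩ := H (π y)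
    exact C.exists_equation hU
  existsUnique_lift T g hg := by
    refine existsUnique_lift_of_local π g (fun p => ?_) fun T' j _ h h' hh hh' => ?_
    · obtain ⟨U, hU, ⟨C⟩⟩ := H (g p)
      exact C.exists_lift hg hU
    · have hg' : IsEffectiveCartier (J.comap (j ≫ g)) := by
        rw [Scheme.IdealSheafData.comap_comp]; exact hg.comap_of_flat j
      refine Scheme.hom_ext_of_forall _ _ fun p => ?_
      obtain ⟨U, hU, ⟨C⟩⟩ := H ((j ≫ g) p)
      exact C.lift_eq hg' hU hh hh'

/-- A blowup is an isomorphism over each open set on which the center is already an effective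
Cartier divisor. -/
theorem IsBlowup.isIso_restrict {J : X.IdealSheafData} {π : X' ⟶ X} (hπ : IsBlowup J π)
    (O : X.Opens) (hO : IsEffectiveCartier (J.comap O.ι)) : IsIso (π ∣_ O) := by
  obtain ⟨σ, hσ, -⟩ := hπ.existsUnique_lift _ O.ι hO
  have hr : Set.range σ ⊆ Set.range (π ⁻¹ᵁ O).ι := by
    rintro _ ⟨x, rfl⟩
    rw [Scheme.Opens.range_ι]
    change π (σ x) ∈ O
    rw [← Scheme.Hom.comp_apply, hσ]
    exact x.2
  let σ' : O.toScheme ⟶ (π ⁻¹ᵁ O).toScheme := IsOpenImmersion.lift (π ⁻¹ᵁ O).ι σ hr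
  have hσ' : σ' ≫ (π ⁻¹ᵁ O).ι = σ := IsOpenImmersion.lift_fac _ _ _
  refine ⟨σ', ?_, ?_⟩
  · rw [← cancel_mono (π ⁻¹ᵁ O).ι, Category.assoc, hσ', Category.id_comp]
    have hc : IsEffectiveCartier (J.comap ((π ⁻¹ᵁ O).ι ≫ π)) := by
      rw [Scheme.IdealSheafData.comap_comp]
      exact hπ.isEffectiveCartier.comap_of_flat _
    refine (hπ.existsUnique_lift _ _ hc).unique ?_ rfl
    rw [Category.assoc, hσ, morphismRestrict_ι]
  · rw [← cancel_mono O.ι, Category.assoc, morphismRestrict_ι, ← Category.assoc, hσ', hσ,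
      Category.id_comp]

end Glue


/-! ### Standard charts and coordinates of projective space. -/

section ProjectiveCharts

attribute [local instance] MvPolynomial.gradedAlgebra

open HomogeneousLocalization

lemma isHomogeneous_eval₂_smul {R S σ : Type*} [CommSemiring R] [CommSemiring S] (f : R →+* S)
    (x : σ → S) (u : S) {p : MvPolynomial σ R} {n : ℕ} (hp : p.IsHomogeneous n) :
    p.eval₂ f (fun i => u * x i) = u ^ n * p.eval₂ f x := by
  rw [MvPolynomial.eval₂_eq, MvPolynomial.eval₂_eq, Finset.mul_sum]
  refine Finset.sum_congr rfl fun d hd => ?_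
  have h := hp (MvPolynomial.mem_support_iff.mp hd)
  rw [Finsupp.weight_apply, Finsupp.sum] at h
  simp_rw [mul_pow, Finset.prod_mul_distrib]
  rw [Finset.prod_pow_eq_pow_sum]
  rw [show ∑ i ∈ d.support, d i = n by simpa using h]
  ring

lemma le_preimage_top {X Y : Scheme.{0}} (f : X ⟶ Y) (U : X.Opens) : U ≤ f ⁻¹ᵁ ⊤ := le_top

lemma appLE_eq_of_fromSpec_comp {X : Scheme.{0}} {R : CommRingCat.{0}} {U : X.Opens}
    (hU : IsAffineOpen U) {g : X ⟶ Spec R} {φ : R ⟶ Γ(X, U)} (h : hU.fromSpec ≫ g = Spec.map φ) :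
    (Scheme.ΓSpecIso R).inv ≫ g.appLE ⊤ U (le_preimage_top g U) = φ := by
  have h2 : (hU.fromSpec ≫ g).appTop =
      g.appLE ⊤ U (le_preimage_top g U) ≫ (Scheme.ΓSpecIso _).inv := by
    rw [← fromSpec_appLE_top hU, Scheme.Hom.appLE_comp_appLE]
    exact Scheme.Hom.app_eq_appLE _
  rw [h] at h2
  rw [← cancel_mono (Scheme.ΓSpecIso _).inv, Category.assoc, ← h2]
  exact (Scheme.ΓSpecIso_inv_naturality φ).symm

lemma fromSpec_eq_awayι {A : Type} [CommRing A] {σ : Type} [SetLike σ A] [AddSubgroupClass σ A]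
    (𝒜 : ℕ → σ) [GradedRing 𝒜] {f : A} (hf : f ∈ 𝒜 1) (hA : IsAffineOpen (Proj.basicOpen 𝒜 f)) :
    hA.fromSpec = Spec.map (Proj.awayToSection 𝒜 f) ≫ Proj.awayι 𝒜 f hf one_pos := by
  rw [Proj.awayι, ← Category.assoc, ← cancel_epi hA.isoSpec.hom, hA.isoSpec_hom_fromSpec]
  have : hA.isoSpec.hom ≫ Spec.map (Proj.awayToSection 𝒜 f) =
      (Proj.basicOpenIsoSpec 𝒜 f hf one_pos).hom := by
    rw [Proj.basicOpenIsoSpec_hom, Proj.basicOpenToSpec, IsAffineOpen.isoSpec_hom]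
  rw [← Category.assoc, ← Category.assoc, this, Iso.hom_inv_id, Category.id_comp]

lemma mem_basicOpen_of_mem_basicOpen_awayToSection {A : Type} [CommRing A] {σ : Type} [SetLike σ A]
    [AddSubgroupClass σ A] (𝒜 : ℕ → σ) [GradedRing 𝒜] {f g : A} (hf : f ∈ 𝒜 1) (hg : g ∈ 𝒜 1)
    {x : Proj 𝒜} (hx : x ∈ (Proj 𝒜).basicOpen ((Proj.awayToSection 𝒜 f).hom
      (Away.isLocalizationElem hf hg))) : x ∈ Proj.basicOpen 𝒜 g := by
  have hA : IsAffineOpen (Proj.basicOpen 𝒜 f) := Proj.isAffineOpen_basicOpen _ _ hf one_pos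
  have hxr := (Proj 𝒜).basicOpen_le _ hx
  rw [← SetLike.mem_coe, ← hA.range_fromSpec] at hxr
  obtain ⟨p, rfl⟩ := hxr
  have hp : p ∈ PrimeSpectrum.basicOpen ((Proj.awayToSection 𝒜 f).hom
      (Away.isLocalizationElem hf hg)) := by
    rw [← hA.fromSpec_preimage_basicOpen]; exact hx
  rw [fromSpec_eq_awayι 𝒜 hf]
  have h3 : Spec.map (Proj.awayToSection 𝒜 f) p ∈
      Proj.awayι 𝒜 f hf one_pos ⁻¹ᵁ Proj.basicOpen 𝒜 g := by
    rw [Proj.awayι_preimage_basicOpen 𝒜 hf one_pos hg one_pos]; exact hp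
  exact h3

lemma awayToSection_toSpecZero {A : Type} [CommRing A] {σ : Type} [SetLike σ A]
    [AddSubgroupClass σ A] (𝒜 : ℕ → σ) [GradedRing 𝒜] {f : A} (hf : f ∈ 𝒜 1)
    {R : CommRingCat.{0}} (φ : R ⟶ CommRingCat.of (𝒜 0)) :
    (Scheme.ΓSpecIso R).inv ≫ (Proj.toSpecZero 𝒜 ≫ Spec.map φ).appLE ⊤ (Proj.basicOpen 𝒜 f)
      (le_preimage_top _ _) =
      φ ≫ CommRingCat.ofHom (fromZeroRingHom 𝒜 _) ≫ Proj.awayToSection 𝒜 f := by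
  have hA : IsAffineOpen (Proj.basicOpen 𝒜 f) := Proj.isAffineOpen_basicOpen _ _ hf one_pos
  refine appLE_eq_of_fromSpec_comp hA ?_
  rw [fromSpec_eq_awayι 𝒜 hf, Category.assoc, Proj.awayι_toSpecZero_assoc, ← Spec.map_comp,
    ← Spec.map_comp, Category.assoc]

/-- `MvPolynomial (Fin (n + 1)) ℂ` with its grading. -/
abbrev homGrading (n : ℕ) := MvPolynomial.homogeneousSubmodule (Fin (n + 1)) ℂ

lemma X_mem_homGrading {n : ℕ} (a : Fin (n + 1)) : MvPolynomial.X a ∈ homGrading n 1 :=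
  MvPolynomial.isHomogeneous_X ℂ a

/-- The standard affine open subsets of projective space. -/
noncomputable def projChart (n : ℕ) (a : Fin (n + 1)) : (ProjSpace n).Opens :=
  Proj.basicOpen (homGrading n) (MvPolynomial.X a)

/-- The function `x_b / x_a` on a standard affine open subset. -/
noncomputable def projCoord (n : ℕ) (a b : Fin (n + 1)) : Γ(ProjSpace n, projChart n a) :=
  (Proj.awayToSection (homGrading n) (MvPolynomial.X a)).hom
    (Away.isLocalizationElem (X_mem_homGrading a) (X_mem_homGrading b))

lemma isAffineOpen_projChart (n : ℕ) (a : Fin (n + 1)) : IsAffineOpen (projChart n a) :=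
  Proj.isAffineOpen_basicOpen _ _ (X_mem_homGrading a) one_pos

lemma iSup_projChart (n : ℕ) : ⨆ a, projChart n a = ⊤ := by
  refine Proj.iSup_basicOpen_eq_top' (homGrading n) (fun a => MvPolynomial.X a)
    (fun a => ⟨1, X_mem_homGrading a⟩) ?_
  rw [eq_top_iff]
  intro p _
  induction p using MvPolynomial.induction_on with
  | C c =>
    have := (Algebra.adjoin (homGrading n 0) (Set.range fun a : Fin (n + 1) =>
      (MvPolynomial.X a : MvPolynomial (Fin (n + 1)) ℂ))).algebraMap_mem
        ⟨MvPolynomial.C c, MvPolynomial.isHomogeneous_C _ c⟩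
    exact this
  | add p q hp hq => exact add_mem (hp trivial) (hq trivial)
  | mul_X p i hp => exact mul_mem (hp trivial) (Algebra.subset_adjoin ⟨i, rfl⟩)

lemma projCoord_self (n : ℕ) (a : Fin (n + 1)) : projCoord n a a = 1 := by
  rw [projCoord]
  refine Eq.trans (congrArg _ ?_) (map_one (Proj.awayToSection (homGrading n) (MvPolynomial.X a)).hom)
  ext
  rw [Away.val_mk, HomogeneousLocalization.val_one]
  rw [← Localization.mk_one, Localization.mk_eq_mk_iff, Localization.r_iff_exists]
  exact ⟨1, by simp⟩

/-- The cocycle relation `(x_b / x_a) (x_c / x_b) = x_c / x_a`, compared on the chart of `x_a x_b`.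
It is stated for germs because the factors live on different open sets. -/
lemma germ_projCoord_mul (n : ℕ) (a b c : Fin (n + 1)) {x : ProjSpace n}
    (ha : x ∈ projChart n a) (hb : x ∈ projChart n b) :
    (ProjSpace n).presheaf.germ _ x ha (projCoord n a b) *
      (ProjSpace n).presheaf.germ _ x hb (projCoord n b c) =
      (ProjSpace n).presheaf.germ _ x ha (projCoord n a c) := by
  let 𝒜 := homGrading n
  let Xa : MvPolynomial (Fin (n + 1)) ℂ := MvPolynomial.X a
  let Xb : MvPolynomial (Fin (n + 1)) ℂ := MvPolynomial.X b
  have hab : Xa * Xb = Xa * Xb := rfl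
  have hba : Xa * Xb = Xb * Xa := mul_comm _ _
  have hx : x ∈ Proj.basicOpen 𝒜 (Xa * Xb) := by
    rw [Proj.basicOpen_mul]; exact ⟨ha, hb⟩
  have ga (z : Away 𝒜 Xa) : (ProjSpace n).presheaf.germ _ x ha
      ((Proj.awayToSection 𝒜 Xa).hom z) = (ProjSpace n).presheaf.germ _ x hx
        ((Proj.awayToSection 𝒜 (Xa * Xb)).hom (awayMap 𝒜 (X_mem_homGrading b) hab z)) := by
    have := congr(CommRingCat.Hom.hom $(Proj.awayMap_awayToSection 𝒜 (X_mem_homGrading b) hab) z)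
    refine Eq.trans ?_ (congrArg ((ProjSpace n).presheaf.germ _ x hx).hom this.symm)
    exact (congr(CommRingCat.Hom.hom $((ProjSpace n).presheaf.germ_res
      (homOfLE (Proj.basicOpen_mono 𝒜 _ _ ⟨_, hab⟩)) x hx) _)).symm
  have gb (z : Away 𝒜 Xb) : (ProjSpace n).presheaf.germ _ x hb
      ((Proj.awayToSection 𝒜 Xb).hom z) = (ProjSpace n).presheaf.germ _ x hx
        ((Proj.awayToSection 𝒜 (Xa * Xb)).hom (awayMap 𝒜 (X_mem_homGrading a) hba z)) := by
    have := congr(CommRingCat.Hom.hom $(Proj.awayMap_awayToSection 𝒜 (X_mem_homGrading a) hba) z)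
    refine Eq.trans ?_ (congrArg ((ProjSpace n).presheaf.germ _ x hx).hom this.symm)
    exact (congr(CommRingCat.Hom.hom $((ProjSpace n).presheaf.germ_res
      (homOfLE (Proj.basicOpen_mono 𝒜 _ _ ⟨_, hba⟩)) x hx) _)).symm
  refine ((congrArg₂ (· * ·) (ga _) (gb _)).trans ?_).trans (ga _).symm
  refine (map_mul ((ProjSpace n).presheaf.germ _ x hx).hom _ _).symm.trans ?_
  refine congrArg ((ProjSpace n).presheaf.germ _ x hx).hom ?_
  refine (map_mul (Proj.awayToSection 𝒜 (Xa * Xb)).hom _ _).symm.trans ?_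
  refine congrArg (Proj.awayToSection 𝒜 (Xa * Xb)).hom ?_
  ext
  rw [awayMap_mk, awayMap_mk, awayMap_mk, HomogeneousLocalization.val_mul, Away.val_mk,
    Away.val_mk, Away.val_mk, Localization.mk_mul, Localization.mk_eq_mk_iff,
    Localization.r_iff_exists]
  refine ⟨1, ?_⟩
  simp only [Submonoid.coe_mul, Xa, Xb]
  ring

lemma basicOpen_projCoord (n : ℕ) (a b : Fin (n + 1)) :
    (ProjSpace n).basicOpen (projCoord n a b) = projChart n a ⊓ projChart n b := by
  have hle := (ProjSpace n).basicOpen_le (projCoord n a b)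
  refine le_antisymm (le_inf hle fun x hx => ?_) fun x hx => ?_
  · exact mem_basicOpen_of_mem_basicOpen_awayToSection (homGrading n) _ _ hx
  · rw [Scheme.mem_basicOpen _ _ _ hx.1]
    refine IsUnit.of_mul_eq_one _ ((germ_projCoord_mul n a b a hx.1 hx.2).trans ?_)
    rw [projCoord_self]
    exact map_one ((ProjSpace n).presheaf.germ _ x hx.1).hom

/-- Constants on a standard affine open subset. -/
noncomputable def projConst (n : ℕ) (a : Fin (n + 1)) : ℂ →+* Γ(ProjSpace n, projChart n a) :=
  ((Scheme.ΓSpecIso (CommRingCat.of ℂ)).inv ≫ (ProjSpace.str n).appLE ⊤ (projChart n a)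
    (le_preimage_top _ _)).hom

lemma projConst_eq (n : ℕ) (a : Fin (n + 1)) : projConst n a =
    (Proj.awayToSection (homGrading n) (MvPolynomial.X a)).hom.comp
      ((fromZeroRingHom (homGrading n) _).comp (algebraMap ℂ (homGrading n 0))) := by
  exact congrArg CommRingCat.Hom.hom (awayToSection_toSpecZero (homGrading n) (X_mem_homGrading a)
    (CommRingCat.ofHom (algebraMap ℂ (homGrading n 0))))

lemma awayToSection_surjective (n : ℕ) (a : Fin (n + 1)) :
    Function.Bijective (Proj.awayToSection (homGrading n) (MvPolynomial.X a)).hom := by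
  have h : IsIso (Proj.awayToSection (homGrading n) (MvPolynomial.X a)) := by
    rw [← Proj.basicOpenIsoAway_hom _ _ (X_mem_homGrading a) one_pos]; infer_instance
  exact ConcreteCategory.bijective_of_isIso (Proj.awayToSection (homGrading n) (MvPolynomial.X a))

/-- Dehomogenization: a form `p` of degree `m` divided by `x_a ^ m` is `p` evaluated at the ratios
`x_b / x_a`. -/
lemma closure_projCoord (n : ℕ) (a : Fin (n + 1)) :
    Subring.closure (Set.range (projConst n a) ∪ Set.range (projCoord n a)) = ⊤ := by
  let 𝒜 := homGrading n
  let Xa : MvPolynomial (Fin (n + 1)) ℂ := MvPolynomial.X a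
  let c : ℂ →+* Away 𝒜 Xa := (fromZeroRingHom 𝒜 _).comp (algebraMap ℂ (𝒜 0))
  let e (b : Fin (n + 1)) : Away 𝒜 Xa :=
    Away.isLocalizationElem (X_mem_homGrading a) (X_mem_homGrading b)
  let ev : MvPolynomial (Fin (n + 1)) ℂ →+* Away 𝒜 Xa := MvPolynomial.eval₂Hom c e
  let v : Away 𝒜 Xa →+* Localization.Away Xa := algebraMap _ _
  have hve (b : Fin (n + 1)) : v (e b) * algebraMap (MvPolynomial (Fin (n + 1)) ℂ) _ Xa =
      algebraMap (MvPolynomial (Fin (n + 1)) ℂ) _ (MvPolynomial.X b) := by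
    change Localization.mk _ _ * _ = _
    rw [← Localization.mk_one_eq_algebraMap, ← Localization.mk_one_eq_algebraMap,
      Localization.mk_mul, Localization.mk_eq_mk_iff, Localization.r_iff_exists]
    exact ⟨1, by simp [Xa]; ring⟩
  have hvc : v.comp c = (algebraMap (MvPolynomial (Fin (n + 1)) ℂ) (Localization.Away Xa)).comp MvPolynomial.C := by
    ext z
    change Localization.mk _ _ = _
    rw [RingHom.comp_apply, ← Localization.mk_one_eq_algebraMap]
    rfl
  have hsurj : Function.Surjective ev := by
    intro z
    obtain ⟨m, p, hp, rfl⟩ := Away.mk_surjective 𝒜 (X_mem_homGrading a) z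
    refine ⟨p, HomogeneousLocalization.val_injective _ ?_⟩
    have hp' : p.IsHomogeneous m := by
      rw [smul_eq_mul, mul_one] at hp; exact hp
    have h1 := isHomogeneous_eval₂_smul (v.comp c) (fun b => v (e b)) (algebraMap _ _ Xa) hp'
    simp_rw [mul_comm (algebraMap _ _ Xa) (v (e _)), hve] at h1
    have h2 : p.eval₂ (v.comp c) (fun b => algebraMap (MvPolynomial (Fin (n + 1)) ℂ)
        (Localization.Away Xa) (MvPolynomial.X b)) = algebraMap _ _ p := by
      rw [hvc]
      have : MvPolynomial.eval₂Hom ((algebraMap (MvPolynomial (Fin (n + 1)) ℂ) (Localization.Away Xa)).comp MvPolynomial.C)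
          (fun b => algebraMap (MvPolynomial (Fin (n + 1)) ℂ) (Localization.Away Xa)
            (MvPolynomial.X b)) = algebraMap _ _ := by
        refine MvPolynomial.ringHom_ext (fun r => ?_) fun b => ?_ <;> simp
      exact congr($this p)
    have h3 : v (ev p) = p.eval₂ (v.comp c) (fun b => v (e b)) := MvPolynomial.hom_eval₂ ..
    rw [h2] at h1
    change v (ev p) = _
    rw [Away.val_mk, Localization.mk_eq_mk', IsLocalization.eq_mk'_iff_mul_eq, h3, h1, map_pow,
      mul_comm]
  rw [eq_top_iff]
  intro z _
  obtain ⟨y, rfl⟩ := (awayToSection_surjective n a).surjective z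
  obtain ⟨p, rfl⟩ := hsurj y
  induction p using MvPolynomial.induction_on with
  | C r =>
    refine Subring.subset_closure (Or.inl ⟨r, ?_⟩)
    rw [projConst_eq]
    change _ = (Proj.awayToSection (homGrading n) (MvPolynomial.X a)).hom (ev _)
    rw [show ev (MvPolynomial.C r) = c r from MvPolynomial.eval₂_C _ _ _]
    rfl
  | add p q hp hq =>
    rw [map_add]
    exact (map_add (Proj.awayToSection (homGrading n) (MvPolynomial.X a)).hom _ _).symm ▸
      add_mem (hp trivial) (hq trivial)
  | mul_X p i hp =>
    rw [map_mul]
    refine (map_mul (Proj.awayToSection (homGrading n) (MvPolynomial.X a)).hom _ _).symm ▸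
      mul_mem (hp trivial) (Subring.subset_closure (Or.inr ⟨i, ?_⟩))
    rw [show ev (MvPolynomial.X i) = e i from MvPolynomial.eval₂_X _ _ _]
    rfl

/-- Homogeneous coordinates define a ring homomorphism on each standard chart at which
they are invertible. -/
lemma exists_ringHom_projChart (n : ℕ) (a : Fin (n + 1)) {K : Type} [CommRing K] (c : ℂ →+* K)
    (v : Fin (n + 1) → K) (ha : IsUnit (v a)) : ∃ χ : Γ(ProjSpace n, projChart n a) →+* K,
      χ.comp (projConst n a) = c ∧ ∀ b, χ (projCoord n a b) * v a = v b := by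
  let 𝒜 := homGrading n
  let Xa : MvPolynomial (Fin (n + 1)) ℂ := MvPolynomial.X a
  let E : MvPolynomial (Fin (n + 1)) ℂ →+* K := MvPolynomial.eval₂Hom c v
  have hE : IsUnit (E Xa) := by
    rw [show E Xa = v a from MvPolynomial.eval₂_X _ _ _]; exact ha
  let lft : Localization.Away Xa →+* K := IsLocalization.Away.lift Xa hE
  let v' : Away 𝒜 Xa →+* Localization.Away Xa := algebraMap _ _
  let eq : Away 𝒜 Xa ≃+* Γ(ProjSpace n, projChart n a) :=
    RingEquiv.ofBijective _ (awayToSection_surjective n a)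
  refine ⟨(lft.comp v').comp eq.symm.toRingHom, ?_, fun b => ?_⟩
  · ext z
    have : eq.symm (projConst n a z) = (fromZeroRingHom 𝒜 _).comp (algebraMap ℂ (𝒜 0)) z := by
      rw [RingEquiv.symm_apply_eq, projConst_eq]; rfl
    change lft (v' (eq.symm (projConst n a z))) = c z
    rw [this]
    have h2 : v' ((fromZeroRingHom 𝒜 _).comp (algebraMap ℂ (𝒜 0)) z) =
        algebraMap (MvPolynomial (Fin (n + 1)) ℂ) _ (MvPolynomial.C z) := by
      change Localization.mk _ _ = _
      rw [← Localization.mk_one_eq_algebraMap]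
      rfl
    rw [h2, IsLocalization.Away.lift_eq]
    exact MvPolynomial.eval₂_C _ _ _
  · have : eq.symm (projCoord n a b) =
        Away.isLocalizationElem (X_mem_homGrading a) (X_mem_homGrading b) := by
      rw [RingEquiv.symm_apply_eq]; rfl
    change lft (v' (eq.symm (projCoord n a b))) * v a = _
    rw [this]
    have h2 : v' (Away.isLocalizationElem (X_mem_homGrading a) (X_mem_homGrading b)) *
        algebraMap _ _ Xa = 
        algebraMap (MvPolynomial (Fin (n + 1)) ℂ) _ (MvPolynomial.X b) := by
      change Localization.mk _ _ * _ = _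
      rw [← Localization.mk_one_eq_algebraMap, ← Localization.mk_one_eq_algebraMap,
        Localization.mk_mul, Localization.mk_eq_mk_iff, Localization.r_iff_exists]
      exact ⟨1, by simp [Xa]; ring⟩
    have h3 := congrArg lft h2
    rw [map_mul, IsLocalization.Away.lift_eq, IsLocalization.Away.lift_eq] at h3
    rw [show E Xa = v a from MvPolynomial.eval₂_X _ _ _,
      show E (MvPolynomial.X b) = v b from MvPolynomial.eval₂_X _ _ _] at h3
    exact h3

end ProjectiveCharts


/-! ### Generators of the coordinate ring of a fibre product. -/

section Generation

lemma closure_range_eq_top_of_isPushout {R A B P : CommRingCat.{0}} {f : R ⟶ A} {g : R ⟶ B}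
    {a : A ⟶ P} {b : B ⟶ P} (h : IsPushout f g a b) :
    Subring.closure (Set.range a.hom ∪ Set.range b.hom) = ⊤ := by
  set S := Subring.closure (Set.range a.hom ∪ Set.range b.hom)
  let a' : A ⟶ CommRingCat.of S := CommRingCat.ofHom
    (a.hom.codRestrict S fun x => Subring.subset_closure (Or.inl ⟨x, rfl⟩))
  let b' : B ⟶ CommRingCat.of S := CommRingCat.ofHom
    (b.hom.codRestrict S fun x => Subring.subset_closure (Or.inr ⟨x, rfl⟩))
  have hw : f ≫ a' = g ≫ b' := CommRingCat.hom_ext (RingHom.ext fun x => Subtype.ext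
    (show a.hom (f.hom x) = b.hom (g.hom x) from congrArg (fun k => k.hom x) h.w))
  let d : P ⟶ CommRingCat.of S := h.desc a' b' hw
  have hd : d ≫ CommRingCat.ofHom S.subtype = 𝟙 P := by
    refine h.hom_ext ?_ ?_
    · rw [← Category.assoc, h.inl_desc, Category.comp_id]; rfl
    · rw [← Category.assoc, h.inr_desc, Category.comp_id]; rfl
  rw [eq_top_iff]
  intro x _
  have : (d.hom x : P) = x := congr(CommRingCat.Hom.hom $hd x)
  exact this ▸ (d.hom x).2

variable {X Y Z : Scheme.{0}}

lemma isAffineOpen_pullback_inf {f : X ⟶ Z} {g : Y ⟶ Z} [IsAffine Z] {U : X.Opens} {V : Y.Opens}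
    (hU : IsAffineOpen U) (hV : IsAffineOpen V) :
    IsAffineOpen (pullback.fst f g ⁻¹ᵁ U ⊓ pullback.snd f g ⁻¹ᵁ V) := by
  have hZ : IsAffineOpen (⊤ : Z.Opens) := isAffineOpen_top Z
  have : IsAffine U := hU
  have : IsAffine V := hV
  have : IsAffine (⊤ : Z.Opens) := hZ
  exact .of_isIso (Scheme.Hom.isPullback_resLE (IsPullback.of_hasPullback f g)
    (le_preimage_top g V) (le_preimage_top f U) rfl).isoPullback.hom

lemma closure_pullback {f : X ⟶ Z} {g : Y ⟶ Z} [IsAffine Z] {U : X.Opens} {V : Y.Opens}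
    (hU : IsAffineOpen U) (hV : IsAffineOpen V) :
    Subring.closure (Set.range ((pullback.fst f g).appLE U
      (pullback.fst f g ⁻¹ᵁ U ⊓ pullback.snd f g ⁻¹ᵁ V) inf_le_left).hom ∪
      Set.range ((pullback.snd f g).appLE V
      (pullback.fst f g ⁻¹ᵁ U ⊓ pullback.snd f g ⁻¹ᵁ V) inf_le_right).hom) = ⊤ := by
  have h := (isIso_pushoutSection_iff (IsPullback.of_hasPullback f g) (le_preimage_top g V)
    (le_preimage_top f U) rfl).mp
    (isIso_pushoutSection_of_isAffineOpen _ _ _ _ (isAffineOpen_top Z) hV hU)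
  exact closure_range_eq_top_of_isPushout h

lemma closure_image_eq_top {A B : Type*} [CommRing A] [CommRing B] {f : A →+* B}
    (hf : Function.Surjective f) {s : Set A} (hs : Subring.closure s = ⊤) :
    Subring.closure (f '' s) = ⊤ := by
  rw [← RingHom.map_closure, hs, ← RingHom.range_eq_map, RingHom.range_eq_top.mpr hf]

end Generation

/-! ### Points of projective space over the function field, and the closure of a graph. -/

section Points

variable {X : Scheme.{0}}

lemma fromSpec_comp {R : CommRingCat.{0}} {U : X.Opens} (hU : IsAffineOpen U) (g : X ⟶ Spec R) :
    hU.fromSpec ≫ g =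
      Spec.map ((Scheme.ΓSpecIso R).inv ≫ g.appLE ⊤ U (le_preimage_top g U)) := by
  obtain ⟨φ, hφ⟩ := Spec.map_surjective (hU.fromSpec ≫ g)
  rw [appLE_eq_of_fromSpec_comp hU hφ.symm, hφ]

lemma fromSpecStalk_comp (s : X ⟶ SpecC) (x : X) :
    X.fromSpecStalk x ≫ s = Spec.map (CommRingCat.ofHom (stalkStr s x)) := by
  obtain ⟨U, hU, hxU, -⟩ := exists_isAffineOpen_mem_and_subset (show x ∈ (⊤ : X.Opens) from trivial)
  rw [← hU.fromSpecStalk_eq_fromSpecStalk hxU, IsAffineOpen.fromSpecStalk, Category.assoc,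
    fromSpec_comp, ← Spec.map_comp]
  congr 1
  rw [stalkStr, CommRingCat.ofHom_hom, Category.assoc]
  congr 1
  rw [Scheme.Hom.appLE, Category.assoc]
  congr 1
  exact X.presheaf.germ_res _ x hxU

lemma germ_appLE {T Y : Scheme.{0}} (q : T ⟶ Y) {O : T.Opens} {D : Y.Opens} (h : O ≤ q ⁻¹ᵁ D)
    {x : T} (hx : x ∈ O) (z : Γ(Y, D)) :
    (T.presheaf.germ O x hx).hom ((q.appLE D O h).hom z) =
      (q.stalkMap x).hom ((Y.presheaf.germ D (q x) (h hx)).hom z) := by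
  change (q.appLE D O h ≫ T.presheaf.germ O x hx).hom z =
    (Y.presheaf.germ D (q x) (h hx) ≫ q.stalkMap x).hom z
  congr 2
  refine Eq.trans ?_ (Scheme.Hom.germ_stalkMap q D x (h hx)).symm
  rw [Scheme.Hom.appLE, Category.assoc]
  congr 1
  exact T.presheaf.germ_res (homOfLE h) x hx

lemma appLE_projCoord_mul {T : Scheme.{0}} {n : ℕ} (q : T ⟶ ProjSpace n) {O : T.Opens}
    (a b c : Fin (n + 1)) (ha : O ≤ q ⁻¹ᵁ projChart n a) (hb : O ≤ q ⁻¹ᵁ projChart n b) :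
    (q.appLE _ O ha).hom (projCoord n a b) * (q.appLE _ O hb).hom (projCoord n b c) =
      (q.appLE _ O ha).hom (projCoord n a c) := by
  refine TopCat.Presheaf.section_ext T.sheaf O _ _ fun x hx => ?_
  have key (a : Fin (n + 1)) (ha : O ≤ q ⁻¹ᵁ projChart n a) (z : Γ(ProjSpace n, projChart n a)) :
      (T.presheaf.germ O x hx).hom ((q.appLE _ O ha).hom z) =
      (q.stalkMap x).hom (((ProjSpace n).presheaf.germ _ (q x) (ha hx)).hom z) := by
    exact (germ_appLE q ha hx z)
  change (T.presheaf.germ O x hx).hom _ = (T.presheaf.germ O x hx).hom _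
  rw [map_mul, key, key, key, ← map_mul]
  exact congrArg _ (germ_projCoord_mul n a b c _ _)

lemma appLE_projCoord_self {T : Scheme.{0}} {n : ℕ} (q : T ⟶ ProjSpace n) {O : T.Opens}
    (a : Fin (n + 1)) (ha : O ≤ q ⁻¹ᵁ projChart n a) :
    (q.appLE _ O ha).hom (projCoord n a a) = 1 := by
  rw [projCoord_self, map_one]

lemma appLE_injective {T Y : Scheme.{0}} (q : T ⟶ Y) {O : T.Opens} {D : Y.Opens}
    (h : O ≤ q ⁻¹ᵁ D) (h' : q ⁻¹ᵁ D ≤ O) (hq : Function.Injective (q.app D)) :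
    Function.Injective (q.appLE D O h).hom := by
  obtain rfl := le_antisymm h h'
  rw [Scheme.Hom.appLE_eq_app]
  exact hq

/-- Injectivity for preimages of affine open sets of the target extends to all open sets, because
these preimages form a basis of the image. -/
lemma toImage_app_injective {Y : Scheme.{0}} (f : X ⟶ Y) [QuasiCompact f] (U : f.image.Opens) :
    Function.Injective (f.toImage.app U) := by
  rw [injective_iff_map_eq_zero]
  intro s hs
  refine f.image.IsSheaf.section_ext fun x hx => ?_
  obtain ⟨_, ⟨_, ⟨V, hV, rfl⟩, rfl⟩, hxV, hVU⟩ :=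
    (Y.isBasis_affineOpens.of_isInducing f.imageι.isEmbedding.isInducing).exists_subset_of_mem_open
      hx U.isOpen
  have hVU' : f.imageι ⁻¹ᵁ V ≤ U := hVU
  refine ⟨f.imageι ⁻¹ᵁ V, hVU', hxV, f.toImage_app_injective ⟨V, hV⟩ ?_⟩
  rw [← ConcreteCategory.comp_apply, f.toImage.naturality]
  simp [hs]

lemma isIntegral_image {Y : Scheme.{0}} [IsIntegral X] (f : X ⟶ Y) [QuasiCompact f] :
    IsIntegral f.image := by
  have h1 : IsReduced f.image := ⟨fun U => isReduced_of_injective _ (toImage_app_injective f U)⟩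
  have h2 : IrreducibleSpace f.image := by
    have hne : Nonempty f.image := ⟨f.toImage (Classical.arbitrary X)⟩
    have hpre : PreirreducibleSpace f.image := by
      constructor
      have h3 := (PreirreducibleSpace.isPreirreducible_univ (X := X)).image f.toImage
        f.toImage.continuous.continuousOn
      have h4 := h3.closure
      rwa [Set.image_univ, f.toImage.denseRange.closure_range] at h4
    exact @IrreducibleSpace.mk _ _ hpre hne
  exact isIntegral_of_irreducibleSpace_of_isReduced _

lemma fromSpecStalk_appLE {x : X} {U : X.Opens} (hx : x ∈ U)
    (h : ⊤ ≤ X.fromSpecStalk x ⁻¹ᵁ U) :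
    (X.fromSpecStalk x).appLE U ⊤ h ≫ (Scheme.ΓSpecIso _).hom = X.presheaf.germ U x hx := by
  rw [Scheme.Hom.appLE, Scheme.fromSpecStalk_app hx, Category.assoc, Category.assoc, Category.assoc,
    ← Functor.map_comp_assoc]
  have (m : Opposite.op (⊤ : (Spec (X.presheaf.stalk x)).Opens) ⟶ Opposite.op ⊤) :
      (Spec (X.presheaf.stalk x)).presheaf.map m = 𝟙 _ := by
    rw [show m = 𝟙 _ from Subsingleton.elim _ _, CategoryTheory.Functor.map_id]
  rw [this, Category.id_comp, Iso.inv_hom_id, Category.comp_id]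

lemma specMap_fromSpec_appLE {K : CommRingCat.{0}} {U : X.Opens} (hU : IsAffineOpen U)
    (χ : Γ(X, U) ⟶ K) (h : ⊤ ≤ (Spec.map χ ≫ hU.fromSpec) ⁻¹ᵁ U) :
    (Spec.map χ ≫ hU.fromSpec).appLE U ⊤ h ≫ (Scheme.ΓSpecIso K).hom = χ := by
  rw [← Iso.eq_comp_inv, ← Scheme.Hom.appLE_comp_appLE (Spec.map χ) hU.fromSpec _ ⊤ ⊤
    (by rw [hU.fromSpec_preimage_self]) le_top, fromSpec_appLE_top]
  refine Eq.trans ?_ (Scheme.ΓSpecIso_inv_naturality χ).symm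
  congr 1

lemma exists_hom_eq {A B : CommRingCat.{0}} (f : A →+* B) : ∃ g : A ⟶ B, g.hom = f :=
  ⟨CommRingCat.ofHom f, rfl⟩

/-- The point of projective space with given homogeneous coordinates. -/
lemma exists_projPoint {K : CommRingCat.{0}} (c : ℂ →+* K) (n : ℕ) (v : Fin (n + 1) → K)
    (hv : ∀ b, IsUnit (v b)) : ∃ q : Spec K ⟶ ProjSpace n,
      q ≫ ProjSpace.str n = Spec.map (CommRingCat.ofHom c) ∧
      ∀ b, ∃ hb : ⊤ ≤ q ⁻¹ᵁ projChart n b, ∀ a,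
        (Scheme.ΓSpecIso K).hom.hom ((q.appLE _ ⊤ hb).hom (projCoord n b a)) * v b = v a := by
  obtain ⟨χ, hχ, hχ'⟩ := exists_ringHom_projChart n 0 c v (hv 0)
  obtain ⟨χ, rfl⟩ := exists_hom_eq (A := Γ(ProjSpace n, projChart n 0)) χ
  have hA := isAffineOpen_projChart n 0
  refine ⟨Spec.map χ ≫ hA.fromSpec, ?_, ?_⟩
  · rw [Category.assoc, fromSpec_comp, ← Spec.map_comp]
    congr 1
    ext z
    exact congr($hχ z)
  have h0 : ⊤ ≤ (Spec.map χ ≫ hA.fromSpec) ⁻¹ᵁ projChart n 0 := by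
    rw [Scheme.Hom.comp_preimage, hA.fromSpec_preimage_self]
    exact le_preimage_top _ _
  have h0' (y) : (Scheme.ΓSpecIso K).hom.hom
      (((Spec.map χ ≫ hA.fromSpec).appLE _ ⊤ h0).hom y) = χ.hom y :=
    congr(CommRingCat.Hom.hom $(specMap_fromSpec_appLE hA χ h0) y)
  generalize Spec.map χ ≫ hA.fromSpec = q at h0 h0'
  intro b
  -- The point is built in the chart of the coordinate `0`; it lies in the other charts because each
  -- ratio `v b / v 0` is invertible.
  have hb : ⊤ ≤ q ⁻¹ᵁ projChart n b := by
    have h1 : IsUnit ((q.appLE _ ⊤ h0).hom (projCoord n 0 b)) := by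
      refine (MulEquiv.isUnit_map (Scheme.ΓSpecIso K).commRingCatIsoToRingEquiv).mp ?_
      have h2 := isUnit_of_mul_isUnit_left (hχ' b ▸ hv b)
      rw [← h0'] at h2
      exact h2
    have h2 := Scheme.basicOpen_of_isUnit _ h1
    rw [Scheme.basicOpen_appLE, basicOpen_projCoord] at h2
    intro x hx
    exact (h2.ge hx).2.2
  refine ⟨hb, fun a => ?_⟩
  have h1 := congrArg (Scheme.ΓSpecIso K).hom.hom (appLE_projCoord_mul q 0 b a h0 hb)
  rw [map_mul, h0', h0'] at h1
  rw [← hχ' b, ← hχ' a, ← h1]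
  ring

/-- The closure of the graph of the rational map to projective space with given homogeneous
coordinates. -/
theorem exists_closure_graph [IsIntegral X] (s : X ⟶ SpecC) (n : ℕ)
    (v : Fin (n + 1) → X.functionField) (hv : ∀ b, v b ≠ 0) :
    ∃ (X' : Scheme.{0}) (ε : X' ⟶ pullback s (ProjSpace.str n))
      (θ : Spec X.functionField ⟶ X'), IsClosedImmersion ε ∧ IsIntegral X' ∧
      (∀ W, Function.Injective (θ.app W)) ∧
      θ ≫ ε ≫ pullback.fst _ _ = X.fromSpecStalk (genericPoint X) ∧
      ∀ b, ∃ hb : ⊤ ≤ (θ ≫ ε ≫ pullback.snd _ _) ⁻¹ᵁ projChart n b,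
        ∀ a, (Scheme.ΓSpecIso _).hom.hom (((θ ≫ ε ≫ pullback.snd _ _).appLE _ ⊤ hb).hom
          (projCoord n b a)) * v b = v a := by
  obtain ⟨q, hq, hq'⟩ := exists_projPoint (stalkStr s (genericPoint X)) n v fun b => (hv b).isUnit
  have hw : X.fromSpecStalk (genericPoint X) ≫ s = q ≫ ProjSpace.str n := by
    rw [fromSpecStalk_comp, hq]
  -- The graph over the generic point. Its scheme-theoretic image is integral, and the functions on
  -- it embed into the function field.
  let z : Spec X.functionField ⟶ pullback s (ProjSpace.str n) := pullback.lift _ q hw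
  have hz1 : z.toImage ≫ z.imageι ≫ pullback.fst _ _ = X.fromSpecStalk (genericPoint X) := by
    rw [← Category.assoc, Scheme.Hom.toImage_imageι]; exact pullback.lift_fst _ _ _
  have hz2 : z.toImage ≫ z.imageι ≫ pullback.snd _ _ = q := by
    rw [← Category.assoc, Scheme.Hom.toImage_imageι]; exact pullback.lift_snd _ _ _
  have hdom : IsDomain X.functionField := inferInstance
  have hK : IsIntegral (Spec X.functionField) := inferInstance
  have hqc : QuasiCompact z := inferInstance
  have hint : IsIntegral z.image := isIntegral_image z
  refine ⟨z.image, z.imageι, z.toImage, inferInstance, hint, toImage_app_injective z, hz1, ?_⟩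
  rw [hz2]
  exact hq'

end Points


/-! ### A criterion for closed immersions over an affine open set. -/

section AppSurjective

variable {T Y : Scheme.{0}} (q : T ⟶ Y)

lemma appLE_surjective {O : T.Opens} {D : Y.Opens}
    (h : O ≤ q ⁻¹ᵁ D) (h' : q ⁻¹ᵁ D ≤ O) (hq : Function.Surjective (q.app D)) :
    Function.Surjective (q.appLE D O h).hom := by
  obtain rfl := le_antisymm h h'
  rw [Scheme.Hom.appLE_eq_app]
  exact hq

lemma app_surjective_of_appLE {O : T.Opens} {D : Y.Opens}
    (h : O ≤ q ⁻¹ᵁ D) (h' : q ⁻¹ᵁ D ≤ O) (hq : Function.Surjective (q.appLE D O h).hom) :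
    Function.Surjective (q.app D) := by
  obtain rfl := le_antisymm h h'
  rw [Scheme.Hom.appLE_eq_app] at hq
  exact hq

lemma app_surjective_congr {D D' : Y.Opens} (h : D = D') (hq : Function.Surjective (q.app D)) :
    Function.Surjective (q.app D') := by
  subst h; exact hq

lemma isClosedImmersion_restrict {D : Y.Opens} (hD : IsAffineOpen D)
    (hqD : IsAffineOpen (q ⁻¹ᵁ D)) (hq : Function.Surjective (q.app D)) :
    IsClosedImmersion (q ∣_ D) := by
  have : IsAffine D := hD
  have : IsAffine (q ⁻¹ᵁ D) := hqD
  refine IsClosedImmersion.of_surjective_of_isAffine _ ?_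
  have h1 : Function.Surjective (q.app (D.ι ''ᵁ ⊤)) :=
    app_surjective_congr q (by rw [Scheme.Hom.image_top_eq_opensRange, Scheme.Opens.opensRange_ι]) hq
  rw [Scheme.Hom.appTop, morphismRestrict_app']
  exact appLE_surjective q _ (image_morphismRestrict_preimage q D ⊤).ge h1

end AppSurjective

/-! ### Affine charts of closed subschemes of a product. -/

section GraphCharts

variable {X Y Z X' : Scheme.{0}} {s : X ⟶ Z} {g : Y ⟶ Z} (ε : X' ⟶ pullback s g)

/-- The open subset of a subscheme of `X × Y` lying over `U` and `D`. -/
noncomputable def boxOpen (U : X.Opens) (D : Y.Opens) : X'.Opens :=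
  (ε ≫ pullback.fst s g) ⁻¹ᵁ U ⊓ (ε ≫ pullback.snd s g) ⁻¹ᵁ D

lemma boxOpen_le_fst (U : X.Opens) (D : Y.Opens) :
    boxOpen ε U D ≤ (ε ≫ pullback.fst s g) ⁻¹ᵁ U := inf_le_left

lemma boxOpen_le_snd (U : X.Opens) (D : Y.Opens) :
    boxOpen ε U D ≤ (ε ≫ pullback.snd s g) ⁻¹ᵁ D := inf_le_right

variable [IsAffine Z] [IsClosedImmersion ε]

lemma isAffineOpen_boxOpen {U : X.Opens} {D : Y.Opens} (hU : IsAffineOpen U)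
    (hD : IsAffineOpen D) : IsAffineOpen (boxOpen ε U D) :=
  (isAffineOpen_pullback_inf (f := s) (g := g) hU hD).preimage ε

lemma closure_boxOpen {U : X.Opens} {D : Y.Opens} (hU : IsAffineOpen U) (hD : IsAffineOpen D) :
    Subring.closure
      (Set.range ((ε ≫ pullback.fst s g).appLE U _ (boxOpen_le_fst ε U D)).hom ∪
        Set.range ((ε ≫ pullback.snd s g).appLE D _ (boxOpen_le_snd ε U D)).hom) = ⊤ := by
  have hP := isAffineOpen_pullback_inf (f := s) (g := g) hU hD
  have h := closure_image_eq_top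
    (appLE_surjective ε (O := boxOpen ε U D) le_rfl le_rfl (ε.app_surjective _ hP))
    (closure_pullback (f := s) (g := g) hU hD)
  rw [Set.image_union, ← Set.range_comp, ← Set.range_comp] at h
  rw [← Scheme.Hom.appLE_comp_appLE ε (pullback.fst s g) U
      (pullback.fst s g ⁻¹ᵁ U ⊓ pullback.snd s g ⁻¹ᵁ D) (boxOpen ε U D) inf_le_left le_rfl,
    ← Scheme.Hom.appLE_comp_appLE ε (pullback.snd s g) D
      (pullback.fst s g ⁻¹ᵁ U ⊓ pullback.snd s g ⁻¹ᵁ D) (boxOpen ε U D) inf_le_right le_rfl]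
  exact h

lemma closure_boxOpen_of_closure {U : X.Opens} {D : Y.Opens} (hU : IsAffineOpen U)
    (hD : IsAffineOpen D) {ι : Type*} {y : ι → Γ(Y, D)}
    (hy : Subring.closure (Set.range (g.appLE ⊤ D (le_preimage_top g D)).hom ∪ Set.range y) = ⊤) :
    Subring.closure
      (Set.range ((ε ≫ pullback.fst s g).appLE U _ (boxOpen_le_fst ε U D)).hom ∪
        Set.range fun i => ((ε ≫ pullback.snd s g).appLE D _ (boxOpen_le_snd ε U D)).hom (y i)) =
      ⊤ := by
  rw [eq_top_iff, ← closure_boxOpen ε hU hD, Subring.closure_le]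
  refine Set.union_subset (Set.subset_union_left.trans Subring.subset_closure) ?_
  rintro _ ⟨a, rfl⟩
  rw [SetLike.mem_coe, ← Subring.mem_comap]
  refine (hy.symm.le.trans ?_) (Subring.mem_top a)
  rw [Subring.closure_le]
  rintro _ (⟨z, rfl⟩ | ⟨i, rfl⟩)
  · refine Subring.subset_closure (Or.inl ⟨(s.appLE ⊤ U (le_preimage_top s U)).hom z, ?_⟩)
    rw [← CommRingCat.comp_apply, ← CommRingCat.comp_apply, Scheme.Hom.appLE_comp_appLE,
      Scheme.Hom.appLE_comp_appLE]
    simp only [Category.assoc, pullback.condition]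
  · exact Subring.subset_closure (Or.inr ⟨i, rfl⟩)

end GraphCharts

/-! ### Evaluation in the function field. -/

section GenericPoint

variable {X' : Scheme.{0}} {K : CommRingCat.{0}} (θ : Spec K ⟶ X')

/-- Evaluation of functions along a morphism from the spectrum of `K`. -/
noncomputable def evalAlong {W : X'.Opens} (hW : ⊤ ≤ θ ⁻¹ᵁ W) : Γ(X', W) →+* K :=
  (θ.appLE W ⊤ hW ≫ (Scheme.ΓSpecIso K).hom).hom

/-- Identities between functions on the closure of the graph are verified in the function field
through this injection. -/
lemma evalAlong_injective (hθ : ∀ W, Function.Injective (θ.app W)) {W : X'.Opens}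
    (hW : ⊤ ≤ θ ⁻¹ᵁ W) : Function.Injective (evalAlong θ hW) := by
  rw [evalAlong, CommRingCat.hom_comp]
  exact (Scheme.ΓSpecIso K).commRingCatIsoToRingEquiv.injective.comp
    (appLE_injective θ hW le_top (hθ W))

lemma evalAlong_appLE {Y : Scheme.{0}} (f : X' ⟶ Y) {W : X'.Opens} {U : Y.Opens}
    (hW : ⊤ ≤ θ ⁻¹ᵁ W) (h : W ≤ f ⁻¹ᵁ U) (hU : ⊤ ≤ (θ ≫ f) ⁻¹ᵁ U) (a : Γ(Y, U)) :
    evalAlong θ hW ((f.appLE U W h).hom a) =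
      (Scheme.ΓSpecIso K).hom.hom (((θ ≫ f).appLE U ⊤ hU).hom a) := by
  rw [← Scheme.Hom.appLE_comp_appLE θ f U W ⊤ h hW]
  rfl

end GenericPoint

/-! ### The blowup as the closure of a graph. -/

section BlowupOfCoordinates

variable {X : Scheme.{0}}

lemma closure_range_str_projCoord (n : ℕ) (b : Fin (n + 1)) :
    Subring.closure (Set.range ((ProjSpace.str n).appLE ⊤ (projChart n b)
      (le_preimage_top _ _)).hom ∪ Set.range (projCoord n b)) = ⊤ := by
  rw [eq_top_iff, ← closure_projCoord n b]
  refine Subring.closure_mono (Set.union_subset_union_left _ ?_)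
  rintro _ ⟨z, rfl⟩
  exact ⟨(Scheme.ΓSpecIso (CommRingCat.of ℂ)).inv.hom z, rfl⟩

/-- On each `V j` the generators of `J` are proportional to one vector `v` over the function field,
so the closure of the graph of `v` has over `V j` the charts `V j × {x_b ≠ 0}`. Their coordinate
rings are generated by the functions on `V j` and the ratios `v c / v b`, as in an affine blowup
algebra. The last two conditions serve the projection to `ℙⁿ`: `hlj` places everything over `{x_b ≠
0}` inside the single affine set `V (l b)`, and `hl` says that the functions there are generated by
ratios of coordinates, so the projection is a closed immersion. -/
theorem exists_blowup_of_coordinates [IsIntegral X] (s : X ⟶ SpecC) (J : X.IdealSheafData) (n : ℕ)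
    (v : Fin (n + 1) → X.functionField) (hv : ∀ b, v b ≠ 0) {κ : Type} (V : κ → X.affineOpens)
    (hne : ∀ j, genericPoint X ∈ (V j).1) (hcov : ∀ x : X, ∃ j, x ∈ (V j).1)
    (F : ∀ j, Fin (n + 1) → Γ(X, (V j).1)) (u : κ → X.functionField)
    (hF : ∀ j b, (X.presheaf.germ _ _ (hne j)).hom (F j b) = u j * v b)
    (hu : ∀ j, u j ≠ 0)
    (hJ : ∀ j, J.ideal (V j) = Ideal.span (Set.range (F j))) (l : Fin (n + 1) → κ)
    (hl : ∀ b, ∃ G : Set Γ(X, (V (l b)).1),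
      Subring.closure (Set.range (s.appLE ⊤ (V (l b)).1 (le_preimage_top _ _)).hom ∪ G) = ⊤ ∧
      ∀ a ∈ G, (X.presheaf.germ _ _ (hne (l b))).hom a = 0 ∨
        ∃ c, (X.presheaf.germ _ _ (hne (l b))).hom a * v b = v c)
    (hlj : ∀ b j, ∃ a : Γ(X, (V j).1), X.basicOpen a ≤ (V (l b)).1 ∧
      ∃ c, (X.presheaf.germ _ _ (hne j)).hom a * v c = v b) :
    ∃ (X' : Scheme.{0}) (ε : X' ⟶ pullback s (ProjSpace.str n)), IsClosedImmersion ε ∧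
      IsIntegral X' ∧ (∀ j, Nonempty (BlowupCharts J (ε ≫ pullback.fst _ _) (V j))) ∧
      IsClosedImmersion (ε ≫ pullback.snd _ _) := by
  obtain ⟨X', ε, θ, hε, hint, hθ, hξ, hq⟩ := exists_closure_graph s n v hv
  choose hb hq using hq
  have hUj (j : κ) : IsAffineOpen (V j).1 := (V j).2
  have hD := isAffineOpen_projChart n
  have hξ' (j : κ) : ⊤ ≤ (θ ≫ ε ≫ pullback.fst _ _) ⁻¹ᵁ (V j).1 := by
    rw [hξ]
    intro x _
    have h1 : genericPoint X ∈ (V j).1 := hne j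
    have h2 : X.fromSpecStalk (genericPoint X) x ⤳ genericPoint X := by
      have : X.fromSpecStalk (genericPoint X) x ∈ Set.range (X.fromSpecStalk (genericPoint X)) :=
        ⟨x, rfl⟩
      rwa [Scheme.range_fromSpecStalk] at this
    exact h2.mem_open (V j).1.isOpen h1
  have hW (j : κ) (b : Fin (n + 1)) : ⊤ ≤ θ ⁻¹ᵁ boxOpen ε (V j).1 (projChart n b) :=
    fun x hx => ⟨hξ' j hx, hb b hx⟩
  have hinj (j b) := evalAlong_injective θ hθ (hW j b)
  have ev1 (j b) (a : Γ(X, (V j).1)) : evalAlong θ (hW j b)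
      (((ε ≫ pullback.fst _ _).appLE _ _ (boxOpen_le_fst ε _ _)).hom a) =
        (X.presheaf.germ _ _ (hne j)).hom a := by
    rw [evalAlong_appLE θ _ _ _ (hξ' j)]
    have key : ∀ (k : Spec X.functionField ⟶ X) (_ : k = X.fromSpecStalk (genericPoint X)) (h),
        (Scheme.ΓSpecIso X.functionField).hom.hom ((k.appLE (V j).1 ⊤ h).hom a) =
          (X.presheaf.germ _ _ (hne j)).hom a := by
      rintro _ rfl h
      exact congr(CommRingCat.Hom.hom $(fromSpecStalk_appLE (hne j) h) a)
    exact key _ hξ _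
  have ev2 (j b c) : evalAlong θ (hW j b)
      (((ε ≫ pullback.snd _ _).appLE _ _ (boxOpen_le_snd ε _ _)).hom (projCoord n b c)) * v b =
        v c := by
    rw [evalAlong_appLE θ _ _ _ (hb b)]
    exact hq b c
  have hdomK : IsDomain X.functionField := inferInstance
  refine ⟨X', ε, hε, hint, fun j => ⟨?_⟩, ?_⟩
  · exact
    { ι := Fin (n + 1)
      f := F j
      W := fun b => boxOpen ε (V j).1 (projChart n b)
      isAffineOpen_W := fun b => isAffineOpen_boxOpen ε (hUj j) (hD b)
      W_le := fun b => boxOpen_le_fst ε _ _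
      t := fun b c => ((ε ≫ pullback.snd _ _).appLE _ _ (boxOpen_le_snd ε _ _)).hom
        (projCoord n b c)
      ideal_eq := hJ j
      le_iSup := by
        intro y hy
        have h1 : (ε ≫ pullback.snd _ _) y ∈ (⊤ : (ProjSpace n).Opens) := trivial
        rw [← iSup_projChart n, Opens.mem_iSup] at h1
        obtain ⟨b, hb⟩ := h1
        exact Opens.mem_iSup.mpr ⟨b, hy, hb⟩
      injective := fun b => by
        refine Function.Injective.of_comp (f := evalAlong θ (hW j b)) ?_
        intro a a' haa
        simp only [Function.comp_apply, ev1] at haa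
        exact germ_injective_of_isIntegral _ _ (hne j) haa
      mem_nonZeroDivisors := fun b => by
        have hd : IsDomain Γ(X', boxOpen ε (V j).1 (projChart n b)) :=
          (hinj j b).isDomain _
        rw [mem_nonZeroDivisors_iff_ne_zero]
        intro h0
        have := ev1 j b (F j b)
        rw [h0, map_zero, hF] at this
        exact mul_ne_zero (hu j) (hv b) this.symm
      map_f := fun b c => by
        apply hinj j b
        rw [map_mul, ev1, ev1, hF, hF]
        linear_combination (-u j) * ev2 j b c
      closure_eq := fun b => closure_boxOpen_of_closure ε (hUj j) (hD b)
        (closure_range_str_projCoord n b)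
      basicOpen_le := fun b c => by
        rw [Scheme.basicOpen_appLE, basicOpen_projCoord]
        exact fun x hx => ⟨hx.1.1, hx.2.2⟩ }
  · have hle (b) : (ε ≫ pullback.snd _ _) ⁻¹ᵁ projChart n b =
        boxOpen ε (V (l b)).1 (projChart n b) := by
      refine le_antisymm (fun y hy => ⟨?_, hy⟩) inf_le_right
      obtain ⟨j, hj⟩ := hcov ((ε ≫ pullback.fst _ _) y)
      obtain ⟨a, ha, c, hc⟩ := hlj b j
      -- Over `x_b ≠ 0` the function `a` is inverse to the coordinate `x_c / x_b`, so the point lies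
      -- in `X.basicOpen a`, hence over `V (l b)`.
      have h1 : ((ε ≫ pullback.fst _ _).appLE _ _ (boxOpen_le_fst ε (V j).1 (projChart n b))).hom a *
          ((ε ≫ pullback.snd _ _).appLE _ _ (boxOpen_le_snd ε (V j).1 (projChart n b))).hom
            (projCoord n b c) = 1 := by
        apply hinj j b
        rw [map_mul, ev1, map_one]
        refine mul_right_cancel₀ (hv b) ?_
        rw [mul_assoc, ev2, hc, one_mul]
      have h2 := Scheme.basicOpen_of_isUnit _ (IsUnit.of_mul_eq_one _ h1)
      rw [Scheme.basicOpen_appLE] at h2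
      exact ha (h2.ge ⟨hj, hy⟩).2
    refine IsZariskiLocalAtTarget.of_iSup_eq_top (P := @IsClosedImmersion) (projChart n)
      (iSup_projChart n) fun b => ?_
    have hWb := isAffineOpen_boxOpen ε (hUj (l b)) (hD b)
    refine isClosedImmersion_restrict _ (hD b) (hle b ▸ hWb) ?_
    refine app_surjective_of_appLE _ (O := boxOpen ε (V (l b)).1 (projChart n b)) (hle b).ge
      (hle b).le ?_
    rw [← RingHom.range_eq_top, eq_top_iff, ← closure_boxOpen ε (hUj (l b)) (hD b),
      Subring.closure_le]
    refine Set.union_subset ?_ fun _ h => h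
    rintro _ ⟨a, rfl⟩
    obtain ⟨G, hG, hGc⟩ := hl b
    rw [SetLike.mem_coe, ← Subring.mem_comap]
    refine (hG.symm.le.trans ?_) (Subring.mem_top a)
    rw [Subring.closure_le]
    rintro _ (⟨z, rfl⟩ | ha)
    · refine ⟨((ProjSpace.str n).appLE ⊤ (projChart n b) (le_preimage_top _ _)).hom z, ?_⟩
      rw [← CommRingCat.comp_apply, ← CommRingCat.comp_apply, Scheme.Hom.appLE_comp_appLE,
        Scheme.Hom.appLE_comp_appLE]
      simp only [Category.assoc, pullback.condition]
    · rename_i a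
      rcases hGc a ha with h0 | ⟨c, hc⟩
      · have : a = 0 := germ_injective_of_isIntegral _ _ (hne (l b)) (h0.trans (map_zero _).symm)
        rw [this]
        exact zero_mem _
      · refine ⟨projCoord n b c, hinj (l b) b (mul_right_cancel₀ (hv b) ?_)⟩
        rw [ev2, ev1, hc]

end BlowupOfCoordinates


/-! ### Projective morphisms are proper. -/

section Projective

attribute [local instance] MvPolynomial.gradedAlgebra

instance isProper_projSpace_str (n : ℕ) : IsProper (ProjSpace.str n) := by
  have h0 : IsScalarTower ℂ (homGrading n 0) (MvPolynomial (Fin (n + 1)) ℂ) :=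
    IsScalarTower.of_algebraMap_eq (R := ℂ) (S := homGrading n 0)
      (A := MvPolynomial (Fin (n + 1)) ℂ) fun _ => rfl
  have h1 : Algebra.FiniteType (homGrading n 0) (MvPolynomial (Fin (n + 1)) ℂ) :=
    Algebra.FiniteType.of_restrictScalars_finiteType ℂ _ _
  have h2 : Function.Surjective (algebraMap ℂ (homGrading n 0)) := by
    rintro ⟨p, hp⟩
    have hp' : p.IsHomogeneous 0 := hp
    refine ⟨p.coeff 0, Subtype.ext ?_⟩
    exact ((MvPolynomial.totalDegree_eq_zero_iff_eq_C).mp (by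
      have := hp'.totalDegree_le; omega)).symm
  have h3 : IsClosedImmersion (Spec.map (CommRingCat.ofHom (algebraMap ℂ (homGrading n 0)))) :=
    IsClosedImmersion.spec_of_surjective _ h2
  have h4 : IsProper (Proj.toSpecZero (homGrading n)) := inferInstance
  exact MorphismProperty.comp_mem @IsProper (Proj.toSpecZero (homGrading n)) _ h4 inferInstance

lemma IsProjective.isProper {X : Scheme.{0}} {s : X ⟶ SpecC} (h : IsProjective s) : IsProper s := by
  obtain ⟨n, e, he, rfl⟩ := h
  infer_instance

lemma IsProjectiveMorphism.isProper {X Y : Scheme.{0}} {s : X ⟶ SpecC} {π : Y ⟶ X}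
    (h : IsProjectiveMorphism s π) : IsProper π := by
  obtain ⟨n, e, he, rfl⟩ := h
  infer_instance

lemma IsProjective.isLocallyNoetherian {X : Scheme.{0}} {s : X ⟶ SpecC} (h : IsProjective s) :
    IsLocallyNoetherian X := by
  have := h.isProper
  exact LocallyOfFiniteType.isLocallyNoetherian s

end Projective

/-! ### Existence and projectivity of the blowup. -/

section ExistsBlowup

variable {X : Scheme.{0}}

lemma genericPoint_mem [IrreducibleSpace X] {U : X.Opens} {x : X} (hx : x ∈ U) :
    genericPoint X ∈ U :=
  (genericPoint_specializes x).mem_open U.isOpen hx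

/-- The blowup of an integral projective scheme along a nonzero ideal sheaf exists, and is
projective. -/
theorem exists_blowup [IsIntegral X] (s : X ⟶ SpecC) (hs : IsProjective s) (J : X.IdealSheafData)
    (hJ : stalkIdeal J (genericPoint X) ≠ ⊥) :
    ∃ (X' : Scheme.{0}) (π : X' ⟶ X), IsIntegral X' ∧ IsProjective (π ≫ s) ∧
      IsProjectiveMorphism s π ∧
      ∀ x, ∃ U : X.affineOpens, x ∈ U.1 ∧ Nonempty (BlowupCharts J π U) := by
  classical
  have hnoeth := hs.isLocallyNoetherian
  obtain ⟨N, e, he, rfl⟩ := hs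
  let η := genericPoint X
  let O (a : Fin (N + 1)) : X.Opens := e ⁻¹ᵁ projChart N a
  have hO (a) : IsAffineOpen (O a) := (isAffineOpen_projChart N a).preimage e
  -- Standard charts not meeting `X` are discarded, so that the generic point lies in every `V j`.
  let κ := {a : Fin (N + 1) // η ∈ O a}
  let V (j : κ) : X.affineOpens := ⟨O j.1, hO j.1⟩
  have hcovO (x : X) : ∃ a, x ∈ O a := by
    have h1 : e x ∈ (⊤ : (ProjSpace N).Opens) := trivial
    rw [← iSup_projChart N, Opens.mem_iSup] at h1
    exact h1
  have hcov (x : X) : ∃ j, x ∈ (V j).1 := by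
    obtain ⟨a, ha⟩ := hcovO x
    exact ⟨⟨a, genericPoint_mem ha⟩, ha⟩
  have hne (j : κ) : η ∈ (V j).1 := j.2
  let γ (j : κ) : Γ(X, (V j).1) →+* X.functionField := (X.presheaf.germ _ η (hne j)).hom
  have hγ (j : κ) : Function.Injective (γ j) := germ_injective_of_isIntegral _ _ (hne j)
  let c (j : κ) (b : Fin (N + 1)) : Γ(X, (V j).1) := (e.appLE _ _ le_rfl).hom (projCoord N j.1 b)
  have hcB (j : κ) (b) : X.basicOpen (c j b) ≤ O b := by
    have h1 : X.basicOpen (c j b) = _ := Scheme.basicOpen_appLE e (O j.1) (projChart N j.1) le_rfl _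
    rw [h1, basicOpen_projCoord]
    exact fun x hx => hx.2.2
  obtain ⟨a₀, -⟩ := hcov η
  -- Homogeneous coordinates of the generic point, normalised by `w a₀ = 1`.
  let w (b : Fin (N + 1)) : X.functionField := γ a₀ (c a₀ b)
  have hcw (j : κ) (b) : γ j (c j b) * w j.1 = w b := by
    have h1 (j : κ) (b) : γ j (c j b) = (e.stalkMap η).hom
        (((ProjSpace N).presheaf.germ _ (e η) (hne j)).hom (projCoord N j.1 b)) :=
      germ_appLE e le_rfl (hne j) _
    change γ j (c j b) * γ a₀ (c a₀ j.1) = γ a₀ (c a₀ b)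
    rw [h1, h1, h1, mul_comm]
    refine (map_mul (e.stalkMap η).hom _ _).symm.trans (congrArg _ ?_)
    exact germ_projCoord_mul N a₀.1 j.1 b (hne a₀) (hne j)
  have hcself (j : κ) : c j j.1 = 1 := appLE_projCoord_self e j.1 le_rfl
  have hw (j : κ) : w j.1 ≠ 0 := by
    intro h0
    have := hcw j a₀.1
    rw [h0, mul_zero] at this
    change 0 = γ a₀ (c a₀ a₀.1) at this
    rw [hcself, map_one] at this
    exact zero_ne_one this
  have hw0 (b : Fin (N + 1)) (hb : η ∉ O b) : w b = 0 := by
    by_contra hne0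
    refine hb (hcB a₀ b ?_)
    rw [Scheme.mem_basicOpen _ _ _ (hne a₀)]
    exact (Ne.isUnit hne0 : IsUnit (w b))
  have hgen (j : κ) : ∃ G : Finset Γ(X, (V j).1), J.ideal (V j) = Ideal.span (G : Set _) ∧
      0 ∉ G := by
    have hN : IsNoetherianRing Γ(X, (V j).1) := IsLocallyNoetherian.component_noetherian (V j)
    obtain ⟨G, hG⟩ := (isNoetherianRing_iff_ideal_fg _).mp hN (J.ideal (V j))
    -- Zero is removed because all homogeneous coordinates of the graph must be nonzero.
    refine ⟨G.erase 0, ?_, by simp⟩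
    rw [Finset.coe_erase, Ideal.span, Submodule.span_sdiff_singleton_zero]
    exact hG.symm
  choose G hG hG0 using hgen
  -- A section `g` of `J` over `V i` extends to `V j` after multiplication by a large power of `x_i
  -- / x_j`; that is, `x_i ^ d g` is a global section of `J(d)`. As there are finitely many triples,
  -- one exponent `d` serves for all.
  have hgerm (j i : κ) (g : G i) : ∃ d₀, ∀ d, d₀ ≤ d → ∃ h ∈ J.ideal (V j),
      γ j h = γ j (c j i.1) ^ d * γ i g := by
    have hVj : IsAffineOpen (V j).1 := hO j.1
    let B := X.affineBasicOpen (U := V j) (c j i.1)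
    have hBi : B ≤ V i := hcB j i.1
    have hBj : B ≤ V j := X.basicOpen_le _
    have h1 : (X.presheaf.map (homOfLE hBi).op).hom g ∈ J.ideal B :=
      J.ideal_le_comap_ideal hBi (hG i ▸ Ideal.subset_span g.2)
    rw [← J.map_ideal hBj] at h1
    have hloc : IsLocalization.Away (c j i.1) Γ(X, X.basicOpen (c j i.1)) :=
      hVj.isLocalization_basicOpen _
    obtain ⟨⟨⟨h, hh⟩, ⟨_, d₀, rfl⟩⟩, hhd⟩ :=
      (IsLocalization.mem_map_algebraMap_iff (Submonoid.powers (c j i.1))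
        Γ(X, X.basicOpen (c j i.1))).mp h1
    have hηB : η ∈ B.1 := by
      change η ∈ X.basicOpen _
      rw [Scheme.mem_basicOpen _ _ _ (hne j)]
      refine Ne.isUnit fun h0 => hw i ?_
      rw [← hcw j i.1]
      exact mul_eq_zero_of_left h0 _
    have h2 := (map_mul (X.presheaf.germ B.1 η hηB).hom _ _).symm.trans
      (congrArg (X.presheaf.germ B.1 η hηB).hom hhd)
    have r1 (z : Γ(X, (V i).1)) : (X.presheaf.germ B.1 η hηB).hom
        ((X.presheaf.map (homOfLE hBi).op).hom z) = γ i z :=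
      congr(CommRingCat.Hom.hom $(X.presheaf.germ_res (homOfLE hBi) η hηB) z)
    have r2 (z : Γ(X, (V j).1)) : (X.presheaf.germ B.1 η hηB).hom
        ((X.presheaf.map (homOfLE hBj).op).hom z) = γ j z :=
      congr(CommRingCat.Hom.hom $(X.presheaf.germ_res (homOfLE hBj) η hηB) z)
    have h3 : γ i g * γ j (c j i.1 ^ d₀) = γ j h := by
      rw [← r1, ← r2, ← r2]; exact h2
    refine ⟨d₀, fun d hd => ⟨c j i.1 ^ (d - d₀) * h, Ideal.mul_mem_left _ _ hh, ?_⟩⟩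
    rw [map_mul, ← h3, map_pow, map_pow, mul_left_comm, ← pow_add, Nat.sub_add_cancel hd, mul_comm]
  choose d₀ hd₀ using fun p : κ × (Σ i : κ, G i) => hgerm p.1 p.2.1 p.2.2
  obtain ⟨d, hd⟩ := Finite.exists_le d₀
  choose h hhJ hhγ using fun p => hd₀ p d (hd p)
  let σ := κ × (Σ i : κ, G i)
  have hσ : Nonempty σ := by
    have hG1 : (G a₀).Nonempty := by
      by_contra hcon
      rw [Finset.not_nonempty_iff_eq_empty] at hcon
      refine hJ ?_
      rw [stalkIdeal_eq_map J (hne a₀), hG a₀, hcon]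
      simp
    exact ⟨(a₀, ⟨a₀, ⟨_, hG1.choose_spec⟩⟩)⟩
  obtain ⟨n, hn⟩ := Nat.exists_eq_succ_of_ne_zero (Fintype.card_ne_zero (α := σ))
  let E : σ ≃ Fin (n + 1) := Fintype.equivFinOfCardEq hn
  -- The coordinates are the products of a linear coordinate `x_k` with a section `x_i ^ d g` of
  -- `J(d)`. Fixing the second factor and varying `k` recovers the ratios `x_k / x_j`, which is what
  -- makes the projection to `ℙⁿ` a closed immersion.
  let v (p : σ) : X.functionField := w p.1.1 * (w p.2.1.1 ^ d * γ p.2.1 p.2.2.1)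
  have hv (p : σ) : v p ≠ 0 := by
    refine mul_ne_zero (hw _) (mul_ne_zero (pow_ne_zero _ (hw _)) fun h0 => ?_)
    have h1 : p.2.2.1 = 0 := hγ _ (h0.trans (map_zero _).symm)
    exact hG0 p.2.1 (h1 ▸ p.2.2.2)
  have hswap (j k : κ) (q : Σ i : κ, G i) : γ j (c j k.1) * v (j, q) = v (k, q) := by
    change γ j (c j k.1) * (w j.1 * _) = w k.1 * _
    rw [← mul_assoc, hcw]
  have hhγ' (j : κ) (q : Σ i : κ, G i) : γ j (h (j, q)) = γ j (c j q.1.1) ^ d * γ q.1 q.2 :=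
    hhγ (j, q)
  have hhJ' (j : κ) (q : Σ i : κ, G i) : h (j, q) ∈ J.ideal (V j) := hhJ (j, q)
  have hv' (p : σ) : v p = w p.1.1 * (w p.2.1.1 ^ d * γ p.2.1 p.2.2) := rfl
  clear_value v w
  refine Exists.elim (exists_blowup_of_coordinates
    (e ≫ ProjSpace.str N) J n (fun b => v (E.symm b))
    (fun b => hv _) V hne hcov (fun j b => c j (E.symm b).1.1 * h (j, (E.symm b).2))
    (fun j => (w j.1)⁻¹ ^ (d + 1)) ?_ (fun j => pow_ne_zero _ (inv_ne_zero (hw j))) ?_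
    (fun b => (E.symm b).1) ?_ ?_) ?_
  · intro j b
    change γ j _ = _
    rw [map_mul, hhγ', hv']
    generalize E.symm b = p
    obtain ⟨k, i, g⟩ := p
    have h1 := hcw j k.1
    have h2 := hcw j i.1
    have hwj := hw j
    rw [eq_div_of_mul_eq hwj h1, eq_div_of_mul_eq hwj h2]
    ring
  · intro j
    refine le_antisymm ?_ ?_
    · rw [hG j, Ideal.span_le]
      intro g hg
      refine Ideal.subset_span ⟨E (j, ⟨j, ⟨g, hg⟩⟩), hγ j ?_⟩
      beta_reduce
      rw [Equiv.symm_apply_apply, map_mul, hhγ', hcself, map_one, one_pow, one_mul, one_mul]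
    · rw [Ideal.span_le]
      rintro _ ⟨b, rfl⟩
      exact Ideal.mul_mem_left _ _ (hhJ' j (E.symm b).2)
  · intro b
    generalize E.symm b = p
    refine ⟨Set.range (c p.1), ?_, ?_⟩
    · have h1 := closure_image_eq_top (appLE_surjective e (O := O p.1.1) le_rfl le_rfl
        (e.app_surjective _ (isAffineOpen_projChart N p.1.1)))
        (closure_range_str_projCoord N p.1.1)
      rw [Set.image_union, ← Set.range_comp, ← Set.range_comp] at h1
      rw [← Scheme.Hom.appLE_comp_appLE e (ProjSpace.str N) ⊤ (projChart N p.1.1) (V p.1).1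
        (le_preimage_top _ _) le_rfl]
      exact h1
    · rintro _ ⟨k, rfl⟩
      by_cases hk : η ∈ O k
      · exact Or.inr ⟨E (⟨k, hk⟩, p.2), by simpa using hswap p.1 ⟨k, hk⟩ p.2⟩
      · left
        have := hcw p.1 k
        rw [hw0 k hk] at this
        exact (mul_eq_zero.mp this).resolve_right (hw _)
  · intro b j
    exact ⟨c j (E.symm b).1.1, hcB _ _, E (j, (E.symm b).2), by
      simpa using hswap j (E.symm b).1 (E.symm b).2⟩
  · rintro X' ⟨ε, hε, hint, hch, hcl⟩
    refine ⟨X', ε ≫ pullback.fst _ _, hint, ⟨n, ε ≫ pullback.snd _ _, hcl, ?_⟩, ⟨n, ε, hε, rfl⟩,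
      fun x => ?_⟩
    · simp only [Category.assoc, pullback.condition]
    · obtain ⟨j, hj⟩ := hcov x
      exact ⟨V j, hj, hch j⟩

end ExistsBlowup


/-! ### Local rings of complex schemes as complex algebras. -/

section StalkAlgebra

variable {X : Scheme.{0}} (s : X ⟶ SpecC)

/-- The map `ℂ → Γ(X, U)` induced by the structure morphism. -/
noncomputable def sectionStr (U : X.Opens) : ℂ →+* Γ(X, U) :=
  ((Scheme.ΓSpecIso (CommRingCat.of ℂ)).inv ≫ s.appLE ⊤ U (le_preimage_top s U)).hom

lemma germ_comp_sectionStr {U : X.Opens} {x : X} (hx : x ∈ U) :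
    (X.presheaf.germ U x hx).hom.comp (sectionStr s U) = stalkStr s x := by
  unfold sectionStr stalkStr
  rw [← CommRingCat.hom_comp, Category.assoc]
  congr 2
  rw [Scheme.Hom.appLE, Category.assoc]
  congr 1
  exact X.presheaf.germ_res _ x hx

lemma stalkSpecializes_comp_stalkStr {x y : X} (h : x ⤳ y) :
    (X.presheaf.stalkSpecializes h).hom.comp (stalkStr s y) = stalkStr s x := by
  unfold stalkStr
  rw [← CommRingCat.hom_comp, Category.assoc, Category.assoc, X.presheaf.germ_stalkSpecializes]

lemma finiteType_sectionStr [LocallyOfFiniteType s] {U : X.Opens} (hU : IsAffineOpen U) :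
    (sectionStr s U).FiniteType := by
  have h1 := s.finiteType_appLE (isAffineOpen_top SpecC) hU (le_preimage_top s U)
  exact h1.comp (.of_surjective _
    (Scheme.ΓSpecIso (CommRingCat.of ℂ)).symm.commRingCatIsoToRingEquiv.surjective)

lemma stalkStr_id_bijective (y : SpecC) : Function.Bijective (stalkStr (𝟙 SpecC) y) := by
  refine ⟨(stalkStr (𝟙 SpecC) y).injective, fun z => ?_⟩
  have hU : IsAffineOpen (⊤ : SpecC.Opens) := isAffineOpen_top _
  have hl := hU.isLocalization_stalk ⟨y, trivial⟩
  let _ : Algebra Γ(SpecC, ⊤) (SpecC.presheaf.stalk y) :=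
    (SpecC.presheaf.germ ⊤ y trivial).hom.toAlgebra
  have hl' : IsLocalization.AtPrime (SpecC.presheaf.stalk y)
    (hU.primeIdealOf ⟨y, trivial⟩).asIdeal := hl
  obtain ⟨⟨r, t⟩, hrt⟩ := IsLocalization.surj
    (hU.primeIdealOf ⟨y, trivial⟩).asIdeal.primeCompl z
  have hs (r : Γ(SpecC, ⊤)) : ∃ c, stalkStr (𝟙 SpecC) y c = algebraMap _ (SpecC.presheaf.stalk y) r := by
    have h2 := germ_comp_sectionStr (𝟙 SpecC) (U := ⊤) (x := y) trivial
    refine ⟨(Scheme.ΓSpecIso (CommRingCat.of ℂ)).hom r, ?_⟩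
    rw [← h2]
    change (SpecC.presheaf.germ ⊤ y trivial).hom _ = (SpecC.presheaf.germ ⊤ y trivial).hom r
    congr 1
    simp only [sectionStr, Scheme.Hom.appLE, CommRingCat.hom_comp, RingHom.comp_apply]
    simp
    rfl
  obtain ⟨c, hc⟩ := hs r
  obtain ⟨d, hd⟩ := hs t
  have hd0 : d ≠ 0 := by
    rintro rfl
    have := IsLocalization.map_units (SpecC.presheaf.stalk y) t
    rw [← hd, map_zero] at this
    exact not_isUnit_zero this
  refine ⟨c * d⁻¹, ?_⟩
  rw [map_mul, hc, ← hrt, ← hd, mul_assoc, ← map_mul, mul_inv_cancel₀ hd0, map_one, mul_one]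

lemma stalkStr_eq_comp (x : X) :
    stalkStr s x = (s.stalkMap x).hom.comp (stalkStr (𝟙 SpecC) (s x)) := by
  have := stalkMap_comp_stalkStr (𝟙 SpecC) s x
  rw [this]
  simp only [Category.comp_id]

instance isIso_ofHom_stalkStr_id (y : SpecC) :
    IsIso (CommRingCat.ofHom (stalkStr (𝟙 SpecC) y)) :=
  (ConcreteCategory.isIso_iff_bijective _).mpr (stalkStr_id_bijective y)

lemma formallySmooth_stalkStr_iff (x : X) :
    (stalkStr s x).FormallySmooth ↔ (s.stalkMap x).hom.FormallySmooth := by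
  rw [stalkStr_eq_comp]
  exact RingHom.FormallySmooth.respectsIso.cancel_left_isIso
    (CommRingCat.ofHom (stalkStr (𝟙 SpecC) (s x))) (s.stalkMap x)

lemma essFiniteType_stalk [LocallyOfFiniteType s] (x : X) :
    letI := stalkAlgebra s x
    Algebra.EssFiniteType ℂ (X.presheaf.stalk x) := by
  have h1 := LocallyOfFiniteType.stalkMap (f := s) x
  have h2 : (stalkStr s x).EssFiniteType := by
    rw [stalkStr_eq_comp]
    exact (RingHom.EssFiniteType.respectsIso.cancel_left_isIso
      (CommRingCat.ofHom (stalkStr (𝟙 SpecC) (s x))) (s.stalkMap x)).mpr h1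
  exact h2

lemma formallySmooth_stalk_iff (x : X) :
    (letI := stalkAlgebra s x; Algebra.FormallySmooth ℂ (X.presheaf.stalk x)) ↔
      (s.stalkMap x).hom.FormallySmooth := formallySmooth_stalkStr_iff s x

/-- The smooth locus is open and is described by formal smoothness of the stalk maps. The local ring
of `Spec ℂ` is `ℂ`, so the condition can be read over `ℂ`. -/
lemma smoothAt_iff [LocallyOfFinitePresentation s] (x : X) :
    SmoothAt s x ↔ (letI := stalkAlgebra s x; Algebra.FormallySmooth ℂ (X.presheaf.stalk x)) := by
  rw [formallySmooth_stalk_iff, ← Scheme.Hom.mem_smoothLocus]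
  constructor
  · rintro ⟨U, hx, hU⟩
    have h1 := Scheme.Hom.smoothLocus_eq_top (U.ι ≫ s)
    rw [← Scheme.Hom.preimage_smoothLocus_eq] at h1
    have h2 : (⟨x, hx⟩ : U) ∈ U.ι ⁻¹ᵁ s.smoothLocus := h1 ▸ trivial
    exact h2
  · intro hx
    refine ⟨s.smoothLocus, hx, ?_⟩
    rw [← Scheme.Hom.smoothLocus_eq_top_iff, ← Scheme.Hom.preimage_smoothLocus_eq]
    simp

lemma smooth_iff_forall_smoothAt [LocallyOfFinitePresentation s] :
    Smooth s ↔ ∀ x, letI := stalkAlgebra s x; Algebra.FormallySmooth ℂ (X.presheaf.stalk x) := by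
  rw [← Scheme.Hom.smoothLocus_eq_top_iff]
  refine ⟨fun h x => ?_, fun h => ?_⟩
  · rw [formallySmooth_stalk_iff, ← Scheme.Hom.mem_smoothLocus, h]; trivial
  · refine top_le_iff.mp fun x _ => ?_
    rw [Scheme.Hom.mem_smoothLocus, ← formallySmooth_stalk_iff]
    exact h x

lemma isLocalization_germ {U : X.Opens} (hU : IsAffineOpen U) {x : X} (hx : x ∈ U) :
    letI := (X.presheaf.germ U x hx).hom.toAlgebra
    IsLocalization.AtPrime (X.presheaf.stalk x) (hU.primeIdealOf ⟨x, hx⟩).asIdeal :=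
  hU.isLocalization_stalk ⟨x, hx⟩

lemma residueTrivial_stalk [LocallyOfFiniteType s] {x : X} (hx : IsClosed {x}) :
    letI := stalkAlgebra s x
    ResidueTrivial ℂ (X.presheaf.stalk x) := by
  obtain ⟨U, hU, hxU, -⟩ := exists_isAffineOpen_mem_and_subset (show x ∈ (⊤ : X.Opens) from trivial)
  let _ := stalkAlgebra s x
  let _ : Algebra ℂ Γ(X, U) := (sectionStr s U).toAlgebra
  let _ := (X.presheaf.germ U x hxU).hom.toAlgebra
  have h1 : Algebra.FiniteType ℂ Γ(X, U) := finiteType_sectionStr s hU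
  have h2 : IsScalarTower ℂ Γ(X, U) (X.presheaf.stalk x) :=
    IsScalarTower.of_algebraMap_eq' (germ_comp_sectionStr s hxU).symm
  have h3 := hU.primeIdealOf_isMaximal_of_isClosed ⟨x, hxU⟩ hx
  have h4 := isLocalization_germ hU hxU
  exact residueTrivial_localization _ (residueTrivial_of_isMaximal (k := ℂ) (hU.primeIdealOf ⟨x, hxU⟩).asIdeal)

lemma isLocalization_stalkSpecializes {x y : X} (h : x ⤳ y) :
    letI := (X.presheaf.stalkSpecializes h).hom.toAlgebra
    ∃ M : Submonoid (X.presheaf.stalk y), IsLocalization M (X.presheaf.stalk x) := by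
  obtain ⟨U, hU, hyU, -⟩ := exists_isAffineOpen_mem_and_subset (show y ∈ (⊤ : X.Opens) from trivial)
  have hxU : x ∈ U := h.mem_open U.isOpen hyU
  let _ := (X.presheaf.stalkSpecializes h).hom.toAlgebra
  let _ : Algebra Γ(X, U) (X.presheaf.stalk x) := (X.presheaf.germ U x hxU).hom.toAlgebra
  let _ : Algebra Γ(X, U) (X.presheaf.stalk y) := (X.presheaf.germ U y hyU).hom.toAlgebra
  have h2 : IsScalarTower Γ(X, U) (X.presheaf.stalk y) (X.presheaf.stalk x) :=
    IsScalarTower.of_algebraMap_eq' congr(CommRingCat.Hom.hom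
      $(X.presheaf.germ_stalkSpecializes hyU h)).symm
  have hx := isLocalization_germ hU hxU
  have hy := isLocalization_germ hU hyU
  refine ⟨_, IsLocalization.isLocalization_of_submonoid_le (X.presheaf.stalk y)
    (X.presheaf.stalk x) (hU.primeIdealOf ⟨y, hyU⟩).asIdeal.primeCompl
    (hU.primeIdealOf ⟨x, hxU⟩).asIdeal.primeCompl fun r hr hr' => ?_⟩
  refine hr ((IsLocalization.AtPrime.to_map_mem_maximal_iff (X.presheaf.stalk y) _ r).mp ?_)
  by_contra hcon
  rw [IsLocalRing.mem_maximalIdeal, mem_nonunits_iff, not_not] at hcon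
  have h3 := hcon.map (algebraMap (X.presheaf.stalk y) (X.presheaf.stalk x))
  rw [← IsScalarTower.algebraMap_apply] at h3
  exact (IsLocalRing.mem_maximalIdeal _).mp
    ((IsLocalization.AtPrime.to_map_mem_maximal_iff (X.presheaf.stalk x) _ r).mpr hr') h3

end StalkAlgebra

/-! ### Ranks of differentials and dimension. -/

section Finrank

variable {X : Scheme.{0}} (s : X ⟶ SpecC)

lemma finrank_kaehlerDifferential_localization {R O : Type} [CommRing R] [CommRing O] [Algebra ℂ R]
    [Algebra ℂ O] [Algebra R O] [IsScalarTower ℂ R O] (M : Submonoid R) [IsLocalization M O]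
    [Nontrivial O] [Module.Free R Ω[R⁄ℂ]] :
    Module.finrank O Ω[O⁄ℂ] = Module.finrank R Ω[R⁄ℂ] := by
  have : Algebra.FormallyEtale R O := Algebra.FormallyEtale.of_isLocalization M
  have : Nontrivial R := (algebraMap R O).domain_nontrivial
  rw [← (KaehlerDifferential.tensorKaehlerEquivOfFormallyEtale ℂ R O).finrank_eq,
    Module.finrank_baseChange]

lemma finrank_stalk_of_smoothOfRelativeDimension (n : ℕ) [SmoothOfRelativeDimension n s] (x : X) :
    letI := stalkAlgebra s x
    Module.finrank (X.presheaf.stalk x) Ω[X.presheaf.stalk x⁄ℂ] = n := by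
  obtain ⟨U, hU, V, hV, hx, e, h⟩ :=
    SmoothOfRelativeDimension.exists_isStandardSmoothOfRelativeDimension (n := n) (f := s) x
  have hU' : U = ⊤ := by
    refine top_le_iff.mp fun y _ => ?_
    have : y = s x := Subsingleton.elim (α := PrimeSpectrum ℂ) _ _
    exact this ▸ e hx
  subst hU'
  let _ := stalkAlgebra s x
  let _ : Algebra ℂ Γ(X, V) := (sectionStr s V).toAlgebra
  let _ := (X.presheaf.germ V x hx).hom.toAlgebra
  have h2 : IsScalarTower ℂ Γ(X, V) (X.presheaf.stalk x) :=
    IsScalarTower.of_algebraMap_eq' (germ_comp_sectionStr s hx).symm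
  have h3 : (sectionStr s V).IsStandardSmoothOfRelativeDimension n :=
    (RingHom.isStandardSmoothOfRelativeDimension_respectsIso.cancel_left_isIso
      (Scheme.ΓSpecIso (CommRingCat.of ℂ)).inv (s.appLE ⊤ V e)).mpr h
  have h4 : Algebra.IsStandardSmoothOfRelativeDimension n ℂ Γ(X, V) := h3
  have h5 : Algebra.IsStandardSmooth ℂ Γ(X, V) := h4.isStandardSmooth
  have h6 := isLocalization_germ hV hx
  have : Nontrivial Γ(X, V) := (algebraMap Γ(X, V) (X.presheaf.stalk x)).domain_nontrivial
  rw [finrank_kaehlerDifferential_localization (R := Γ(X, V))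
    (hV.primeIdealOf ⟨x, hx⟩).asIdeal.primeCompl]
  exact Module.finrank_eq_of_rank_eq
    (Algebra.IsStandardSmoothOfRelativeDimension.rank_kaehlerDifferential n)

/-- Every nonempty affine open set has dimension equal to the rank of the differentials of the
function field. This dimension is at most that of `X`, and bounds the dimensions of the local rings,
whose supremum is the dimension of `X`. -/
lemma finrank_functionField [IsIntegral X] [LocallyOfFiniteType s] {n : ℕ}
    (hdim : topologicalKrullDim X = n) :
    letI := stalkAlgebra s (genericPoint X)
    Module.finrank X.functionField Ω[X.functionField⁄ℂ] = n := by
  let _ := stalkAlgebra s (genericPoint X)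
  have key (x : X) : ∃ (R : Type) (_ : CommRing R), ringKrullDim (X.presheaf.stalk x) ≤ ringKrullDim R ∧
      ringKrullDim R ≤ topologicalKrullDim X ∧
      (Module.finrank X.functionField Ω[X.functionField⁄ℂ] : WithBot ℕ∞) = ringKrullDim R := by
    obtain ⟨U, hU, hxU, -⟩ :=
      exists_isAffineOpen_mem_and_subset (show x ∈ (⊤ : X.Opens) from trivial)
    have hne : Nonempty U := ⟨⟨x, hxU⟩⟩
    have hη : genericPoint X ∈ U := genericPoint_mem hxU
    let _ : Algebra ℂ Γ(X, U) := (sectionStr s U).toAlgebra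
    have h1 : Algebra.FiniteType ℂ Γ(X, U) := finiteType_sectionStr s hU
    have h2 : IsScalarTower ℂ Γ(X, U) X.functionField :=
      IsScalarTower.of_algebraMap_eq' (germ_comp_sectionStr s hη).symm
    have h3 : IsFractionRing Γ(X, U) X.functionField :=
      functionField_isFractionRing_of_isAffineOpen X U hU
    refine ⟨Γ(X, U), inferInstance, ?_, ?_,
      finrank_kaehlerDifferential_eq_ringKrullDim ℂ Γ(X, U) X.functionField⟩
    · let _ := (X.presheaf.germ U x hxU).hom.toAlgebra
      have h6 := isLocalization_germ hU hxU
      rw [IsLocalization.AtPrime.ringKrullDim_eq_height (hU.primeIdealOf ⟨x, hxU⟩).asIdeal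
        (X.presheaf.stalk x)]
      exact Ideal.height_le_ringKrullDim_of_isPrime
    · rw [← PrimeSpectrum.topologicalKrullDim_eq_ringKrullDim]
      exact (hU.fromSpec.isOpenEmbedding.isInducing).topologicalKrullDim_le
  refine le_antisymm ?_ ?_ |> fun h : (Module.finrank X.functionField Ω[X.functionField⁄ℂ] :
    WithBot ℕ∞) = n => by exact_mod_cast h
  · obtain ⟨R, _, -, h2, h3⟩ := key (genericPoint X)
    rw [h3, ← hdim]
    exact h2
  · rw [← hdim, topologicalKrullDim,
      Order.krullDim_eq_of_orderIso (irreducibleSetEquivPoints (α := X)),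
      Order.krullDim_eq_iSup_coheight]
    refine iSup_le fun x => ?_
    rw [← ringKrullDim_stalk_eq_coheight]
    obtain ⟨R, _, h1, -, h3⟩ := key x
    rw [h3]
    exact h1

end Finrank


/-! ### Effective Cartier divisors checked on stalks. -/

section CartierStalk

lemma exists_notMem_forall_mul_mem {R : Type*} [CommRing R] [IsNoetherianRing R] {p : Ideal R}
    [p.IsPrime] {I K : Ideal R} (H : ∀ j ∈ I, ∃ f ∉ p, f * j ∈ K) :
    ∃ f ∉ p, ∀ j ∈ I, f * j ∈ K := by
  classical
  obtain ⟨G, rfl⟩ := (isNoetherianRing_iff_ideal_fg R).mp inferInstance I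
  choose! F hFp hF using H
  refine ⟨∏ j ∈ G, F j, fun h => ?_, fun j hj => ?_⟩
  · obtain ⟨j, hj, hjp⟩ := (Ideal.IsPrime.prod_mem_iff).mp h
    exact hFp j (Ideal.subset_span hj) hjp
  · induction hj using Submodule.span_induction with
    | mem j hj =>
      rw [← Finset.prod_erase_mul _ _ hj, mul_assoc]
      exact Ideal.mul_mem_left _ _ (hF j (Ideal.subset_span hj))
    | zero => rw [mul_zero]; exact K.zero_mem
    | add x y _ _ hx hy => rw [mul_add]; exact K.add_mem hx hy
    | smul c x _ hx => rw [smul_eq_mul, mul_left_comm]; exact Ideal.mul_mem_left _ _ hx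

lemma exists_notMem_forall_mul_mem_of_map_le {R : Type*} (O : Type*) [CommRing R]
    [IsNoetherianRing R] [CommRing O] [Algebra R O] (p : Ideal R) [p.IsPrime]
    [IsLocalization.AtPrime O p] {I K : Ideal R}
    (H : I.map (algebraMap R O) ≤ K.map (algebraMap R O)) :
    ∃ f ∉ p, ∀ j ∈ I, f * j ∈ K := by
  refine exists_notMem_forall_mul_mem fun j hj => ?_
  obtain ⟨f, hf⟩ := (IsLocalization.algebraMap_mem_map_algebraMap_iff p.primeCompl O _ _).mp
    (H (Ideal.mem_map_of_mem _ hj))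
  exact ⟨f, hf⟩

/-- Spreading out: a numerator `r` of the generator differs from it by a unit. Both the inclusion `I
⊆ (r)` and the vanishing of the annihilator of `r` involve finitely generated ideals, so each holds
after inverting one element outside `p`. The localization is any model `T`, so that sections over a
basic open set may be used. -/
lemma exists_localization_principal {R O : Type*} [CommRing R] [IsNoetherianRing R] [CommRing O]
    [Algebra R O] (p : Ideal R) [p.IsPrime] [IsLocalization.AtPrime O p] (I : Ideal R) {c : O}
    (hc : c ∈ nonZeroDivisors O) (hI : I.map (algebraMap R O) = Ideal.span {c}) :
    ∃ f ∉ p, ∃ r : R, ∀ (T : Type) [CommRing T] [Algebra R T] [IsLocalization.Away f T],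
      algebraMap R T r ∈ nonZeroDivisors T ∧
        I.map (algebraMap R T) = Ideal.span {algebraMap R T r} := by
  classical
  have hcI : c ∈ I.map (algebraMap R O) := hI ▸ Ideal.mem_span_singleton_self c
  obtain ⟨⟨⟨r, hr⟩, t⟩, hrt⟩ :=
    (IsLocalization.mem_map_algebraMap_iff p.primeCompl O).mp hcI
  have htu := IsLocalization.map_units O t
  have hrO : algebraMap R O r ∈ nonZeroDivisors O := by
    rw [← hrt]; exact mul_mem hc htu.mem_nonZeroDivisors
  have hspan : I.map (algebraMap R O) = Ideal.span {algebraMap R O r} := by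
    rw [hI, ← hrt, Ideal.span_singleton_mul_right_unit htu]
  have h2 : ∀ j ∈ (⊥ : Ideal R).colon {r}, ∃ f ∉ p, f * j = 0 := by
    intro j hj
    rw [Submodule.mem_colon_singleton, Submodule.mem_bot, smul_eq_mul] at hj
    have h3 : algebraMap R O j = 0 := by
      refine (mul_right_mem_nonZeroDivisors_eq_zero_iff hrO).mp ?_
      rw [← map_mul, hj, map_zero]
    obtain ⟨f, hf⟩ := (IsLocalization.map_eq_zero_iff p.primeCompl O j).mp h3
    exact ⟨f, f.2, hf⟩
  obtain ⟨f₁, hf₁, H₁⟩ := exists_notMem_forall_mul_mem_of_map_le O p (I := I)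
    (K := Ideal.span {r}) (by rw [Ideal.map_span, Set.image_singleton, ← hspan])
  obtain ⟨f₂, hf₂, H₂⟩ := exists_notMem_forall_mul_mem (I := (⊥ : Ideal R).colon {r}) (K := ⊥)
    (by simpa using h2)
  refine ⟨f₁ * f₂, fun h => (Ideal.IsPrime.mem_or_mem ‹_› h).elim hf₁ hf₂, r, ?_⟩
  intro T _ _ hT
  have hu : IsUnit (algebraMap R T f₁) ∧ IsUnit (algebraMap R T f₂) := by
    have := IsLocalization.Away.algebraMap_isUnit (S := T) (f₁ * f₂)
    rwa [map_mul, IsUnit.mul_iff] at this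
  constructor
  · rw [mem_nonZeroDivisors_iff_right]
    intro z hz
    obtain ⟨⟨z', ⟨_, n, rfl⟩⟩, hz'⟩ := IsLocalization.surj (Submonoid.powers (f₁ * f₂)) z
    have hun : IsUnit (algebraMap R T ((f₁ * f₂) ^ n)) := by
      rw [map_pow, map_mul]; exact (hu.1.mul hu.2).pow n
    have h4 : algebraMap R T (z' * r) = 0 := by
      rw [map_mul]
      refine Eq.trans (congrArg (· * _) hz'.symm) ?_
      rw [mul_right_comm, hz, zero_mul]
    obtain ⟨⟨_, m, rfl⟩, hm⟩ := (IsLocalization.map_eq_zero_iff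
      (Submonoid.powers (f₁ * f₂)) T _).mp h4
    have h5 : f₂ * ((f₁ * f₂) ^ m * z') = 0 := by
      refine H₂ _ ?_
      rw [Submodule.mem_colon_singleton, Submodule.mem_bot, smul_eq_mul, mul_assoc]
      exact hm
    have h6 := congrArg (algebraMap R T) h5
    rw [map_zero, map_mul, map_mul, map_pow, map_mul, hu.2.mul_right_eq_zero,
      ((hu.1.mul hu.2).pow m).mul_right_eq_zero] at h6
    refine hun.mul_left_eq_zero.mp ?_
    exact hz'.trans h6
  · refine le_antisymm (Ideal.map_le_iff_le_comap.mpr fun j hj => ?_) ?_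
    · have h4 := Ideal.mem_map_of_mem (algebraMap R T) (H₁ j hj)
      rw [Ideal.map_span, Set.image_singleton, map_mul] at h4
      exact (Ideal.unit_mul_mem_iff_mem _ hu.1).mp h4
    · rw [Ideal.span_singleton_le_iff_mem]
      exact Ideal.mem_map_of_mem _ hr

variable {Y : Scheme.{0}}

/-- On a locally noetherian scheme, being an effective Cartier divisor can be checked on stalks. -/
theorem isEffectiveCartier_of_stalk [IsLocallyNoetherian Y] {J : Y.IdealSheafData}
    (H : ∀ y, ∃ c ∈ nonZeroDivisors (Y.presheaf.stalk y), stalkIdeal J y = Ideal.span {c}) :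
    IsEffectiveCartier J := by
  intro y
  obtain ⟨c, hc, hJ⟩ := H y
  obtain ⟨U, hU, hyU, -⟩ := exists_isAffineOpen_mem_and_subset (show y ∈ (⊤ : Y.Opens) from trivial)
  let U' : Y.affineOpens := ⟨U, hU⟩
  have hN : IsNoetherianRing Γ(Y, U) := IsLocallyNoetherian.component_noetherian U'
  rw [stalkIdeal_eq_map J (U := U') hyU] at hJ
  let _ := (Y.presheaf.germ U y hyU).hom.toAlgebra
  have hloc := isLocalization_germ hU hyU
  obtain ⟨f, hf, r, hr⟩ := exists_localization_principal (hU.primeIdealOf ⟨y, hyU⟩).asIdeal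
    (J.ideal U') hc hJ
  have hloc2 : IsLocalization.Away f Γ(Y, Y.basicOpen f) := hU.isLocalization_basicOpen f
  obtain ⟨h1, h2⟩ := hr Γ(Y, Y.basicOpen f)
  refine ⟨⟨Y.basicOpen f, hU.basicOpen f⟩, ?_, _, h1, ?_⟩
  · change y ∈ Y.basicOpen f
    rw [Scheme.mem_basicOpen _ _ _ hyU]
    exact (IsLocalization.AtPrime.isUnit_to_map_iff (Y.presheaf.stalk y)
      (hU.primeIdealOf ⟨y, hyU⟩).asIdeal f).mpr hf
  · rw [← h2]
    exact (J.map_ideal (U := ⟨Y.basicOpen f, hU.basicOpen f⟩) (V := U') (Y.basicOpen_le f)).symm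

end CartierStalk

/-! ### Stalks of the ideal of a closed subscheme. -/

section ClosedImmersion

variable {S X : Scheme.{0}} (i : S ⟶ X) [IsClosedImmersion i]

/-- An element whose image in the stalk of `S` is zero has a numerator killed by a function on `S`
that is invertible at `p`. This function lifts to `X`, and the lift is invertible at `i p` because
the stalk map is local. -/
lemma stalkIdeal_ker (p : S) : stalkIdeal i.ker (i p) = RingHom.ker (i.stalkMap p).hom := by
  obtain ⟨U, hU, hxU, -⟩ :=
    exists_isAffineOpen_mem_and_subset (show i p ∈ (⊤ : X.Opens) from trivial)
  let U' : X.affineOpens := ⟨U, hU⟩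
  have hV : IsAffineOpen (i ⁻¹ᵁ U) := hU.preimage i
  have hp : p ∈ i ⁻¹ᵁ U := hxU
  rw [stalkIdeal_eq_map _ (U := U') hxU, Scheme.Hom.ker_apply]
  have hg (r : Γ(X, U)) : (i.stalkMap p).hom ((X.presheaf.germ U (i p) hxU).hom r) =
      (S.presheaf.germ (i ⁻¹ᵁ U) p hp).hom ((i.app U).hom r) :=
    congr(CommRingCat.Hom.hom $(i.germ_stalkMap U p hxU) r)
  refine le_antisymm (Ideal.map_le_iff_le_comap.mpr fun r hr => ?_) fun z hz => ?_
  · rw [RingHom.mem_ker] at hr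
    rw [Ideal.mem_comap, RingHom.mem_ker]
    exact (hg r).trans ((congrArg _ hr).trans (map_zero _))
  · let _ := (X.presheaf.germ U (i p) hxU).hom.toAlgebra
    have hloc := isLocalization_germ hU hxU
    obtain ⟨⟨r, t⟩, hrt⟩ := IsLocalization.surj (hU.primeIdealOf ⟨i p, hxU⟩).asIdeal.primeCompl z
    have htu := IsLocalization.map_units (X.presheaf.stalk (i p)) t
    have h0 : (S.presheaf.germ (i ⁻¹ᵁ U) p hp).hom ((i.app U).hom r) = 0 := by
      rw [← hg]
      refine (congrArg (i.stalkMap p).hom hrt.symm).trans ?_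
      rw [map_mul, (RingHom.mem_ker).mp hz, zero_mul]
    let _ : Algebra Γ(S, i ⁻¹ᵁ U) (S.presheaf.stalk p) :=
      (S.presheaf.germ (i ⁻¹ᵁ U) p hp).hom.toAlgebra
    have hloc' := isLocalization_germ hV hp
    obtain ⟨t', ht'⟩ := (IsLocalization.map_eq_zero_iff
      (hV.primeIdealOf ⟨p, hp⟩).asIdeal.primeCompl (S.presheaf.stalk p) _).mp h0
    obtain ⟨t'', ht''⟩ := i.app_surjective U hU t'.1
    have hu : IsUnit ((X.presheaf.germ U (i p) hxU).hom t'') := by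
      refine (isUnit_map_iff (i.stalkMap p).hom _).mp ?_
      rw [hg]
      refine Eq.mpr (congrArg (fun q => IsUnit ((S.presheaf.germ (i ⁻¹ᵁ U) p hp).hom q)) ht'') ?_
      exact IsLocalization.map_units (S.presheaf.stalk p) t'
    have h1 : t'' * r ∈ RingHom.ker (i.app U).hom := by
      rw [RingHom.mem_ker, map_mul]
      exact (congrArg (· * _) ht'').trans ht'
    have h2 := Ideal.mem_map_of_mem (X.presheaf.germ U (i p) hxU).hom h1
    rw [map_mul, Ideal.unit_mul_mem_iff_mem _ hu] at h2
    rw [← Ideal.mul_unit_mem_iff_mem _ htu]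
    exact hrt ▸ h2

omit [IsClosedImmersion i] in
lemma stalkIdeal_ker_of_notMem [QuasiCompact i] {x : X} (hx : x ∉ closure (Set.range i)) :
    stalkIdeal i.ker x = ⊤ := by
  obtain ⟨U, hU, hxU, hsub⟩ := exists_isAffineOpen_mem_and_subset
    (U := ⟨(closure (Set.range i))ᶜ, isClosed_closure.isOpen_compl⟩) (x := x) hx
  let U' : X.affineOpens := ⟨U, hU⟩
  rw [stalkIdeal_eq_map _ (U := U') hxU, Scheme.Hom.ker_apply, Ideal.eq_top_iff_one,
    ← map_one (X.presheaf.germ U'.1 x hxU).hom]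
  refine Ideal.mem_map_of_mem _ ?_
  have h1 : i ⁻¹ᵁ U = ⊥ := by
    refine eq_bot_iff.mpr fun p hp => ?_
    exact (hsub hp (subset_closure ⟨p, rfl⟩)).elim
  rw [RingHom.mem_ker]
  have : Subsingleton Γ(S, i ⁻¹ᵁ U) := by rw [h1]; infer_instance
  exact Subsingleton.elim _ _

end ClosedImmersion


open IsLocalRing

/-! ### The surface is a Cartier divisor at smooth points of the threefold. -/

section SmoothPoints

variable {X : Scheme.{0}} (s : X ⟶ SpecC)

lemma isNoetherianRing_stalk [LocallyOfFiniteType s] (x : X) :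
    IsNoetherianRing (X.presheaf.stalk x) :=
  let _ := stalkAlgebra s x
  have := essFiniteType_stalk s x
  Algebra.EssFiniteType.isNoetherianRing ℂ _

lemma isScalarTower_functionField [IsIntegral X] (x : X) :
    letI := stalkAlgebra s x
    letI := stalkAlgebra s (genericPoint X)
    IsScalarTower ℂ (X.presheaf.stalk x) X.functionField :=
  letI := stalkAlgebra s x
  letI := stalkAlgebra s (genericPoint X)
  IsScalarTower.of_algebraMap_eq'
    (stalkSpecializes_comp_stalkStr s (genericPoint_specializes x)).symm

lemma finrank_stalk [IsIntegral X] [LocallyOfFinitePresentation s] {n : ℕ}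
    (hdim : topologicalKrullDim X = n) {x : X} (hx : SmoothAt s x) :
    letI := stalkAlgebra s x
    Module.finrank (X.presheaf.stalk x) Ω[X.presheaf.stalk x⁄ℂ] = n := by
  let _ := stalkAlgebra s x
  let _ := stalkAlgebra s (genericPoint X)
  have h1 := (smoothAt_iff s x).mp hx
  have h2 := essFiniteType_stalk s x
  have h3 := isScalarTower_functionField s x
  have h4 : Module.Free (X.presheaf.stalk x) Ω[X.presheaf.stalk x⁄ℂ] :=
    Module.free_of_flat_of_isLocalRing
  rw [← finrank_kaehlerDifferential_localization (O := X.functionField)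
    (nonZeroDivisors (X.presheaf.stalk x))]
  exact finrank_functionField s hdim

variable {S : Scheme.{0}} (i : S ⟶ X) [IsClosedImmersion i]

/-- A smooth surface in a smooth threefold is locally defined by one equation. -/
lemma exists_generator_of_smoothAt [IsIntegral X] [LocallyOfFinitePresentation s]
    (hdim : topologicalKrullDim X = 3) [SmoothOfRelativeDimension 2 (i ≫ s)] {x : X}
    (hx : SmoothAt s x) :
    ∃ c ∈ nonZeroDivisors (X.presheaf.stalk x), stalkIdeal i.ker x = Ideal.span {c} := by
  by_cases hxi : x ∈ Set.range i
  · obtain ⟨p, rfl⟩ := hxi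
    let _ := stalkAlgebra s (i p)
    let _ := stalkAlgebra (i ≫ s) p
    let _ : Algebra (X.presheaf.stalk (i p)) (S.presheaf.stalk p) := (i.stalkMap p).hom.toAlgebra
    have ht : IsScalarTower ℂ (X.presheaf.stalk (i p)) (S.presheaf.stalk p) :=
      IsScalarTower.of_algebraMap_eq' (stalkMap_comp_stalkStr s i p).symm
    have hs2 : Smooth (i ≫ s) := SmoothOfRelativeDimension.smooth 2 (i ≫ s)
    have h1 := (smoothAt_iff s (i p)).mp hx
    have h2 := (smooth_iff_forall_smoothAt (i ≫ s)).mp hs2 p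
    have h3 := essFiniteType_stalk s (i p)
    have h4 := essFiniteType_stalk (i ≫ s) p
    have h5 := isNoetherianRing_stalk s (i p)
    -- The conormal rank is `3 - 2 = 1`, and the independence statement `hc2` excludes a zero
    -- generator.
    obtain ⟨-, c, hc, hc2⟩ := exists_generators_ker_of_formallySmooth (k := ℂ)
      (i.stalkMap_surjective p) (finrank_stalk s hdim hx)
      (finrank_stalk_of_smoothOfRelativeDimension (i ≫ s) 2 p)
    have hsub : Subsingleton (Fin (3 - 2)) := inferInstanceAs (Subsingleton (Fin 1))
    have hr : Set.range c = {c 0} := by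
      ext z; constructor
      · rintro ⟨j, rfl⟩; rw [Subsingleton.elim j 0]; rfl
      · rintro rfl; exact ⟨0, rfl⟩
    rw [hr] at hc
    refine ⟨c 0, mem_nonZeroDivisors_of_ne_zero fun h0 => ?_, (stalkIdeal_ker i p).trans hc⟩
    have h6 := hc2 (fun _ => 1) (by
      refine Eq.mpr (congrArg (· ∈ _) ?_) (Ideal.zero_mem _)
      exact Finset.sum_eq_zero fun j _ => by rw [Subsingleton.elim j 0, h0, mul_zero]) 0
    rw [RingHom.mem_ker, map_one] at h6
    exact one_ne_zero h6
  · refine ⟨1, one_mem _, ?_⟩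
    rw [stalkIdeal_ker_of_notMem i, Ideal.span_singleton_one]
    rwa [i.isClosedEmbedding.isClosed_range.closure_eq]

lemma smoothAt_genericPoint [IsIntegral X] [LocallyOfFinitePresentation s] :
    SmoothAt s (genericPoint X) := by
  rw [smoothAt_iff, formallySmooth_stalk_iff]
  exact s.genericPoint_mem_smoothLocus_of_perfectField

lemma stalkIdeal_genericPoint_ne_bot [IsIntegral X] [LocallyOfFinitePresentation s]
    (hdim : topologicalKrullDim X = 3) [SmoothOfRelativeDimension 2 (i ≫ s)] :
    stalkIdeal i.ker (genericPoint X) ≠ ⊥ := by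
  obtain ⟨c, hc, h⟩ := exists_generator_of_smoothAt s i hdim (smoothAt_genericPoint s)
  rw [h, Ne, Ideal.span_singleton_eq_bot]
  exact nonZeroDivisors.ne_zero hc

lemma isEffectiveCartier_comap_ι [IsIntegral X] [LocallyOfFinitePresentation s]
    (hdim : topologicalKrullDim X = 3) [SmoothOfRelativeDimension 2 (i ≫ s)] (O : X.Opens)
    (hO : ∀ x ∈ O, SmoothAt s x) : IsEffectiveCartier (i.ker.comap O.ι) := by
  have : IsLocallyNoetherian X := LocallyOfFiniteType.isLocallyNoetherian s
  have : IsLocallyNoetherian O := LocallyOfFiniteType.isLocallyNoetherian (O.ι ≫ s)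
  refine isEffectiveCartier_of_stalk fun y => ?_
  have : Nonempty O := ⟨y⟩
  obtain ⟨c, hc, h⟩ := exists_generator_of_smoothAt s i hdim (hO (O.ι y) y.2)
  refine ⟨(O.ι.stalkMap y).hom c, ?_, ?_⟩
  · exact map_mem_nonZeroDivisors _
      (MulEquiv.injective (asIso (O.ι.stalkMap y)).commRingCatIsoToRingEquiv.toMulEquiv) hc
  · rw [stalkIdeal_comap, h, Ideal.map_span, Set.image_singleton]

end SmoothPoints

/-! ### Ordinary double points are closed and singular. -/

section OrdinaryDoublePoints

variable {X : Scheme.{0}} {s : X ⟶ SpecC} {x : X}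

/-- With residue field `ℂ` the spectrum of the residue field is a closed subscheme of `Spec ℂ`, so
its inclusion in `X` is of finite type; in a Jacobson scheme this characterises closed points. -/
lemma isClosed_of_residueTrivial [LocallyOfFiniteType s]
    (h : letI := stalkAlgebra s x; ResidueTrivial ℂ (X.presheaf.stalk x)) : IsClosed {x} := by
  have : JacobsonSpace X := LocallyOfFiniteType.jacobsonSpace s
  rw [isClosed_singleton_iff_locallyOfFiniteType]
  have h1 : X.fromSpecResidueField x ≫ s =
      Spec.map (CommRingCat.ofHom (stalkStr s x) ≫ X.residue x) := by
    rw [Scheme.fromSpecResidueField, Category.assoc, fromSpecStalk_comp, ← Spec.map_comp]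
  have h2 : IsClosedImmersion (X.fromSpecResidueField x ≫ s) := by
    rw [h1]
    refine IsClosedImmersion.spec_of_surjective _ fun z => ?_
    obtain ⟨w, rfl⟩ := X.residue_surjective x z
    obtain ⟨c, hc⟩ := h w
    refine ⟨c, ?_⟩
    have h3 := (IsLocalRing.residue_eq_zero_iff _).mpr hc
    rw [map_sub, sub_eq_zero] at h3
    exact h3.symm
  exact locallyOfFiniteType_of_comp _ s

lemma IsODP.isClosed [LocallyOfFiniteType s] (h : IsODP s x) : IsClosed {x} := by
  obtain ⟨f, φ, h0, h1, hdet, hφ, hker, hC⟩ := h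
  let _ := stalkAlgebra s x
  have := isNoetherianRing_stalk s x
  exact isClosed_of_residueTrivial (s := s) (exists_of_completion rfl h0 h1 hφ hker hC).1

/-- A smooth point of a threefold has a maximal ideal with three generators, whereas a double point
has four elements independent modulo the square of the maximal ideal. -/
lemma IsODP.not_smoothAt [IsIntegral X] [LocallyOfFinitePresentation s]
    (hdim : topologicalKrullDim X = 3) (h : IsODP s x) : ¬ SmoothAt s x := by
  intro hx
  obtain ⟨f, φ, h0, h1, hdet, hφ, hker, hC⟩ := h
  let _ := stalkAlgebra s x
  have hn := isNoetherianRing_stalk s x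
  obtain ⟨hres, z, hz, -, hv⟩ := exists_of_completion rfl h0 h1 hφ hker hC
  have h2 := (smoothAt_iff s x).mp hx
  have h3 := essFiniteType_stalk s x
  obtain ⟨c, hc, -⟩ := exists_parameters_of_formallySmooth hres (finrank_stalk s hdim hx)
  exact not_exists_three_generators hres
    (fun j => hz ▸ Ideal.mem_sup_left (Ideal.subset_span ⟨j, rfl⟩)) hv c hc

end OrdinaryDoublePoints

/-! ### The node equation at a double point of the threefold. -/

section Node

lemma IsParameterSystemMod.comp_equiv {k A ι κ : Type*} [Field k] [CommRing A] [IsLocalRing A]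
    [Algebra k A] {I : Ideal A} {c : ι → A} (hc : IsParameterSystemMod k I c) (e : κ ≃ ι) :
    IsParameterSystemMod k I (c ∘ e) where
  sup_span := by rw [e.surjective.range_comp]; exact hc.sup_span
  eq_zero n F hF h := by
    rw [← MvPolynomial.aeval_rename] at h
    exact MvPolynomial.rename_injective e e.injective
      ((hc.eq_zero n _ hF.rename_isHomogeneous h).trans (map_zero _).symm)

/-- `A` is the local ring of a node with equation `a * g = b * h`, such that `(a, b)` defines a
smooth surface. -/
structure IsNode {A : Type} [CommRing A] [IsLocalRing A] [Algebra ℂ A] (a b g h : A) : Prop where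
  residueTrivial : ResidueTrivial ℂ A
  rel : a * g = b * h
  maximalIdeal_eq : maximalIdeal A = Ideal.span {a, b, g, h}
  isParameterSystemMod : IsParameterSystemMod ℂ (Ideal.span {a, b}) ![g, h]

lemma IsNode.swap {A : Type} [CommRing A] [IsLocalRing A] [Algebra ℂ A] {a b g h : A}
    (H : IsNode a b g h) : IsNode b a h g where
  residueTrivial := H.residueTrivial
  rel := H.rel.symm
  maximalIdeal_eq := by
    rw [H.maximalIdeal_eq]; congr 1; ext z; simp; tauto
  isParameterSystemMod := by
    rw [Set.pair_comm b a]
    have := H.isParameterSystemMod.comp_equiv (Equiv.swap (0 : Fin 2) 1)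
    convert this using 1
    funext j; fin_cases j <;> rfl

variable {X S : Scheme.{0}} {s : X ⟶ SpecC} {x : X}

theorem IsODP.exists_isNode [LocallyOfFiniteType s] (i : S ⟶ X) [IsClosedImmersion i]
    [SmoothOfRelativeDimension 2 (i ≫ s)] (h : IsODP s x) (hx : x ∈ Set.range i) :
    letI := stalkAlgebra s x
    ∃ a b g h : X.presheaf.stalk x, IsNode a b g h ∧ stalkIdeal i.ker x = Ideal.span {a, b} := by
  obtain ⟨p, rfl⟩ := hx
  obtain ⟨f, φ, h0, h1, hdet, hφ, hker, hC⟩ := h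
  let _ := stalkAlgebra s (i p)
  let _ := stalkAlgebra (i ≫ s) p
  let _ : Algebra (X.presheaf.stalk (i p)) (S.presheaf.stalk p) := (i.stalkMap p).hom.toAlgebra
  have ht : IsScalarTower ℂ (X.presheaf.stalk (i p)) (S.presheaf.stalk p) :=
    IsScalarTower.of_algebraMap_eq' (stalkMap_comp_stalkStr s i p).symm
  have hs2 : Smooth (i ≫ s) := SmoothOfRelativeDimension.smooth 2 (i ≫ s)
  have h2 := (smooth_iff_forall_smoothAt (i ≫ s)).mp hs2 p
  have h4 := essFiniteType_stalk (i ≫ s) p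
  have h5 := isNoetherianRing_stalk s (i p)
  obtain ⟨a, b, g, h, hab, hrel, hm, hpar⟩ := exists_node_equation rfl h0 h1 hdet hφ hker hC
    (finrank_stalk_of_smoothOfRelativeDimension (i ≫ s) 2 p) (i.stalkMap_surjective p)
  exact ⟨a, b, g, h, ⟨(exists_of_completion rfl h0 h1 hφ hker hC).1, hrel, hm, hpar⟩,
    (stalkIdeal_ker i p).trans hab⟩

end Node


open IsLocalRing

/-! ### The ratio `t = a / b` on the blowup. -/

section Ratio

variable {A O : Type} [CommRing A] [CommRing O] [Algebra A O]

/-- Every element of `O` is a fraction of polynomials in `t` with coefficients in `A`. -/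
def IsFractionIn (A : Type) {O : Type} [CommRing A] [CommRing O] [Algebra A O] (t : O) : Prop :=
  ∀ z : O, ∃ u v : Polynomial A, IsUnit (Polynomial.aeval t v) ∧
    z * Polynomial.aeval t v = Polynomial.aeval t u

/-- Since `b'` is a unit, `b` generates the extended ideal, and each chart coordinate `τ m` is a
linear polynomial in `t` times `b'`. The case `m = l`, where `τ l = 1`, shows that `b'` is itself
the inverse of such a polynomial, so all coordinates are fractions in `t`. -/
lemma isFractionIn_of_unit {κ : Type} {f : κ → A} {l : κ} {τ : κ → O} {a b : A} {a' b' : O}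
    [IsDomain O] (hf : ∀ m, f m ∈ Ideal.span {a, b}) (h0 : algebraMap A O (f l) ≠ 0)
    (hτ : ∀ m, algebraMap A O (f m) = τ m * algebraMap A O (f l))
    (hfrac : ∀ z : O, ∃ u ∈ Subring.closure (Set.range (algebraMap A O) ∪ Set.range τ),
      ∃ v ∈ Subring.closure (Set.range (algebraMap A O) ∪ Set.range τ), IsUnit v ∧ z * v = u)
    (ha' : algebraMap A O a = a' * algebraMap A O (f l))
    (hb' : algebraMap A O b = b' * algebraMap A O (f l)) (hb : IsUnit b') :
    ∃ t : O, algebraMap A O a = t * algebraMap A O b ∧ algebraMap A O b ≠ 0 ∧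
      IsFractionIn A t := by
  obtain ⟨w, rfl⟩ := hb
  refine ⟨a' * ↑w⁻¹, ?_, ?_, ?_⟩
  · rw [hb', mul_assoc, Units.inv_mul_cancel_left, ha']
  · rw [hb']; exact mul_ne_zero w.ne_zero h0
  set t := a' * ↑w⁻¹
  let F (z : O) : Prop := ∃ u v : Polynomial A, IsUnit (Polynomial.aeval t v) ∧
    z * Polynomial.aeval t v = Polynomial.aeval t u
  have hmul (y z : O) (hy : F y) (hz : F z) : F (y * z) := by
    obtain ⟨u, v, hv, h⟩ := hy
    obtain ⟨u', v', hv', h'⟩ := hz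
    exact ⟨u * u', v * v', by rw [map_mul]; exact hv.mul hv', by
      rw [map_mul, map_mul, ← h, ← h']; ring⟩
  have hinv (y z : O) (hy : F y) (hyz : y * z = 1) : F z := by
    obtain ⟨u, v, hv, h⟩ := hy
    have hyu : IsUnit y := IsUnit.of_mul_eq_one _ hyz
    exact ⟨v, u, h ▸ hyu.mul hv, by rw [← h]; linear_combination (Polynomial.aeval t v) * hyz⟩
  have hpoly (u : Polynomial A) : F (Polynomial.aeval t u) := ⟨u, 1, by simp, by simp⟩
  have hlin (m : κ) : ∃ u : Polynomial A, τ m = Polynomial.aeval t u * w := by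
    obtain ⟨α, β, h⟩ := Ideal.mem_span_pair.mp (hf m)
    refine ⟨Polynomial.C α * Polynomial.X + Polynomial.C β, mul_right_cancel₀ h0 ?_⟩
    rw [← hτ, ← h]
    simp only [map_add, map_mul, Polynomial.aeval_C, Polynomial.aeval_X, ha', hb']
    have : t * w = a' := Units.inv_mul_cancel_right _ _
    linear_combination (-algebraMap A O α * algebraMap A O (f l)) * this
  have hτl : τ l = 1 := mul_right_cancel₀ h0 (by rw [← hτ, one_mul])
  have hFw : F w := by
    obtain ⟨u, hu⟩ := hlin l
    exact hinv _ _ (hpoly u) (by rw [← hu, hτl])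
  have hcl : ∀ z ∈ Subring.closure (Set.range (algebraMap A O) ∪ Set.range τ), F z := by
    intro z hz
    induction hz using Subring.closure_induction with
    | mem z hz =>
      obtain ⟨y, rfl⟩ | ⟨m, rfl⟩ := hz
      · simpa using hpoly (Polynomial.C y)
      · obtain ⟨u, hu⟩ := hlin m
        rw [hu]; exact hmul _ _ (hpoly u) hFw
    | zero => simpa using hpoly 0
    | one => simpa using hpoly 1
    | add y z _ _ hy hz =>
      obtain ⟨u, v, hv, h⟩ := hy
      obtain ⟨u', v', hv', h'⟩ := hz
      exact ⟨u * v' + u' * v, v * v', by rw [map_mul]; exact hv.mul hv', by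
        rw [map_mul, map_add, map_mul, map_mul, ← h, ← h']; ring⟩
    | neg z _ hz => simpa using hmul (-1) z (by simpa using hpoly (-1)) hz
    | mul y z _ _ hy hz => exact hmul y z hy hz
  intro z
  obtain ⟨u, hu, v, hv, ⟨v, rfl⟩, hz⟩ := hfrac z
  have : z = u * ↑v⁻¹ := by rw [← hz, Units.mul_inv_cancel_right]
  rw [this]
  exact hmul _ _ (hcl u hu) (hinv _ _ (hcl _ hv) v.mul_inv)

/-- The extension of `(a, b)` to `O` is principal, so the quotients of `a` and `b` by its generator
generate the unit ideal. As `O` is local, one of these quotients is a unit. This passes from the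
arbitrary generators `f` used for the blowup to the two generators adapted to the node. -/
lemma exists_ratio {κ : Type} {f : κ → A} {l : κ} {τ : κ → O} {a b : A} [IsDomain O]
    [IsLocalRing O] (hf : Ideal.span (Set.range f) = Ideal.span {a, b})
    (h0 : algebraMap A O (f l) ≠ 0)
    (hτ : ∀ m, algebraMap A O (f m) = τ m * algebraMap A O (f l))
    (hfrac : ∀ z : O, ∃ u ∈ Subring.closure (Set.range (algebraMap A O) ∪ Set.range τ),
      ∃ v ∈ Subring.closure (Set.range (algebraMap A O) ∪ Set.range τ), IsUnit v ∧ z * v = u) :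
    (∃ t : O, algebraMap A O a = t * algebraMap A O b ∧ algebraMap A O b ≠ 0 ∧
      IsFractionIn A t) ∨
    ∃ t : O, algebraMap A O b = t * algebraMap A O a ∧ algebraMap A O a ≠ 0 ∧
      IsFractionIn A t := by
  have hle : (Ideal.span {a, b}).map (algebraMap A O) ≤ Ideal.span {algebraMap A O (f l)} := by
    rw [← hf, Ideal.map_span, ← Set.range_comp, Ideal.span_le]
    rintro _ ⟨m, rfl⟩
    exact Ideal.mem_span_singleton'.mpr ⟨_, (hτ m).symm⟩
  have h1 (c) (hc : c ∈ Ideal.span {a, b}) : ∃ c', algebraMap A O c = c' * algebraMap A O (f l) := by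
    obtain ⟨c', h⟩ := Ideal.mem_span_singleton'.mp (hle (Ideal.mem_map_of_mem _ hc))
    exact ⟨c', h.symm⟩
  have hf' (m) : f m ∈ Ideal.span {a, b} := hf ▸ Ideal.subset_span ⟨m, rfl⟩
  obtain ⟨a', ha'⟩ := h1 a (Ideal.subset_span (by simp))
  obtain ⟨b', hb'⟩ := h1 b (Ideal.subset_span (by simp))
  obtain ⟨α, β, h⟩ := Ideal.mem_span_pair.mp (hf' l)
  have h2 : algebraMap A O α * a' + algebraMap A O β * b' = 1 := by
    refine mul_right_cancel₀ h0 ?_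
    rw [one_mul, add_mul, mul_assoc, mul_assoc, ← ha', ← hb', ← map_mul, ← map_mul, ← map_add, h]
  obtain hu | hu := isUnit_or_isUnit_of_add_one h2
  · right
    refine isFractionIn_of_unit (l := l) (fun m => ?_) h0 hτ hfrac hb' ha'
      (isUnit_of_mul_isUnit_right hu)
    rw [Set.pair_comm]; exact hf' m
  · left
    exact isFractionIn_of_unit hf' h0 hτ hfrac ha' hb' (isUnit_of_mul_isUnit_right hu)

end Ratio

/-! ### Smoothness of the blowup over a node. -/

section NodeChart

variable {A O L : Type} [CommRing A] [IsLocalRing A] [IsNoetherianRing A] [IsDomain A] [Algebra ℂ A]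
  [CommRing O] [IsLocalRing O] [IsDomain O] [Algebra ℂ O] [Algebra A O] [IsScalarTower ℂ A O]
  [IsLocalHom (algebraMap A O)] [Algebra.EssFiniteType ℂ O]
  [Field L] [Algebra ℂ L] [Algebra O L] [IsScalarTower ℂ O L] [IsFractionRing O L]

/-- Two elements of the maximal ideal which form a regular sequence. -/
def HasRegularPair (A : Type) [CommRing A] [IsLocalRing A] : Prop :=
  ∃ a ∈ maximalIdeal A, ∃ s ∈ maximalIdeal A, a ≠ 0 ∧ ∀ u v : A, s * u = a * v → a ∣ u

/-- The maximal ideal of `O` is generated by the three elements `b, g, t - t₀`, and `Ω_L` has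
dimension three: this makes `O` smooth and the generators analytically independent. The same chart
shows that the node has depth two. -/
lemma IsNode.isNodeChart {a b g h : A} (H : IsNode a b g h) (hres : ResidueTrivial ℂ O)
    (hL : Module.finrank L Ω[L⁄ℂ] = 3) {t : O} (hta : algebraMap A O a = t * algebraMap A O b)
    (hb : algebraMap A O b ≠ 0) (ht : IsFractionIn A t) :
    algebraMap A O h = t * algebraMap A O g ∧ IsNodeChart A b g t ∧ HasRegularPair A := by
  have : IsNoetherianRing O := Algebra.EssFiniteType.isNoetherianRing ℂ O
  have hth := node_ratio H.rel hta hb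
  obtain ⟨t₀, ht₀⟩ := hres t
  have hm := maximalIdeal_eq_of_node H.residueTrivial H.maximalIdeal_eq hta hth ht ht₀
  obtain ⟨h1, -, h3⟩ := formallySmooth_of_span_eq_maximalIdeal (L := L) hres hL hm
  exact ⟨hth, .of_analyticallyIndependent h1 hres hm h3,
    exists_regular_pair H.residueTrivial hres H.rel H.maximalIdeal_eq H.isParameterSystemMod
      hta hth hm h3⟩

end NodeChart

/-! ### Homomorphisms of local rings along specializations. -/

section StalkHom

variable {X X' : Scheme.{0}} (π : X' ⟶ X)

/-- The homomorphism of local rings `𝒪_{X,x} → 𝒪_{X',y}` if `x` is in the closure of `π y`. -/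
noncomputable def stalkHom {x : X} {y : X'} (h : π y ⤳ x) :
    X.presheaf.stalk x →+* X'.presheaf.stalk y :=
  (X.presheaf.stalkSpecializes h ≫ π.stalkMap y).hom

lemma stalkHom_self (y : X') : stalkHom π (specializes_refl (π y)) = (π.stalkMap y).hom := by
  rw [stalkHom, X.presheaf.stalkSpecializes_refl, Category.id_comp]

lemma stalkSpecializes_comp_stalkHom {x : X} {y y₀ : X'} (hy : y ⤳ y₀) (h₀ : π y₀ ⤳ x)
    (h : π y ⤳ x) :
    (X'.presheaf.stalkSpecializes hy).hom.comp (stalkHom π h₀) = stalkHom π h := by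
  unfold stalkHom
  rw [← CommRingCat.hom_comp, Category.assoc, ← Scheme.Hom.stalkSpecializes_stalkMap π y y₀ hy,
    X.presheaf.stalkSpecializes_comp_assoc]

lemma stalkHom_comp_stalkSpecializes {x x₀ : X} {y : X'} (hx : x ⤳ x₀) (h : π y ⤳ x) :
    (stalkHom π h).comp (X.presheaf.stalkSpecializes hx).hom = stalkHom π (h.trans hx) := by
  unfold stalkHom
  rw [← CommRingCat.hom_comp, X.presheaf.stalkSpecializes_comp_assoc]

lemma stalkHom_comp_stalkStr (s : X ⟶ SpecC) {x : X} {y : X'} (h : π y ⤳ x) :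
    (stalkHom π h).comp (stalkStr s x) = stalkStr (π ≫ s) y := by
  rw [← stalkMap_comp_stalkStr, ← stalkSpecializes_comp_stalkStr s h]
  rfl

lemma BlowupCharts.exists_fractions {J : X.IdealSheafData} {U : X.affineOpens}
    (C : BlowupCharts J π U) {y : X'} (hy : π y ∈ U.1) :
    ∃ (κ : Type) (f : κ → X.presheaf.stalk (π y)) (l : κ) (τ : κ → X'.presheaf.stalk y),
      stalkIdeal J (π y) = Ideal.span (Set.range f) ∧
      (π.stalkMap y).hom (f l) ∈ nonZeroDivisors _ ∧
      (∀ m, (π.stalkMap y).hom (f m) = τ m * (π.stalkMap y).hom (f l)) ∧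
      ∀ z, ∃ u ∈ Subring.closure (Set.range (π.stalkMap y).hom ∪ Set.range τ),
        ∃ v ∈ Subring.closure (Set.range (π.stalkMap y).hom ∪ Set.range τ),
          IsUnit v ∧ z * v = u := by
  obtain ⟨l, hl⟩ := Opens.mem_iSup.mp (C.le_iSup hy)
  let γ := (X.presheaf.germ U.1 (π y) hy).hom
  let δ := (X'.presheaf.germ (C.W l) y hl).hom
  have hγδ (r) : (π.stalkMap y).hom (γ r) = δ ((π.appLE U.1 (C.W l) (C.W_le l)).hom r) :=
    (germ_appLE π (C.W_le l) hl r).symm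
  let _ := δ.toAlgebra
  have hloc := isLocalization_germ (C.isAffineOpen_W l) hl
  refine ⟨C.ι, fun m => γ (C.f m), l, fun m => δ (C.t l m), ?_, ?_, fun m => ?_, fun z => ?_⟩
  · rw [stalkIdeal_eq_map J hy, C.ideal_eq, Ideal.map_span, ← Set.range_comp]
    rfl
  · rw [hγδ]
    exact IsLocalization.map_nonZeroDivisors_le
      ((C.isAffineOpen_W l).primeIdealOf ⟨y, hl⟩).asIdeal.primeCompl _
      (Submonoid.mem_map_of_mem _ (C.mem_nonZeroDivisors l))
  · rw [hγδ, hγδ, C.map_f, map_mul]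
  · have hcl (r) : δ r ∈ Subring.closure (Set.range (π.stalkMap y).hom ∪
        Set.range fun m => δ (C.t l m)) := by
      have h1 : r ∈ Subring.closure (Set.range (π.appLE U.1 (C.W l) (C.W_le l)).hom ∪
        Set.range (C.t l)) := C.closure_eq l ▸ Subring.mem_top r
      have h2 : δ r ∈ Subring.map δ _ := Subring.mem_map.mpr ⟨r, h1, rfl⟩
      rw [RingHom.map_closure] at h2
      refine Subring.closure_mono ?_ h2
      rw [Set.image_union, ← Set.range_comp, ← Set.range_comp]
      refine Set.union_subset_union ?_ subset_rfl
      rintro _ ⟨r, rfl⟩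
      exact ⟨_, hγδ r⟩
    obtain ⟨⟨r, t⟩, hrt⟩ := IsLocalization.surj
      ((C.isAffineOpen_W l).primeIdealOf ⟨y, hl⟩).asIdeal.primeCompl z
    exact ⟨_, hcl r, _, hcl t, IsLocalization.map_units (X'.presheaf.stalk y) t, hrt⟩

end StalkHom

/-! ### Charts at all points over a node. -/

section ChartAt

variable {X X' : Scheme.{0}} (s : X ⟶ SpecC) (π : X' ⟶ X)

/-- The local ring of `X'` at `y` is a chart of the small resolution of the node
`a * g = b * h` of `X` at `x`. -/
def NodeChartAt {x : X} {y : X'} (hy : π y ⤳ x) (a b g h : X.presheaf.stalk x) : Prop :=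
  letI := stalkAlgebra (π ≫ s) y
  letI := (stalkHom π hy).toAlgebra
  ∃ t : X'.presheaf.stalk y, stalkHom π hy a = t * stalkHom π hy b ∧
    stalkHom π hy h = t * stalkHom π hy g ∧ IsNodeChart (X.presheaf.stalk x) b g t

variable {s π}

lemma NodeChartAt.of_specializes [IsIntegral X'] {x : X} {y y₀ : X'} (hyy : y ⤳ y₀)
    {h₀ : π y₀ ⤳ x} {a b g h : X.presheaf.stalk x} (H : NodeChartAt s π h₀ a b g h)
    (hy : π y ⤳ x) : NodeChartAt s π hy a b g h := by
  obtain ⟨t, hta, hth, H⟩ := H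
  let _ := stalkAlgebra (π ≫ s) y₀
  let _ := stalkAlgebra (π ≫ s) y
  let _ := (stalkHom π h₀).toAlgebra
  let _ := (stalkHom π hy).toAlgebra
  let _ := (X'.presheaf.stalkSpecializes hyy).hom.toAlgebra
  have hc := stalkSpecializes_comp_stalkHom π hyy h₀ hy
  have hc' (z) : stalkHom π hy z = (X'.presheaf.stalkSpecializes hyy).hom (stalkHom π h₀ z) := by
    rw [← hc]; rfl
  have i1 : IsScalarTower (X.presheaf.stalk x) (X'.presheaf.stalk y₀) (X'.presheaf.stalk y) :=
    IsScalarTower.of_algebraMap_eq' hc.symm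
  have i2 : IsScalarTower ℂ (X'.presheaf.stalk y₀) (X'.presheaf.stalk y) :=
    IsScalarTower.of_algebraMap_eq' (stalkSpecializes_comp_stalkStr (π ≫ s) hyy).symm
  obtain ⟨M, hM⟩ := isLocalization_stalkSpecializes hyy
  refine ⟨(X'.presheaf.stalkSpecializes hyy).hom t, ?_, ?_, H.localization M ?_⟩
  · rw [hc', hta, map_mul, hc']
  · rw [hc', hth, map_mul, hc']
  · refine le_nonZeroDivisors_of_noZeroDivisors fun h0 => ?_
    have := IsLocalization.map_units (X'.presheaf.stalk y) (⟨0, h0⟩ : M)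
    simp at this

lemma exists_nodeChartAt_of_isClosed [IsIntegral X] [IsIntegral X'] [LocallyOfFiniteType s]
    [LocallyOfFiniteType π] {J : X.IdealSheafData}
    (hL : letI := stalkAlgebra (π ≫ s) (genericPoint X')
      Module.finrank X'.functionField Ω[X'.functionField⁄ℂ] = 3)
    {x : X} {a b g h : X.presheaf.stalk x}
    (H : letI := stalkAlgebra s x; IsNode a b g h) (hJ : stalkIdeal J x = Ideal.span {a, b})
    (hC : ∃ U : X.affineOpens, x ∈ U.1 ∧ Nonempty (BlowupCharts J π U)) {y : X'}
    (hyx : π y = x) (hy : IsClosed {y}) (hs : π y ⤳ x) :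
    (NodeChartAt s π hs a b g h ∨ NodeChartAt s π hs b a h g) ∧
      HasRegularPair (X.presheaf.stalk x) := by
  subst hyx
  let _ := stalkAlgebra s (π y)
  let _ := stalkAlgebra (π ≫ s) y
  let _ := stalkAlgebra (π ≫ s) (genericPoint X')
  let _ := (stalkHom π hs).toAlgebra
  have e1 : algebraMap (X.presheaf.stalk (π y)) (X'.presheaf.stalk y) = (π.stalkMap y).hom :=
    stalkHom_self π y
  have i1 : IsScalarTower ℂ (X.presheaf.stalk (π y)) (X'.presheaf.stalk y) :=
    IsScalarTower.of_algebraMap_eq' (stalkHom_comp_stalkStr π s hs).symm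
  have i2 : IsLocalHom (algebraMap (X.presheaf.stalk (π y)) (X'.presheaf.stalk y)) := by
    rw [e1]; infer_instance
  have i3 := essFiniteType_stalk (π ≫ s) y
  have i4 := isNoetherianRing_stalk s (π y)
  have i5 := isScalarTower_functionField (π ≫ s) y
  have hres := residueTrivial_stalk (π ≫ s) hy
  obtain ⟨U, hU, ⟨C⟩⟩ := hC
  obtain ⟨κ, f, l, τ, hf, h0, hτ, hfrac⟩ := C.exists_fractions π hU
  rw [← e1] at h0 hτ hfrac
  obtain ⟨t, h1, h2, h3⟩ | ⟨t, h1, h2, h3⟩ := exists_ratio (hf.symm.trans hJ)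
    (nonZeroDivisors.ne_zero h0) hτ hfrac
  · obtain ⟨h4, h5, h6⟩ := H.isNodeChart (L := X'.functionField) hres hL h1 h2 h3
    exact ⟨Or.inl ⟨t, h1, h4, h5⟩, h6⟩
  · obtain ⟨h4, h5, h6⟩ := H.swap.isNodeChart (L := X'.functionField) hres hL h1 h2 h3
    exact ⟨Or.inr ⟨t, h1, h4, h5⟩, h6⟩

/-- Over a node, every point of the blowup has one of the two standard charts. -/
theorem exists_nodeChartAt [IsIntegral X] [IsIntegral X'] [LocallyOfFiniteType s]
    [LocallyOfFiniteType π] [CompactSpace X'] {J : X.IdealSheafData}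
    (hL : letI := stalkAlgebra (π ≫ s) (genericPoint X')
      Module.finrank X'.functionField Ω[X'.functionField⁄ℂ] = 3)
    {x : X} (hx : IsClosed {x}) {a b g h : X.presheaf.stalk x}
    (H : letI := stalkAlgebra s x; IsNode a b g h) (hJ : stalkIdeal J x = Ideal.span {a, b})
    (hC : ∃ U : X.affineOpens, x ∈ U.1 ∧ Nonempty (BlowupCharts J π U)) {y : X'}
    (hyx : π y = x) (hs : π y ⤳ x) :
    (NodeChartAt s π hs a b g h ∨ NodeChartAt s π hs b a h g) ∧
      HasRegularPair (X.presheaf.stalk x) := by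
  -- Every point specializes to a closed point, which stays in the fibre because the node is closed;
  -- the chart found there is inherited by the generization.
  obtain ⟨y₀, hy₀, hcl⟩ := (isClosed_closure (s := {y})).exists_closed_singleton
    ⟨y, subset_closure rfl⟩
  have hyy : y ⤳ y₀ := specializes_iff_mem_closure.mpr hy₀
  have h1 : π y₀ = x := by
    have h2 : π y ⤳ π y₀ := hyy.map π.continuous
    rw [hyx] at h2
    exact h2.mem_closed hx rfl
  obtain ⟨h2, h3⟩ := exists_nodeChartAt_of_isClosed hL H hJ hC h1 hcl (specializes_of_eq h1)
  exact ⟨h2.imp (fun h => h.of_specializes hyy hs) (fun h => h.of_specializes hyy hs), h3⟩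

end ChartAt


/-! ### The small resolution and its cotangent map. -/

open IsLocalRing

lemma isLocalization_bot_of_bijective {A B : Type*} [CommRing A] [CommRing B] [Algebra A B]
    (h : Function.Bijective (algebraMap A B)) : IsLocalization (⊥ : Submonoid A) B where
  map_units x := by rw [(Submonoid.mem_bot).mp x.2, map_one]; exact isUnit_one
  surj z := by
    obtain ⟨a, rfl⟩ := h.2 z
    exact ⟨⟨a, 1⟩, by simp⟩
  exists_of_eq hxy := ⟨1, by rw [h.1 hxy]⟩

lemma stalkMap_bijective_of_isOpenImmersion {X Y Z : Scheme.{0}} (j : Z ⟶ Y) (f : Y ⟶ X)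
    [IsOpenImmersion j] [IsOpenImmersion (j ≫ f)] (z : Z) :
    Function.Bijective (f.stalkMap (j z)).hom := by
  have h2 : IsIso ((j ≫ f).stalkMap z) := inferInstance
  rw [Scheme.Hom.stalkMap_comp] at h2
  have h2' : IsIso (f.stalkMap (j z) ≫ j.stalkMap z) := h2
  have h3 : IsIso (f.stalkMap (j z)) := IsIso.of_isIso_comp_right _ (j.stalkMap z)
  exact (asIso (f.stalkMap (j z))).commRingCatIsoToRingEquiv.bijective

/-- `π : X' ⟶ X` is described by the charts of the blowup of a nodal threefold `X` along a smooth
surface `S` which contains all nodes. -/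
structure IsNodalBlowup {X X' S : Scheme.{0}} (s : X ⟶ SpecC) (i : S ⟶ X) (π : X' ⟶ X) : Prop where
  topologicalKrullDim_eq : topologicalKrullDim X = 3
  isODP : ∀ x : X, ¬ SmoothAt s x → IsODP s x
  mem_range : ∀ x : X, IsODP s x → x ∈ Set.range i
  exists_charts : ∀ x, ∃ U : X.affineOpens, x ∈ U.1 ∧ Nonempty (BlowupCharts i.ker π U)

lemma mem_smoothLocus_iff {X : Scheme.{0}} {s : X ⟶ SpecC} [LocallyOfFinitePresentation s] {x : X} :
    x ∈ s.smoothLocus ↔ SmoothAt s x := by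
  rw [smoothAt_iff, formallySmooth_stalk_iff, Scheme.Hom.mem_smoothLocus]

lemma SmoothAt.of_specializes {X : Scheme.{0}} {s : X ⟶ SpecC} {x z : X} (hx : SmoothAt s x)
    (h : z ⤳ x) : SmoothAt s z := by
  obtain ⟨U, hU, hs⟩ := hx
  exact ⟨U, h.mem_open U.isOpen hU, hs⟩

namespace IsNodalBlowup

variable {X X' S : Scheme.{0}} {s : X ⟶ SpecC} {i : S ⟶ X} {π : X' ⟶ X}
  (H : IsNodalBlowup s i π) [IsIntegral X] [IsIntegral X'] [LocallyOfFinitePresentation s]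
  [IsClosedImmersion i] [SmoothOfRelativeDimension 2 (i ≫ s)] [IsProper π] [CompactSpace X']

include H

omit [IsIntegral X] [IsIntegral X'] [LocallyOfFinitePresentation s]
  [IsClosedImmersion i] [SmoothOfRelativeDimension 2 (i ≫ s)] [IsProper π] [CompactSpace X'] in
lemma isBlowup : IsBlowup i.ker π := isBlowup_of_charts H.exists_charts

omit [IsIntegral X'] [IsProper π] [CompactSpace X'] in
lemma isIso_restrict (U : X.Opens) (hU : ∀ x ∈ U, SmoothAt s x) : IsIso (π ∣_ U) :=
  H.isBlowup.isIso_restrict U (isEffectiveCartier_comap_ι s i H.topologicalKrullDim_eq U hU)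

omit [IsIntegral X'] [IsProper π] [CompactSpace X'] in
lemma isIso_restrict_smoothLocus : IsIso (π ∣_ s.smoothLocus) :=
  H.isIso_restrict _ fun _ hx => mem_smoothLocus_iff.mp hx

omit [IsIntegral X'] [IsProper π] [CompactSpace X'] in
lemma isOpenImmersion_smoothLocus : IsOpenImmersion ((π ⁻¹ᵁ s.smoothLocus).ι ≫ π) := by
  have := H.isIso_restrict_smoothLocus
  rw [← morphismRestrict_ι]
  infer_instance

omit [IsIntegral X'] [IsProper π] [CompactSpace X'] in
lemma stalkMap_bijective {y : X'} (hy : SmoothAt s (π y)) :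
    Function.Bijective (π.stalkMap y).hom := by
  have h1 := H.isOpenImmersion_smoothLocus
  have h2 : π y ∈ s.smoothLocus := mem_smoothLocus_iff.mpr hy
  have h3 : y ∈ π ⁻¹ᵁ s.smoothLocus := h2
  exact stalkMap_bijective_of_isOpenImmersion (π ⁻¹ᵁ s.smoothLocus).ι π ⟨y, h3⟩

omit [IsIntegral X'] [IsProper π] [CompactSpace X'] in
lemma exists_eq_of_smoothAt {x : X} (hx : SmoothAt s x) : ∃ y, π y = x := by
  have h1 := H.isIso_restrict_smoothLocus
  obtain ⟨y, hy⟩ := (π ∣_ s.smoothLocus).surjective ⟨x, mem_smoothLocus_iff.mpr hx⟩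
  refine ⟨(π ⁻¹ᵁ s.smoothLocus).ι y, ?_⟩
  rw [← Scheme.Hom.comp_apply, ← morphismRestrict_ι, Scheme.Hom.comp_apply, hy]
  rfl

omit [IsProper π] [CompactSpace X'] in
lemma map_genericPoint_specializes (x : X) : π (genericPoint X') ⤳ x := by
  obtain ⟨y, hy⟩ := H.exists_eq_of_smoothAt (smoothAt_genericPoint s)
  have h1 := (genericPoint_specializes y).map π.continuous
  rw [hy] at h1
  exact h1.trans (genericPoint_specializes x)

omit [IsProper π] [CompactSpace X'] in
lemma smoothAt_map_genericPoint : SmoothAt s (π (genericPoint X')) :=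
  (smoothAt_genericPoint s).of_specializes (H.map_genericPoint_specializes _)

omit [IsProper π] [CompactSpace X'] in
lemma finrank_functionField : letI := stalkAlgebra (π ≫ s) (genericPoint X')
    Module.finrank X'.functionField Ω[X'.functionField⁄ℂ] = 3 := by
  let _ := stalkAlgebra (π ≫ s) (genericPoint X')
  let x := π (genericPoint X')
  let _ := stalkAlgebra s x
  let _ : Algebra (X.presheaf.stalk x) X'.functionField :=
    (π.stalkMap (genericPoint X')).hom.toAlgebra
  have h1 : IsScalarTower ℂ (X.presheaf.stalk x) X'.functionField :=
    IsScalarTower.of_algebraMap_eq' (stalkMap_comp_stalkStr s π _).symm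
  have hx := H.smoothAt_map_genericPoint
  have h2 := (smoothAt_iff s x).mp hx
  have h3 := essFiniteType_stalk s x
  have h4 : Module.Free (X.presheaf.stalk x) Ω[X.presheaf.stalk x⁄ℂ] :=
    Module.free_of_flat_of_isLocalRing
  have h5 : IsLocalization (⊥ : Submonoid (X.presheaf.stalk x)) X'.functionField :=
    isLocalization_bot_of_bijective (H.stalkMap_bijective hx)
  rw [finrank_kaehlerDifferential_localization (R := X.presheaf.stalk x) ⊥]
  exact finrank_stalk s H.topologicalKrullDim_eq hx

omit [IsIntegral X'] [IsProper π] [CompactSpace X'] in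
lemma formallySmooth_stalk_of_smoothAt {y : X'} (hy : SmoothAt s (π y)) :
    letI := stalkAlgebra (π ≫ s) y; Algebra.FormallySmooth ℂ (X'.presheaf.stalk y) := by
  let _ := stalkAlgebra (π ≫ s) y
  let _ := stalkAlgebra s (π y)
  let e := RingEquiv.ofBijective _ (H.stalkMap_bijective hy)
  have := (smoothAt_iff s _).mp hy
  let e' : X.presheaf.stalk (π y) ≃ₐ[ℂ] X'.presheaf.stalk y :=
    { e with commutes' := fun c => congr($(stalkMap_comp_stalkStr s π y) c) }
  exact Algebra.FormallySmooth.of_equiv e'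

omit [IsIntegral X'] [IsClosedImmersion i] [SmoothOfRelativeDimension 2 (i ≫ s)] [IsProper π]
  [CompactSpace X'] in
lemma smoothAt_iff_not_isODP {x : X} : SmoothAt s x ↔ ¬ IsODP s x :=
  ⟨fun h h' => h'.not_smoothAt H.topologicalKrullDim_eq h, fun h => by
    by_contra hcon; exact h (H.isODP x hcon)⟩

/-- The local structure of `π` at a point over a node. -/
lemma exists_isNode {y : X'} (hy : ¬ SmoothAt s (π y)) :
    letI := stalkAlgebra s (π y)
    ∃ a b g h : X.presheaf.stalk (π y), IsNode a b g h ∧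
      stalkIdeal i.ker (π y) = Ideal.span {a, b} ∧
      NodeChartAt s π (specializes_refl (π y)) a b g h := by
  have ho := H.isODP _ hy
  let _ := stalkAlgebra s (π y)
  obtain ⟨a, b, g, h, hn, hJ⟩ := ho.exists_isNode i (H.mem_range _ ho)
  obtain h1 | h1 := (exists_nodeChartAt H.finrank_functionField ho.isClosed hn hJ
    (H.exists_charts _) rfl (specializes_refl (π y))).1
  · exact ⟨a, b, g, h, hn, hJ, h1⟩
  · exact ⟨b, a, h, g, hn.swap, by rw [hJ, Set.pair_comm], h1⟩

omit [IsIntegral X] [IsIntegral X'] [IsClosedImmersion i] [SmoothOfRelativeDimension 2 (i ≫ s)]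
  [CompactSpace X'] H in
lemma locallyOfFinitePresentation_comp : LocallyOfFinitePresentation (π ≫ s) := by
  rw [LocallyOfFinitePresentation.iff_locallyOfFiniteType]
  infer_instance

lemma formallySmooth_stalk (y : X') :
    letI := stalkAlgebra (π ≫ s) y; Algebra.FormallySmooth ℂ (X'.presheaf.stalk y) := by
  by_cases hy : SmoothAt s (π y)
  · exact H.formallySmooth_stalk_of_smoothAt hy
  · obtain ⟨a, b, g, h, -, -, t, -, -, ht⟩ := H.exists_isNode hy
    let _ := stalkAlgebra (π ≫ s) y
    let _ := (stalkHom π (specializes_refl (π y))).toAlgebra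
    exact ht.formallySmooth

theorem isSmallResolution : IsSmallResolution s π where
  isIntegral := inferInstance
  smooth := by
    have := locallyOfFinitePresentation_comp (s := s) (π := π)
    exact (smooth_iff_forall_smoothAt (π ≫ s)).mpr H.formallySmooth_stalk
  isProper := inferInstance
  birational := by
    have h1 : genericPoint X ∈ s.smoothLocus := mem_smoothLocus_iff.mpr (smoothAt_genericPoint s)
    exact ⟨s.smoothLocus, ⟨_, h1⟩, H.isIso_restrict_smoothLocus⟩
  isIso_over_smooth := H.isIso_restrict
  small y hy := by
    have h1 : ¬ SmoothAt s (π y) := fun h1 => by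
      have h2 : π y ∈ s.smoothLocus := mem_smoothLocus_iff.mpr h1
      have h3 : y ∈ π ⁻¹ᵁ s.smoothLocus := h2
      exact hy ⟨π ⁻¹ᵁ s.smoothLocus, h3, H.isOpenImmersion_smoothLocus⟩
    obtain ⟨a, b, g, h, hn, -, t, -, -, ht⟩ := H.exists_isNode h1
    let _ := stalkAlgebra s (π y)
    let _ := stalkAlgebra (π ≫ s) y
    let _ := (stalkHom π (specializes_refl (π y))).toAlgebra
    have hmem : ∀ z ∈ maximalIdeal (X.presheaf.stalk (π y)),
        stalkHom π (specializes_refl (π y)) z ∈ maximalIdeal (X'.presheaf.stalk y) := by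
      rw [stalkHom_self]
      exact fun z hz => (mem_maximalIdeal _).mpr fun hu =>
        (mem_maximalIdeal _).mp hz (isUnit_of_map_unit (π.stalkMap y).hom z hu)
    -- Since `y` lies over the node, `b` and `g` are nonunits at `y`, and they form a regular
    -- sequence.
    exact ht.two_le_ringKrullDim
      (hmem b (hn.maximalIdeal_eq ▸ Ideal.subset_span (by simp)))
      (hmem g (hn.maximalIdeal_eq ▸ Ideal.subset_span (by simp)))

theorem cotangentMapInjective : CotangentMapInjective s π := by
  intro y
  let _ := stalkAlgebra s (π y)
  let _ := stalkAlgebra (π ≫ s) y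
  let _ : Algebra (X.presheaf.stalk (π y)) (X'.presheaf.stalk y) := (π.stalkMap y).hom.toAlgebra
  have i1 : IsScalarTower ℂ (X.presheaf.stalk (π y)) (X'.presheaf.stalk y) :=
    IsScalarTower.of_algebraMap_eq' (stalkMap_comp_stalkStr s π y).symm
  by_cases hy : SmoothAt s (π y)
  · have h1 := isLocalization_bot_of_bijective (A := X.presheaf.stalk (π y))
      (B := X'.presheaf.stalk y) (H.stalkMap_bijective hy)
    have h2 : Algebra.FormallyEtale (X.presheaf.stalk (π y)) (X'.presheaf.stalk y) :=
      Algebra.FormallyEtale.of_isLocalization ⊥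
    exact (KaehlerDifferential.tensorKaehlerEquivOfFormallyEtale ℂ (X.presheaf.stalk (π y))
      (X'.presheaf.stalk y)).injective
  · obtain ⟨a, b, g, h, hn, -, t, hta, hth, ht⟩ := H.exists_isNode hy
    have i4 := isNoetherianRing_stalk s (π y)
    have i5 := essFiniteType_stalk s (π y)
    -- The chart is phrased with `stalkHom` and the claim with `stalkMap`. The two homomorphisms
    -- agree only propositionally, so the algebra structure is generalised before substituting.
    have key (ψ : X.presheaf.stalk (π y) →+* X'.presheaf.stalk y)
        (hψ : stalkHom π (specializes_refl (π y)) = ψ) :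
        letI := ψ.toAlgebra
        ∀ _ : IsScalarTower ℂ (X.presheaf.stalk (π y)) (X'.presheaf.stalk y), Function.Injective
          (KaehlerDifferential.mapBaseChange ℂ (X.presheaf.stalk (π y)) (X'.presheaf.stalk y)) := by
      subst hψ
      let _ := (stalkHom π (specializes_refl (π y))).toAlgebra
      let _ := stalkAlgebra (π ≫ s) (genericPoint X')
      intro i1
      have i6 := isScalarTower_functionField (π ≫ s) y
      have h1 := linearIndependent_D_of_linearIndependent_map
        (linearIndependent_D_of_span (L := X'.functionField) H.finrank_functionField ht.span_D)
      refine mapBaseChange_injective_of_node hn.rel hta hth ?_ ?_ ?_ ht.dvd_of_dvd_mul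
      · refine span_range_D_eq_top hn.residueTrivial ?_
        rw [hn.maximalIdeal_eq]
        congr 1
        simp only [Matrix.range_cons, Matrix.range_empty, Set.union_empty]
        rfl
      · convert h1 using 1
        funext j; fin_cases j <;> simp
      · exact fun z hz => (mul_eq_zero.mp hz).resolve_left ht.ne_zero
    exact key _ (stalkHom_self π y) i1

end IsNodalBlowup


open IsLocalRing

/-! ### Primes of local rings as generizations; normality of smooth points. -/

section Primes

lemma isLocalization_atPrime_comap {A B : Type*} [CommRing A] [CommRing B] [Algebra A B]
    [IsLocalRing B] (M : Submonoid A) [IsLocalization M B] :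
    IsLocalization.AtPrime B ((maximalIdeal B).comap (algebraMap A B)) := by
  refine IsLocalization.of_le M _ (fun r hr hr' => ?_) fun r hr => ?_
  · exact (mem_maximalIdeal _).mp (Ideal.mem_comap.mp hr') (IsLocalization.map_units B ⟨r, hr⟩)
  · by_contra hcon
    exact hr (Ideal.mem_comap.mpr ((mem_maximalIdeal _).mpr hcon))

variable {Y : Scheme.{0}}

lemma exists_stalk_isLocalization_atPrime (y : Y) (P : Ideal (Y.presheaf.stalk y)) [hP : P.IsPrime] :
    ∃ (z : Y) (h : z ⤳ y), letI := (Y.presheaf.stalkSpecializes h).hom.toAlgebra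
      IsLocalization.AtPrime (Y.presheaf.stalk z) P := by
  let p : Spec (Y.presheaf.stalk y) := ⟨P, hP⟩
  let z := Y.fromSpecStalk y p
  have h : z ⤳ y := by
    have : z ∈ Set.range (Y.fromSpecStalk y) := ⟨p, rfl⟩
    rwa [Scheme.range_fromSpecStalk] at this
  refine ⟨z, h, ?_⟩
  let _ := (Y.presheaf.stalkSpecializes h).hom.toAlgebra
  obtain ⟨M, hM⟩ := isLocalization_stalkSpecializes h
  have h1 := isLocalization_atPrime_comap (A := Y.presheaf.stalk y) (B := Y.presheaf.stalk z) M
  have h2 : Y.fromSpecStalk y (Spec.map (Y.presheaf.stalkSpecializes h)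
      (closedPoint (Y.presheaf.stalk z))) = Y.fromSpecStalk y p :=
    ((Scheme.Hom.comp_apply _ _ _).symm.trans
      congr($(Scheme.SpecMap_stalkSpecializes_fromSpecStalk h)
        (closedPoint (Y.presheaf.stalk z)))).trans Scheme.fromSpecStalk_closedPoint
  have h3 := (Y.fromSpecStalk y).isEmbedding.injective h2
  have h4 : (maximalIdeal (Y.presheaf.stalk z)).comap (algebraMap (Y.presheaf.stalk y) _) = P :=
    congrArg PrimeSpectrum.asIdeal h3
  have key (Q : Ideal (Y.presheaf.stalk y)) [Q.IsPrime] (hQ : Q = P)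
    (hl : IsLocalization.AtPrime (Y.presheaf.stalk z) Q) :
    IsLocalization.AtPrime (Y.presheaf.stalk z) P := by subst hQ; exact hl
  exact key _ h4 h1

/-- The point need not be closed, so parameters over `ℂ` are not available at it. Instead smoothness
spreads to an affine neighbourhood, whose coordinate ring is normal, and normality localizes. -/
lemma isIntegrallyClosed_stalk [IsIntegral Y] {s : Y ⟶ SpecC} [LocallyOfFinitePresentation s]
    {y : Y} (hy : SmoothAt s y) : IsIntegrallyClosed (Y.presheaf.stalk y) := by
  rw [← mem_smoothLocus_iff, Scheme.Hom.mem_smoothLocus] at hy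
  obtain ⟨U, hU, V, hV, e, hyV, h⟩ := exists_smooth_of_formallySmooth_stalk s y hy
  have hU' : U = ⊤ := by
    refine top_le_iff.mp fun z _ => ?_
    have : z = s y := Subsingleton.elim (α := PrimeSpectrum ℂ) _ _
    exact this ▸ e hyV
  subst hU'
  let _ : Algebra ℂ Γ(Y, V) := (sectionStr s V).toAlgebra
  have h3 : (sectionStr s V).Smooth :=
    (RingHom.Smooth.propertyIsLocal.respectsIso.cancel_left_isIso
      (Scheme.ΓSpecIso (CommRingCat.of ℂ)).inv (s.appLE ⊤ V e)).mpr h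
  have h4 : Algebra.Smooth ℂ Γ(Y, V) := h3
  have : Nonempty V := ⟨⟨y, hyV⟩⟩
  have : Algebra.FiniteType ℂ Γ(Y, V) := finiteType_sectionStr s hV
  have h5 : IsIntegrallyClosed Γ(Y, V) := isIntegrallyClosed_of_formallySmooth (k := ℂ)
  let _ := (Y.presheaf.germ V y hyV).hom.toAlgebra
  have h6 := isLocalization_germ hV hyV
  exact isIntegrallyClosed_of_isLocalization (R := Γ(Y, V)) (Y.presheaf.stalk y)
    (hV.primeIdealOf ⟨y, hyV⟩).asIdeal.primeCompl
    (le_nonZeroDivisors_of_noZeroDivisors fun h => h (Ideal.zero_mem _))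

end Primes

/-! ### Stalks of the canonical sheaf and change of charts. -/

section CanonicalStalk

variable {L : Type} [Field L] [Algebra ℂ L]

omit [Algebra ℂ L] in
lemma mem_of_smul_mem_span {V : Type} [AddCommGroup V] [Module L V] {η : V}
    (hη : η ≠ 0) {R : Subring L} {β : L}
    (h : β • η ∈ (Submodule.span R {η}).toAddSubgroup) : β ∈ R := by
  obtain ⟨r, hr⟩ := Submodule.mem_span_singleton.mp h
  have h1 : ((r : L) - β) • η = 0 := by rw [sub_smul, sub_eq_zero]; exact hr
  rw [← sub_eq_zero.mp ((smul_eq_zero.mp h1).resolve_right hη)]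
  exact r.2

variable {Y : Scheme.{0}} (ρ : ∀ y : Y, Y.presheaf.stalk y →+* L)

/-- The stalk of the canonical sheaf at a point where the local ring has Serre's property `S₂`. -/
theorem canonicalStalk_eq
    (hρ : ∀ {z y : Y} (h : z ⤳ y), (ρ z).comp (Y.presheaf.stalkSpecializes h).hom = ρ y)
    (hfrac : ∀ y, letI := (ρ y).toAlgebra; IsFractionRing (Y.presheaf.stalk y) L)
    (y : Y) [IsDomain (Y.presheaf.stalk y)] [IsNoetherianRing (Y.presheaf.stalk y)]
    {η : ⋀[L]^3 (Ω[L⁄ℂ])} (hη : η ≠ 0) (hspan : ∀ ω, ∃ β : L, ω = β • η)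
    (hz : ∀ z, z ⤳ y → ringKrullDim (Y.presheaf.stalk z) = 1 →
      regularForms (ρ z).range 3 = (Submodule.span (ρ z).range {η}).toAddSubgroup)
    (hn : ∀ z, z ⤳ y → z ≠ y → IsIntegrallyClosed (Y.presheaf.stalk z))
    (hy : IsIntegrallyClosed (Y.presheaf.stalk y) ∨ HasRegularPair (Y.presheaf.stalk y)) :
    canonicalStalk (fun z => (ρ z).range) 3 y =
      (Submodule.span (ρ y).range {η}).toAddSubgroup := by
  have hle (z : Y) (h : z ⤳ y) : (ρ y).range ≤ (ρ z).range := by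
    rintro _ ⟨r, rfl⟩
    exact ⟨(Y.presheaf.stalkSpecializes h).hom r, congr($(hρ h) r)⟩
  let _ := (ρ y).toAlgebra
  have hfr : IsFractionRing (Y.presheaf.stalk y) L := hfrac y
  refine le_antisymm (fun ω hω => ?_) (le_iInf fun z => le_iInf fun h => le_iInf fun hd => ?_)
  · obtain ⟨β, rfl⟩ := hspan ω
    -- Rational forms are multiples of `η`, so it remains to see that a function regular in
    -- codimension one is regular, by the criterion with normality or depth two at each prime.
    suffices hβ : β ∈ (ρ y).range by
      exact Submodule.mem_span_singleton.mpr ⟨⟨β, hβ⟩, rfl⟩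
    refine mem_range_of_forall_height_eq_one (A := Y.presheaf.stalk y) (K := L) ?_ ?_
    · intro P hP hP0
      obtain ⟨z, h, hloc⟩ := exists_stalk_isLocalization_atPrime y P
      let _ := (Y.presheaf.stalkSpecializes h).hom.toAlgebra
      by_cases hc : IsIntegrallyClosed (Y.presheaf.stalk z)
      · left
        intro γ hγ
        let _ := (ρ z).toAlgebra
        have hfz : IsFractionRing (Y.presheaf.stalk z) L := hfrac z
        have htow : IsScalarTower (Y.presheaf.stalk y) (Y.presheaf.stalk z) L :=
          IsScalarTower.of_algebraMap_eq' (hρ h).symm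
        obtain ⟨w, hw⟩ := (isIntegrallyClosed_iff L).mp hc (hγ.tower_top (A := Y.presheaf.stalk z))
        obtain ⟨⟨r, t⟩, hrt⟩ := IsLocalization.surj P.primeCompl w
        refine ⟨t, t.2, r, ?_⟩
        have h5 := congrArg (algebraMap (Y.presheaf.stalk z) L) hrt
        rw [map_mul, ← IsScalarTower.algebraMap_apply, ← IsScalarTower.algebraMap_apply, hw] at h5
        rw [Algebra.smul_def, mul_comm]
        exact h5.symm
      -- Only `y` itself can fail to be normal; the prime is then the maximal ideal, and the regular
      -- pair is used.
      · have hzy : z = y := by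
          by_contra hne
          exact hc (hn z h hne)
        have hy' : HasRegularPair (Y.presheaf.stalk y) :=
          hy.resolve_left fun h' => hc (hzy ▸ h')
        right
        have hPm : P = maximalIdeal (Y.presheaf.stalk y) := by
          subst hzy
          ext r
          rw [← not_iff_not, mem_maximalIdeal, mem_nonunits_iff, not_not]
          have h6 := IsLocalization.AtPrime.isUnit_to_map_iff (Y.presheaf.stalk z) P r
          have : algebraMap (Y.presheaf.stalk z) (Y.presheaf.stalk z) r = r := by
            change (Y.presheaf.stalkSpecializes h).hom r = r
            rw [Y.presheaf.stalkSpecializes_refl]; rfl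
          rw [this] at h6
          exact h6.symm
        rw [hPm]
        exact hy'
    · intro P hP hP1
      obtain ⟨z, h, hloc⟩ := exists_stalk_isLocalization_atPrime y P
      let _ := (Y.presheaf.stalkSpecializes h).hom.toAlgebra
      have hd : ringKrullDim (Y.presheaf.stalk z) = 1 := by
        rw [IsLocalization.AtPrime.ringKrullDim_eq_height P, hP1]; rfl
      have h1 : β • η ∈ regularForms (ρ z).range 3 := by
        have := hω
        simp only [canonicalStalk, AddSubgroup.mem_iInf] at this
        exact this z h hd
      rw [hz z h hd] at h1
      obtain ⟨w, hw⟩ := mem_of_smul_mem_span hη h1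
      obtain ⟨⟨r, t⟩, hrt⟩ := IsLocalization.surj P.primeCompl w
      refine ⟨t, t.2, r, ?_⟩
      have h5 := congrArg (ρ z) hrt
      rw [map_mul, hw] at h5
      rw [Algebra.smul_def, mul_comm]
      have e (r) : ρ z (algebraMap (Y.presheaf.stalk y) (Y.presheaf.stalk z) r) = ρ y r :=
        congr($(hρ h) r)
      rw [e, e] at h5
      exact h5.symm
  · rw [hz z h hd]
    intro ω hω
    obtain ⟨r, rfl⟩ := Submodule.mem_span_singleton.mp hω
    exact Submodule.mem_span_singleton.mpr ⟨⟨r.1, hle z h r.2⟩, rfl⟩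

/-- The form `dx₀ ∧ dx₁ ∧ dx₂`. -/
noncomputable def wedgeD (x : Fin 3 → L) : ⋀[L]^3 (Ω[L⁄ℂ]) :=
  exteriorPower.ιMulti L 3 fun j => KaehlerDifferential.D ℂ L (x j)

lemma regularForms_eq_of_coordinates (s : Y ⟶ SpecC)
    (hρ : ∀ {z y : Y} (h : z ⤳ y), (ρ z).comp (Y.presheaf.stalkSpecializes h).hom = ρ y)
    (hs : ∀ y, (ρ y).comp (stalkStr s y) = algebraMap ℂ L) {y z : Y} (h : z ⤳ y)
    {x : Fin 3 → Y.presheaf.stalk y}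
    (hx : letI := stalkAlgebra s y
      Submodule.span (Y.presheaf.stalk y) (Set.range fun j => KaehlerDifferential.D ℂ _ (x j)) = ⊤) :
    regularForms (ρ z).range 3 =
      (Submodule.span (ρ z).range {wedgeD fun j => ρ y (x j)}).toAddSubgroup := by
  let _ := stalkAlgebra s y
  let _ := stalkAlgebra s z
  let _ := (Y.presheaf.stalkSpecializes h).hom.toAlgebra
  let _ := (ρ z).toAlgebra
  have i1 : IsScalarTower ℂ (Y.presheaf.stalk y) (Y.presheaf.stalk z) :=
    IsScalarTower.of_algebraMap_eq' (stalkSpecializes_comp_stalkStr s h).symm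
  have i2 : IsScalarTower ℂ (Y.presheaf.stalk z) L := IsScalarTower.of_algebraMap_eq' (hs z).symm
  obtain ⟨M, hM⟩ := isLocalization_stalkSpecializes h
  have h1 := regularForms_range_eq (L := L) (span_range_D_of_isLocalization
    (B := Y.presheaf.stalk z) M hx)
  have h2 (j) : algebraMap (Y.presheaf.stalk z) L (algebraMap (Y.presheaf.stalk y) _ (x j)) =
    ρ y (x j) := congr($(hρ h) (x j))
  simp only [h2] at h1
  exact h1

lemma wedgeD_ne_zero_and_span (hL : Module.finrank L Ω[L⁄ℂ] = 3) {x : Fin 3 → L}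
    (hx : Submodule.span L (Set.range fun j => KaehlerDifferential.D ℂ L (x j)) = ⊤) :
    wedgeD x ≠ 0 ∧ ∀ ω, ∃ β : L, ω = β • wedgeD x := by
  let e : Fin 3 → Ω[L⁄ℂ] := fun j => KaehlerDifferential.D ℂ L (x j)
  have hli : LinearIndependent L e :=
    linearIndependent_of_top_le_span_of_card_eq_finrank hx.ge (by simp [hL])
  let b : Module.Basis (Fin 3) L Ω[L⁄ℂ] := Module.Basis.mk hli hx.ge
  have hb : ⇑b = e := Module.Basis.coe_mk _ _
  constructor
  · intro h0
    have h1 := congrArg (exteriorPower.alternatingMapLinearEquiv b.det) h0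
    rw [map_zero] at h1
    have h2 : exteriorPower.alternatingMapLinearEquiv b.det (wedgeD x) = b.det e :=
      exteriorPower.alternatingMapLinearEquiv_apply_ιMulti _ _
    rw [h2, ← hb, b.det_self] at h1
    exact one_ne_zero h1
  · intro ω
    have h1 : ω ∈ Submodule.span L (Set.range (exteriorPower.ιMulti L 3 (M := Ω[L⁄ℂ]))) := by
      rw [exteriorPower.ιMulti_span]; trivial
    have h2 : Submodule.span L (Set.range (exteriorPower.ιMulti L 3 (M := Ω[L⁄ℂ]))) ≤
        Submodule.span L {wedgeD x} := by
      rw [Submodule.span_le]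
      rintro _ ⟨v, rfl⟩
      exact alternatingMap_mem_span_singleton _ e fun j => by rw [hx]; trivial
    obtain ⟨β, hβ⟩ := Submodule.mem_span_singleton.mp (h2 h1)
    exact ⟨β, hβ.symm⟩

omit [Algebra ℂ L] in
lemma map_vecCons_three {M N : Type*} [AddCommGroup M] [Module L M] [AddCommGroup N] [Module L N]
    (f : M [⋀^Fin 3]→ₗ[L] N) (u v w : M) (t b g c : L) :
    f ![t • u + b • w, t • v + g • w, c • w] = (t * t * c) • f ![u, v, w] := by
  have u0 (p q r p' : M) : Function.update ![p, q, r] 0 p' = ![p', q, r] := by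
    funext j; fin_cases j <;> rfl
  have u1 (p q r q' : M) : Function.update ![p, q, r] 1 q' = ![p, q', r] := by
    funext j; fin_cases j <;> rfl
  have u2 (p q r r' : M) : Function.update ![p, q, r] 2 r' = ![p, q, r'] := by
    funext j; fin_cases j <;> rfl
  have h3 (p q r : M) (c : L) : f ![p, q, c • r] = c • f ![p, q, r] := by
    have := f.map_update_smul ![p, q, r] 2 c r
    simp only [u2] at this
    exact this
  have h2 (p q q' r : M) : f ![p, q + q', r] = f ![p, q, r] + f ![p, q', r] := by
    have := f.map_update_add ![p, q, r] 1 q q'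
    simp only [u1] at this
    exact this
  have h2' (p q r : M) (c : L) : f ![p, c • q, r] = c • f ![p, q, r] := by
    have := f.map_update_smul ![p, q, r] 1 c q
    simp only [u1] at this
    exact this
  have h1 (p p' q r : M) : f ![p + p', q, r] = f ![p, q, r] + f ![p', q, r] := by
    have := f.map_update_add ![p, q, r] 0 p p'
    simp only [u0] at this
    exact this
  have h1' (p q r : M) (c : L) : f ![c • p, q, r] = c • f ![p, q, r] := by
    have := f.map_update_smul ![p, q, r] 0 c p
    simp only [u0] at this
    exact this
  have z1 (p r : M) : f ![p, r, r] = 0 := f.map_eq_zero_of_eq _ (i := 1) (j := 2) rfl (by decide)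
  have z2 (q r : M) : f ![r, q, r] = 0 := f.map_eq_zero_of_eq _ (i := 0) (j := 2) rfl (by decide)
  simp only [h3, h2, h2', h1, h1', z1, z2, smul_zero, add_zero, smul_smul]
  congr 1
  ring

/-- The source of crepancy. Modulo `dt` the differentials of `a = t b` and `h = t g` are `t db` and
`t dg`, and `d(1/t) = -t⁻² dt`, so the two powers of `t` cancel and the charts over a node have the
same form up to sign. -/
lemma wedgeD_swap {a b g h t : L} (hta : a = t * b) (hth : h = t * g) {t' : L} (ht : t * t' = 1) :
    wedgeD ![a, h, t'] = -wedgeD ![b, g, t] := by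
  have h1 (c : L) : KaehlerDifferential.D ℂ L (t * c) =
      t • KaehlerDifferential.D ℂ L c + c • KaehlerDifferential.D ℂ L t := Derivation.leibniz _ _ _
  have h2 : KaehlerDifferential.D ℂ L t' = (-(t' * t')) • KaehlerDifferential.D ℂ L t := by
    have h3 := congrArg (KaehlerDifferential.D ℂ L) ht
    rw [h1, Derivation.map_one_eq_zero] at h3
    have h4 := congrArg (t' • ·) h3
    simp only [smul_add, smul_smul, smul_zero] at h4
    rw [mul_comm t' t, ht, one_smul] at h4
    rw [neg_smul]
    exact eq_neg_of_add_eq_zero_left h4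
  have e1 : (fun j => KaehlerDifferential.D ℂ L (![a, h, t'] j)) =
      ![t • KaehlerDifferential.D ℂ L b + b • KaehlerDifferential.D ℂ L t,
        t • KaehlerDifferential.D ℂ L g + g • KaehlerDifferential.D ℂ L t,
        (-(t' * t')) • KaehlerDifferential.D ℂ L t] := by
    funext j
    fin_cases j
    · exact (congrArg _ hta).trans (h1 b)
    · exact (congrArg _ hth).trans (h1 g)
    · exact h2
  have e2 : (fun j => KaehlerDifferential.D ℂ L (![b, g, t] j)) =
      ![KaehlerDifferential.D ℂ L b, KaehlerDifferential.D ℂ L g, KaehlerDifferential.D ℂ L t] := by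
    funext j
    fin_cases j <;> rfl
  rw [wedgeD, wedgeD, e1, e2, map_vecCons_three]
  have : t * t * -(t' * t') = -1 := by linear_combination (-(t * t') - 1) * ht
  rw [this, neg_one_smul]

end CanonicalStalk


/-! ### Crepancy of the blowup. -/

open IsLocalRing

lemma isFractionRing_of_isLocalization_field {A L : Type*} [CommRing A] [IsDomain A] [Field L]
    [Algebra A L] (M : Submonoid A) [IsLocalization M L] : IsFractionRing A L := by
  have hM : M ≤ nonZeroDivisors A := le_nonZeroDivisors_of_noZeroDivisors fun h0 => by
    have := IsLocalization.map_units L (⟨0, h0⟩ : M)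
    simp at this
  have hinj := IsLocalization.injective L hM
  refine IsLocalization.of_le M _ hM fun r hr => ?_
  exact Ne.isUnit fun h0 => nonZeroDivisors.ne_zero hr
    ((injective_iff_map_eq_zero _).mp hinj r h0)

section

variable {Y : Scheme.{0}} [IsIntegral Y]

/-- The inclusion of a local ring into the function field. -/
noncomputable def toFunctionField (y : Y) : Y.presheaf.stalk y →+* Y.functionField :=
  (Y.presheaf.stalkSpecializes (genericPoint_specializes y)).hom

lemma toFunctionField_comp {z y : Y} (h : z ⤳ y) :
    (toFunctionField z).comp (Y.presheaf.stalkSpecializes h).hom = toFunctionField y := by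
  unfold toFunctionField
  rw [← CommRingCat.hom_comp, Y.presheaf.stalkSpecializes_comp]

lemma isFractionRing_toFunctionField (y : Y) : letI := (toFunctionField y).toAlgebra
    IsFractionRing (Y.presheaf.stalk y) Y.functionField :=
  letI := (toFunctionField y).toAlgebra
  let ⟨M, hM⟩ := isLocalization_stalkSpecializes (genericPoint_specializes y)
  have : IsLocalization M Y.functionField := hM
  isFractionRing_of_isLocalization_field M

lemma wedgeD_toFunctionField (s : Y ⟶ SpecC)
    (hL : letI := stalkAlgebra s (genericPoint Y)
      Module.finrank Y.functionField Ω[Y.functionField⁄ℂ] = 3) {y : Y}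
    {x : Fin 3 → Y.presheaf.stalk y}
    (hx : letI := stalkAlgebra s y
      Submodule.span (Y.presheaf.stalk y) (Set.range fun j => KaehlerDifferential.D ℂ _ (x j)) = ⊤) :
    letI := stalkAlgebra s (genericPoint Y)
    (wedgeD fun j => toFunctionField y (x j)) ≠ 0 ∧
      ∀ ω, ∃ β : Y.functionField, ω = β • wedgeD fun j => toFunctionField y (x j) := by
  let _ := stalkAlgebra s y
  let _ := stalkAlgebra s (genericPoint Y)
  let _ := (toFunctionField y).toAlgebra
  have i1 : IsScalarTower ℂ (Y.presheaf.stalk y) Y.functionField :=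
    IsScalarTower.of_algebraMap_eq'
      (stalkSpecializes_comp_stalkStr s (genericPoint_specializes y)).symm
  have i2 := isFractionRing_toFunctionField y
  exact wedgeD_ne_zero_and_span hL
    (span_range_D_of_isLocalization (nonZeroDivisors (Y.presheaf.stalk y)) hx)

lemma canonicalStalk_toFunctionField (s : Y ⟶ SpecC) [Smooth s]
    (hL : letI := stalkAlgebra s (genericPoint Y)
      Module.finrank Y.functionField Ω[Y.functionField⁄ℂ] = 3) {y : Y}
    {x : Fin 3 → Y.presheaf.stalk y}
    (hx : letI := stalkAlgebra s y
      Submodule.span (Y.presheaf.stalk y) (Set.range fun j => KaehlerDifferential.D ℂ _ (x j)) = ⊤) :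
    letI := stalkAlgebra s (genericPoint Y)
    canonicalStalk (fun z => (toFunctionField (Y := Y) z).range) 3 y =
      (Submodule.span (toFunctionField y).range
        {wedgeD fun j => toFunctionField y (x j)}).toAddSubgroup := by
  let _ := stalkAlgebra s (genericPoint Y)
  obtain ⟨h1, h2⟩ := wedgeD_toFunctionField s hL hx
  have hn (z : Y) : IsIntegrallyClosed (Y.presheaf.stalk z) :=
    isIntegrallyClosed_stalk ((smoothAt_iff s z).mpr ((smooth_iff_forall_smoothAt s).mp ‹_› z))
  have := isNoetherianRing_stalk s y
  exact canonicalStalk_eq (fun z => toFunctionField z) toFunctionField_comp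
    isFractionRing_toFunctionField y h1 h2
    (fun z hz _ => regularForms_eq_of_coordinates _ s toFunctionField_comp
      (fun y => stalkSpecializes_comp_stalkStr s (genericPoint_specializes y)) hz hx)
    (fun z _ _ => hn z) (Or.inl (hn y))

end

namespace IsNodalBlowup

variable {X X' S : Scheme.{0}} {s : X ⟶ SpecC} {i : S ⟶ X} {π : X' ⟶ X}
  (H : IsNodalBlowup s i π) [IsIntegral X] [IsIntegral X'] [LocallyOfFinitePresentation s]
  [IsClosedImmersion i] [SmoothOfRelativeDimension 2 (i ≫ s)] [IsProper π] [CompactSpace X']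

/-- The inclusion of a local ring of `X` into the function field of `X'`. -/
noncomputable def toField (x : X) : X.presheaf.stalk x →+* X'.functionField :=
  stalkHom π (H.map_genericPoint_specializes x)

omit [IsProper π] [CompactSpace X'] in
lemma toField_comp {z x : X} (h : z ⤳ x) :
    (H.toField z).comp (X.presheaf.stalkSpecializes h).hom = H.toField x :=
  stalkHom_comp_stalkSpecializes π h _

omit [IsProper π] [CompactSpace X'] in
lemma toFunctionField_comp_stalkHom {y : X'} {x : X} (h : π y ⤳ x) :
    (toFunctionField y).comp (stalkHom π h) = H.toField x :=
  stalkSpecializes_comp_stalkHom π (genericPoint_specializes y) h _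

omit [IsProper π] [CompactSpace X'] in
lemma isFractionRing_toField (x : X) : letI := (H.toField x).toAlgebra
    IsFractionRing (X.presheaf.stalk x) X'.functionField := by
  let x' := π (genericPoint X')
  have hx : x' ⤳ x := H.map_genericPoint_specializes x
  let _ := (H.toField x).toAlgebra
  let _ := (X.presheaf.stalkSpecializes hx).hom.toAlgebra
  obtain ⟨M, hM⟩ := isLocalization_stalkSpecializes hx
  let e : X.presheaf.stalk x' ≃+* X'.functionField :=
    RingEquiv.ofBijective (π.stalkMap (genericPoint X')).hom
      (H.stalkMap_bijective H.smoothAt_map_genericPoint)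
  let e' : X.presheaf.stalk x' ≃ₐ[X.presheaf.stalk x] X'.functionField :=
    { e with commutes' := fun _ => rfl }
  have h1 : IsLocalization M X'.functionField := IsLocalization.isLocalization_of_algEquiv M e'
  exact isFractionRing_of_isLocalization_field M

omit [IsProper π] [CompactSpace X'] in
lemma range_toField {y : X'} (hy : SmoothAt s (π y)) :
    (H.toField (π y)).range = (toFunctionField y).range := by
  rw [← H.toFunctionField_comp_stalkHom (specializes_refl (π y)), stalkHom_self]
  ext z
  constructor
  · rintro ⟨w, rfl⟩; exact ⟨_, rfl⟩
  · rintro ⟨w, rfl⟩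
    obtain ⟨w, rfl⟩ := (H.stalkMap_bijective hy).2 w
    exact ⟨w, rfl⟩

omit H [IsIntegral X'] [IsClosedImmersion i] [SmoothOfRelativeDimension 2 (i ≫ s)]
  [CompactSpace X'] [IsIntegral X] [LocallyOfFinitePresentation s] in
/-- A proper generalization of a node is the image of a point specializing to the fibre. -/
lemma exists_lift_specializes {x z : X} (h : z ⤳ x) {z' : X'} (hz : π z' = z) :
    ∃ y, z' ⤳ y ∧ π y = x := by
  have h1 := π.isClosedMap _ (isClosed_closure (s := {z'}))
  have h2 : z ∈ π '' closure {z'} := ⟨z', subset_closure rfl, hz⟩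
  obtain ⟨y, hy, hyx⟩ := h.mem_closed h1 h2
  exact ⟨y, specializes_iff_mem_closure.mpr hy, hyx⟩

omit [IsProper π] [CompactSpace X'] in
lemma wedgeD_nodeChart {x : X} {y : X'} {h : π y ⤳ x} {b g : X.presheaf.stalk x}
    {t : X'.presheaf.stalk y} :
    (fun j => toFunctionField y (![stalkHom π h b, stalkHom π h g, t] j)) =
      ![H.toField x b, H.toField x g, toFunctionField y t] := by
  rw [← H.toFunctionField_comp_stalkHom h]
  funext j
  fin_cases j <;> rfl

omit [IsProper π] [CompactSpace X'] in
/-- The generators of the canonical sheaf given by two charts of the same node agree. -/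
lemma wedgeD_eq_or_eq_neg {x : X} {y y' : X'} {h : π y ⤳ x} {h' : π y' ⤳ x}
    {a b g k : X.presheaf.stalk x} {t : X'.presheaf.stalk y} {t' : X'.presheaf.stalk y'}
    (hb : stalkHom π h b ≠ 0)
    (hta : stalkHom π h a = t * stalkHom π h b) (htk : stalkHom π h k = t * stalkHom π h g) :
    letI := stalkAlgebra (π ≫ s) (genericPoint X')
    (stalkHom π h' a = t' * stalkHom π h' b →
      wedgeD ![H.toField x b, H.toField x g, toFunctionField y' t'] =
      wedgeD ![H.toField x b, H.toField x g, toFunctionField y t]) ∧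
    (stalkHom π h' b = t' * stalkHom π h' a →
      wedgeD ![H.toField x a, H.toField x k, toFunctionField y' t'] =
      -wedgeD ![H.toField x b, H.toField x g, toFunctionField y t]) := by
  let _ := stalkAlgebra (π ≫ s) (genericPoint X')
  have hc (z) : toFunctionField y (stalkHom π h z) = H.toField x z :=
    congr($(H.toFunctionField_comp_stalkHom h) z)
  have hc' (z) : toFunctionField y' (stalkHom π h' z) = H.toField x z :=
    congr($(H.toFunctionField_comp_stalkHom h') z)
  have hb' : H.toField x b ≠ 0 := by
    rw [← hc]
    refine fun h0 => hb ?_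
    let _ := (toFunctionField y).toAlgebra
    have := isFractionRing_toFunctionField y
    exact (injective_iff_map_eq_zero _).mp
      (IsFractionRing.injective (X'.presheaf.stalk y) X'.functionField) _ h0
  have e1 := congrArg (toFunctionField y) hta
  have e2 := congrArg (toFunctionField y) htk
  rw [map_mul, hc, hc] at e1 e2
  refine ⟨fun h1 => ?_, fun h1 => wedgeD_swap e1 e2 ?_⟩
  · have e3 := congrArg (toFunctionField y') h1
    rw [map_mul, hc', hc'] at e3
    rw [mul_right_cancel₀ hb' (e3.symm.trans e1)]
  · have e3 := congrArg (toFunctionField y') h1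
    rw [map_mul, hc', hc'] at e3
    refine mul_right_cancel₀ hb' ?_
    linear_combination (-toFunctionField y' t') * e1 - e3

omit [IsIntegral X'] [IsProper π] [CompactSpace X'] H [IsClosedImmersion i]
  [SmoothOfRelativeDimension 2 (i ≫ s)] in
-- In a one-dimensional domain the nonzero prime `(a, b)` would be maximal, but it does not contain
-- `g`.
lemma ringKrullDim_ne_one_of_isNode {x : X} {a b g h : X.presheaf.stalk x}
    (hn : letI := stalkAlgebra s x; IsNode a b g h) (hb : b ≠ 0) :
    ringKrullDim (X.presheaf.stalk x) ≠ 1 := by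
  let _ := stalkAlgebra s x
  have := isNoetherianRing_stalk s x
  intro hd
  have h1 : Ring.KrullDimLE 1 (X.presheaf.stalk x) := (Ring.krullDimLE_iff).mpr hd.le
  have hbI : b ∈ Ideal.span {a, b} := Ideal.subset_span (by simp)
  have hg : g ∉ Ideal.span {a, b} := hn.isParameterSystemMod.notMem 0
  have hI := hn.isParameterSystemMod.isPrime hn.residueTrivial
    fun hI : Ideal.span {a, b} = ⊤ => hg (by rw [hI]; exact Submodule.mem_top)
  have hne : Ideal.span {a, b} ≠ ⊥ := fun h0 => hb (by rw [h0] at hbI; exact hbI)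
  have h2 := Ring.krullDimLE_one_iff_of_noZeroDivisors.mp h1 _ hne hI
  refine hg ?_
  rw [eq_maximalIdeal h2, hn.maximalIdeal_eq]
  exact Ideal.subset_span (by simp)

end IsNodalBlowup

/-- The coordinates of a chart of the small resolution of a node. -/
lemma NodeChartAt.exists_coordinates {X X' : Scheme.{0}} {s : X ⟶ SpecC} {π : X' ⟶ X}
    {x : X} {y : X'} {hy : π y ⤳ x} {a b g h : X.presheaf.stalk x}
    (H : NodeChartAt s π hy a b g h) :
    letI := stalkAlgebra (π ≫ s) y
    ∃ t : X'.presheaf.stalk y, stalkHom π hy a = t * stalkHom π hy b ∧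
      stalkHom π hy h = t * stalkHom π hy g ∧ stalkHom π hy b ≠ 0 ∧
      Submodule.span (X'.presheaf.stalk y) (Set.range fun j =>
        KaehlerDifferential.D ℂ _ (![stalkHom π hy b, stalkHom π hy g, t] j)) = ⊤ := by
  let _ := stalkAlgebra (π ≫ s) y
  let _ := (stalkHom π hy).toAlgebra
  obtain ⟨t, hta, hth, H⟩ := H
  exact ⟨t, hta, hth, H.ne_zero, H.span_D⟩

namespace IsNodalBlowup

variable {X X' S : Scheme.{0}} {s : X ⟶ SpecC} {i : S ⟶ X} {π : X' ⟶ X}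
  (H : IsNodalBlowup s i π) [IsIntegral X] [IsIntegral X'] [LocallyOfFinitePresentation s]
  [IsClosedImmersion i] [SmoothOfRelativeDimension 2 (i ≫ s)] [IsProper π] [CompactSpace X']

include H

omit [IsIntegral X] [IsIntegral X'] [IsProper π] [CompactSpace X'] [IsClosedImmersion i]
  [SmoothOfRelativeDimension 2 (i ≫ s)] in
lemma smoothAt_of_specializes_of_ne {x z : X} (hz : z ⤳ x) (hne : z ≠ x) : SmoothAt s z := by
  by_contra hcon
  exact hne (hz.mem_closed (H.isODP _ hcon).isClosed rfl).symm

omit [IsProper π] [CompactSpace X'] in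
/-- The canonical stalk at a node, computed in a chart of the small resolution. -/
lemma regularForms_eq_of_nodeChart {x z : X} {y y' : X'} {hy : π y ⤳ x} {hy' : π y' ⤳ x}
    {a b g h : X.presheaf.stalk x} {t : X'.presheaf.stalk y}
    (hb : stalkHom π hy b ≠ 0) (hta : stalkHom π hy a = t * stalkHom π hy b)
    (hth : stalkHom π hy h = t * stalkHom π hy g)
    (hc : NodeChartAt s π hy' a b g h ∨ NodeChartAt s π hy' b a h g)
    {z' : X'} (hz' : z' ⤳ y') (hz : π z' = z) (hsm : SmoothAt s z) :
    letI := stalkAlgebra (π ≫ s) (genericPoint X')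
    regularForms (H.toField z).range 3 = (Submodule.span (H.toField z).range
      {wedgeD ![H.toField x b, H.toField x g, toFunctionField y t]}).toAddSubgroup := by
  let _ := stalkAlgebra (π ≫ s) (genericPoint X')
  subst hz
  rw [H.range_toField hsm]
  have key {a b g h : X.presheaf.stalk x} (hc : NodeChartAt s π hy' a b g h) :
      ∃ t', stalkHom π hy' a = t' * stalkHom π hy' b ∧
        regularForms (toFunctionField z').range 3 = (Submodule.span (toFunctionField z').range
      {wedgeD ![H.toField x b, H.toField x g, toFunctionField y' t']}).toAddSubgroup := by
    obtain ⟨t', h1, -, -, h2⟩ := hc.exists_coordinates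
    refine ⟨t', h1, ?_⟩
    rw [← H.wedgeD_nodeChart (h := hy')]
    exact regularForms_eq_of_coordinates _ (π ≫ s) toFunctionField_comp
      (fun y => stalkSpecializes_comp_stalkStr (π ≫ s) (genericPoint_specializes y)) hz' h2
  obtain hc | hc := hc
  · obtain ⟨t', h1, h2⟩ := key hc
    rw [h2, (H.wedgeD_eq_or_eq_neg (h' := hy') (t' := t') hb hta hth).1 h1]
  · obtain ⟨t', h1, h2⟩ := key hc
    rw [h2, (H.wedgeD_eq_or_eq_neg (h' := hy') (t' := t') hb hta hth).2 h1]
    congr 1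
    rw [← Set.neg_singleton, Submodule.span_neg]

/-- The form `db ∧ dg ∧ dt` of the chart at `y` generates the canonical stalk upstairs by
smoothness. Downstairs, codimension one points near the node are smooth points and lift to the
blowup, where some chart over the same node computes their regular forms; all these charts give the
same form up to sign. -/
lemma exists_isCrepant_of_not_smoothAt {y : X'} (hy : ¬ SmoothAt s (π y)) :
    letI := stalkAlgebra (π ≫ s) (genericPoint X')
    ∃ η : ⋀[X'.functionField]^3 (Ω[X'.functionField⁄ℂ]), η ≠ 0 ∧
      canonicalStalk (fun x => (H.toField x).range) 3 (π y) =
        (Submodule.span (H.toField (π y)).range {η}).toAddSubgroup ∧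
      canonicalStalk (fun z => (toFunctionField (Y := X') z).range) 3 y =
        (Submodule.span (toFunctionField y).range {η}).toAddSubgroup := by
  let _ := stalkAlgebra (π ≫ s) (genericPoint X')
  have hsm := H.isSmallResolution.smooth
  obtain ⟨a, b, g, h, hn, hJ, hch⟩ := H.exists_isNode hy
  obtain ⟨t, hta, hth, hb0, ht⟩ := hch.exists_coordinates
  have hxcl : IsClosed {π y} := (H.isODP _ hy).isClosed
  have hb : b ≠ 0 := fun h0 => hb0 (by rw [h0, map_zero])
  have hη := wedgeD_toFunctionField (π ≫ s) H.finrank_functionField ht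
  have hcan := canonicalStalk_toFunctionField (π ≫ s) H.finrank_functionField ht
  rw [H.wedgeD_nodeChart] at hη hcan
  have hchart {y' : X'} (hy' : π y' = π y) := exists_nodeChartAt (π := π) H.finrank_functionField
    hxcl hn hJ (H.exists_charts _) hy' (specializes_of_eq hy')
  have := isNoetherianRing_stalk s (π y)
  refine ⟨_, hη.1, ?_, hcan⟩
  refine canonicalStalk_eq (fun x => H.toField x) H.toField_comp H.isFractionRing_toField (π y)
    hη.1 hη.2 (fun z hz hd => ?_)
    (fun z hz hne => isIntegrallyClosed_stalk (H.smoothAt_of_specializes_of_ne hz hne))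
    (Or.inr (hchart rfl).2)
  have hne : z ≠ π y := by
    rintro rfl
    exact ringKrullDim_ne_one_of_isNode hn hb hd
  have hzs := H.smoothAt_of_specializes_of_ne hz hne
  -- The lift of `z` may specialize to a point `y'` of the fibre other than `y`, possibly in the
  -- other chart, so both orientations of the node must be compared.
  obtain ⟨z', hz'⟩ := H.exists_eq_of_smoothAt hzs
  obtain ⟨y', hy', hyy⟩ := exists_lift_specializes hz hz'
  exact H.regularForms_eq_of_nodeChart hb0 hta hth (hchart hyy).1 hy' hz' hzs

lemma exists_isCrepant_of_smoothAt {y : X'} (hy : SmoothAt s (π y)) :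
    letI := stalkAlgebra (π ≫ s) (genericPoint X')
    ∃ η : ⋀[X'.functionField]^3 (Ω[X'.functionField⁄ℂ]), η ≠ 0 ∧
      canonicalStalk (fun x => (H.toField x).range) 3 (π y) =
        (Submodule.span (H.toField (π y)).range {η}).toAddSubgroup ∧
      canonicalStalk (fun z => (toFunctionField (Y := X') z).range) 3 y =
        (Submodule.span (toFunctionField y).range {η}).toAddSubgroup := by
  let _ := stalkAlgebra (π ≫ s) (genericPoint X')
  let _ := stalkAlgebra s (π y)
  let _ := stalkAlgebra (π ≫ s) y
  let _ := (stalkHom π (specializes_refl (π y))).toAlgebra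
  have hsm := H.isSmallResolution.smooth
  have h1 := (smoothAt_iff s _).mp hy
  have h2 := essFiniteType_stalk s (π y)
  obtain ⟨x, hx⟩ := exists_span_D_eq_top (finrank_stalk s H.topologicalKrullDim_eq hy)
  have i1 : IsScalarTower ℂ (X.presheaf.stalk (π y)) (X'.presheaf.stalk y) :=
    IsScalarTower.of_algebraMap_eq' (stalkHom_comp_stalkStr π s (specializes_refl (π y))).symm
  have i2 : IsLocalization (⊥ : Submonoid (X.presheaf.stalk (π y))) (X'.presheaf.stalk y) :=
    isLocalization_bot_of_bijective (by
      have := H.stalkMap_bijective hy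
      rwa [← stalkHom_self] at this)
  have hx' : Submodule.span (X'.presheaf.stalk y) (Set.range fun j => KaehlerDifferential.D ℂ _
      (stalkHom π (specializes_refl (π y)) (x j))) = ⊤ := span_range_D_of_isLocalization ⊥ hx
  have hη := wedgeD_toFunctionField (π ≫ s) H.finrank_functionField hx'
  have hcan := canonicalStalk_toFunctionField (π ≫ s) H.finrank_functionField hx'
  have e : (fun j => toFunctionField y (stalkHom π (specializes_refl (π y)) (x j))) =
      fun j => H.toField (π y) (x j) := by
    rw [← H.toFunctionField_comp_stalkHom (specializes_refl (π y))]
    rfl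
  rw [e] at hη hcan
  refine ⟨_, hη.1, ?_, hcan⟩
  have := isNoetherianRing_stalk s (π y)
  exact canonicalStalk_eq (fun x => H.toField x) H.toField_comp H.isFractionRing_toField (π y)
    hη.1 hη.2 (fun z hz _ => regularForms_eq_of_coordinates _ s H.toField_comp
      (fun y => stalkHom_comp_stalkStr π s _) hz hx)
    (fun z hz _ => isIntegrallyClosed_stalk (hy.of_specializes hz))
    (Or.inl (isIntegrallyClosed_stalk hy))

theorem isCrepant : IsCrepant s π 3 := by
  refine ⟨H.map_genericPoint_specializes, fun y => ?_⟩
  by_cases hy : SmoothAt s (π y)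
  · exact H.exists_isCrepant_of_smoothAt hy
  · exact H.exists_isCrepant_of_not_smoothAt hy

end IsNodalBlowup


open IsLocalRing

/-! ### Proportional ideals have the same blowup. -/

section Transfer

lemma span_singleton_mul_span_range {A ι : Type*} [CommRing A] (c : A) (f : ι → A) :
    Ideal.span {c} * Ideal.span (Set.range f) = Ideal.span (Set.range fun m => c * f m) := by
  rw [Ideal.span_mul_span', Set.singleton_mul, ← Set.range_comp]
  rfl

/-- An ideal which is locally at a prime isomorphic to the ideal generated by a given family
is locally generated by a proportional family. -/
lemma exists_proportional_family {A O ι : Type*} [CommRing A] [IsDomain A] [IsNoetherianRing A]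
    [CommRing O] [IsDomain O] [Algebra A O] (p : Ideal A) [p.IsPrime] [IsLocalization.AtPrime O p]
    (f : ι → A) {c d : O} (hc : c ≠ 0) (hd : d ≠ 0) {Q : Ideal O}
    (h : Ideal.span {c} * (Ideal.span (Set.range f)).map (algebraMap A O) = Ideal.span {d} * Q) :
    ∃ (c₀ d₀ : A) (f' : ι → A), c₀ ≠ 0 ∧ d₀ ≠ 0 ∧ (∀ m, c₀ * f m = d₀ * f' m) ∧
      (Ideal.span (Set.range f')).map (algebraMap A O) = Q := by
  obtain ⟨⟨c₁, s⟩, hs⟩ := IsLocalization.surj p.primeCompl c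
  obtain ⟨⟨d₁, t⟩, ht⟩ := IsLocalization.surj p.primeCompl d
  have hsu := IsLocalization.map_units O s
  have htu := IsLocalization.map_units O t
  have hc' : algebraMap A O (c₁ * t) = c * (algebraMap A O s * algebraMap A O t) := by
    rw [map_mul, ← hs]; ring
  have hd' : algebraMap A O (d₁ * s) = d * (algebraMap A O s * algebraMap A O t) := by
    rw [map_mul, ← ht]; ring
  have hc0 : c₁ * t ≠ 0 := fun h0 => by
    rw [h0, map_zero] at hc'
    exact mul_ne_zero hc (hsu.mul htu).ne_zero hc'.symm
  have hd0 : algebraMap A O (d₁ * s) ≠ 0 := hd' ▸ mul_ne_zero hd (hsu.mul htu).ne_zero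
  have h' : Ideal.span {algebraMap A O (c₁ * t)} * (Ideal.span (Set.range f)).map (algebraMap A O) =
      Ideal.span {algebraMap A O (d₁ * s)} * Q := by
    rw [hc', hd', Ideal.span_singleton_mul_right_unit (hsu.mul htu),
      Ideal.span_singleton_mul_right_unit (hsu.mul htu), h]
  obtain ⟨v, hv, hvm⟩ := exists_notMem_forall_mul_mem_of_map_le O p
    (I := Ideal.span {c₁ * t} * Ideal.span (Set.range f)) (K := Ideal.span {d₁ * s}) (by
      rw [Ideal.map_mul, Ideal.map_span, Ideal.map_span (algebraMap A O) {d₁ * s},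
        Set.image_singleton, Set.image_singleton, h']
      exact Ideal.mul_le_left)
  have h1 (m) : ∃ z, v * (c₁ * t) * f m = d₁ * s * z := by
    rw [mul_assoc]
    exact Ideal.mem_span_singleton.mp (hvm _ (Ideal.mul_mem_mul
      (Ideal.mem_span_singleton_self _) (Ideal.subset_span ⟨m, rfl⟩)))
  choose f' hf' using h1
  have hvu : IsUnit (algebraMap A O v) := IsLocalization.map_units O (⟨v, hv⟩ : p.primeCompl)
  refine ⟨v * (c₁ * t), d₁ * s, f', mul_ne_zero (fun h0 => hv (h0 ▸ p.zero_mem)) hc0,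
    fun h0 => hd0 (by rw [h0, map_zero]), hf', ?_⟩
  rw [← Ideal.span_singleton_mul_right_inj hd0, ← h',
    ← Ideal.span_singleton_mul_left_unit hvu (algebraMap A O (c₁ * t)), ← map_mul]
  have h2 (z : A) : Ideal.span {algebraMap A O z} = (Ideal.span {z}).map (algebraMap A O) := by
    rw [Ideal.map_span, Set.image_singleton]
  rw [h2, h2, ← Ideal.map_mul, ← Ideal.map_mul, span_singleton_mul_span_range,
    span_singleton_mul_span_range]
  congr 3
  exact funext fun m => (hf' m).symm

variable {X X' : Scheme.{0}}

/-- The charts of a blowup are also charts for each proportional family of generators. -/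
noncomputable def BlowupCharts.ofProportional [IsIntegral X'] {J J' : X.IdealSheafData}
    {π : X' ⟶ X} {U : X.affineOpens} (C : BlowupCharts J π U) [IsDomain Γ(X, U.1)]
    {c d : Γ(X, U.1)} {f' : C.ι → Γ(X, U.1)}
    (hc : c ≠ 0) (hd : d ≠ 0) (hf : ∀ m, c * C.f m = d * f' m)
    (hJ : J'.ideal U = Ideal.span (Set.range f')) : BlowupCharts J' π U :=
  have hdom (l) : IsDomain Γ(X', C.W l) := by
    have h1 := (C.injective l).nontrivial
    have h2 : Nonempty (C.W l) := by
      by_contra hcon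
      have h3 : C.W l = ⊥ := by
        rw [eq_bot_iff]; exact fun y hy => (hcon ⟨y, hy⟩).elim
      rw [h3] at h1
      exact not_subsingleton Γ(X', ⊥) inferInstance
    infer_instance
  have hne (l) {z : Γ(X, U.1)} (hz : z ≠ 0) : (π.appLE U.1 (C.W l) (C.W_le l)).hom z ≠ 0 :=
    fun h0 => hz ((injective_iff_map_eq_zero _).mp (C.injective l) z h0)
  { ι := C.ι
    f := f'
    W := C.W
    isAffineOpen_W := C.isAffineOpen_W
    W_le := C.W_le
    t := C.t
    ideal_eq := hJ
    le_iSup := C.le_iSup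
    injective := C.injective
    mem_nonZeroDivisors := fun l => by
      have := hdom l
      have : Nontrivial Γ(X', C.W l) := inferInstance
      refine mem_nonZeroDivisors_of_ne_zero (hne l fun h0 => ?_)
      have h1 := hf l
      rw [h0, mul_zero] at h1
      have h2 := (mul_eq_zero.mp h1).resolve_left hc
      exact nonZeroDivisors.ne_zero (C.mem_nonZeroDivisors l) (by rw [h2, map_zero])
    map_f := fun l m => by
      have := hdom l
      refine mul_left_cancel₀ (hne l hd) ?_
      rw [← map_mul, ← hf, map_mul, C.map_f, mul_left_comm, mul_left_comm (a := _ ) (b := C.t l m),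
        ← map_mul, ← map_mul, hf]
    closure_eq := C.closure_eq
    basicOpen_le := C.basicOpen_le }

/-- Take the kernel of the morphism to `X` from the closed subscheme of `U` defined by `I`. -/
lemma exists_idealSheafData_ideal_eq [IsLocallyNoetherian X] (U : X.affineOpens)
    (I : Ideal Γ(X, U.1)) : ∃ J : X.IdealSheafData, J.ideal U = I := by
  have hU : IsAffineOpen U.1 := U.2
  have hN : IsNoetherianRing Γ(X, U.1) := IsLocallyNoetherian.component_noetherian U
  let q : Γ(X, U.1) ⟶ CommRingCat.of (Γ(X, U.1) ⧸ I) := CommRingCat.ofHom (Ideal.Quotient.mk I)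
  let k : Spec (CommRingCat.of (Γ(X, U.1) ⧸ I)) ⟶ X := Spec.map q ≫ hU.fromSpec
  have hN' : IsNoetherianRing (CommRingCat.of (Γ(X, U.1) ⧸ I)) :=
    inferInstanceAs (IsNoetherianRing (Γ(X, U.1) ⧸ I))
  have hk : QuasiCompact k := quasiCompact_of_noetherianSpace_source _
  refine ⟨k.ker, ?_⟩
  rw [Scheme.Hom.ker_apply, Scheme.Hom.app_eq_appLE]
  have hpre : k ⁻¹ᵁ U.1 = ⊤ := by
    rw [Scheme.Hom.comp_preimage, hU.fromSpec_preimage_self]; rfl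
  have key (V : (Spec (CommRingCat.of (Γ(X, U.1) ⧸ I))).Opens) (hV : V = ⊤) (h : V ≤ k ⁻¹ᵁ U.1) :
      RingHom.ker (k.appLE U.1 V h).hom = I := by
    subst hV
    have h1 := specMap_fromSpec_appLE hU q h
    ext z
    rw [RingHom.mem_ker, ← Ideal.Quotient.eq_zero_iff_mem (I := I)]
    have h2 : (Scheme.ΓSpecIso (CommRingCat.of (Γ(X, U.1) ⧸ I))).hom.hom
        ((k.appLE U.1 ⊤ h).hom z) = Ideal.Quotient.mk I z := congr($(h1).hom z)
    rw [← h2]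
    exact (map_eq_zero_iff _ (Scheme.ΓSpecIso (CommRingCat.of
      (Γ(X, U.1) ⧸ I))).commRingCatIsoToRingEquiv.injective).symm
  exact key _ hpre _

/-- A proportionality of ideals at one point spreads to sections over `U`, and the charts depend
only on ratios of generators. It is applied with `Q` the unit ideal at smooth points and with `g (a,
b) = b (g, h)` at nodes. -/
theorem BlowupCharts.exists_of_stalk [IsIntegral X] [IsIntegral X'] [IsLocallyNoetherian X]
    {J : X.IdealSheafData} {π : X' ⟶ X} {U : X.affineOpens} (C : BlowupCharts J π U) {x : X}
    (hx : x ∈ U.1) {c d : X.presheaf.stalk x} (hc : c ≠ 0) (hd : d ≠ 0)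
    {Q : Ideal (X.presheaf.stalk x)} (h : Ideal.span {c} * stalkIdeal J x = Ideal.span {d} * Q) :
    ∃ J' : X.IdealSheafData, stalkIdeal J' x = Q ∧ Nonempty (BlowupCharts J' π U) := by
  have hU : IsAffineOpen U.1 := U.2
  have hN : IsNoetherianRing Γ(X, U.1) := IsLocallyNoetherian.component_noetherian U
  have : Nonempty U.1 := ⟨⟨x, hx⟩⟩
  let _ := (X.presheaf.germ U.1 x hx).hom.toAlgebra
  have hloc := isLocalization_germ hU hx
  rw [stalkIdeal_eq_map J hx, C.ideal_eq] at h
  obtain ⟨c₀, d₀, f', hc₀, hd₀, hf, hQ⟩ :=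
    exists_proportional_family (hU.primeIdealOf ⟨x, hx⟩).asIdeal C.f hc hd h
  obtain ⟨J', hJ'⟩ := exists_idealSheafData_ideal_eq U (Ideal.span (Set.range f'))
  refine ⟨J', ?_, ⟨C.ofProportional hc₀ hd₀ hf hJ'⟩⟩
  rw [stalkIdeal_eq_map J' hx, hJ']
  exact hQ

end Transfer

/-! ### Ideal sheaves with equal stalks. -/

section Agree

variable {S : Scheme.{0}}

/-- Coherent ideal sheaves with the same stalk at a point agree near that point. -/
lemma exists_ideal_eq_of_stalkIdeal_eq [IsLocallyNoetherian S] {I K : S.IdealSheafData} {p : S}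
    (h : stalkIdeal I p = stalkIdeal K p) :
    ∃ V : S.affineOpens, p ∈ V.1 ∧ I.ideal V = K.ideal V := by
  obtain ⟨U, hU, hp, -⟩ := exists_isAffineOpen_mem_and_subset (show p ∈ (⊤ : S.Opens) from trivial)
  let U' : S.affineOpens := ⟨U, hU⟩
  have hN : IsNoetherianRing Γ(S, U) := IsLocallyNoetherian.component_noetherian U'
  let _ := (S.presheaf.germ U p hp).hom.toAlgebra
  have hloc := isLocalization_germ hU hp
  rw [stalkIdeal_eq_map I (U := U') hp, stalkIdeal_eq_map K (U := U') hp] at h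
  obtain ⟨f₁, hf₁, h₁⟩ := exists_notMem_forall_mul_mem_of_map_le (S.presheaf.stalk p)
    (hU.primeIdealOf ⟨p, hp⟩).asIdeal (I := I.ideal U') (K := K.ideal U') h.le
  obtain ⟨f₂, hf₂, h₂⟩ := exists_notMem_forall_mul_mem_of_map_le (S.presheaf.stalk p)
    (hU.primeIdealOf ⟨p, hp⟩).asIdeal (I := K.ideal U') (K := I.ideal U') h.ge
  have hle : S.basicOpen (f₁ * f₂) ≤ U := S.basicOpen_le _
  let V' : S.affineOpens := ⟨S.basicOpen (f₁ * f₂), hU.basicOpen _⟩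
  have hVU : V' ≤ U' := hle
  have hu : IsUnit ((S.presheaf.map (homOfLE hle).op).hom (f₁ * f₂)) :=
    RingedSpace.isUnit_res_basicOpen _ _
  rw [map_mul, IsUnit.mul_iff] at hu
  refine ⟨V', ?_, ?_⟩
  · change p ∈ S.basicOpen (f₁ * f₂)
    rw [Scheme.mem_basicOpen _ _ _ hp]
    have h3 : f₁ * f₂ ∈ (hU.primeIdealOf ⟨p, hp⟩).asIdeal.primeCompl := mul_mem hf₁ hf₂
    exact IsLocalization.map_units (S.presheaf.stalk p)
      (⟨_, h3⟩ : (hU.primeIdealOf ⟨p, hp⟩).asIdeal.primeCompl)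
  · have key (I K : S.IdealSheafData) (f : Γ(S, U)) (h : ∀ j ∈ I.ideal U', f * j ∈ K.ideal U')
        (hu : IsUnit ((S.presheaf.map (homOfLE hle).op).hom f)) : I.ideal V' ≤ K.ideal V' := by
      rw [← I.map_ideal hVU, Ideal.map_le_iff_le_comap]
      intro j hj
      have h4 := K.ideal_le_comap_ideal hVU (h j hj)
      rw [Ideal.mem_comap] at h4 ⊢
      have h5 : (S.presheaf.map (homOfLE hle).op).hom f *
        (S.presheaf.map (homOfLE hle).op).hom j ∈ K.ideal V' := by rw [← map_mul]; exact h4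
      exact (Ideal.unit_mul_mem_iff_mem _ hu).mp h5
    exact le_antisymm (key I K f₁ h₁ hu.1) (key K I f₂ h₂ hu.2)

lemma comap_eq_of_ideal_eq {I K : S.IdealSheafData} {V : S.affineOpens} (h : I.ideal V = K.ideal V)
    {T : Scheme.{0}} (g : T ⟶ S) (hg : ∀ t, g t ∈ V.1) : I.comap g = K.comap g := by
  refine Scheme.IdealSheafData.ext (funext fun W => ?_)
  have hW : W.1 ≤ g ⁻¹ᵁ V.1 := fun t _ => hg t
  rw [ideal_comap_eq_map I g hW, ideal_comap_eq_map K g hW, h]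

end Agree

/-! ### Restricting a blowup to a closed subscheme. -/

section Lift

variable {X X' S : Scheme.{0}} {i : S ⟶ X} {π : X' ⟶ X}

lemma BlowupCharts.existsUnique_lift {J : X.IdealSheafData} {U : X.affineOpens}
    (C : BlowupCharts J π U) {T : Scheme.{0}} (g : T ⟶ X) (hg : IsEffectiveCartier (J.comap g))
    (hU : ∀ t, g t ∈ U.1) : ∃! h : T ⟶ X', h ≫ π = g := by
  refine existsUnique_lift_of_local π g (fun p => C.exists_lift hg (hU p))
    fun T' j _ h h' hh hh' => ?_
  have hg' : IsEffectiveCartier (J.comap (j ≫ g)) := by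
    rw [Scheme.IdealSheafData.comap_comp]; exact hg.comap_of_flat j
  refine Scheme.hom_ext_of_forall _ _ fun p => C.lift_eq hg' (p := p) ?_ hh hh'
  rw [Scheme.Hom.comp_apply]
  exact hU _

variable {K : S.IdealSheafData} [IsLocallyNoetherian S]

/-- Lifts to `X'` of a morphism to `S` which turns `K` into a Cartier divisor, where near each point
of `S` the morphism `π` is also the blowup of an ideal sheaf restricting to `K`. -/
theorem existsUnique_lift_of_stalkIdeal_eq
    (H : ∀ p : S, ∃ J : X.IdealSheafData, stalkIdeal (J.comap i) p = stalkIdeal K p ∧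
      ∃ U : X.affineOpens, i p ∈ U.1 ∧ Nonempty (BlowupCharts J π U))
    {T : Scheme.{0}} (g : T ⟶ S) (hg : IsEffectiveCartier (K.comap g)) :
    ∃! h : T ⟶ X', h ≫ π = g ≫ i := by
  have key (t : T) : ∃ V : T.Opens, t ∈ V ∧ ∀ (T' : Scheme.{0}) (j : T' ⟶ T) [IsOpenImmersion j],
      (∀ z, j z ∈ V) → ∃! h : T' ⟶ X', h ≫ π = j ≫ g ≫ i := by
    obtain ⟨J, hJ, U, hU, ⟨C⟩⟩ := H (g t)
    obtain ⟨V, hV, hVJ⟩ := exists_ideal_eq_of_stalkIdeal_eq hJ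
    have hV' : t ∈ g ⁻¹ᵁ V.1 := hV
    have hU' : t ∈ (g ≫ i) ⁻¹ᵁ U.1 := (by
      rw [Scheme.Hom.comp_apply]; exact hU : (g ≫ i) t ∈ U.1)
    refine ⟨g ⁻¹ᵁ V.1 ⊓ (g ≫ i) ⁻¹ᵁ U.1, ⟨hV', hU'⟩, fun T' j _ hj => ?_⟩
    refine C.existsUnique_lift _ ?_ fun z => ?_
    · rw [← Category.assoc, Scheme.IdealSheafData.comap_comp, comap_eq_of_ideal_eq hVJ,
        Scheme.IdealSheafData.comap_comp]
      · exact hg.comap_of_flat j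
      · intro z
        rw [Scheme.Hom.comp_apply]
        exact (hj z).1
    · rw [Scheme.Hom.comp_apply]
      exact (hj z).2
  refine existsUnique_lift_of_local π _ (fun t => ?_) fun T' j _ h h' hh hh' => ?_
  · obtain ⟨V, ht, hV⟩ := key t
    obtain ⟨h, hh, -⟩ := hV V V.ι fun z => z.2
    exact ⟨V, ht, h, hh⟩
  · refine Scheme.hom_ext_of_forall _ _ fun p => ?_
    obtain ⟨V, ht, hV⟩ := key (j p)
    have ht' : p ∈ j ⁻¹ᵁ V := ht
    refine ⟨j ⁻¹ᵁ V, ht', (hV _ ((j ⁻¹ᵁ V).ι ≫ j) fun z => ?_).unique ?_ ?_⟩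
    · rw [Scheme.Hom.comp_apply]
      exact z.2
    · rw [Category.assoc, hh, Category.assoc]
    · rw [Category.assoc, hh', Category.assoc]

/-- A morphism `T → S` making `K` Cartier makes, locally on `T`, the ideal `J` with restriction `K`
Cartier, so the composite to `X` lifts uniquely to `X'`. The universal property of the fibre product
turns this into a lift over `S`. -/
theorem isBlowup_pullback_fst
    (H : ∀ p : S, ∃ J : X.IdealSheafData, stalkIdeal (J.comap i) p = stalkIdeal K p ∧
      ∃ U : X.affineOpens, i p ∈ U.1 ∧ Nonempty (BlowupCharts J π U))
    (hK : IsEffectiveCartier (K.comap (pullback.fst i π))) : IsBlowup K (pullback.fst i π) where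
  isEffectiveCartier := hK
  existsUnique_lift T g hg := by
    obtain ⟨h, hh, huniq⟩ := existsUnique_lift_of_stalkIdeal_eq H g hg
    refine ⟨pullback.lift g h hh.symm, pullback.lift_fst _ _ _, fun h' hh' => ?_⟩
    refine pullback.hom_ext (by rw [hh', pullback.lift_fst]) ?_
    rw [pullback.lift_snd]
    refine huniq _ ?_
    change (h' ≫ pullback.snd i π) ≫ π = g ≫ i
    rw [Category.assoc, ← pullback.condition, ← Category.assoc, hh']

end Lift


open IsLocalRing

/-! ### The reduced ideal of a closed set at its isolated points. -/

section VanishingIdeal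

variable {Y : Scheme.{0}}

lemma map_stalkSpecializes_stalkIdeal (J : Y.IdealSheafData) {z y : Y} (h : z ⤳ y) :
    (stalkIdeal J y).map (Y.presheaf.stalkSpecializes h).hom = stalkIdeal J z := by
  obtain ⟨U, hU, hy, -⟩ := exists_isAffineOpen_mem_and_subset (show y ∈ (⊤ : Y.Opens) from trivial)
  let U' : Y.affineOpens := ⟨U, hU⟩
  have hz : z ∈ U := h.mem_open U.2 hy
  rw [stalkIdeal_eq_map J (U := U') hy, stalkIdeal_eq_map J (U := U') hz, Ideal.map_map,
    ← CommRingCat.hom_comp]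
  congr 2
  exact Y.presheaf.germ_stalkSpecializes hy h

lemma stalkIdeal_eq_top_of_notMem_support {J : Y.IdealSheafData} {y : Y} (hy : y ∉ J.support) :
    stalkIdeal J y = ⊤ := by
  obtain ⟨U, hU, hyU, -⟩ := exists_isAffineOpen_mem_and_subset (show y ∈ (⊤ : Y.Opens) from trivial)
  let U' : Y.affineOpens := ⟨U, hU⟩
  rw [Scheme.IdealSheafData.mem_support_iff_of_mem (U := U') hyU, Scheme.mem_zeroLocus_iff] at hy
  push Not at hy
  obtain ⟨f, hf, hyf⟩ := hy
  rw [Scheme.mem_basicOpen _ _ _ hyU] at hyf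
  rw [stalkIdeal_eq_map J (U := U') hyU]
  exact Ideal.eq_top_of_isUnit_mem _ (Ideal.mem_map_of_mem _ hf) hyf

lemma isRadical_stalkIdeal_vanishingIdeal (Z : Closeds Y) (y : Y) :
    (stalkIdeal (Scheme.IdealSheafData.vanishingIdeal Z) y).IsRadical := by
  obtain ⟨U, hU, hy, -⟩ := exists_isAffineOpen_mem_and_subset (show y ∈ (⊤ : Y.Opens) from trivial)
  let U' : Y.affineOpens := ⟨U, hU⟩
  let _ := (Y.presheaf.germ U y hy).hom.toAlgebra
  have hloc := isLocalization_germ hU hy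
  have h1 : ((Scheme.IdealSheafData.vanishingIdeal Z).ideal U').IsRadical :=
    PrimeSpectrum.isRadical_vanishingIdeal _
  have h2 := IsLocalization.map_radical (hU.primeIdealOf ⟨y, hy⟩).asIdeal.primeCompl
    (Y.presheaf.stalk y) ((Scheme.IdealSheafData.vanishingIdeal Z).ideal U')
  rw [h1.radical] at h2
  rw [stalkIdeal_eq_map _ (U := U') hy]
  exact Ideal.radical_eq_iff.mp h2.symm

/-- The reduced ideal of a closed set at an isolated closed point. -/
lemma stalkIdeal_vanishingIdeal_eq_maximalIdeal {Z : Closeds Y} {y : Y} (hy : y ∈ Z)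
    (H : ∀ z ∈ Z, z ⤳ y → z = y) :
    stalkIdeal (Scheme.IdealSheafData.vanishingIdeal Z) y = maximalIdeal (Y.presheaf.stalk y) := by
  set K := Scheme.IdealSheafData.vanishingIdeal Z
  have hsupp : (K.support : Set Y) = Z := Scheme.IdealSheafData.coe_support_vanishingIdeal Z
  have hP (P : Ideal (Y.presheaf.stalk y)) (hP : P.IsPrime) (hK : stalkIdeal K y ≤ P) :
      P = maximalIdeal _ := by
    obtain ⟨z, hz, hloc⟩ := exists_stalk_isLocalization_atPrime y P
    let _ := (Y.presheaf.stalkSpecializes hz).hom.toAlgebra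
    have h1 : (maximalIdeal (Y.presheaf.stalk z)).comap (Y.presheaf.stalkSpecializes hz).hom = P :=
      IsLocalization.AtPrime.under_maximalIdeal _ P
    have h2 : z ∈ Z := by
      rw [← SetLike.mem_coe, ← hsupp]
      by_contra hcon
      have h3 := stalkIdeal_eq_top_of_notMem_support hcon
      rw [← map_stalkSpecializes_stalkIdeal K hz] at h3
      have h4 := Ideal.map_le_iff_le_comap.mpr (hK.trans h1.ge)
      rw [h3] at h4
      exact (maximalIdeal.isMaximal _).ne_top (top_le_iff.mp h4)
    obtain rfl := H z h2 hz
    rw [← h1, TopCat.Presheaf.stalkSpecializes_refl]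
    rfl
  rw [← (isRadical_stalkIdeal_vanishingIdeal Z y).radical, Ideal.radical_eq_sInf]
  refine le_antisymm (sInf_le ⟨?_, inferInstance⟩) (le_sInf fun P hP' => (hP P hP'.2 hP'.1).ge)
  refine le_maximalIdeal fun htop => ?_
  obtain ⟨U, hU, hyU, -⟩ := exists_isAffineOpen_mem_and_subset (show y ∈ (⊤ : Y.Opens) from trivial)
  let U' : Y.affineOpens := ⟨U, hU⟩
  have h1 : y ∈ K.support := by rw [← SetLike.mem_coe, hsupp]; exact hy
  rw [Scheme.IdealSheafData.mem_support_iff_of_mem (U := U') hyU, Scheme.mem_zeroLocus_iff] at h1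
  have h2 : (K.ideal U').map (Y.presheaf.germ U y hyU).hom ≤ maximalIdeal _ := by
    rw [Ideal.map_le_iff_le_comap]
    intro f hf
    have h3 := h1 f hf
    rw [Scheme.mem_basicOpen _ _ _ hyU] at h3
    exact h3
  rw [← stalkIdeal_eq_map K (U := U') hyU, htop] at h2
  exact (maximalIdeal.isMaximal _).ne_top (top_le_iff.mp h2)

end VanishingIdeal

/-! ### Restriction of ideals at a node to the surface. -/

section Node

variable {X S : Scheme.{0}} {s : X ⟶ SpecC} {i : S ⟶ X} [IsClosedImmersion i]

lemma mem_nonZeroDivisors_of_surjective {A B : Type*} [CommRing A] [CommRing B] {f : A →+* B}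
    (hf : Function.Surjective f) {b g : A} (hker : RingHom.ker f = Ideal.span {b})
    (hg : ∀ z, b ∣ g * z → b ∣ z) : f g ∈ nonZeroDivisors B := by
  refine mem_nonZeroDivisors_iff_right.mpr fun w hw => ?_
  obtain ⟨z, rfl⟩ := hf w
  rw [← map_mul, ← RingHom.mem_ker, hker, Ideal.mem_span_singleton, mul_comm] at hw
  rw [← RingHom.mem_ker, hker, Ideal.mem_span_singleton]
  exact hg z hw

lemma maximalIdeal_eq_map_of_surjective {A B : Type*} [CommRing A] [CommRing B] [IsLocalRing A]
    [IsLocalRing B] (f : A →+* B) [IsLocalHom f] (hf : Function.Surjective f) :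
    (maximalIdeal A).map f = maximalIdeal B := by
  have h : (maximalIdeal B).comap f = maximalIdeal A := ((local_hom_TFAE f).out 0 4).mp ‹_›
  rw [← h, Ideal.map_comap_of_surjective f hf]

/-- On `S` the generators `a` and `b` of the maximal ideal of the node become zero, so `g` and `h`
alone generate the maximal ideal there. -/
lemma IsNode.stalkIdeal_comap_eq_maximalIdeal {x : X} {p : S} (hx : i p = x)
    {a b g h : X.presheaf.stalk x} (H : letI := stalkAlgebra s x; IsNode a b g h)
    (hI : stalkIdeal i.ker x = Ideal.span {a, b}) {J : X.IdealSheafData}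
    (hJ : stalkIdeal J x = Ideal.span {g, h}) :
    stalkIdeal (J.comap i) p = maximalIdeal (S.presheaf.stalk p) := by
  subst hx
  let _ := stalkAlgebra s (i p)
  rw [← maximalIdeal_eq_map_of_surjective (i.stalkMap p).hom (i.stalkMap_surjective p),
    H.maximalIdeal_eq, stalkIdeal_comap, hJ,
    show ({a, b, g, h} : Set (X.presheaf.stalk (i p))) = {a, b} ∪ {g, h} by
      rw [Set.insert_union, Set.singleton_union], Ideal.span_union, Ideal.map_sup, ← hI, stalkIdeal_ker,
    (Ideal.map_eq_bot_iff_le_ker _).mpr le_rfl, bot_sup_eq]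

end Node

/-! ### The inverse image of the surface as a blowup of the surface at the nodes. -/

namespace IsNodalBlowup

variable {X X' S : Scheme.{0}} {s : X ⟶ SpecC} {i : S ⟶ X} {π : X' ⟶ X}
  (H : IsNodalBlowup s i π) [IsIntegral X] [IsIntegral X'] [LocallyOfFinitePresentation s]
  [IsClosedImmersion i] [SmoothOfRelativeDimension 2 (i ≫ s)] [IsProper π] [CompactSpace X']

include H

/-- The set of nodes of `X`, as a closed subset of `S`. -/
def nodes : Closeds S where
  carrier := {p | IsODP s (i p)}
  isClosed' := by
    have h1 : {p | IsODP s (i p)} = i ⁻¹' (s.smoothLocus : Set X)ᶜ := by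
      ext p
      rw [Set.mem_preimage, Set.mem_compl_iff, SetLike.mem_coe, mem_smoothLocus_iff,
        H.smoothAt_iff_not_isODP, not_not]
      rfl
    rw [h1]
    exact s.smoothLocus.2.isClosed_compl.preimage i.continuous

omit [IsIntegral X'] [SmoothOfRelativeDimension 2 (i ≫ s)] [IsProper π] [CompactSpace X'] in
lemma stalkIdeal_vanishingIdeal_of_not_smoothAt {p : S} (hp : ¬ SmoothAt s (i p)) :
    stalkIdeal (Scheme.IdealSheafData.vanishingIdeal H.nodes) p =
      maximalIdeal (S.presheaf.stalk p) := by
  refine stalkIdeal_vanishingIdeal_eq_maximalIdeal (H.isODP _ hp) fun z hz hzp => ?_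
  have h1 : IsODP s (i z) := hz
  exact i.isEmbedding.injective ((hzp.map i.continuous).mem_closed h1.isClosed rfl).symm

omit [IsIntegral X'] [IsClosedImmersion i] [SmoothOfRelativeDimension 2 (i ≫ s)] [IsProper π]
  [CompactSpace X'] in
lemma stalkIdeal_vanishingIdeal_of_smoothAt {p : S} (hp : SmoothAt s (i p)) :
    stalkIdeal (Scheme.IdealSheafData.vanishingIdeal H.nodes) p = ⊤ := by
  refine stalkIdeal_eq_top_of_notMem_support fun h1 => ?_
  rw [← SetLike.mem_coe, Scheme.IdealSheafData.coe_support_vanishingIdeal] at h1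
  exact H.smoothAt_iff_not_isODP.mp hp h1

omit [IsClosedImmersion i] [SmoothOfRelativeDimension 2 (i ≫ s)] [IsProper π] [CompactSpace X'] in
/-- At a node the blowup is also the blowup of the second ideal in `a * g = b * h`. -/
lemma exists_charts_of_isNode {y : X'} {a b g h : X.presheaf.stalk (π y)}
    (hn : letI := stalkAlgebra s (π y); IsNode a b g h)
    (hI : stalkIdeal i.ker (π y) = Ideal.span {a, b}) (hb : b ≠ 0) :
    ∃ J : X.IdealSheafData, stalkIdeal J (π y) = Ideal.span {g, h} ∧
      ∃ U : X.affineOpens, π y ∈ U.1 ∧ Nonempty (BlowupCharts J π U) := by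
  let _ := stalkAlgebra s (π y)
  have : IsLocallyNoetherian X := LocallyOfFiniteType.isLocallyNoetherian s
  obtain ⟨U, hU, ⟨C⟩⟩ := H.exists_charts (π y)
  have hg : g ∉ Ideal.span {a, b} := hn.isParameterSystemMod.notMem 0
  have hg0 : g ≠ 0 := fun h0 => hg (h0 ▸ Ideal.zero_mem _)
  -- `g (a, b) = (g a, g b) = (b h, b g) = b (g, h)`.
  obtain ⟨J, hJ, hC⟩ := C.exists_of_stalk hU (Q := Ideal.span {g, h}) hg0 hb (by
    rw [hI, Ideal.span_mul_span', Ideal.span_mul_span', Set.singleton_mul, Set.singleton_mul,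
      Set.image_pair, Set.image_pair, mul_comm g a, hn.rel, mul_comm g b, Set.pair_comm])
  exact ⟨J, hJ, U, hU, hC⟩

/-- At a smooth point the ideal of `S` is principal, so the blowup is locally also that of the unit
ideal. At a node it is that of `(g, h)`, whose restriction to `S` is the ideal of the point. -/
lemma exists_charts_of_comap (p : S) : ∃ J : X.IdealSheafData, stalkIdeal (J.comap i) p =
      stalkIdeal (Scheme.IdealSheafData.vanishingIdeal H.nodes) p ∧
      ∃ U : X.affineOpens, i p ∈ U.1 ∧ Nonempty (BlowupCharts J π U) := by
  have : IsLocallyNoetherian X := LocallyOfFiniteType.isLocallyNoetherian s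
  by_cases hp : SmoothAt s (i p)
  · obtain ⟨U, hU, ⟨C⟩⟩ := H.exists_charts (i p)
    obtain ⟨c, hc, hI⟩ := exists_generator_of_smoothAt s i H.topologicalKrullDim_eq hp
    obtain ⟨J, hJ, hC⟩ := C.exists_of_stalk hU (Q := ⊤) one_ne_zero (nonZeroDivisors.ne_zero hc)
      (by rw [hI, Ideal.span_singleton_one, Ideal.top_mul, Ideal.mul_top])
    refine ⟨J, ?_, U, hU, hC⟩
    rw [stalkIdeal_comap, hJ, Ideal.map_top, H.stalkIdeal_vanishingIdeal_of_smoothAt hp]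
  -- The closed map `π` reaches every point of `X`; a point of the fibre supplies a chart, and with
  -- it `b ≠ 0`.
  · obtain ⟨y, -, hy⟩ := exists_lift_specializes (π := π) (H.map_genericPoint_specializes (i p)) rfl
    have hp' : ¬ SmoothAt s (π y) := by rwa [hy]
    obtain ⟨a, b, g, h, hn, hI, hch⟩ := H.exists_isNode hp'
    obtain ⟨t, -, -, hb, -⟩ := hch.exists_coordinates
    obtain ⟨J, hJ, U, hU, hC⟩ := H.exists_charts_of_isNode hn hI
      (fun h0 => hb (by rw [h0, map_zero]))
    refine ⟨J, ?_, U, hy ▸ hU, hC⟩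
    rw [hn.stalkIdeal_comap_eq_maximalIdeal hy.symm hI hJ,
      H.stalkIdeal_vanishingIdeal_of_not_smoothAt hp]

/-- In a chart over a node the inverse image of `S` is `b = 0`, because `a = t b`, and the ideal
`(g, h)` becomes `(g)`, because `h = t g`. The element `g` is a nonzerodivisor modulo `b`. -/
lemma isEffectiveCartier_comap_fst : IsEffectiveCartier
    ((Scheme.IdealSheafData.vanishingIdeal H.nodes).comap (pullback.fst i π)) := by
  have h0 : IsLocallyNoetherian (pullback i π) :=
    LocallyOfFiniteType.isLocallyNoetherian (pullback.snd i π ≫ π ≫ s)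
  refine isEffectiveCartier_of_stalk fun y => ?_
  have hxy : i (pullback.fst i π y) = π (pullback.snd i π y) := by
    rw [← Scheme.Hom.comp_apply, ← Scheme.Hom.comp_apply, pullback.condition]
  by_cases hy : SmoothAt s (i (pullback.fst i π y))
  · refine ⟨1, one_mem _, ?_⟩
    rw [stalkIdeal_comap, H.stalkIdeal_vanishingIdeal_of_smoothAt hy, Ideal.map_top,
      Ideal.span_singleton_one]
  · have hy' : ¬ SmoothAt s (π (pullback.snd i π y)) := hxy ▸ hy
    obtain ⟨a, b, g, h, hn, hI, t, hta, hth, ht⟩ := H.exists_isNode hy'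
    let _ := stalkAlgebra s (π (pullback.snd i π y))
    let _ := stalkAlgebra (π ≫ s) (pullback.snd i π y)
    let _ := (stalkHom π (specializes_refl (π (pullback.snd i π y)))).toAlgebra
    have hb := ht.ne_zero
    obtain ⟨J, hJ, -⟩ := H.exists_charts_of_isNode hn hI (fun h0 => hb (by rw [h0, map_zero]))
    have hdvd := ht.dvd_of_dvd_mul
    have e : algebraMap _ (X'.presheaf.stalk (pullback.snd i π y)) =
      (π.stalkMap (pullback.snd i π y)).hom := stalkHom_self π (pullback.snd i π y)
    rw [stalkHom_self] at hta hth
    rw [e] at hdvd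
    have hk : (pullback.snd i π).ker = i.ker.comap π := by
      rw [← Scheme.IdealSheafData.ker_fst_of_isClosedImmersion, ← pullbackSymmetry_hom_comp_fst,
        Scheme.Hom.ker_comp_of_isIso]
    have hker : RingHom.ker ((pullback.snd i π).stalkMap y).hom =
        Ideal.span {(π.stalkMap (pullback.snd i π y)).hom b} := by
      rw [← stalkIdeal_ker, hk, stalkIdeal_comap, hI, Ideal.map_span, Set.image_pair, hta]
      refine le_antisymm (Ideal.span_le.mpr ?_) (Ideal.span_mono (by simp))
      rintro z (rfl | rfl)
      · exact Ideal.mem_span_singleton'.mpr ⟨t, rfl⟩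
      · exact Ideal.mem_span_singleton_self _
    refine ⟨_, mem_nonZeroDivisors_of_surjective ((pullback.snd i π).stalkMap_surjective y)
      hker hdvd, ?_⟩
    have h1 : stalkIdeal ((Scheme.IdealSheafData.vanishingIdeal H.nodes).comap
        (pullback.fst i π)) y = stalkIdeal ((J.comap i).comap (pullback.fst i π)) y := by
      rw [stalkIdeal_comap, stalkIdeal_comap (J.comap i),
        hn.stalkIdeal_comap_eq_maximalIdeal hxy hI hJ,
        H.stalkIdeal_vanishingIdeal_of_not_smoothAt hy]
    rw [h1, ← Scheme.IdealSheafData.comap_comp, pullback.condition,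
      Scheme.IdealSheafData.comap_comp, stalkIdeal_comap, stalkIdeal_comap, hJ, Ideal.map_span,
      Ideal.map_span, Set.image_pair, Set.image_pair, hth, map_mul]
    refine le_antisymm (Ideal.span_le.mpr ?_) (Ideal.span_mono (by simp))
    rintro z (rfl | rfl)
    · exact Ideal.mem_span_singleton_self _
    · exact Ideal.mem_span_singleton'.mpr ⟨_, rfl⟩

theorem isBlowup_nodes : IsBlowup (Scheme.IdealSheafData.vanishingIdeal H.nodes)
    (pullback.fst i π : pullback i π ⟶ S) := by
  have : IsLocallyNoetherian S := LocallyOfFiniteType.isLocallyNoetherian (i ≫ s)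
  exact isBlowup_pullback_fst H.exists_charts_of_comap H.isEffectiveCartier_comap_fst

end IsNodalBlowup

end SmallRes

/-! ### Assembly: the constructed blowup has all the required properties. -/

theorem mainTheorem9 {X S : Scheme.{0}} (s : X ⟶ SmallRes.SpecC) (i : S ⟶ X)
    [IsIntegral X] (hproj : SmallRes.IsProjective s) (hdim : topologicalKrullDim X = 3)
    (hODP : ∀ x : X, ¬ SmallRes.SmoothAt s x → SmallRes.IsODP s x)
    [IsClosedImmersion i] [SmoothOfRelativeDimension 2 (i ≫ s)]
    (hS : ∀ x : X, SmallRes.IsODP s x → x ∈ Set.range i) :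
    ∃ (X' : Scheme.{0}) (π : X' ⟶ X) (_ : IsIntegral X'),
      SmallRes.IsBlowup i.ker π ∧
      SmallRes.IsProjective (π ≫ s) ∧
      SmallRes.IsProjectiveMorphism s π ∧
      SmallRes.IsSmallResolution s π ∧
      SmallRes.IsCrepant s π 3 ∧
      (∃ Z : Closeds S, (Z : Set S) = {p | SmallRes.IsODP s (i p)} ∧
        SmallRes.IsBlowup (Scheme.IdealSheafData.vanishingIdeal Z)
          (pullback.fst i π : pullback i π ⟶ S)) ∧
      SmallRes.CotangentMapInjective s π := by
  have hs := hproj.isProper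
  have hfp : LocallyOfFinitePresentation s := by
    have : IsLocallyNoetherian SmallRes.SpecC := by unfold SmallRes.SpecC; infer_instance
    exact LocallyOfFinitePresentation.iff_locallyOfFiniteType.mpr inferInstance
  obtain ⟨X', π, hX', hproj', hπ, hch⟩ := SmallRes.exists_blowup s hproj i.ker
    (fun h => SmallRes.stalkIdeal_genericPoint_ne_bot s i hdim h)
  have hπ' := hπ.isProper
  have hp' := hproj'.isProper
  have hc : CompactSpace X' := by
    have h := QuasiCompact.compactSpace_of_compactSpace (π ≫ s)
    exact h
  have H : SmallRes.IsNodalBlowup s i π := ⟨hdim, hODP, hS, hch⟩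
  exact ⟨X', π, hX', H.isBlowup, hproj', hπ, H.isSmallResolution, H.isCrepant,
    ⟨H.nodes, rfl, H.isBlowup_nodes⟩, H.cotangentMapInjective⟩
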